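/- **Setting.** Let $(M,g)$ be a smooth $n$-dimensional Riemannian manifold without boundary (Hausdorff, second countable), with Levi-Civita connection $\nabla^{LC}$ and Riemannian measure $\mathrm{dvol}$. Let $E,F\to M$ be smooth complex vector bundles of finite rank with smooth Hermitian metrics $(\cdot,\cdot)$ (linear in the first, conjugate linear in the second argument) and smooth metric-preserving connections $\nabla$. The bundles $T^{*\otimes k}M\otimes E$, and bundles of homomorphisms between such bundles, carry the induced metrics and connections; $\nabla^k u$ is a section of $T^{*\otimes k}M\otimes E$, and $(\nabla^k)^*$ is the formal adjoint of $\nabla^k$. For a bundle $A$ with metric and connection, $C_b^\infty(M;A)$ is the space of smooth sections all of whose covariant derivatives $\nabla^k a$, $k\ge 0$, are bounded. Condition (FFC) says: for some $N$ there is an isometric vector bundle embedding $\Phi:TM\to M\times\mathbb R^N$ with $\Phi\in C_b^\infty(M;\mathrm{Hom}(TM,\mathbb R^N))$, where $M\times\mathbb R^N$ has the trivial connection. For positive functions $f,\rho$ on $M$ and $m\in\mathbb N_0$, let $$fH^m_{\nabla,\rho}(M;E)=\{u:\ \rho^k\nabla^k(f^{-1}u)\in L^2(M;T^{*\otimes k}M\otimes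 E),\ 0\le k\le m\}$$ (weak derivatives), with norm $\big(\sum_{k\le m}\|\rho^k\nabla^k(f^{-1}u)\|_{L^2}^2\big)^{1/2}$; let $fH^m_{0,\nabla,\rho}(M;E)$ be the closure of $C_c^\infty(M;E)$ in it, and let $fH^{-m}_{\nabla,\rho}(M;E)=\big(f^{-1}H^m_{0,\nabla,\rho}(M;E)\big)^*$ be the space of bounded conjugate linear functionals. Write $H^{\pm m}_\nabla$ for $f=\rho=1$. A function $f>0$ is an admissible weight for a metric $g_0$ if it is smooth and $f^{-1}df\in C_b^\infty(M;T^*M)$ with respect to $g_0$. Let $m\in\mathbb N_0$ and let $\mathfrak b$ be a $\nabla$-bidifferential operator of order $\le 2m$ with $C_b^\infty$ coefficients, $$\mathfrak b(u\otimes\overline w)=\sum_{i,j=0}^m(a_{ij}\nabla^iu,\nabla^jw),\qquad a_{ij}\in C_b^\infty\big(M;\mathrm{Hom}(T^{*\otimes i}M\otimes E,T^{*\otimes j}M\otimes F)\big),$$ with Dirichlet form $B(u,w)=\int_M\mathfrak b(u\otimes\overline w)\,\mathrm{dvol}$ and associated divergence form operator $P_{\mathfrak b}u=B(u,\cdot)$.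 **Proposition.** Assume that $M$ satisfies (FFC). Then $P_{\mathfrak b}$ is a $\nabla$-differential operator in $\mathrm{Diff}_b^{2m}(M;E,F)$, and it maps $H^m_\nabla(M;E)$ continuously to $H^{-m}_\nabla(M;F)$. That is, there are $c_j\in C_b^\infty(M;\mathrm{Hom}(T^{*\otimes j}M\otimes E,F))$, $0\le j\le 2m$, such that $P=\sum_{j=0}^{2m}c_j\nabla^j$ has the following properties. 1. $B(u,w)=\int_M(Pu,w)\,\mathrm{dvol}$ for all $u\in C_c^\infty(M;E)$ and $w\in C_c^\infty(M;F)$. 2. With weak derivatives in place of classical ones, $B(u,w)$ converges absolutely for all $u\in H^m_\nabla(M;E)$ and $w\in H^m_{0,\nabla}(M;F)$, it agrees with the classical value if $u$ and $w$ are smooth with compact support, and $u\mapsto B(u,\cdot)$ is a continuous linear map $H^m_\nabla(M;E)\to H^{-m}_\nabla(M;F)$. It is given by $P$ in the sense of distributions: $B(u,w)=\sum_{j=0}^{2m}\int_M(u,(\nabla^j)^*c_j^*w)\,\mathrm{dvol}$ for $u\in H^m_\nabla(M;E)$ and $w\in C_c^\infty(M;F)$. 3. (Weighted spaces.) Let $\rho,f,h:M\to(0,\infty)$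 be admissible weights for the metric $g_0=\rho^{-2}g$, and suppose that $f\le Ch$ and $f\le Ch\rho^{2m}$ on $M$ for some constant $C$. Then the same operator $P$ has the properties in 2 with $fH^m_{\nabla,\rho}(M;E)$ in place of $H^m_\nabla(M;E)$, with $h^{-1}H^m_{0,\nabla,\rho}(M;F)$ in place of $H^m_{0,\nabla}(M;F)$, and with $hH^{-m}_{\nabla,\rho}(M;F)$ in place of $H^{-m}_\nabla(M;F)$: it is a continuous linear map $$P_{\mathfrak b}:fH^m_{\nabla,\rho}(M;E)\to hH^{-m}_{\nabla,\rho}(M;F).$$ -/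

import Mathlib

set_option linter.checkUnivs false

open Bundle MeasureTheory
open scoped Manifold ContDiff Topology

noncomputable section

namespace NablaSobolev

/-! ### Smooth real vector bundles with a fibre metric and a connection -/

/-- The data of a smooth real vector bundle of finite rank over `M`, together with a bilinear form
on its fibres and a covariant derivative. The structure records data only: the metrics and
connections that occur below are those of a Riemannian structure, of a Hermitian structure, of
trivial bundles, and those they induce on bundles of homomorphisms. -/
structure MetricBundle (n : ℕ) (M : Type*) [TopologicalSpace M]
    [ChartedSpace (EuclideanSpace ℝ (Fin n)) M] where
  /-- The model fibre. -/
  Model : Type*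
  [normedModel : NormedAddCommGroup Model]
  [spaceModel : NormedSpace ℝ Model]
  [finModel : FiniteDimensional ℝ Model]
  /-- The fibres. -/
  Fib : M → Type*
  [topTotal : TopologicalSpace (TotalSpace Model Fib)]
  [topFib : ∀ x, TopologicalSpace (Fib x)]
  [addFib : ∀ x, AddCommGroup (Fib x)]
  [modFib : ∀ x, Module ℝ (Fib x)]
  [topAddFib : ∀ x, IsTopologicalAddGroup (Fib x)]
  [smulFib : ∀ x, ContinuousSMul ℝ (Fib x)]
  [fiber : FiberBundle Model Fib]
  [vector : VectorBundle ℝ Model Fib]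
  [smooth : ContMDiffVectorBundle ∞ Model Fib (𝓡 n)]
  /-- The metric on the fibres. -/
  inner : ∀ x, Fib x → Fib x → ℝ
  /-- The covariant derivative; `cov s x v` is the derivative of the section `s` in the direction of
  the tangent vector `v` at `x`. -/
  cov : (∀ x, Fib x) → ∀ x, TangentSpace (𝓡 n) x →L[ℝ] Fib x

attribute [instance] MetricBundle.normedModel MetricBundle.spaceModel MetricBundle.finModel
  MetricBundle.topTotal MetricBundle.topFib MetricBundle.addFib MetricBundle.modFib
  MetricBundle.topAddFib MetricBundle.smulFib MetricBundle.fiber MetricBundle.vector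
  MetricBundle.smooth

section Bundles

variable {n : ℕ} {M : Type*} [TopologicalSpace M] [ChartedSpace (EuclideanSpace ℝ (Fin n)) M]

namespace MetricBundle

/-- Sections, with no regularity. -/
abbrev Sec (A : MetricBundle n M) := ∀ x, A.Fib x

/-- Smooth sections. -/
def IsSmooth (A : MetricBundle n M) (s : A.Sec) : Prop :=
  ContMDiff (𝓡 n) ((𝓡 n).prod 𝓘(ℝ, A.Model)) ∞ (fun x => TotalSpace.mk' A.Model x (s x))

/-- Smooth sections with compact support. -/
def IsTest (A : MetricBundle n M) (s : A.Sec) : Prop :=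
  A.IsSmooth s ∧ ∃ K : Set M, IsCompact K ∧ ∀ x ∉ K, s x = 0

/-- The norm of a vector in a fibre. -/
def norm (A : MetricBundle n M) (x : M) (v : A.Fib x) : ℝ := √(A.inner x v v)

/-- The local frame given by the preferred trivialization at `x₀`. -/
def frame (A : MetricBundle n M) (x₀ : M) (i : Fin (Module.finrank ℝ A.Model)) : A.Sec :=
  fun x => (trivializationAt A.Model A.Fib x₀).symm x (Module.finBasis ℝ A.Model i)

/-- The basis of the dual of the fibre at `x` that is dual to the frame `A.frame x` at `x`. -/
def coframe (A : MetricBundle n M) (x : M) (i : Fin (Module.finrank ℝ A.Model)) :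
    A.Fib x →L[ℝ] ℝ :=
  (LinearMap.toContinuousLinearMap ((Module.finBasis ℝ A.Model).coord i)).comp
    ((trivializationAt A.Model A.Fib x).continuousLinearMapAt ℝ x)

/-- The inverse of the Gram matrix of the frame `A.frame x` at `x`, that is `(g^{ij})`. -/
def gramInv (A : MetricBundle n M) (x : M) :
    Matrix (Fin (Module.finrank ℝ A.Model)) (Fin (Module.finrank ℝ A.Model)) ℝ :=
  (Matrix.of fun i j => A.inner x (A.frame x i x) (A.frame x j x))⁻¹

/-- The induced covariant derivative of a section `a` of `Hom(A, B)`,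
`(∇_v a) ξ = ∇_v (a ξ) - a (∇_v ξ)`, computed in the local frame at `x`. -/
def homCov (A B : MetricBundle n M) (a : ∀ x, A.Fib x →L[ℝ] B.Fib x) (x : M) :
    TangentSpace (𝓡 n) x →L[ℝ] A.Fib x →L[ℝ] B.Fib x :=
  letI : FiniteDimensional ℝ (TangentSpace (𝓡 n) x) :=
    inferInstanceAs (FiniteDimensional ℝ (EuclideanSpace ℝ (Fin n)))
  letI : T2Space (TangentSpace (𝓡 n) x) := inferInstanceAs (T2Space (EuclideanSpace ℝ (Fin n)))
  LinearMap.toContinuousLinearMap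
    { toFun := fun v => ∑ i, (A.coframe x i).smulRight
        (B.cov (fun y => a y (A.frame x i y)) x v - a x (A.cov (A.frame x i) x v))
      map_add' := fun v w => by
        ext ξ
        simp only [map_add, add_apply, sum_apply,
          ContinuousLinearMap.smulRight_apply, ← Finset.sum_add_distrib]
        refine Finset.sum_congr rfl fun i _ => ?_
        rw [← smul_add]
        congr 1
        abel
      map_smul' := fun c v => by
        ext ξ
        simp only [map_smul, smul_apply, sum_apply,
          ContinuousLinearMap.smulRight_apply, Finset.smul_sum, RingHom.id_apply]
        refine Finset.sum_congr rfl fun i _ => ?_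
        rw [← smul_sub, smul_comm] }

/-- The bundle `Hom(A, B) = A' ⊗ B`, with the Hilbert--Schmidt metric
`∑ g^{ij} (a e_i, b e_j)` and the induced connection. -/
def Hom (A B : MetricBundle n M) : MetricBundle n M where
  Model := A.Model →L[ℝ] B.Model
  Fib x := A.Fib x →L[ℝ] B.Fib x
  inner x a b := ∑ i, ∑ j,
    A.gramInv x i j * B.inner x (a (A.frame x i x)) (b (A.frame x j x))
  cov := homCov A B

/-- The trivial bundle with fibre `V`, its constant metric and its flat connection. -/
def trivial (n : ℕ) (M : Type*) [TopologicalSpace M] [ChartedSpace (EuclideanSpace ℝ (Fin n)) M]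
    (V : Type*) [NormedAddCommGroup V] [InnerProductSpace ℝ V] [FiniteDimensional ℝ V] :
    MetricBundle n M where
  Model := V
  Fib := Bundle.Trivial M V
  topFib _ := inferInstanceAs (TopologicalSpace V)
  addFib _ := inferInstanceAs (AddCommGroup V)
  modFib _ := inferInstanceAs (Module ℝ V)
  topAddFib _ := inferInstanceAs (IsTopologicalAddGroup V)
  smulFib _ := inferInstanceAs (ContinuousSMul ℝ V)
  inner _ v w := Inner.inner ℝ (E := V) v w
  cov s x := mvfderiv (𝓡 n) (F := V) s x

/-- The pointwise adjoint `a* : B → A` of a section `a` of `Hom(A, B)`. -/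
def adjoint (A B : MetricBundle n M) (a : ∀ x, A.Fib x →L[ℝ] B.Fib x) (s : B.Sec) : A.Sec :=
  fun x => ∑ i, ∑ j, (A.gramInv x i j * B.inner x (a x (A.frame x i x)) (s x)) • A.frame x j x

end MetricBundle

/-! ### Riemannian manifolds and Hermitian bundles -/

/-- A smooth Riemannian metric together with its Levi-Civita connection, that is, the torsion-free
covariant derivative on the tangent bundle that preserves the metric. -/
structure RiemannianStructure (n : ℕ) (M : Type*) [TopologicalSpace M]
    [ChartedSpace (EuclideanSpace ℝ (Fin n)) M] [IsManifold (𝓡 n) ∞ M] where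
  /-- The metric. -/
  metric : ContMDiffRiemannianMetric (𝓡 n) ∞ (EuclideanSpace ℝ (Fin n))
    (fun x : M => TangentSpace (𝓡 n) x)
  /-- The Levi-Civita connection. -/
  conn : CovariantDerivative (𝓡 n) (EuclideanSpace ℝ (Fin n)) (fun x : M => TangentSpace (𝓡 n) x)
  smooth_conn : CovariantDerivative.ContMDiffCovariantDerivative conn ∞
  torsion_free : conn.torsion = 0
  metric_conn : ∀ (x : M) (v : TangentSpace (𝓡 n) x) (Y Z : ∀ y : M, TangentSpace (𝓡 n) y),
    MDifferentiableAt (𝓡 n) ((𝓡 n).prod 𝓘(ℝ, EuclideanSpace ℝ (Fin n)))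
      (fun y => TotalSpace.mk' (EuclideanSpace ℝ (Fin n)) y (Y y)) x →
    MDifferentiableAt (𝓡 n) ((𝓡 n).prod 𝓘(ℝ, EuclideanSpace ℝ (Fin n)))
      (fun y => TotalSpace.mk' (EuclideanSpace ℝ (Fin n)) y (Z y)) x →
    mvfderiv (𝓡 n) (fun y => metric.inner y (Y y) (Z y)) x v =
      metric.inner x (conn Y x v) (Z x) + metric.inner x (Y x) (conn Z x v)

/-- A smooth Hermitian metric on a complex vector bundle (the given inner products on the fibres
vary smoothly) together with a smooth, complex linear, metric preserving connection. -/
structure HermitianStructure (n : ℕ) {M : Type*} [TopologicalSpace M]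
    [ChartedSpace (EuclideanSpace ℝ (Fin n)) M] [IsManifold (𝓡 n) ∞ M]
    (F : Type*) [NormedAddCommGroup F] [NormedSpace ℂ F]
    (E : M → Type*) [TopologicalSpace (TotalSpace F E)] [∀ x, NormedAddCommGroup (E x)]
    [∀ x, InnerProductSpace ℂ (E x)] [FiberBundle F E] [VectorBundle ℂ F E]
    [VectorBundle ℝ F E] [ContMDiffVectorBundle ∞ F E (𝓡 n)] where
  smooth_inner : ∀ u w : (∀ x, E x),
    ContMDiff (𝓡 n) ((𝓡 n).prod 𝓘(ℝ, F)) ∞ (fun x => TotalSpace.mk' F x (u x)) →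
    ContMDiff (𝓡 n) ((𝓡 n).prod 𝓘(ℝ, F)) ∞ (fun x => TotalSpace.mk' F x (w x)) →
    ContMDiff (𝓡 n) 𝓘(ℝ, ℂ) ∞ (fun x => inner ℂ (u x) (w x))
  /-- The connection. -/
  conn : CovariantDerivative (𝓡 n) F E
  smooth_conn : CovariantDerivative.ContMDiffCovariantDerivative conn ∞
  complex_conn : ∀ (x : M) (v : TangentSpace (𝓡 n) x) (u : ∀ y, E y),
    MDifferentiableAt (𝓡 n) ((𝓡 n).prod 𝓘(ℝ, F)) (fun y => TotalSpace.mk' F y (u y)) x →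
    conn (fun y => Complex.I • u y) x v = Complex.I • conn u x v
  metric_conn : ∀ (x : M) (v : TangentSpace (𝓡 n) x) (u w : ∀ y, E y),
    MDifferentiableAt (𝓡 n) ((𝓡 n).prod 𝓘(ℝ, F)) (fun y => TotalSpace.mk' F y (u y)) x →
    MDifferentiableAt (𝓡 n) ((𝓡 n).prod 𝓘(ℝ, F)) (fun y => TotalSpace.mk' F y (w y)) x →
    mvfderiv (𝓡 n) (fun y => inner ℂ (u y) (w y)) x v =
      inner ℂ (conn u x v) (w x) + inner ℂ (u x) (conn w x v)

variable [IsManifold (𝓡 n) ∞ M]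

/-- The tangent bundle of a Riemannian manifold. -/
def RiemannianStructure.tangent (R : RiemannianStructure n M) : MetricBundle n M where
  Model := EuclideanSpace ℝ (Fin n)
  Fib := fun x : M => TangentSpace (𝓡 n) x
  inner x v w := R.metric.inner x v w
  cov := R.conn.toFun

/-- The real metric bundle underlying a Hermitian bundle. -/
def HermitianStructure.bundle {F : Type*} [NormedAddCommGroup F] [NormedSpace ℂ F]
    [FiniteDimensional ℂ F] {E : M → Type*} [TopologicalSpace (TotalSpace F E)]
    [∀ x, NormedAddCommGroup (E x)] [∀ x, InnerProductSpace ℂ (E x)] [FiberBundle F E]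
    [VectorBundle ℂ F E] [VectorBundle ℝ F E] [ContMDiffVectorBundle ∞ F E (𝓡 n)] (H : HermitianStructure n F E) :
    MetricBundle n M where
  Model := F
  Fib := E
  inner x u w := (inner ℂ u w).re
  cov := H.conn.toFun

namespace MetricBundle

/-- The bundle `T^{*⊗k}M ⊗ A`. -/
def tens (R : RiemannianStructure n M) (A : MetricBundle n M) : ℕ → MetricBundle n M
  | 0 => A
  | k + 1 => Hom R.tangent (tens R A k)

/-- The iterated covariant derivative `∇^k`, from sections of `A` to sections of
`T^{*⊗k}M ⊗ A`. -/
def nabla (R : RiemannianStructure n M) (A : MetricBundle n M) : ∀ k, A.Sec → (A.tens R k).Sec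
  | 0 => fun u => u
  | k + 1 => fun u => (A.tens R k).cov (nabla R A k u)

/-- The codifferential `∇^* φ = - ∑ g^{ij} (∇_{e_i} φ)(e_j)` of a section `φ` of `T^*M ⊗ A`. -/
def codiff (R : RiemannianStructure n M) (A : MetricBundle n M) (φ : (Hom R.tangent A).Sec) :
    A.Sec := fun x =>
  -∑ i, ∑ j, R.tangent.gramInv x i j •
    homCov R.tangent A φ x (R.tangent.frame x i x) (R.tangent.frame x j x)

/-- The formal adjoint `(∇^k)^*` of `∇^k`. -/
def nablaStar (R : RiemannianStructure n M) (A : MetricBundle n M) :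
    ∀ k, (A.tens R k).Sec → A.Sec
  | 0 => fun φ => φ
  | k + 1 => fun φ => nablaStar R A k (codiff R (A.tens R k) φ)

/-- The space `C_b^∞(M; A)` of smooth sections all of whose covariant derivatives are bounded. -/
def IsTotallyBounded (R : RiemannianStructure n M) (A : MetricBundle n M) (s : A.Sec) : Prop :=
  A.IsSmooth s ∧ ∀ k, ∃ C : ℝ, ∀ x, (A.tens R k).norm x (A.nabla R k s x) ≤ C

end MetricBundle

open MetricBundle

/-- The Fréchet finiteness condition: `TM` has an isometric embedding into a trivial bundle
`M × ℝ^N` that is a section of class `C_b^∞` of `Hom(TM, ℝ^N)`. -/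
def RiemannianStructure.FrechetFiniteness (R : RiemannianStructure n M) : Prop :=
  ∃ (N : ℕ) (Φ : ∀ x, R.tangent.Fib x →L[ℝ] (trivial n M (EuclideanSpace ℝ (Fin N))).Fib x),
    IsTotallyBounded R (Hom R.tangent (trivial n M (EuclideanSpace ℝ (Fin N)))) Φ ∧
    ∀ (x : M) (v w : R.tangent.Fib x),
      (trivial n M (EuclideanSpace ℝ (Fin N))).inner x (Φ x v) (Φ x w) = R.metric.inner x v w

/-- `f` is an admissible weight for the Riemannian metric of `R`: a smooth positive function with
`f⁻¹ df ∈ C_b^∞(M; T^*M)`. -/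
def RiemannianStructure.IsAdmissible (R : RiemannianStructure n M) (f : M → ℝ) : Prop :=
  ContMDiff (𝓡 n) 𝓘(ℝ, ℝ) ∞ f ∧ (∀ x, 0 < f x) ∧
    IsTotallyBounded R (Hom R.tangent (trivial n M ℝ))
      (fun x => (f x)⁻¹ • mvfderiv (𝓡 n) f x)

/-! ### The Riemannian volume measure -/

theorem exists_countable_charts (n : ℕ) (M : Type*) [TopologicalSpace M]
    [ChartedSpace (EuclideanSpace ℝ (Fin n)) M] [SecondCountableTopology M] :
    ∃ s : Set M, s.Countable ∧ ⋃ x ∈ s, (chartAt (EuclideanSpace ℝ (Fin n)) x).source = Set.univ :=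
  TopologicalSpace.countable_cover_nhds fun x => chart_source_mem_nhds _ x

/-- The measure `√(det g_{ij}) dy` of the preferred chart at `x₀`, carried by its domain. The vectors
`∂_i` are read off the trivialization of `TM` that belongs to this chart. -/
def RiemannianStructure.chartVolume [MeasurableSpace M] (R : RiemannianStructure n M) (x₀ : M) :
    Measure M :=
  letI e : Fin n → ∀ x : M, TangentSpace (𝓡 n) x := fun i x =>
    (trivializationAt (EuclideanSpace ℝ (Fin n)) (fun x : M => TangentSpace (𝓡 n) x) x₀).symm x
      (EuclideanSpace.single i 1)
  Measure.map (extChartAt (𝓡 n) x₀).symm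
    ((volume.restrict (extChartAt (𝓡 n) x₀).target).withDensity fun y =>
      ENNReal.ofReal √(Matrix.det (Matrix.of fun i j =>
        R.metric.inner ((extChartAt (𝓡 n) x₀).symm y) (e i ((extChartAt (𝓡 n) x₀).symm y))
          (e j ((extChartAt (𝓡 n) x₀).symm y)))))

/-- The Riemannian volume measure: the measures of the charts of a countable cover of `M` by chart
domains, each restricted to the part of its domain that no earlier chart covers. -/
def RiemannianStructure.vol [MeasurableSpace M] [SecondCountableTopology M]
    (R : RiemannianStructure n M) : Measure M :=
  letI : Encodable (exists_countable_charts n M).choose :=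
    (exists_countable_charts n M).choose_spec.1.toEncodable
  Measure.sum fun x : (exists_countable_charts n M).choose =>
    (R.chartVolume x.1).restrict
      ((chartAt (EuclideanSpace ℝ (Fin n)) x.1).source \
        ⋃ y : (exists_countable_charts n M).choose, ⋃ _ : Encodable.encode y < Encodable.encode x,
          (chartAt (EuclideanSpace ℝ (Fin n)) y.1).source)

/-! ### Weak covariant derivatives and (weighted) Sobolev spaces -/

namespace MetricBundle

variable [MeasurableSpace M] [SecondCountableTopology M]

/-- Measurability of a section, in the local trivializations and up to null sets. -/
def IsMeas (R : RiemannianStructure n M) (A : MetricBundle n M) (s : A.Sec) : Prop :=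
  ∀ x₀, AEStronglyMeasurable (fun x => (trivializationAt A.Model A.Fib x₀ ⟨x, s x⟩).2)
    (R.vol.restrict (trivializationAt A.Model A.Fib x₀).baseSet)

/-- Square integrable sections. -/
def IsL2 (R : RiemannianStructure n M) (A : MetricBundle n M) (s : A.Sec) : Prop :=
  A.IsMeas R s ∧ Integrable (fun x => A.inner x (s x) (s x)) R.vol

/-- Locally integrable sections. -/
def IsLocL1 (R : RiemannianStructure n M) (A : MetricBundle n M) (s : A.Sec) : Prop :=
  A.IsMeas R s ∧ LocallyIntegrable (fun x => A.norm x (s x)) R.vol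

/-- `∇^k u = v` in the sense of distributions, for locally integrable `u` and `v`. -/
def IsWeakNabla (R : RiemannianStructure n M) (A : MetricBundle n M) (k : ℕ) (u : A.Sec)
    (v : (A.tens R k).Sec) : Prop :=
  A.IsLocL1 R u ∧ (A.tens R k).IsLocL1 R v ∧
    ∀ φ, (A.tens R k).IsTest φ →
      integral R.vol (fun x => (A.tens R k).inner x (v x) (φ x)) =
        integral R.vol (fun x => A.inner x (u x) (A.nablaStar R k φ x))

open Classical in
/-- The weak derivative `∇^k u`, unique up to null sets when it exists (and `0` otherwise). -/
def weakNabla (R : RiemannianStructure n M) (A : MetricBundle n M) (k : ℕ) (u : A.Sec) :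
    (A.tens R k).Sec :=
  if h : ∃ v, A.IsWeakNabla R k u v then h.choose else 0

/-- The Sobolev space `f H^m_{∇,ρ}(M; A)` of all `u` such that `ρ^k ∇^k (f⁻¹ u)` is square
integrable for `k ≤ m`. For `f = ρ = 1` it is `H^m_∇(M; A)`. -/
def MemSobolev (R : RiemannianStructure n M) (A : MetricBundle n M) (f ρ : M → ℝ) (m : ℕ)
    (u : A.Sec) : Prop :=
  ∀ k ≤ m, ∃ v, A.IsWeakNabla R k (fun x => (f x)⁻¹ • u x) v ∧
    (A.tens R k).IsL2 R (fun x => ρ x ^ k • v x)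

/-- The norm of `f H^m_{∇,ρ}(M; A)`. -/
def sobolevNorm (R : RiemannianStructure n M) (A : MetricBundle n M) (f ρ : M → ℝ) (m : ℕ)
    (u : A.Sec) : ℝ :=
  √(∑ k ∈ Finset.range (m + 1),
    integral R.vol (fun x =>
      (A.tens R k).norm x (ρ x ^ k • A.weakNabla R k (fun y => (f y)⁻¹ • u y) x) ^ 2))

/-- The closure `f H^m_{0,∇,ρ}(M; A)` of the smooth compactly supported sections in
`f H^m_{∇,ρ}(M; A)`. -/
def MemSobolevZero (R : RiemannianStructure n M) (A : MetricBundle n M) (f ρ : M → ℝ) (m : ℕ)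
    (u : A.Sec) : Prop :=
  A.MemSobolev R f ρ m u ∧ ∀ ε > 0, ∃ φ, A.IsTest φ ∧ A.sobolevNorm R f ρ m (u - φ) < ε

end MetricBundle

/-! ### Differential and bidifferential operators on Hermitian bundles -/

section Operators

variable {F : Type*} [NormedAddCommGroup F] [NormedSpace ℂ F] [FiniteDimensional ℂ F]
  {E : M → Type*} [TopologicalSpace (TotalSpace F E)] [∀ x, NormedAddCommGroup (E x)]
  [∀ x, InnerProductSpace ℂ (E x)] [FiberBundle F E] [VectorBundle ℂ F E] [VectorBundle ℝ F E]
  [ContMDiffVectorBundle ∞ F E (𝓡 n)]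
  {F' : Type*} [NormedAddCommGroup F'] [NormedSpace ℂ F'] [FiniteDimensional ℂ F']
  {E' : M → Type*} [TopologicalSpace (TotalSpace F' E')] [∀ x, NormedAddCommGroup (E' x)]
  [∀ x, InnerProductSpace ℂ (E' x)] [FiberBundle F' E'] [VectorBundle ℂ F' E']
  [VectorBundle ℝ F' E'] [ContMDiffVectorBundle ∞ F' E' (𝓡 n)]

/-- Multiplication by `i` on the fibres of `T^{*⊗k}M ⊗ E`. -/
def mulI (R : RiemannianStructure n M) (H : HermitianStructure n F E) :
    ∀ k x, (H.bundle.tens R k).Fib x →L[ℝ] (H.bundle.tens R k).Fib x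
  | 0, x => (Complex.I • ContinuousLinearMap.id ℝ (E x) : E x →L[ℝ] E x)
  | k + 1, x => ContinuousLinearMap.postcomp (R.tangent.Fib x) (mulI R H k x)

/-- The Hermitian inner product `(ξ, η)` on `T^{*⊗k}M ⊗ E`, linear in `ξ` and conjugate linear in
`η`, whose real part is the metric. -/
def herm (R : RiemannianStructure n M) (H : HermitianStructure n F E) (k : ℕ) (x : M)
    (ξ η : (H.bundle.tens R k).Fib x) : ℂ :=
  ((H.bundle.tens R k).inner x ξ η : ℂ) +
    Complex.I * ((H.bundle.tens R k).inner x ξ (mulI R H k x η) : ℂ)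

/-- The fibres of the bundle of real linear homomorphisms `T^{*⊗i}M ⊗ E → T^{*⊗j}M ⊗ E'`. -/
abbrev tensHom (R : RiemannianStructure n M) (H : HermitianStructure n F E)
    (H' : HermitianStructure n F' E') (i j : ℕ) : MetricBundle n M :=
  Hom (H.bundle.tens R i) (H'.bundle.tens R j)

/-- `a ∈ C_b^∞(M; Hom(T^{*⊗i}M ⊗ E, T^{*⊗j}M ⊗ E'))`, with complex linear homomorphisms. -/
def IsCoeff (R : RiemannianStructure n M) (H : HermitianStructure n F E)
    (H' : HermitianStructure n F' E') (i j : ℕ)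
    (a : ∀ x, (H.bundle.tens R i).Fib x →L[ℝ] (H'.bundle.tens R j).Fib x) : Prop :=
  (tensHom R H H' i j).IsTotallyBounded R a ∧
    ∀ x ξ, a x (mulI R H i x ξ) = mulI R H' j x (a x ξ)

/-- The `∇`-differential operator `∑_{j ≤ μ} c_j ∇^j` of order `≤ μ`. -/
def diffOp (R : RiemannianStructure n M) (H : HermitianStructure n F E)
    (H' : HermitianStructure n F' E') (μ : ℕ)
    (c : ∀ j x, (H.bundle.tens R j).Fib x →L[ℝ] (H'.bundle.tens R 0).Fib x)
    (u : H.bundle.Sec) : H'.bundle.Sec :=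
  fun x => ∑ j ∈ Finset.range (μ + 1), c j x (H.bundle.nabla R j u x)

/-- The integrand `𝔟(u ⊗ w̄) = ∑_{i,j ≤ m} (a_{ij} ξ_i, η_j)` of a bidifferential operator, where
`ξ_i` and `η_j` stand for the derivatives `∇^i u` and `∇^j w`. -/
def bidiffForm (R : RiemannianStructure n M) (H : HermitianStructure n F E)
    (H' : HermitianStructure n F' E') (m : ℕ)
    (a : ∀ i j x, (H.bundle.tens R i).Fib x →L[ℝ] (H'.bundle.tens R j).Fib x) (x : M)
    (ξ : ∀ i, (H.bundle.tens R i).Fib x) (η : ∀ j, (H'.bundle.tens R j).Fib x) : ℂ :=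
  ∑ i ∈ Finset.range (m + 1), ∑ j ∈ Finset.range (m + 1), herm R H' j x (a i j x (ξ i)) (η j)

/-- The function `𝔟(u ⊗ w̄) = ∑_{i,j ≤ m} (a_{ij} ∇^i u, ∇^j w)` on `M`, for smooth `u` and `w`. -/
def bidiff (R : RiemannianStructure n M) (H : HermitianStructure n F E)
    (H' : HermitianStructure n F' E') (m : ℕ)
    (a : ∀ i j x, (H.bundle.tens R i).Fib x →L[ℝ] (H'.bundle.tens R j).Fib x)
    (u : H.bundle.Sec) (w : H'.bundle.Sec) (x : M) : ℂ :=
  bidiffForm R H H' m a x (fun i => H.bundle.nabla R i u x) (fun j => H'.bundle.nabla R j w x)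

variable [MeasurableSpace M] [SecondCountableTopology M]

/-- The function `𝔟(u ⊗ w̄)` on `M`, with weak derivatives. -/
def weakBidiff (R : RiemannianStructure n M) (H : HermitianStructure n F E)
    (H' : HermitianStructure n F' E') (m : ℕ)
    (a : ∀ i j x, (H.bundle.tens R i).Fib x →L[ℝ] (H'.bundle.tens R j).Fib x)
    (u : H.bundle.Sec) (w : H'.bundle.Sec) (x : M) : ℂ :=
  bidiffForm R H H' m a x (fun i => H.bundle.weakNabla R i u x)
    (fun j => H'.bundle.weakNabla R j w x)

/-- The Dirichlet form `B(u, w) = ∫ 𝔟(u ⊗ w̄) dvol` on Sobolev sections. For fixed `u`, the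
functional `w ↦ B(u, w)` is `P_𝔟 u`. -/
def dirichletForm (R : RiemannianStructure n M) (H : HermitianStructure n F E)
    (H' : HermitianStructure n F' E') (m : ℕ)
    (a : ∀ i j x, (H.bundle.tens R i).Fib x →L[ℝ] (H'.bundle.tens R j).Fib x)
    (u : H.bundle.Sec) (w : H'.bundle.Sec) : ℂ :=
  integral R.vol (weakBidiff R H H' m a u w)

/-- The value at the test section `w` of `∑_{j ≤ μ} c_j ∇^j u`, computed in the sense of
distributions: `∑_j ∫ (u, (∇^j)^* c_j^* w) dvol`. -/
def diffOpDistribution (R : RiemannianStructure n M) (H : HermitianStructure n F E)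
    (H' : HermitianStructure n F' E') (μ : ℕ)
    (c : ∀ j x, (H.bundle.tens R j).Fib x →L[ℝ] (H'.bundle.tens R 0).Fib x)
    (u : H.bundle.Sec) (w : H'.bundle.Sec) : ℂ :=
  ∑ j ∈ Finset.range (μ + 1), integral R.vol (fun x => herm R H 0 x (u x)
    (H.bundle.nablaStar R j (adjoint (H.bundle.tens R j) (H'.bundle.tens R 0) (c j) w) x))

/-- `ℓ` restricts to an element of `f H^{-m}_{∇,ρ}(M; E)`, the space of bounded conjugate linear
functionals on `f⁻¹ H^m_{0,∇,ρ}(M; E)`, and its norm there is at most `C`. -/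
structure IsNegSobolev (R : RiemannianStructure n M) (H : HermitianStructure n F E)
    (f ρ : M → ℝ) (m : ℕ) (ℓ : (∀ x, E x) → ℂ) (C : ℝ) : Prop where
  add : ∀ w₁ w₂, H.bundle.MemSobolevZero R f⁻¹ ρ m w₁ → H.bundle.MemSobolevZero R f⁻¹ ρ m w₂ →
    ℓ (w₁ + w₂) = ℓ w₁ + ℓ w₂
  smul : ∀ (z : ℂ) (w : ∀ x, E x), H.bundle.MemSobolevZero R f⁻¹ ρ m w →
    ℓ (z • w) = (starRingEnd ℂ) z * ℓ w
  bound : ∀ w, H.bundle.MemSobolevZero R f⁻¹ ρ m w →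
    ‖ℓ w‖ ≤ C * H.bundle.sobolevNorm R f⁻¹ ρ m w

/-- `u ↦ B(u, ·)` is a continuous linear map `f H^m_{∇,ρ}(M; E) → h H^{-m}_{∇,ρ}(M; E')`, and it is
given by the differential operator `∑_{j ≤ 2m} c_j ∇^j` in the sense of distributions. -/
structure IsExtension (R : RiemannianStructure n M) (H : HermitianStructure n F E)
    (H' : HermitianStructure n F' E') (m : ℕ)
    (a : ∀ i j x, (H.bundle.tens R i).Fib x →L[ℝ] (H'.bundle.tens R j).Fib x)
    (c : ∀ j x, (H.bundle.tens R j).Fib x →L[ℝ] (H'.bundle.tens R 0).Fib x)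
    (f h ρ : M → ℝ) : Prop where
  integrable : ∀ u w, H.bundle.MemSobolev R f ρ m u → H'.bundle.MemSobolevZero R h⁻¹ ρ m w →
    Integrable (weakBidiff R H H' m a u w) R.vol
  linear : ∀ (z : ℂ) (u₁ u₂ : ∀ x, E x) (w : ∀ x, E' x), H.bundle.MemSobolev R f ρ m u₁ →
    H.bundle.MemSobolev R f ρ m u₂ → H'.bundle.MemSobolevZero R h⁻¹ ρ m w →
    dirichletForm R H H' m a (z • u₁ + u₂) w =
      z * dirichletForm R H H' m a u₁ w + dirichletForm R H H' m a u₂ w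
  bounded : ∃ C : ℝ, ∀ u, H.bundle.MemSobolev R f ρ m u →
    IsNegSobolev R H' h ρ m (fun w => dirichletForm R H H' m a u w)
      (C * H.bundle.sobolevNorm R f ρ m u)
  eq_diffOp : ∀ u w, H.bundle.MemSobolev R f ρ m u → H'.bundle.IsTest w →
    dirichletForm R H H' m a u w = diffOpDistribution R H H' (2 * m) c u w

end Operators

end Bundles

end NablaSobolev

/-!
Why a divergence form operator with `C_b^∞` coefficients is an operator `∑ c_l ∇^l` of the same kind,
and why it acts between (weighted) Sobolev spaces.

Condition (FFC) is used through a single consequence: the Riesz representatives of the components of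
the embedding `TM → M × ℝ^N` are finitely many smooth vector fields `X_i` that form a Parseval frame
of every tangent space (`exists_isParseval`). Traces over the tangent bundle are then global finite
sums, in particular `∇^* φ = -∑ (∇_{X_i} φ)(X_i)`, and no local orthonormal frames are needed. The
derivatives of the `X_i` never have to be estimated: differentiating `v = ∑ ⟨X_i, v⟩ X_i` shows that
they cancel in every sum `∑ β(X_i, X_i)` with `β` bilinear (`IsGeometric.sum_dual_dir`).

The bundles that occur arise from `TM`, `E`, `F` and trivial bundles by forming homomorphisms, and
each has a smooth metric and a smooth metric connection (`IsGeometric`, `IsGeometric.hom`). The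
contractions with the metric of `TM` are parallel and bounded (`IsParseval.isParallel_contract`,
`IsParseval.isParallel_flatten`), so the product rule for `∇^*` turns `∇^* ∘ ∑ c_l ∇^l` into an
operator of the same form whose coefficients are again of class `C_b^∞`
(`IsParseval.isOperator_codiff`). Iterating, `∑ (∇^j)^* a_{ij} ∇^i` becomes `∑ c_l ∇^l` with
`l ≤ 2 m` (`isOperator_divergenceOp`). Integration by parts (`IsParseval.integral_inner_nabla`) shows
that this operator represents the Dirichlet form on sections with compact support. It rests on the
divergence theorem (`IsParseval.integral_div`), which is proved in charts: there the Riemannian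
measure has density `√det g` (`vol_restrict_source`), and the logarithmic derivative of `√det g` is
the trace of the Christoffel symbols (`der_density`).

For Sobolev sections, the Leibniz rule for weak derivatives (`IsWeakGrad.app`,
`HasWeakBounds.weight`) bounds `f⁻¹ ρ^k |∇^k u|` pointwise by the square integrable function
`∑_{k ≤ m} ρ^k |∇^k (f⁻¹ u)|`, as soon as `ρ^{j+1} |∇^j (f⁻¹ df)|` is bounded for every `j`. The two
conditions on `f`, `h` and `ρ` give `f ≤ C h ρ^l` for all `l ≤ 2 m` (`weight_le`), which lets the
weights of the two arguments compensate each other; the Cauchy--Schwarz inequality gives convergence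
and continuity (`exists_norm_dirichletForm_le`). The bounds for `f⁻¹ df` are with respect to `g`,
while admissibility refers to `ρ⁻² g`; the formula for the conformal change of the Levi-Civita
connection (`IsParseval.conn_conformal`) translates between the two, first for `ρ` itself and then
for `f` and `h` (`hasBounds_logDeriv`).

The distributional identity needs no approximation of `u`. For a fixed test section `w`, both sides
are integrals of `u` against smooth compactly supported sections that depend on `w` only. These agree
almost everywhere, because they agree when tested against smooth `u` (`sum_integral_inner_weak`).

All of this is carried out with the real parts of the Hermitian metrics. Multiplication by `i` is a
skew parallel endomorphism, and the imaginary part of the form is its real part with `w` replaced by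
`i w` (`integral_bidiffForm`).
-/

namespace NablaSobolev

namespace MetricBundle

section

/-! ### Linear algebra of an inner product on a finite-dimensional space -/

section InnerProduct

variable {V : Type*} [AddCommGroup V] [Module ℝ V]

/-- A positive definite symmetric bilinear form on a real vector space. -/
structure IsInner (b : V → V → ℝ) : Prop where
  symm : ∀ v w, b v w = b w v
  add_left : ∀ u v w, b (u + v) w = b u w + b v w
  smul_left : ∀ (c : ℝ) v w, b (c • v) w = c * b v w
  pos : ∀ v, v ≠ 0 → 0 < b v v

namespace IsInner

variable {b : V → V → ℝ} (hb : IsInner b)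
include hb

lemma add_right (u v w : V) : b u (v + w) = b u v + b u w := by
  rw [hb.symm, hb.add_left, hb.symm v, hb.symm w]

lemma smul_right (c : ℝ) (v w : V) : b v (c • w) = c * b v w := by
  rw [hb.symm, hb.smul_left, hb.symm]

lemma zero_left (w : V) : b 0 w = 0 := by
  simpa using hb.smul_left 0 0 w

lemma zero_right (w : V) : b w 0 = 0 := by
  rw [hb.symm, hb.zero_left]

lemma neg_left (v w : V) : b (-v) w = -b v w := by
  simpa using hb.smul_left (-1) v w

lemma neg_right (v w : V) : b v (-w) = -b v w := by
  simpa using hb.smul_right (-1) v w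

lemma sub_left (u v w : V) : b (u - v) w = b u w - b v w := by
  rw [sub_eq_add_neg, hb.add_left, hb.neg_left, sub_eq_add_neg]

lemma sub_right (u v w : V) : b u (v - w) = b u v - b u w := by
  rw [sub_eq_add_neg, hb.add_right, hb.neg_right, sub_eq_add_neg]

lemma sum_left {ι : Type*} (s : Finset ι) (f : ι → V) (w : V) :
    b (∑ i ∈ s, f i) w = ∑ i ∈ s, b (f i) w := by
  classical
  induction s using Finset.induction_on with
  | empty => simp [hb.zero_left]
  | insert i s hi ih => rw [Finset.sum_insert hi, Finset.sum_insert hi, hb.add_left, ih]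

lemma sum_right {ι : Type*} (s : Finset ι) (f : ι → V) (w : V) :
    b w (∑ i ∈ s, f i) = ∑ i ∈ s, b w (f i) := by
  rw [hb.symm, hb.sum_left]
  exact Finset.sum_congr rfl fun i _ => hb.symm _ _

lemma nonneg (v : V) : 0 ≤ b v v := by
  by_cases h : v = 0
  · rw [h, hb.zero_left]
  · exact (hb.pos v h).le

lemma eq_zero {v : V} (h : b v v = 0) : v = 0 := by
  by_contra h'
  exact (hb.pos v h').ne' h

lemma ext {v w : V} (h : ∀ u, b u v = b u w) : v = w := by
  rw [← sub_eq_zero]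
  apply hb.eq_zero
  rw [hb.sub_right, h, sub_self]

/-- The inner product space structure of a positive definite form. -/
@[reducible]
def core : InnerProductSpace.Core ℝ V where
  inner v w := b v w
  conj_inner_symm v w := by simpa using hb.symm w v
  re_inner_nonneg v := by simpa using hb.nonneg v
  add_left := hb.add_left
  smul_left v w c := by simpa using hb.smul_left c v w
  definite v h := hb.eq_zero h

lemma abs_le (v w : V) : |b v w| ≤ √(b v v) * √(b w w) := by
  let : NormedAddCommGroup V := hb.core.toNormedAddCommGroup
  let : InnerProductSpace ℝ V := .ofCore hb.core.toCore
  have := abs_real_inner_le_norm v w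
  rwa [norm_eq_sqrt_real_inner, norm_eq_sqrt_real_inner] at this

lemma sqrt_add_le (v w : V) : √(b (v + w) (v + w)) ≤ √(b v v) + √(b w w) := by
  let : NormedAddCommGroup V := hb.core.toNormedAddCommGroup
  let : InnerProductSpace ℝ V := .ofCore hb.core.toCore
  have := norm_add_le v w
  rwa [norm_eq_sqrt_real_inner, norm_eq_sqrt_real_inner, norm_eq_sqrt_real_inner] at this

lemma exists_orthonormal [FiniteDimensional ℝ V] :
    ∃ o : Fin (Module.finrank ℝ V) → V, (∀ i, b (o i) (o i) = 1) ∧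
      ∀ v, ∑ i, b (o i) v • o i = v := by
  let : NormedAddCommGroup V := hb.core.toNormedAddCommGroup
  let : InnerProductSpace ℝ V := .ofCore hb.core.toCore
  let o := stdOrthonormalBasis ℝ V
  exact ⟨o, fun i => (inner_self_eq_one_of_norm_eq_one (o.norm_eq_one i) : Inner.inner ℝ (o i) (o i) = 1),
    fun v => o.sum_repr' v⟩

/-- If `v = ∑ ⟨s_i, v⟩ t_i` for all `v`, then also `v = ∑ ⟨t_i, v⟩ s_i`. -/
lemma dual_symm {ι : Type*} [Fintype ι] {s t : ι → V} (h : ∀ v, ∑ i, b (s i) v • t i = v) (v : V) :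
    ∑ i, b (t i) v • s i = v := by
  refine hb.ext fun u => ?_
  conv_rhs => rw [← h u, hb.sum_left]
  rw [hb.sum_right]
  refine Finset.sum_congr rfl fun i _ => ?_
  rw [hb.smul_left, hb.smul_right, hb.symm u, mul_comm]

/-- The contraction of a bilinear map with the inverse metric does not depend on the pair of dual
frames that computes it. -/
lemma sum_dual_eq {W : Type*} [AddCommGroup W] [Module ℝ W] {ι κ : Type*} [Fintype ι] [Fintype κ]
    {s t : ι → V} {s' t' : κ → V} (h : ∀ v, ∑ i, b (s i) v • t i = v)
    (h' : ∀ v, ∑ i, b (s' i) v • t' i = v) (β : V →ₗ[ℝ] V →ₗ[ℝ] W) :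
    ∑ i, β (s i) (t i) = ∑ i, β (s' i) (t' i) := by
  calc ∑ i, β (s i) (t i) = ∑ i, β (s i) (∑ k, b (s' k) (t i) • t' k) := by simp only [h']
    _ = ∑ i, ∑ k, β (b (t i) (s' k) • s i) (t' k) := by
        simp only [map_sum, map_smul, LinearMap.smul_apply, hb.symm]
    _ = ∑ k, β (∑ i, b (t i) (s' k) • s i) (t' k) := by
        rw [Finset.sum_comm]
        simp only [map_sum, LinearMap.sum_apply]
    _ = _ := by simp only [hb.dual_symm h]

end IsInner

end InnerProduct

variable {n : ℕ} {M : Type*} [TopologicalSpace M] [ChartedSpace (EuclideanSpace ℝ (Fin n)) M]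

/-! ### Fibres of bundles of homomorphisms -/

section Fibres

instance finiteDimensional_fib (A : MetricBundle n M) (x : M) : FiniteDimensional ℝ (A.Fib x) :=
  ((trivializationAt A.Model A.Fib x).linearEquivAt ℝ x
    (FiberBundle.mem_baseSet_trivializationAt' x)).symm.finiteDimensional

instance t2Space_fib (A : MetricBundle n M) (x : M) : T2Space (A.Fib x) :=
  ((trivializationAt A.Model A.Fib x).continuousLinearEquivAt ℝ x
    (FiberBundle.mem_baseSet_trivializationAt' x)).toHomeomorph.isEmbedding.t2Space

lemma finrank_fib (A : MetricBundle n M) (x : M) :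
    Module.finrank ℝ (A.Fib x) = Module.finrank ℝ A.Model :=
  ((trivializationAt A.Model A.Fib x).linearEquivAt ℝ x
    (FiberBundle.mem_baseSet_trivializationAt' x)).finrank_eq

/-- Evaluation of an element of a fibre of `Hom(A, B)`. -/
def app (A B : MetricBundle n M) {x : M} : (Hom A B).Fib x →ₗ[ℝ] A.Fib x →ₗ[ℝ] B.Fib x :=
  ContinuousLinearMap.coeLM ℝ

/-- The element of a fibre of `Hom(A, B)` given by a linear map. -/
def ofLin (A B : MetricBundle n M) {x : M} : (A.Fib x →ₗ[ℝ] B.Fib x) →ₗ[ℝ] (Hom A B).Fib x where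
  toFun f := LinearMap.toContinuousLinearMap f
  map_add' _ _ := rfl
  map_smul' _ _ := rfl

@[simp]
lemma app_ofLin (A B : MetricBundle n M) {x : M} (f : A.Fib x →ₗ[ℝ] B.Fib x) (ξ : A.Fib x) :
    app A B (ofLin A B f) ξ = f ξ := rfl

lemma hom_ext (A B : MetricBundle n M) {x : M} {a b : (Hom A B).Fib x}
    (h : ∀ ξ, app A B a ξ = app A B b ξ) : a = b :=
  ContinuousLinearMap.ext h

end Fibres

/-! ### Smooth sections and local frames -/

section Sections

lemma IsSmooth.add {A : MetricBundle n M} {s t : A.Sec} (hs : A.IsSmooth s) (ht : A.IsSmooth t) :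
    A.IsSmooth (s + t) := ContMDiff.add_section hs ht

lemma IsSmooth.smul {A : MetricBundle n M} {f : M → ℝ} {s : A.Sec}
    (hf : ContMDiff (𝓡 n) 𝓘(ℝ, ℝ) ∞ f) (hs : A.IsSmooth s) :
    A.IsSmooth (fun x => f x • s x) := ContMDiff.smul_section hf hs

lemma IsSmooth.const_smul {A : MetricBundle n M} (c : ℝ) {s : A.Sec} (hs : A.IsSmooth s) :
    A.IsSmooth (fun x => c • s x) := IsSmooth.smul contMDiff_const hs

lemma isSmooth_zero (A : MetricBundle n M) : A.IsSmooth 0 := contMDiff_zeroSection ℝ A.Fib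

lemma IsSmooth.neg {A : MetricBundle n M} {s : A.Sec} (hs : A.IsSmooth s) :
    A.IsSmooth (-s) := ContMDiff.neg_section hs

lemma IsSmooth.sub {A : MetricBundle n M} {s t : A.Sec} (hs : A.IsSmooth s) (ht : A.IsSmooth t) :
    A.IsSmooth (s - t) := ContMDiff.sub_section hs ht

lemma IsSmooth.sum {A : MetricBundle n M} {ι : Type*} (I : Finset ι) {s : ι → A.Sec}
    (hs : ∀ i ∈ I, A.IsSmooth (s i)) : A.IsSmooth (fun x => ∑ i ∈ I, s i x) :=
  ContMDiff.sum_section hs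

/-- Smoothness of a section can be checked locally. -/
lemma isSmooth_of_locally {A : MetricBundle n M} {s : A.Sec}
    (h : ∀ x₀, ∃ t, A.IsSmooth t ∧ ∀ᶠ y in 𝓝 x₀, s y = t y) : A.IsSmooth s := by
  intro x₀
  obtain ⟨t, ht, hst⟩ := h x₀
  refine (ht x₀).congr_of_eventuallyEq ?_
  filter_upwards [hst] with y hy
  rw [hy]

variable [IsManifold (𝓡 n) ∞ M] [T2Space M]

/-- A section that is smooth near `x₀` agrees near `x₀` with a globally smooth section. -/
lemma exists_isSmooth_eventuallyEq {A : MetricBundle n M} {s : A.Sec} {x₀ : M} {U : Set M}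
    (hU : U ∈ 𝓝 x₀)
    (hs : ContMDiffOn (𝓡 n) ((𝓡 n).prod 𝓘(ℝ, A.Model)) ∞
      (fun x => TotalSpace.mk' A.Model x (s x)) U) :
    ∃ t, A.IsSmooth t ∧ ∀ᶠ y in 𝓝 x₀, t y = s y := by
  obtain ⟨V, hVU, hV, hxV⟩ := mem_nhds_iff.1 hU
  obtain ⟨ψ, -, hψ⟩ := (SmoothBumpFunction.nhds_basis_tsupport (I := 𝓡 n) x₀).mem_iff.1
    (hV.mem_nhds hxV)
  refine ⟨fun x => ψ x • s x, ContMDiffOn.smul_section_of_tsupport ψ.contMDiff.contMDiffOn hV hψ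
    (hs.mono hVU), ?_⟩
  filter_upwards [ψ.eventuallyEq_one] with y hy
  simp [hy]

lemma exists_contMDiff_eventuallyEq {f : M → ℝ} {x₀ : M} {U : Set M} (hU : U ∈ 𝓝 x₀)
    (hf : ContMDiffOn (𝓡 n) 𝓘(ℝ, ℝ) ∞ f U) :
    ∃ g, ContMDiff (𝓡 n) 𝓘(ℝ, ℝ) ∞ g ∧ ∀ᶠ y in 𝓝 x₀, g y = f y := by
  obtain ⟨V, hVU, hV, hxV⟩ := mem_nhds_iff.1 hU
  obtain ⟨ψ, -, hψ⟩ := (SmoothBumpFunction.nhds_basis_tsupport (I := 𝓡 n) x₀).mem_iff.1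
    (hV.mem_nhds hxV)
  refine ⟨fun x => ψ x * f x, ?_, ?_⟩
  · refine contMDiff_of_tsupport fun x hx => ?_
    have hx' : x ∈ V := hψ (tsupport_mul_subset_left hx)
    exact (ψ.contMDiff x).mul ((hf.mono hVU).contMDiffAt (hV.mem_nhds hx'))
  · filter_upwards [ψ.eventuallyEq_one] with y hy
    simp [hy]

omit [IsManifold (𝓡 n) ∞ M] [T2Space M] in
lemma contMDiffOn_frame (A : MetricBundle n M) (x₀ : M) (i : Fin (Module.finrank ℝ A.Model)) :
    ContMDiffOn (𝓡 n) ((𝓡 n).prod 𝓘(ℝ, A.Model)) ∞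
      (fun x => TotalSpace.mk' A.Model x (A.frame x₀ i x))
      (trivializationAt A.Model A.Fib x₀).baseSet := by
  refine ((trivializationAt A.Model A.Fib x₀).contMDiffOn_section_baseSet_iff).2 ?_
  refine (contMDiffOn_const (c := Module.finBasis ℝ A.Model i)).congr fun y hy => ?_
  simp only [frame]
  rw [Trivialization.apply_mk_symm _ hy]

/-- The frame `A.frame x₀` agrees near `x₀` with globally smooth sections. -/
lemma exists_frame (A : MetricBundle n M) (x₀ : M) :
    ∃ e : Fin (Module.finrank ℝ A.Model) → A.Sec, (∀ i, A.IsSmooth (e i)) ∧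
      ∀ᶠ y in 𝓝 x₀, ∀ i, e i y = A.frame x₀ i y := by
  have := fun i => exists_isSmooth_eventuallyEq
    ((trivializationAt A.Model A.Fib x₀).open_baseSet.mem_nhds
    (FiberBundle.mem_baseSet_trivializationAt' x₀)) (A.contMDiffOn_frame x₀ i)
  choose e he he' using this
  exact ⟨e, he, Filter.eventually_all.2 he'⟩

omit [IsManifold (𝓡 n) ∞ M] [T2Space M] in
/-- The frame `A.frame x₀` is a basis of the fibres over the domain of the trivialization. -/
lemma exists_basis_frame (A : MetricBundle n M) (x₀ : M) {y : M}
    (hy : y ∈ (trivializationAt A.Model A.Fib x₀).baseSet) :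
    ∃ b : Module.Basis (Fin (Module.finrank ℝ A.Model)) ℝ (A.Fib y),
      ∀ i, b i = A.frame x₀ i y :=
  ⟨(Module.finBasis ℝ A.Model).map
    ((trivializationAt A.Model A.Fib x₀).linearEquivAt ℝ y hy).symm, fun i => by
      simp [frame]⟩

omit [IsManifold (𝓡 n) ∞ M] [T2Space M] in
lemma sum_coframe_smul (A : MetricBundle n M) (x : M) (ξ : A.Fib x) :
    ∑ i, A.coframe x i ξ • A.frame x i x = ξ := by
  have hx := FiberBundle.mem_baseSet_trivializationAt' (F := A.Model) (E := A.Fib) x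
  have : ∑ i, A.coframe x i ξ • A.frame x i x =
      (trivializationAt A.Model A.Fib x).symmL ℝ x
        (∑ i, A.coframe x i ξ • Module.finBasis ℝ A.Model i) := by
    simp only [map_sum, map_smul, frame]
    exact Finset.sum_congr rfl fun i _ => by rw [Trivialization.symmL_apply (R := ℝ) _ hx]
  rw [this]
  have h2 : ∑ i, A.coframe x i ξ • Module.finBasis ℝ A.Model i =
      (trivializationAt A.Model A.Fib x).continuousLinearMapAt ℝ x ξ :=
    (Module.finBasis ℝ A.Model).sum_repr _
  rw [h2]
  exact (trivializationAt A.Model A.Fib x).symmL_continuousLinearMapAt hx ξ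

end Sections

end

section

variable {n : ℕ} {M : Type*} [TopologicalSpace M] [ChartedSpace (EuclideanSpace ℝ (Fin n)) M]
  [IsManifold (𝓡 n) ∞ M]

/-! ### Bundles with a smooth metric and a smooth metric connection -/

/-- The covariant derivative as an operator from sections of `A` to sections of `T^*M ⊗ A`. -/
def grad (R : RiemannianStructure n M) (A : MetricBundle n M) (s : A.Sec) :
    (Hom R.tangent A).Sec := A.cov s

/-- The covariant derivative of `s` at `x` in the direction of `v`. -/
def dir (R : RiemannianStructure n M) (A : MetricBundle n M) (s : A.Sec) (x : M) :
    R.tangent.Fib x →ₗ[ℝ] A.Fib x := app R.tangent A (grad R A s x)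

/-- The derivative of a function at `x` in the direction of `v`. -/
def der (R : RiemannianStructure n M) (f : M → ℝ) (x : M) :
    R.tangent.Fib x →ₗ[ℝ] ℝ := (mvfderiv (𝓡 n) f x : TangentSpace (𝓡 n) x →L[ℝ] ℝ).toLinearMap

/-- The form of `A` is a smooth Riemannian metric on the fibres and the covariant derivative is a
smooth metric connection. All conditions are stated for globally smooth sections. -/
structure IsGeometric (R : RiemannianStructure n M) (A : MetricBundle n M) : Prop where
  isInner : ∀ x, IsInner (A.inner x)
  smooth_inner : ∀ {s t : A.Sec}, A.IsSmooth s → A.IsSmooth t →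
    ContMDiff (𝓡 n) 𝓘(ℝ, ℝ) ∞ (fun x => A.inner x (s x) (t x))
  cov_add : ∀ {s t : A.Sec}, A.IsSmooth s → A.IsSmooth t → ∀ x (v : R.tangent.Fib x),
    dir R A (fun y => s y + t y) x v = dir R A s x v + dir R A t x v
  cov_smul : ∀ {f : M → ℝ} {s : A.Sec}, ContMDiff (𝓡 n) 𝓘(ℝ, ℝ) ∞ f → A.IsSmooth s →
    ∀ x (v : R.tangent.Fib x),
    dir R A (fun y => f y • s y) x v = f x • dir R A s x v + der R f x v • s x
  cov_congr : ∀ {s t : A.Sec} {x : M}, A.IsSmooth t → (∀ᶠ y in 𝓝 x, s y = t y) →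
    grad R A s x = grad R A t x
  smooth_cov : ∀ {s : A.Sec}, A.IsSmooth s → (Hom R.tangent A).IsSmooth (grad R A s)
  metric : ∀ {s t : A.Sec}, A.IsSmooth s → A.IsSmooth t → ∀ x (v : R.tangent.Fib x),
    der R (fun y => A.inner y (s y) (t y)) x v =
      A.inner x (dir R A s x v) (t x) + A.inner x (s x) (dir R A t x v)

section der

variable {R : RiemannianStructure n M}

lemma der_add {f g : M → ℝ} (hf : ContMDiff (𝓡 n) 𝓘(ℝ, ℝ) ∞ f)
    (hg : ContMDiff (𝓡 n) 𝓘(ℝ, ℝ) ∞ g) (x : M) (v : R.tangent.Fib x) :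
    der R (fun y => f y + g y) x v = der R f x v + der R g x v := by
  have := mvfderiv_add (hf.mdifferentiableAt (x := x) (by simp))
    (hg.mdifferentiableAt (x := x) (by simp))
  exact DFunLike.congr_fun this v

lemma der_mul {f g : M → ℝ} (hf : ContMDiff (𝓡 n) 𝓘(ℝ, ℝ) ∞ f)
    (hg : ContMDiff (𝓡 n) 𝓘(ℝ, ℝ) ∞ g) (x : M) (v : R.tangent.Fib x) :
    der R (fun y => f y * g y) x v = f x * der R g x v + g x * der R f x v := by
  have := mvfderiv_mul (hf.mdifferentiableAt (x := x) (by simp))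
    (hg.mdifferentiableAt (x := x) (by simp))
  exact DFunLike.congr_fun this v

lemma der_const (c : ℝ) (x : M) (v : R.tangent.Fib x) : der R (fun _ => c) x v = 0 := by
  have := mvfderiv_const (I := 𝓡 n) (x := x) c
  exact DFunLike.congr_fun this v

lemma der_congr {f g : M → ℝ} {x : M} (h : ∀ᶠ y in 𝓝 x, f y = g y) :
    der R f x = der R g x := by
  have h1 : mfderiv (𝓡 n) 𝓘(ℝ, ℝ) f x = mfderiv (𝓡 n) 𝓘(ℝ, ℝ) g x :=
    Filter.EventuallyEq.mfderiv_eq h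
  ext v
  change (mfderiv (𝓡 n) 𝓘(ℝ, ℝ) f x) v = (mfderiv (𝓡 n) 𝓘(ℝ, ℝ) g x) v
  rw [h1]
  rfl

lemma der_sum {ι : Type*} (I : Finset ι) {f : ι → M → ℝ}
    (hf : ∀ i ∈ I, ContMDiff (𝓡 n) 𝓘(ℝ, ℝ) ∞ (f i)) (x : M) (v : R.tangent.Fib x) :
    der R (fun y => ∑ i ∈ I, f i y) x v = ∑ i ∈ I, der R (f i) x v := by
  classical
  induction I using Finset.induction_on with
  | empty => simpa using der_const (R := R) 0 x v
  | insert i I hi ih =>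
    simp only [Finset.sum_insert hi]
    rw [der_add (hf i (Finset.mem_insert_self i I))
      (contMDiff_finsetSum fun j hj => hf j (Finset.mem_insert_of_mem hj)),
      ih fun j hj => hf j (Finset.mem_insert_of_mem hj)]

end der

namespace IsGeometric

variable {R : RiemannianStructure n M} {A : MetricBundle n M} (hA : IsGeometric R A)
include hA

lemma dir_add {s t : A.Sec} (hs : A.IsSmooth s) (ht : A.IsSmooth t) (x : M) (v : R.tangent.Fib x) :
    dir R A (fun y => s y + t y) x v = dir R A s x v + dir R A t x v := hA.cov_add hs ht x v

lemma dir_smul {f : M → ℝ} {s : A.Sec} (hf : ContMDiff (𝓡 n) 𝓘(ℝ, ℝ) ∞ f) (hs : A.IsSmooth s)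
    (x : M) (v : R.tangent.Fib x) :
    dir R A (fun y => f y • s y) x v = f x • dir R A s x v + der R f x v • s x :=
  hA.cov_smul hf hs x v

lemma dir_congr {s t : A.Sec} {x : M} (ht : A.IsSmooth t) (h : ∀ᶠ y in 𝓝 x, s y = t y) :
    dir R A s x = dir R A t x := by
  rw [dir, dir, hA.cov_congr ht h]

lemma dir_const_smul (c : ℝ) {s : A.Sec} (hs : A.IsSmooth s) (x : M) (v : R.tangent.Fib x) :
    dir R A (fun y => c • s y) x v = c • dir R A s x v := by
  rw [hA.dir_smul contMDiff_const hs, der_const, zero_smul, add_zero]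

lemma dir_neg {s : A.Sec} (hs : A.IsSmooth s) (x : M) (v : R.tangent.Fib x) :
    dir R A (fun y => -s y) x v = -dir R A s x v := by
  simpa using hA.dir_const_smul (-1) hs x v

lemma dir_sub {s t : A.Sec} (hs : A.IsSmooth s) (ht : A.IsSmooth t) (x : M) (v : R.tangent.Fib x) :
    dir R A (fun y => s y - t y) x v = dir R A s x v - dir R A t x v := by
  rw [sub_eq_add_neg, ← hA.dir_neg ht]
  simp only [sub_eq_add_neg]
  exact hA.dir_add hs ht.neg x v

lemma dir_zero (x : M) (v : R.tangent.Fib x) : dir R A (fun _ => 0) x v = 0 := by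
  simpa using hA.dir_const_smul 0 (isSmooth_zero A) x v

lemma dir_sum {ι : Type*} (I : Finset ι) {s : ι → A.Sec} (hs : ∀ i ∈ I, A.IsSmooth (s i)) (x : M)
    (v : R.tangent.Fib x) :
    dir R A (fun y => ∑ i ∈ I, s i y) x v = ∑ i ∈ I, dir R A (s i) x v := by
  classical
  induction I using Finset.induction_on with
  | empty => simpa using hA.dir_zero x v
  | insert i I hi ih =>
    simp only [Finset.sum_insert hi]
    rw [hA.dir_add (hs i (Finset.mem_insert_self i I))
      (IsSmooth.sum I fun j hj => hs j (Finset.mem_insert_of_mem hj)),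
      ih fun j hj => hs j (Finset.mem_insert_of_mem hj)]

lemma der_inner {s t : A.Sec} (hs : A.IsSmooth s) (ht : A.IsSmooth t) (x : M)
    (v : R.tangent.Fib x) :
    der R (fun y => A.inner y (s y) (t y)) x v =
      A.inner x (dir R A s x v) (t x) + A.inner x (s x) (dir R A t x v) := hA.metric hs ht x v

lemma isSmooth_grad {s : A.Sec} (hs : A.IsSmooth s) : (Hom R.tangent A).IsSmooth (grad R A s) :=
  hA.smooth_cov hs

variable [T2Space M]

/-- Dual frames near a point, made of globally smooth sections. -/
lemma exists_dual (x₀ : M) : ∃ s t : Fin (Module.finrank ℝ A.Model) → A.Sec,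
    (∀ i, A.IsSmooth (s i)) ∧ (∀ i, A.IsSmooth (t i)) ∧
      ∀ᶠ y in 𝓝 x₀, ∀ v, ∑ i, A.inner y (s i y) v • t i y = v := by
  obtain ⟨e, he, hef⟩ := A.exists_frame x₀
  let G : M → Matrix (Fin (Module.finrank ℝ A.Model)) (Fin (Module.finrank ℝ A.Model)) ℝ :=
    fun y => Matrix.of fun i j => A.inner y (e i y) (e j y)
  have hG : ∀ i j, ContMDiff (𝓡 n) 𝓘(ℝ, ℝ) ∞ fun y => G y i j :=
    fun i j => hA.smooth_inner (he i) (he j)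
  have smooth_det : ∀ K : M → Matrix (Fin (Module.finrank ℝ A.Model))
      (Fin (Module.finrank ℝ A.Model)) ℝ, (∀ i j, ContMDiff (𝓡 n) 𝓘(ℝ, ℝ) ∞ fun y => K y i j) →
      ContMDiff (𝓡 n) 𝓘(ℝ, ℝ) ∞ fun y => (K y).det := by
    intro K hK
    simp only [Matrix.det_apply']
    exact contMDiff_finsetSum fun σ _ => contMDiff_const.mul (contMDiff_finsetProd fun i _ => hK _ _)
  -- the entries of the adjugate are polynomials in those of `G`, so they are smooth everywhere,
  -- while the inverse determinant is smooth only where `e` is a frame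
  have hadj : ∀ i j, ContMDiff (𝓡 n) 𝓘(ℝ, ℝ) ∞ fun y => (G y).adjugate i j := by
    intro i j
    simp only [Matrix.adjugate_apply]
    refine smooth_det _ fun k l => ?_
    by_cases hk : k = j
    · subst hk; simp only [Matrix.updateRow_self]; exact contMDiff_const
    · simp only [Matrix.updateRow_ne hk]; exact hG k l
  -- near `x₀` the sections `e i` are a basis, so their Gram matrix is invertible
  have hbas : ∀ᶠ y in 𝓝 x₀, ∃ b : Module.Basis (Fin (Module.finrank ℝ A.Model)) ℝ (A.Fib y),
      ∀ i, b i = e i y := by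
    filter_upwards [hef, (trivializationAt A.Model A.Fib x₀).open_baseSet.mem_nhds
      (FiberBundle.mem_baseSet_trivializationAt' x₀)] with y hy hyb
    obtain ⟨b, hb⟩ := A.exists_basis_frame x₀ hyb
    exact ⟨b, fun i => (hb i).trans (hy i).symm⟩
  have hdet : ∀ y, (∃ b : Module.Basis (Fin (Module.finrank ℝ A.Model)) ℝ (A.Fib y),
      ∀ i, b i = e i y) → (G y).det ≠ 0 := by
    rintro y ⟨b, hb⟩ h0
    obtain ⟨c, hc, hc0⟩ := Matrix.exists_mulVec_eq_zero_iff.2 h0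
    have h1 : ∀ i, A.inner y (e i y) (∑ j, c j • e j y) = 0 := by
      intro i
      have := congrFun hc0 i
      simp only [Matrix.mulVec, dotProduct, G, Matrix.of_apply, Pi.zero_apply] at this
      rw [(hA.isInner y).sum_right, ← this]
      exact Finset.sum_congr rfl fun j _ => by rw [(hA.isInner y).smul_right, mul_comm]
    have h2 : ∑ j, c j • e j y = 0 := by
      apply (hA.isInner y).eq_zero
      rw [(hA.isInner y).sum_left]
      refine Finset.sum_eq_zero fun i _ => ?_
      rw [(hA.isInner y).smul_left, h1, mul_zero]
    simp only [← hb] at h2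
    exact hc (funext fun i => Fintype.linearIndependent_iff.1 b.linearIndependent c h2 i)
  -- a global smooth function that equals `1 / det G` near `x₀`
  obtain ⟨g, hg, hgd⟩ : ∃ g, ContMDiff (𝓡 n) 𝓘(ℝ, ℝ) ∞ g ∧ ∀ᶠ y in 𝓝 x₀, g y = (G y).det⁻¹ := by
    have hne : {y | (G y).det ≠ 0} ∈ 𝓝 x₀ := by
      filter_upwards [hbas] with y hy using hdet y hy
    exact exists_contMDiff_eventuallyEq hne fun y hy =>
      ((smooth_det G hG) y).inv₀ hy |>.contMDiffWithinAt
  -- `t i = ∑ (G⁻¹)_{ij} e j`, with the inverse Gram matrix in the form of Cramer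
  refine ⟨e, fun i y => ∑ j, (g y * (G y).adjugate i j) • e j y, he,
    fun i => IsSmooth.sum _ fun j _ => (he j).smul (hg.mul (hadj i j)), ?_⟩
  filter_upwards [hbas, hgd] with y hy hgy v
  obtain ⟨b, hb⟩ := hy
  have hd := hdet y ⟨b, hb⟩
  have key : ∀ k, ∑ i, A.inner y (e i y) (e k y) • ∑ j, (g y * (G y).adjugate i j) • e j y
      = e k y := by
    intro k
    have hmul : G y * ((G y).det⁻¹ • (G y).adjugate) = 1 := by
      rw [Matrix.mul_smul, Matrix.mul_adjugate, smul_smul, inv_mul_cancel₀ hd, one_smul]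
    simp only [Finset.smul_sum, smul_smul]
    rw [Finset.sum_comm]
    simp only [← Finset.sum_smul]
    calc _ = ∑ j, (G y * ((G y).det⁻¹ • (G y).adjugate)) k j • e j y := by
          refine Finset.sum_congr rfl fun j _ => ?_
          congr 1
          rw [Matrix.mul_apply]
          refine Finset.sum_congr rfl fun i _ => ?_
          rw [hgy, (hA.isInner y).symm]
          simp [G]
      _ = e k y := by
          rw [hmul]
          simp [Matrix.one_apply]
  change ∑ i, A.inner y (e i y) v • ∑ j, (g y * (G y).adjugate i j) • e j y = v
  obtain ⟨τ, hτ⟩ : ∃ τ : Fin (Module.finrank ℝ A.Model) → A.Fib y,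
      ∀ i, ∑ j, (g y * (G y).adjugate i j) • e j y = τ i := ⟨_, fun _ => rfl⟩
  simp only [hτ] at key ⊢
  rw [← b.sum_repr v]
  simp only [(hA.isInner y).sum_right, (hA.isInner y).smul_right, Finset.sum_smul, mul_smul]
  rw [Finset.sum_comm]
  simp only [← Finset.smul_sum, hb, key]

omit [T2Space M] in
lemma dual_smooth_expand {s t : Fin (Module.finrank ℝ A.Model) → A.Sec}
    (hs : ∀ i, A.IsSmooth (s i)) (ht : ∀ i, A.IsSmooth (t i)) {u : A.Sec} (hu : A.IsSmooth u) :
    A.IsSmooth (fun y => ∑ i, A.inner y (s i y) (u y) • t i y) :=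
  IsSmooth.sum _ fun i _ => (ht i).smul (hA.smooth_inner (hs i) hu)

/-- Every vector extends to a smooth section. -/
lemma exists_extend (x : M) (ξ : A.Fib x) : ∃ s, A.IsSmooth s ∧ s x = ξ := by
  obtain ⟨s, t, -, ht, hst⟩ := hA.exists_dual x
  exact ⟨fun y => ∑ i, A.inner x (s i x) ξ • t i y, IsSmooth.sum _ fun i _ => (ht i).const_smul _,
    hst.self_of_nhds ξ⟩

/-- A section is smooth if its inner products with smooth sections are. -/
lemma isSmooth_of_inner {u : A.Sec}
    (hu : ∀ s, A.IsSmooth s → ContMDiff (𝓡 n) 𝓘(ℝ, ℝ) ∞ (fun x => A.inner x (s x) (u x))) :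
    A.IsSmooth u := by
  refine isSmooth_of_locally fun x₀ => ?_
  obtain ⟨s, t, hs, ht, hst⟩ := hA.exists_dual x₀
  refine ⟨fun y => ∑ i, A.inner y (s i y) (u y) • t i y,
    IsSmooth.sum _ fun i _ => (ht i).smul (hu _ (hs i)), ?_⟩
  filter_upwards [hst] with y hy using (hy _).symm

/-- An operator on smooth sections that is local and linear over functions at `x` depends only on
the value of the section at `x`. -/
lemma tensorial {W : Type*} [AddCommGroup W] [Module ℝ W] {x : M} (Q : A.Sec → W)
    (hadd : ∀ s t, A.IsSmooth s → A.IsSmooth t → Q (fun y => s y + t y) = Q s + Q t)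
    (hsmul : ∀ (f : M → ℝ) s, ContMDiff (𝓡 n) 𝓘(ℝ, ℝ) ∞ f → A.IsSmooth s →
      Q (fun y => f y • s y) = f x • Q s)
    (hcongr : ∀ s t, A.IsSmooth s → A.IsSmooth t → (∀ᶠ y in 𝓝 x, s y = t y) → Q s = Q t) :
    ∃ q : A.Fib x →ₗ[ℝ] W, ∀ u, A.IsSmooth u → Q u = q (u x) := by
  obtain ⟨s, t, hs, ht, hst⟩ := hA.exists_dual x
  have hsum : ∀ (I : Finset (Fin (Module.finrank ℝ A.Model)))
      (σ : Fin (Module.finrank ℝ A.Model) → A.Sec), (∀ i, A.IsSmooth (σ i)) →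
      Q (fun y => ∑ i ∈ I, σ i y) = ∑ i ∈ I, Q (σ i) := by
    intro I σ hσ
    induction I using Finset.induction_on with
    | empty =>
      have := hsmul (fun _ => 0) 0 contMDiff_const (isSmooth_zero A)
      simpa using this
    | insert i I hi ih =>
      simp only [Finset.sum_insert hi]
      rw [hadd _ _ (hσ i) (IsSmooth.sum I fun j _ => hσ j), ih]
  -- near `x` every section is `∑ ⟨s i, u⟩ t i`, which expresses `Q u` by the values `Q (t i)`
  refine ⟨{ toFun := fun ξ => ∑ i, A.inner x (s i x) ξ • Q (t i)
            map_add' := fun ξ η => by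
              simp only [(hA.isInner x).add_right, add_smul, Finset.sum_add_distrib]
            map_smul' := fun c ξ => by
              simp only [(hA.isInner x).smul_right, mul_smul, Finset.smul_sum, RingHom.id_apply] },
    fun u hu => ?_⟩
  rw [hcongr u (fun y => ∑ i, A.inner y (s i y) (u y) • t i y) hu
    (hA.dual_smooth_expand hs ht hu)
    (by filter_upwards [hst] with y hy using (hy _).symm),
    hsum _ _ fun i => (ht i).smul (hA.smooth_inner (hs i) hu)]
  exact Finset.sum_congr rfl fun i _ => hsmul _ _ (hA.smooth_inner (hs i) hu) (ht i)

omit [T2Space M] in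
/-- The frame `A.frame x` and its inverse Gram matrix give a pair of dual bases at `x`. -/
lemma gramInv_dual (x : M) (v : A.Fib x) :
    ∑ i, A.inner x (A.frame x i x) v • ∑ j, A.gramInv x i j • A.frame x j x = v := by
  obtain ⟨b, hb⟩ := A.exists_basis_frame x (FiberBundle.mem_baseSet_trivializationAt' x)
  have hI := hA.isInner x
  have hdet : (Matrix.of fun i j => A.inner x (A.frame x i x) (A.frame x j x)).det ≠ 0 := by
    intro h0
    obtain ⟨c, hc, hc0⟩ := Matrix.exists_mulVec_eq_zero_iff.2 h0
    have h2 : ∑ j, c j • A.frame x j x = 0 := by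
      apply hI.eq_zero
      rw [hI.sum_left]
      refine Finset.sum_eq_zero fun i _ => ?_
      have := congrFun hc0 i
      simp only [Matrix.mulVec, dotProduct, Matrix.of_apply, Pi.zero_apply] at this
      rw [hI.smul_left, hI.sum_right]
      simp only [hI.smul_right, mul_comm (c _), this, zero_mul]
    simp only [← hb] at h2
    exact hc (funext fun i => Fintype.linearIndependent_iff.1 b.linearIndependent c h2 i)
  have key : ∀ k, ∑ i, A.inner x (A.frame x i x) (A.frame x k x) •
      ∑ j, A.gramInv x i j • A.frame x j x = A.frame x k x := by
    intro k
    simp only [Finset.smul_sum, smul_smul]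
    rw [Finset.sum_comm]
    simp only [← Finset.sum_smul]
    calc _ = ∑ j, ((Matrix.of fun i j => A.inner x (A.frame x i x) (A.frame x j x)) *
          A.gramInv x) k j • A.frame x j x := by
          refine Finset.sum_congr rfl fun j _ => ?_
          congr 1
          rw [Matrix.mul_apply]
          refine Finset.sum_congr rfl fun i _ => ?_
          rw [hI.symm]
          simp
      _ = A.frame x k x := by
          rw [gramInv, Matrix.mul_nonsing_inv _ (isUnit_iff_ne_zero.2 hdet)]
          simp [Matrix.one_apply]
  rw [← b.sum_repr v]
  simp only [hI.sum_right, hI.smul_right, Finset.sum_smul, mul_smul]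
  rw [Finset.sum_comm]
  simp only [← Finset.smul_sum, hb, key]

omit [T2Space M] in
/-- Contractions with `A.gramInv x` can be computed with any pair of dual bases. -/
lemma sum_gramInv_eq {x : M} {W : Type*} [AddCommGroup W] [Module ℝ W] {ι : Type*} [Fintype ι]
    {s t : ι → A.Fib x} (h : ∀ v, ∑ i, A.inner x (s i) v • t i = v)
    (β : A.Fib x →ₗ[ℝ] A.Fib x →ₗ[ℝ] W) :
    ∑ i, ∑ j, A.gramInv x i j • β (A.frame x i x) (A.frame x j x) = ∑ i, β (s i) (t i) := by
  rw [← (hA.isInner x).sum_dual_eq (hA.gramInv_dual x) h β]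
  simp only [map_sum, map_smul]

end IsGeometric

end

section

variable {n : ℕ} {M : Type*} [TopologicalSpace M] [ChartedSpace (EuclideanSpace ℝ (Fin n)) M]
  [IsManifold (𝓡 n) ∞ M]

/-! ### The bundle of homomorphisms of two geometric bundles -/

omit [IsManifold (𝓡 n) ∞ M] in
lemma IsSmooth.app {A B : MetricBundle n M} {a : (Hom A B).Sec} {s : A.Sec}
    (ha : (Hom A B).IsSmooth a) (hs : A.IsSmooth s) :
    B.IsSmooth (fun x => app A B (a x) (s x)) :=
  ContMDiff.clm_bundle_apply (𝕜 := ℝ) (F₁ := A.Model) (E₁ := A.Fib) (F₂ := B.Model) (E₂ := B.Fib)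
    (b := fun x : M => x) (ϕ := a) (v := s) ha hs

/-- A section of `Hom(A, B)` is smooth if it maps smooth sections to smooth sections. -/
lemma isSmooth_hom [T2Space M] {A B : MetricBundle n M} {a : (Hom A B).Sec}
    (ha : ∀ s, A.IsSmooth s → B.IsSmooth (fun x => app A B (a x) (s x))) :
    (Hom A B).IsSmooth a := by
  intro x₀
  refine (contMDiffAt_hom_bundle (𝕜 := ℝ) (F₁ := A.Model) (E₁ := A.Fib) (F₂ := B.Model)
    (E₂ := B.Fib) _).2 ⟨contMDiffAt_id, ?_⟩
  obtain ⟨e, he, hef⟩ := A.exists_frame x₀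
  let b := Module.finBasis ℝ A.Model
  have hcoord : ∀ i, ContMDiffAt (𝓡 n) 𝓘(ℝ, B.Model) ∞
      (fun y => (trivializationAt B.Model B.Fib x₀ ⟨y, app A B (a y) (e i y)⟩).2) x₀ := fun i =>
    (Bundle.contMDiffAt_section _).1 (ha _ (he i) x₀)
  -- in the trivializations `a` is the sum of the maps `ξ ↦ ξ_i a(e_i)`
  let S : Fin (Module.finrank ℝ A.Model) → B.Model →L[ℝ] (A.Model →L[ℝ] B.Model) := fun i =>
    ContinuousLinearMap.smulRightL ℝ A.Model B.Model (LinearMap.toContinuousLinearMap (b.coord i))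
  have hsum : ContMDiffAt (𝓡 n) 𝓘(ℝ, A.Model →L[ℝ] B.Model) ∞
      (fun y => ∑ i, S i (trivializationAt B.Model B.Fib x₀ ⟨y, app A B (a y) (e i y)⟩).2) x₀ :=
    contMDiffAt_finsetSum fun i _ => (S i).contMDiff.contMDiffAt.comp x₀ (hcoord i)
  refine hsum.congr_of_eventuallyEq ?_
  filter_upwards [hef, (trivializationAt A.Model A.Fib x₀).open_baseSet.mem_nhds
      (FiberBundle.mem_baseSet_trivializationAt' x₀),
      (trivializationAt B.Model B.Fib x₀).open_baseSet.mem_nhds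
      (FiberBundle.mem_baseSet_trivializationAt' x₀)] with y hy hyA hyB
  refine (ContinuousLinearMap.inCoordinates_eq (ϕ := (a y : A.Fib y →L[ℝ] B.Fib y)) hyA hyB).trans ?_
  ext w
  simp only [sum_apply, S, ContinuousLinearMap.smulRightL_apply_apply]
  conv_lhs => rw [← b.sum_repr w]
  rw [map_sum]
  refine Finset.sum_congr rfl fun i _ => ?_
  rw [map_smul]
  congr 1
  rw [hy i]
  rfl

variable {R : RiemannianStructure n M}

/-- The product rule that characterizes the induced connection of `Hom(A, B)`. -/
lemma IsGeometric.app_dir [T2Space M] {A B : MetricBundle n M} (hA : IsGeometric R A)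
    (hB : IsGeometric R B) {a : (Hom A B).Sec} {s : A.Sec} (ha : (Hom A B).IsSmooth a)
    (hs : A.IsSmooth s) (x : M) (v : R.tangent.Fib x) :
    app A B (dir R (Hom A B) a x v) (s x) =
      dir R B (fun y => app A B (a y) (s y)) x v - app A B (a x) (dir R A s x v) := by
  -- the right-hand side is tensorial in `s`, so both sides can be compared on the frame by which
  -- the connection of `Hom(A, B)` is defined
  obtain ⟨q, hq⟩ := hA.tensorial (x := x) (fun s : A.Sec =>
      dir R B (fun y => app A B (a y) (s y)) x v - app A B (a x) (dir R A s x v)) (by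
      intro s t hs ht
      simp only [map_add]
      rw [hB.dir_add (ha.app hs) (ha.app ht), hA.dir_add hs ht, map_add]
      abel) (by
      intro f s hf hs
      simp only [map_smul]
      rw [hB.dir_smul hf (ha.app hs), hA.dir_smul hf hs, map_add, map_smul, map_smul, smul_sub]
      abel) (by
      intro s t hs ht hst
      rw [hA.dir_congr ht hst, hB.dir_congr (ha.app ht)
        (by filter_upwards [hst] with y hy; rw [hy])])
  obtain ⟨e, he, hef⟩ := A.exists_frame x
  have hfr : ∀ i, B.cov (fun y => app A B (a y) (A.frame x i y)) x v -
      app A B (a x) (A.cov (A.frame x i) x v) = q (A.frame x i x) := by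
    intro i
    rw [← hef.self_of_nhds i, ← hq _ (he i)]
    have h1 : B.cov (fun y => app A B (a y) (A.frame x i y)) x =
        B.cov (fun y => app A B (a y) (e i y)) x := hB.cov_congr (ha.app (he i))
      (by filter_upwards [hef] with y hy; rw [hy])
    have h2 : A.cov (A.frame x i) x = A.cov (e i) x := hA.cov_congr (he i)
      (by filter_upwards [hef] with y hy; rw [hy])
    rw [h1, h2]
    rfl
  have h0 : app A B (dir R (Hom A B) a x v) (s x) = ∑ i, A.coframe x i (s x) •
      (B.cov (fun y => app A B (a y) (A.frame x i y)) x v -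
        app A B (a x) (A.cov (A.frame x i) x v)) := by
    change (∑ i, (A.coframe x i).smulRight (B.cov (fun y => app A B (a y) (A.frame x i y)) x v -
        app A B (a x) (A.cov (A.frame x i) x v))) (s x) = _
    simp only [sum_apply, ContinuousLinearMap.smulRight_apply]
  rw [h0, hq s hs]
  simp only [hfr]
  simp only [← map_smul, ← map_sum]
  rw [A.sum_coframe_smul]

/-- The Hilbert--Schmidt metric computed with any pair of dual bases. -/
lemma IsGeometric.inner_hom {A B : MetricBundle n M} (hA : IsGeometric R A)
    (hB : IsGeometric R B) {x : M} {ι : Type*} [Fintype ι] {s t : ι → A.Fib x}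
    (h : ∀ v, ∑ i, A.inner x (s i) v • t i = v) (a b : (Hom A B).Fib x) :
    (Hom A B).inner x a b = ∑ i, B.inner x (app A B a (s i)) (app A B b (t i)) := by
  have := hA.sum_gramInv_eq h (LinearMap.mk₂ ℝ
    (fun ξ η => B.inner x (app A B a ξ) (app A B b η))
    (fun ξ ξ' η => by rw [map_add, (hB.isInner x).add_left])
    (fun c ξ η => by rw [map_smul, (hB.isInner x).smul_left, smul_eq_mul])
    (fun ξ η η' => by rw [map_add, (hB.isInner x).add_right])
    (fun c ξ η => by rw [map_smul, (hB.isInner x).smul_right, smul_eq_mul]))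
  simp only [LinearMap.mk₂_apply, smul_eq_mul] at this
  rw [← this]
  rfl

lemma IsGeometric.exists_orthonormal {A : MetricBundle n M} (hA : IsGeometric R A) (x : M) :
    ∃ o : Fin (Module.finrank ℝ A.Model) → A.Fib x, (∀ i, A.inner x (o i) (o i) = 1) ∧
      ∀ v, ∑ i, A.inner x (o i) v • o i = v := by
  rw [← A.finrank_fib x]
  exact (hA.isInner x).exists_orthonormal

/-- Differentiating the identity `v = ∑ ⟨s i, v⟩ t i` for dual frames `s` and `t`: the inverse metric
is parallel. -/
lemma IsGeometric.sum_dual_dir [T2Space M] {A : MetricBundle n M} (hA : IsGeometric R A) {x : M}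
    {ι : Type*} [Fintype ι] {s t : ι → A.Sec} (hs : ∀ i, A.IsSmooth (s i))
    (ht : ∀ i, A.IsSmooth (t i)) (hst : ∀ᶠ y in 𝓝 x, ∀ v, ∑ i, A.inner y (s i y) v • t i y = v)
    (v : R.tangent.Fib x) {W : Type*} [AddCommGroup W] [Module ℝ W]
    (β : A.Fib x →ₗ[ℝ] A.Fib x →ₗ[ℝ] W) :
    ∑ i, (β (dir R A (s i) x v) (t i x) + β (s i x) (dir R A (t i) x v)) = 0 := by
  have hx := hst.self_of_nhds
  have hII := hA.isInner x
  -- differentiate `⟨u, w⟩ = ∑ ⟨s i, u⟩ ⟨t i, w⟩`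
  have hder : ∀ u w : A.Fib x, ∑ i, A.inner x (dir R A (s i) x v) u * A.inner x (t i x) w +
      ∑ i, A.inner x (s i x) u * A.inner x (dir R A (t i) x v) w = 0 := by
    intro u w
    obtain ⟨u, hu, rfl⟩ := hA.exists_extend x u
    obtain ⟨w, hw, rfl⟩ := hA.exists_extend x w
    have h1 := hA.der_inner hu hw x v
    rw [der_congr (g := fun y => ∑ i, A.inner y (s i y) (u y) * A.inner y (t i y) (w y))
      (by
        filter_upwards [hst] with y hy
        conv_lhs => rw [← hy (u y), (hA.isInner y).sum_left]
        simp only [(hA.isInner y).smul_left]),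
      der_sum (f := fun i y => A.inner y (s i y) (u y) * A.inner y (t i y) (w y)) _
        fun i _ => (hA.smooth_inner (hs i) hu).mul (hA.smooth_inner (ht i) hw)] at h1
    simp only [der_mul (hA.smooth_inner (hs _) hu) (hA.smooth_inner (ht _) hw),
      hA.der_inner (hs _) hu, hA.der_inner (ht _) hw, mul_add, Finset.sum_add_distrib] at h1
    have e1 : ∑ i, A.inner x (t i x) (w x) * A.inner x (s i x) (dir R A u x v) =
        A.inner x (dir R A u x v) (w x) := by
      conv_rhs => rw [← hx (dir R A u x v), hII.sum_left]
      simp only [hII.smul_left, mul_comm]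
    have e2 : ∑ i, A.inner x (s i x) (u x) * A.inner x (t i x) (dir R A w x v) =
        A.inner x (u x) (dir R A w x v) := by
      conv_rhs => rw [← hx (u x), hII.sum_left]
      simp only [hII.smul_left]
    rw [e1, e2] at h1
    have e3 : ∑ i, A.inner x (t i x) (w x) * A.inner x (dir R A (s i) x v) (u x) =
        ∑ i, A.inner x (dir R A (s i) x v) (u x) * A.inner x (t i x) (w x) :=
      Finset.sum_congr rfl fun i _ => mul_comm _ _
    rw [e3] at h1
    linarith
  -- expanding `β` in an orthonormal basis reduces the claim to products of inner products
  obtain ⟨o, -, ho⟩ := hA.exists_orthonormal x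
  have hexp : ∀ p q : ι → A.Fib x, ∑ i, β (p i) (q i) =
      ∑ k, ∑ l, (∑ i, A.inner x (p i) (o k) * A.inner x (q i) (o l)) • β (o k) (o l) := by
    intro p q
    have : ∀ i, β (p i) (q i) = ∑ k, ∑ l, (A.inner x (p i) (o k) * A.inner x (q i) (o l)) •
        β (o k) (o l) := by
      intro i
      conv_lhs => rw [← ho (p i), ← ho (q i)]
      simp only [map_sum, map_smul, LinearMap.sum_apply, LinearMap.smul_apply, Finset.smul_sum,
        smul_smul]
      rw [Finset.sum_comm]
      refine Finset.sum_congr rfl fun k _ => Finset.sum_congr rfl fun l _ => ?_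
      rw [hII.symm (o k), hII.symm (o l), mul_comm]
    simp only [this]
    rw [Finset.sum_comm]
    refine Finset.sum_congr rfl fun k _ => ?_
    rw [Finset.sum_comm]
    simp only [Finset.sum_smul]
  rw [Finset.sum_add_distrib, hexp, hexp, ← Finset.sum_add_distrib]
  refine Finset.sum_eq_zero fun k _ => ?_
  rw [← Finset.sum_add_distrib]
  refine Finset.sum_eq_zero fun l _ => ?_
  rw [← add_smul, hder, zero_smul]

/-- The induced metric and connection on `Hom(A, B)` are smooth and compatible. The metric is
smooth because it can be computed with dual bases of local smooth sections, and the terms in which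
these are differentiated cancel by `IsGeometric.sum_dual_dir`. -/
theorem IsGeometric.hom [T2Space M] {A B : MetricBundle n M} (hA : IsGeometric R A)
    (hB : IsGeometric R B) : IsGeometric R (Hom A B) where
  isInner x := by
    obtain ⟨o, -, ho⟩ := hA.exists_orthonormal x
    have hI := hB.isInner x
    refine ⟨fun a b => ?_, fun a b c => ?_, fun c a b => ?_, fun a ha => ?_⟩
    · rw [hA.inner_hom hB ho, hA.inner_hom hB ho]
      exact Finset.sum_congr rfl fun i _ => hI.symm _ _
    · rw [hA.inner_hom hB ho, hA.inner_hom hB ho, hA.inner_hom hB ho, ← Finset.sum_add_distrib]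
      exact Finset.sum_congr rfl fun i _ => by
        rw [map_add, LinearMap.add_apply, hI.add_left]
    · rw [hA.inner_hom hB ho, hA.inner_hom hB ho, Finset.mul_sum]
      exact Finset.sum_congr rfl fun i _ => by
        rw [map_smul, LinearMap.smul_apply, hI.smul_left]
    · rw [hA.inner_hom hB ho]
      refine lt_of_le_of_ne (Finset.sum_nonneg fun i _ => hI.nonneg _) fun h0 => ha ?_
      have h1 := (Finset.sum_eq_zero_iff_of_nonneg fun i _ => hI.nonneg _).1 h0.symm
      refine hom_ext A B fun ξ => ?_
      rw [← ho ξ, map_sum, map_sum]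
      refine Finset.sum_congr rfl fun i hi => ?_
      rw [map_smul, map_smul, hI.eq_zero (h1 i hi), map_zero, LinearMap.zero_apply]
  smooth_inner {a b} ha hb := by
    intro x₀
    obtain ⟨s, t, hs, ht, hst⟩ := hA.exists_dual x₀
    have : ContMDiff (𝓡 n) 𝓘(ℝ, ℝ) ∞ fun y =>
        ∑ i, B.inner y (app A B (a y) (s i y)) (app A B (b y) (t i y)) :=
      contMDiff_finsetSum fun i _ => hB.smooth_inner (ha.app (hs i)) (hb.app (ht i))
    refine (this x₀).congr_of_eventuallyEq ?_
    filter_upwards [hst] with y hy using hA.inner_hom hB hy _ _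
  cov_add {a b} ha hb x v := by
    refine hom_ext A B fun ξ => ?_
    obtain ⟨s, hs, rfl⟩ := hA.exists_extend x ξ
    rw [map_add, LinearMap.add_apply, hA.app_dir hB (a := fun y => a y + b y) (ha.add hb) hs,
      hA.app_dir hB ha hs, hA.app_dir hB hb hs]
    simp only [map_add, LinearMap.add_apply]
    rw [hB.dir_add (ha.app hs) (hb.app hs)]
    abel
  cov_smul {f a} hf ha x v := by
    refine hom_ext A B fun ξ => ?_
    obtain ⟨s, hs, rfl⟩ := hA.exists_extend x ξ
    rw [map_add, LinearMap.add_apply, hA.app_dir hB (a := fun y => f y • a y) (ha.smul hf) hs]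
    simp only [map_smul, LinearMap.smul_apply]
    rw [hA.app_dir hB ha hs, hB.dir_smul hf (ha.app hs), smul_sub]
    abel
  cov_congr {a b x} hb hab := by
    change homCov A B a x = homCov A B b x
    obtain ⟨e, he, hef⟩ := A.exists_frame x
    have : ∀ i, B.cov (fun y => app A B (a y) (A.frame x i y)) x =
        B.cov (fun y => app A B (b y) (A.frame x i y)) x := by
      intro i
      change grad R B (fun y => app A B (a y) (A.frame x i y)) x =
        grad R B (fun y => app A B (b y) (A.frame x i y)) x
      rw [hB.cov_congr (hb.app (he i)) (s := fun y => app A B (a y) (A.frame x i y))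
        (by filter_upwards [hab, hef] with y hy hy'; rw [hy, hy']),
        hB.cov_congr (hb.app (he i)) (s := fun y => app A B (b y) (A.frame x i y))
        (by filter_upwards [hef] with y hy'; rw [hy'])]
    ext v : 1
    change ∑ i, (A.coframe x i).smulRight (B.cov (fun y => app A B (a y) (A.frame x i y)) x v -
        app A B (a x) (A.cov (A.frame x i) x v)) =
      ∑ i, (A.coframe x i).smulRight (B.cov (fun y => app A B (b y) (A.frame x i y)) x v -
        app A B (b x) (A.cov (A.frame x i) x v))
    simp only [this, hab.self_of_nhds]
  smooth_cov {a} ha := by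
    refine isSmooth_hom fun X hX => isSmooth_hom fun s hs => ?_
    have h1 : B.IsSmooth (fun x => app R.tangent B
        (grad R B (fun y => app A B (a y) (s y)) x) (X x)) :=
      (hB.isSmooth_grad (ha.app hs)).app hX
    have h2 : B.IsSmooth (fun x => app A B (a x) (app R.tangent A (grad R A s x) (X x))) :=
      ha.app ((hA.isSmooth_grad hs).app hX)
    have h3 := h1.sub h2
    convert h3 using 2 with x
    exact hA.app_dir hB ha hs x (X x)
  metric {a b} ha hb x v := by
    obtain ⟨s, t, hs, ht, hst⟩ := hA.exists_dual x
    have hI := hB.isInner x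
    have hx := hst.self_of_nhds
    rw [der_congr (g := fun y => ∑ i, B.inner y (app A B (a y) (s i y)) (app A B (b y) (t i y)))
      (by filter_upwards [hst] with y hy using hA.inner_hom hB hy _ _),
      der_sum _ fun i _ => hB.smooth_inner (ha.app (hs i)) (hb.app (ht i)),
      hA.inner_hom hB hx, hA.inner_hom hB hx]
    simp only [hB.der_inner (ha.app (hs _)) (hb.app (ht _)), hA.app_dir hB ha (hs _),
      hA.app_dir hB hb (ht _), hI.sub_left, hI.sub_right, Finset.sum_add_distrib,
      Finset.sum_sub_distrib]
    -- the remaining terms come from the derivatives of the dual frames, which cancel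
    have h := hA.sum_dual_dir hs ht hst v (LinearMap.mk₂ ℝ
      (fun ξ η => B.inner x (app A B (a x) ξ) (app A B (b x) η))
      (fun ξ ξ' η => by rw [map_add, hI.add_left])
      (fun c ξ η => by rw [map_smul, hI.smul_left, smul_eq_mul])
      (fun ξ η η' => by rw [map_add, hI.add_right])
      (fun c ξ η => by rw [map_smul, hI.smul_right, smul_eq_mul]))
    simp only [LinearMap.mk₂_apply, Finset.sum_add_distrib] at h
    linarith

theorem IsGeometric.tens [T2Space M] {A : MetricBundle n M} (hT : IsGeometric R R.tangent)
    (hA : IsGeometric R A) : ∀ k, IsGeometric R (A.tens R k)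
  | 0 => hA
  | k + 1 => hT.hom (IsGeometric.tens hT hA k)

end

section

variable {n : ℕ} {M : Type*} [TopologicalSpace M] [ChartedSpace (EuclideanSpace ℝ (Fin n)) M]
  [IsManifold (𝓡 n) ∞ M]

/-! ### The tangent bundle, Hermitian bundles and trivial bundles are geometric -/

lemma isInner_re (V : Type*) [NormedAddCommGroup V] [InnerProductSpace ℂ V] :
    IsInner (fun v w : V => (Inner.inner ℂ v w).re) where
  symm v w := by rw [← inner_conj_symm v w, Complex.conj_re]
  add_left u v w := by rw [inner_add_left]; rfl
  smul_left c v w := by rw [inner_smul_left_eq_smul]; simp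
  pos v hv := by
    have h2 := norm_sq_eq_re_inner (𝕜 := ℂ) v
    change 0 < RCLike.re (Inner.inner ℂ v v)
    rw [← h2]
    exact pow_pos (norm_pos_iff.2 hv) 2

theorem _root_.NablaSobolev.RiemannianStructure.isGeometric_tangent
    (R : RiemannianStructure n M) : IsGeometric R R.tangent where
  isInner x := ⟨fun v w => R.metric.symm x v w,
    fun u v w => DFunLike.congr_fun (map_add (R.metric.inner x) u v) w,
    fun c v w => DFunLike.congr_fun (map_smul (R.metric.inner x) c v) w,
    fun v hv => R.metric.pos x v hv⟩
  smooth_inner {s t} hs ht := by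
    have h := ContMDiff.clm_bundle_apply₂ (𝕜 := ℝ) (F₁ := EuclideanSpace ℝ (Fin n))
      (F₂ := EuclideanSpace ℝ (Fin n)) (E₁ := fun x : M => TangentSpace (𝓡 n) x)
      (E₂ := fun x : M => TangentSpace (𝓡 n) x) (E₃ := Bundle.Trivial M ℝ)
      (b := fun x : M => x) (v := s) (w := t) R.metric.contMDiff hs ht
    exact fun x => (Bundle.contMDiffAt_section _).1 (h x)
  cov_add {s t} hs ht x v := by
    have := R.conn.isCovariantDerivativeOnUniv.add
      (hs.mdifferentiableAt (x := x) (by simp)) (ht.mdifferentiableAt (x := x) (by simp))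
    exact DFunLike.congr_fun this v
  cov_smul {f s} hf hs x v := by
    have := R.conn.isCovariantDerivativeOnUniv.leibniz
      (hs.mdifferentiableAt (x := x) (by simp)) (hf.mdifferentiableAt (x := x) (by simp))
    exact DFunLike.congr_fun this v
  cov_congr {s t x} ht hst := by
    have ht' := ht.mdifferentiableAt (x := x) (by simp)
    refine R.conn.isCovariantDerivativeOnUniv.congr_of_eventuallyEq ?_ ht' Filter.univ_mem hst
    refine ht'.congr_of_eventuallyEq ?_
    filter_upwards [hst] with y hy
    exact congrArg _ hy
  smooth_cov {s} hs := by
    have := R.smooth_conn.contMDiff.contMDiff (σ := s) (ContMDiff.contMDiffOn hs)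
    exact contMDiffOn_univ.1 this
  metric {s t} hs ht x v := R.metric_conn x v s t (hs.mdifferentiableAt (by simp))
    (ht.mdifferentiableAt (by simp))

theorem _root_.NablaSobolev.HermitianStructure.isGeometric_bundle (R : RiemannianStructure n M)
    {F : Type*} [NormedAddCommGroup F] [NormedSpace ℂ F]
    [FiniteDimensional ℂ F] {E : M → Type*} [TopologicalSpace (TotalSpace F E)]
    [∀ x, NormedAddCommGroup (E x)] [∀ x, InnerProductSpace ℂ (E x)] [FiberBundle F E]
    [VectorBundle ℂ F E] [VectorBundle ℝ F E] [ContMDiffVectorBundle ∞ F E (𝓡 n)]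
    (H : HermitianStructure n F E) : IsGeometric R H.bundle where
  isInner x := isInner_re (E x)
  smooth_inner {s t} hs ht :=
    Complex.reCLM.contMDiff.comp (H.smooth_inner s t hs ht)
  cov_add {s t} hs ht x v := by
    have := H.conn.isCovariantDerivativeOnUniv.add
      (hs.mdifferentiableAt (x := x) (by simp)) (ht.mdifferentiableAt (x := x) (by simp))
    exact DFunLike.congr_fun this v
  cov_smul {f s} hf hs x v := by
    have := H.conn.isCovariantDerivativeOnUniv.leibniz
      (hs.mdifferentiableAt (x := x) (by simp)) (hf.mdifferentiableAt (x := x) (by simp))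
    exact DFunLike.congr_fun this v
  cov_congr {s t x} ht hst := by
    have ht' := ht.mdifferentiableAt (x := x) (by simp)
    refine H.conn.isCovariantDerivativeOnUniv.congr_of_eventuallyEq ?_ ht' Filter.univ_mem hst
    refine ht'.congr_of_eventuallyEq ?_
    filter_upwards [hst] with y hy
    exact congrArg _ hy
  smooth_cov {s} hs := by
    have := H.smooth_conn.contMDiff.contMDiff (σ := s) (ContMDiff.contMDiffOn hs)
    exact contMDiffOn_univ.1 this
  metric {s t} hs ht x v := by
    have h := H.metric_conn x v s t (hs.mdifferentiableAt (by simp))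
      (ht.mdifferentiableAt (by simp))
    have h2 : MDifferentiableAt (𝓡 n) 𝓘(ℝ, ℂ) (fun x => Inner.inner ℂ (E := E x) (s x) (t x)) x :=
      (H.smooth_inner s t hs ht).mdifferentiableAt (by simp)
    have h3 := mvfderiv_comp_apply (I := 𝓘(ℝ, ℂ)) (I' := 𝓡 n) (g := Complex.reCLM)
      (f := fun x => Inner.inner ℂ (E := E x) (s x) (t x)) x
      (Complex.reCLM.contMDiff (n := ∞).mdifferentiableAt (by simp)) h2 v
    have h4 : ∀ z w : ℂ, mvfderiv 𝓘(ℝ, ℂ) Complex.reCLM z w = w.re := fun z w => by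
      rw [mvfderiv, mfderiv_eq_fderiv, ContinuousLinearMap.fderiv]; rfl
    exact (h3.trans (h4 _ _)).trans ((congrArg Complex.re h).trans (Complex.add_re _ _))

omit [IsManifold (𝓡 n) ∞ M] in
lemma isSmooth_trivial_iff {V : Type*} [NormedAddCommGroup V] [InnerProductSpace ℝ V]
    [FiniteDimensional ℝ V] {s : (trivial n M V).Sec} :
    (trivial n M V).IsSmooth s ↔ ContMDiff (𝓡 n) 𝓘(ℝ, V) ∞ (s : M → V) :=
  forall_congr' fun x => Bundle.contMDiffAt_section (F := V) (E := Bundle.Trivial M V)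
    (IB := 𝓡 n) (s := (s : ∀ x, Bundle.Trivial M V x)) x

lemma contMDiff_der {R : RiemannianStructure n M} {f : M → ℝ} {X : R.tangent.Sec}
    (hf : ContMDiff (𝓡 n) 𝓘(ℝ, ℝ) ∞ f) (hX : R.tangent.IsSmooth X) :
    ContMDiff (𝓡 n) 𝓘(ℝ, ℝ) ∞ (fun x => der R f x (X x)) := by
  have h : ContMDiff (𝓡 n) 𝓘(ℝ, ℝ).tangent ∞ _ :=
    (hf.contMDiff_tangentMap (m := ∞) (by simp)).comp hX
  exact (contMDiff_snd_tangentBundle_modelSpace ℝ 𝓘(ℝ, ℝ)).comp h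

theorem isGeometric_trivial [T2Space M] (R : RiemannianStructure n M) :
    IsGeometric R (trivial n M ℝ) where
  isInner x := ⟨fun v w => real_inner_comm (F := ℝ) _ _, fun u v w => inner_add_left (E := ℝ) _ _ _,
    fun c v w => real_inner_smul_left (F := ℝ) _ _ _, fun v hv => real_inner_self_pos.2 hv⟩
  smooth_inner {s t} hs ht := (isSmooth_trivial_iff.1 ht).mul (isSmooth_trivial_iff.1 hs)
  cov_add {s t} hs ht x v := der_add (isSmooth_trivial_iff.1 hs) (isSmooth_trivial_iff.1 ht) x v
  cov_smul {f s} hf hs x v :=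
    (der_mul hf (isSmooth_trivial_iff.1 hs) x v).trans
      (congrArg (HAdd.hAdd (α := ℝ) (β := ℝ) _) (@mul_comm ℝ _ (s x) _))
  cov_congr {s t x} ht hst := by
    have := der_congr (R := R) (f := (s : M → ℝ)) (g := (t : M → ℝ)) hst
    exact ContinuousLinearMap.ext fun v => DFunLike.congr_fun this v
  smooth_cov {s} hs := isSmooth_hom fun X hX =>
    isSmooth_trivial_iff.2 (contMDiff_der (isSmooth_trivial_iff.1 hs) hX)
  metric {s t} hs ht x v := by
    refine (der_mul (isSmooth_trivial_iff.1 ht) (isSmooth_trivial_iff.1 hs) x v).trans ?_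
    exact congrArg (HAdd.hAdd (α := ℝ) (β := ℝ) _) (@mul_comm ℝ _ (s x) _)

end

section

variable {n : ℕ} {M : Type*} [TopologicalSpace M] [ChartedSpace (EuclideanSpace ℝ (Fin n)) M]
  [IsManifold (𝓡 n) ∞ M] {R : RiemannianStructure n M} {A B D : MetricBundle n M}

/-! ### Norms in the fibres -/

namespace IsGeometric

omit [IsManifold (𝓡 n) ∞ M] in
lemma norm_nonneg (x : M) (v : A.Fib x) : 0 ≤ A.norm x v := Real.sqrt_nonneg _

variable (hA : IsGeometric R A)
include hA

lemma sq_norm (x : M) (v : A.Fib x) : A.norm x v ^ 2 = A.inner x v v :=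
  Real.sq_sqrt ((hA.isInner x).nonneg v)

lemma abs_inner_le (x : M) (v w : A.Fib x) : |A.inner x v w| ≤ A.norm x v * A.norm x w :=
  (hA.isInner x).abs_le v w

lemma norm_add_le (x : M) (v w : A.Fib x) : A.norm x (v + w) ≤ A.norm x v + A.norm x w :=
  (hA.isInner x).sqrt_add_le v w

lemma norm_smul (x : M) (c : ℝ) (v : A.Fib x) : A.norm x (c • v) = |c| * A.norm x v := by
  rw [norm, (hA.isInner x).smul_left, (hA.isInner x).smul_right, ← mul_assoc, ← sq,
    Real.sqrt_mul (sq_nonneg c), Real.sqrt_sq_eq_abs, norm]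

lemma norm_neg (x : M) (v : A.Fib x) : A.norm x (-v) = A.norm x v := by
  simpa using hA.norm_smul x (-1) v

lemma norm_zero (x : M) : A.norm x 0 = 0 := by
  simpa using hA.norm_smul x 0 0

lemma norm_sum_le {ι : Type*} (I : Finset ι) (x : M) (f : ι → A.Fib x) :
    A.norm x (∑ i ∈ I, f i) ≤ ∑ i ∈ I, A.norm x (f i) := by
  classical
  induction I using Finset.induction_on with
  | empty => simp [hA.norm_zero]
  | insert i I hi ih =>
    rw [Finset.sum_insert hi, Finset.sum_insert hi]
    exact (hA.norm_add_le _ _ _).trans (by gcongr)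

lemma inner_self_expand {x : M} {ι : Type*} [Fintype ι] {s : ι → A.Fib x}
    (h : ∀ v, ∑ i, A.inner x (s i) v • s i = v) (v : A.Fib x) :
    A.norm x v ^ 2 = ∑ i, A.inner x (s i) v ^ 2 := by
  rw [hA.sq_norm]
  conv_lhs => rw [← h v, (hA.isInner x).sum_left, h v]
  exact Finset.sum_congr rfl fun i _ => by rw [(hA.isInner x).smul_left, sq]

lemma norm_app_le (hB : IsGeometric R B) {x : M} (a : (Hom A B).Fib x) (ξ : A.Fib x) :
    B.norm x (app A B a ξ) ≤ (Hom A B).norm x a * A.norm x ξ := by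
  obtain ⟨o, -, ho⟩ := hA.exists_orthonormal x
  have h1 : B.norm x (app A B a ξ) ≤
      ∑ i, |A.inner x (o i) ξ| * B.norm x (app A B a (o i)) := by
    conv_lhs => rw [← ho ξ, map_sum]
    refine (hB.norm_sum_le _ _ _).trans_eq (Finset.sum_congr rfl fun i _ => ?_)
    rw [map_smul, hB.norm_smul]
  refine h1.trans ((Real.sum_mul_le_sqrt_mul_sqrt _ _ _).trans_eq ?_)
  rw [mul_comm]
  congr 1
  · rw [norm, hA.inner_hom hB ho]
    simp only [hB.sq_norm]
  · simp only [sq_abs]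
    rw [← hA.inner_self_expand ho, Real.sqrt_sq (norm_nonneg _ _)]

lemma norm_hom_le (hB : IsGeometric R B) {x : M} {a : (Hom A B).Fib x} {K : ℝ} (hK : 0 ≤ K)
    (h : ∀ ξ, B.norm x (app A B a ξ) ≤ K * A.norm x ξ) :
    (Hom A B).norm x a ≤ √(Module.finrank ℝ A.Model) * K := by
  obtain ⟨o, ho1, ho⟩ := hA.exists_orthonormal x
  rw [norm, hA.inner_hom hB ho]
  refine Real.sqrt_le_iff.2 ⟨by positivity, ?_⟩
  rw [mul_pow, Real.sq_sqrt (Nat.cast_nonneg _)]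
  calc _ ≤ ∑ _i : Fin (Module.finrank ℝ A.Model), K ^ 2 := Finset.sum_le_sum fun i _ => by
        rw [← hB.sq_norm]
        have := h (o i)
        rw [norm, norm, ho1, Real.sqrt_one, mul_one] at this
        exact pow_le_pow_left₀ (norm_nonneg _ _) this 2
    _ = _ := by simp

end IsGeometric

open IsGeometric

/-! ### Parallel bundle maps -/

/-- A smooth bounded parallel bundle map `A → B`. -/
structure IsParallel (R : RiemannianStructure n M) (A B : MetricBundle n M)
    (L : ∀ x, A.Fib x →ₗ[ℝ] B.Fib x) : Prop where
  smooth : ∀ {s : A.Sec}, A.IsSmooth s → B.IsSmooth (fun x => L x (s x))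
  dir : ∀ {s : A.Sec}, A.IsSmooth s → ∀ x (v : R.tangent.Fib x),
    dir R B (fun y => L y (s y)) x v = L x (dir R A s x v)
  bound : ∃ C : ℝ, 0 ≤ C ∧ ∀ x ξ, B.norm x (L x ξ) ≤ C * A.norm x ξ

/-- A smooth bounded parallel bilinear bundle map `A × B → D`. -/
structure IsParallelBilin (R : RiemannianStructure n M) (A B D : MetricBundle n M)
    (μ : ∀ x, A.Fib x →ₗ[ℝ] B.Fib x →ₗ[ℝ] D.Fib x) : Prop where
  smooth : ∀ {s : A.Sec} {t : B.Sec}, A.IsSmooth s → B.IsSmooth t →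
    D.IsSmooth (fun x => μ x (s x) (t x))
  dir : ∀ {s : A.Sec} {t : B.Sec}, A.IsSmooth s → B.IsSmooth t → ∀ x (v : R.tangent.Fib x),
    dir R D (fun y => μ y (s y) (t y)) x v = μ x (dir R A s x v) (t x) + μ x (s x) (dir R B t x v)
  bound : ∃ C : ℝ, 0 ≤ C ∧ ∀ x ξ η, D.norm x (μ x ξ η) ≤ C * (A.norm x ξ * B.norm x η)

/-- Composition with a bundle map, `Hom(T, A) → Hom(T, B)`. -/
def postcomp (T : MetricBundle n M) (L : ∀ x, A.Fib x →ₗ[ℝ] B.Fib x) (x : M) :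
    (Hom T A).Fib x →ₗ[ℝ] (Hom T B).Fib x :=
  ofLin T B ∘ₗ (LinearMap.compRight ℝ (L x)) ∘ₗ app T A

omit [IsManifold (𝓡 n) ∞ M] in
@[simp]
lemma app_postcomp {T : MetricBundle n M} (L : ∀ x, A.Fib x →ₗ[ℝ] B.Fib x) {x : M}
    (φ : (Hom T A).Fib x) (v : T.Fib x) :
    app T B (postcomp T L x φ) v = L x (app T A φ v) := rfl

/-- The bilinear map `Hom(T, A) × B → Hom(T, D)` induced by a bilinear map `A × B → D`. -/
def bilinLeft (T : MetricBundle n M) (μ : ∀ x, A.Fib x →ₗ[ℝ] B.Fib x →ₗ[ℝ] D.Fib x) (x : M) :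
    (Hom T A).Fib x →ₗ[ℝ] B.Fib x →ₗ[ℝ] (Hom T D).Fib x :=
  LinearMap.mk₂ ℝ (fun φ η => ofLin T D ((μ x).flip η ∘ₗ app T A φ))
    (fun φ φ' η => hom_ext T D fun v => by simp)
    (fun c φ η => hom_ext T D fun v => by simp)
    (fun φ η η' => hom_ext T D fun v => by simp)
    (fun c φ η => hom_ext T D fun v => by simp)

omit [IsManifold (𝓡 n) ∞ M] in
@[simp]
lemma app_bilinLeft {T : MetricBundle n M} (μ : ∀ x, A.Fib x →ₗ[ℝ] B.Fib x →ₗ[ℝ] D.Fib x) {x : M}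
    (φ : (Hom T A).Fib x) (η : B.Fib x) (v : T.Fib x) :
    app T D (bilinLeft T μ x φ η) v = μ x (app T A φ v) η := rfl

/-- The bilinear map `A × Hom(T, B) → Hom(T, D)` induced by a bilinear map `A × B → D`. -/
def bilinRight (T : MetricBundle n M) (μ : ∀ x, A.Fib x →ₗ[ℝ] B.Fib x →ₗ[ℝ] D.Fib x) (x : M) :
    A.Fib x →ₗ[ℝ] (Hom T B).Fib x →ₗ[ℝ] (Hom T D).Fib x :=
  LinearMap.mk₂ ℝ (fun ξ φ => ofLin T D (μ x ξ ∘ₗ app T B φ))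
    (fun φ φ' η => hom_ext T D fun v => by simp)
    (fun c φ η => hom_ext T D fun v => by simp)
    (fun φ η η' => hom_ext T D fun v => by simp)
    (fun c φ η => hom_ext T D fun v => by simp)

omit [IsManifold (𝓡 n) ∞ M] in
@[simp]
lemma app_bilinRight {T : MetricBundle n M} (μ : ∀ x, A.Fib x →ₗ[ℝ] B.Fib x →ₗ[ℝ] D.Fib x) {x : M}
    (ξ : A.Fib x) (φ : (Hom T B).Fib x) (v : T.Fib x) :
    app T D (bilinRight T μ x ξ φ) v = μ x ξ (app T B φ v) := rfl

lemma app_grad (s : A.Sec) (x : M) (v : R.tangent.Fib x) :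
    app R.tangent A (grad R A s x) v = dir R A s x v := rfl

section T2

variable [T2Space M]

/-- The product rule for the evaluation of a homomorphism. -/
lemma IsGeometric.dir_app (hA : IsGeometric R A) (hB : IsGeometric R B) {a : (Hom A B).Sec}
    {s : A.Sec} (ha : (Hom A B).IsSmooth a) (hs : A.IsSmooth s) (x : M) (v : R.tangent.Fib x) :
    dir R B (fun y => app A B (a y) (s y)) x v =
      app A B (dir R (Hom A B) a x v) (s x) + app A B (a x) (dir R A s x v) := by
  rw [hA.app_dir hB ha hs, sub_add_cancel]

/-- Two elements of a fibre of `Hom(A, B)` agree if they agree on the values of smooth sections. -/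
lemma IsGeometric.hom_ext_smooth (hA : IsGeometric R A) {x : M} {a b : (Hom A B).Fib x}
    (h : ∀ s, A.IsSmooth s → app A B a (s x) = app A B b (s x)) : a = b := by
  refine hom_ext A B fun ξ => ?_
  obtain ⟨s, hs, rfl⟩ := hA.exists_extend x ξ
  exact h s hs

theorem IsParallel.postcomp {T : MetricBundle n M} (hT : IsGeometric R T) (hA : IsGeometric R A)
    (hB : IsGeometric R B) {L : ∀ x, A.Fib x →ₗ[ℝ] B.Fib x} (hL : IsParallel R A B L) :
    IsParallel R (Hom T A) (Hom T B) (postcomp T L) where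
  smooth hs := isSmooth_hom fun X hX => hL.smooth (hs.app hX)
  dir {φ} hφ x v := by
    refine hT.hom_ext_smooth fun X hX => ?_
    rw [hT.app_dir hB (isSmooth_hom fun X hX => hL.smooth (hφ.app hX)) hX]
    simp only [app_postcomp]
    rw [hL.dir (hφ.app hX), hT.dir_app hA hφ hX, map_add, add_sub_cancel_right]
  bound := by
    obtain ⟨C, hC, h⟩ := hL.bound
    refine ⟨√(Module.finrank ℝ T.Model) * C, by positivity, fun x φ => ?_⟩
    rw [mul_assoc]
    refine hT.norm_hom_le hB (mul_nonneg hC (norm_nonneg _ _)) fun v => ?_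
    rw [app_postcomp, mul_assoc]
    exact (h _ _).trans (mul_le_mul_of_nonneg_left (hT.norm_app_le hA _ _) hC)

theorem IsParallelBilin.left {T : MetricBundle n M} (hT : IsGeometric R T) (hA : IsGeometric R A)
    (hD : IsGeometric R D) {μ : ∀ x, A.Fib x →ₗ[ℝ] B.Fib x →ₗ[ℝ] D.Fib x}
    (hμ : IsParallelBilin R A B D μ) :
    IsParallelBilin R (Hom T A) B (Hom T D) (bilinLeft T μ) where
  smooth hs ht := isSmooth_hom fun X hX => hμ.smooth (hs.app hX) ht
  dir {φ t} hφ ht x v := by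
    refine hT.hom_ext_smooth fun X hX => ?_
    rw [hT.app_dir hD (isSmooth_hom fun X hX => hμ.smooth (hφ.app hX) ht) hX, map_add,
      LinearMap.add_apply]
    simp only [app_bilinLeft]
    rw [hμ.dir (hφ.app hX) ht, hT.dir_app hA hφ hX, map_add, LinearMap.add_apply]
    abel
  bound := by
    obtain ⟨C, hC, h⟩ := hμ.bound
    refine ⟨√(Module.finrank ℝ T.Model) * C, by positivity, fun x φ η => ?_⟩
    rw [mul_assoc]
    refine hT.norm_hom_le hD (mul_nonneg hC (mul_nonneg (norm_nonneg _ _) (norm_nonneg _ _)))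
      fun v => ?_
    rw [app_bilinLeft, mul_assoc, mul_right_comm]
    exact (h _ _ _).trans (mul_le_mul_of_nonneg_left (mul_le_mul_of_nonneg_right
      (hT.norm_app_le hA _ _) (norm_nonneg _ _)) hC)

theorem IsParallelBilin.right {T : MetricBundle n M} (hT : IsGeometric R T) (hB : IsGeometric R B)
    (hD : IsGeometric R D) {μ : ∀ x, A.Fib x →ₗ[ℝ] B.Fib x →ₗ[ℝ] D.Fib x}
    (hμ : IsParallelBilin R A B D μ) :
    IsParallelBilin R A (Hom T B) (Hom T D) (bilinRight T μ) where
  smooth hs ht := isSmooth_hom fun X hX => hμ.smooth hs (ht.app hX)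
  dir {s φ} hs hφ x v := by
    refine hT.hom_ext_smooth fun X hX => ?_
    rw [hT.app_dir hD (isSmooth_hom fun X hX => hμ.smooth hs (hφ.app hX)) hX, map_add,
      LinearMap.add_apply]
    simp only [app_bilinRight]
    rw [hμ.dir hs (hφ.app hX), hT.dir_app hB hφ hX, map_add]
    abel
  bound := by
    obtain ⟨C, hC, h⟩ := hμ.bound
    refine ⟨√(Module.finrank ℝ T.Model) * C, by positivity, fun x ξ φ => ?_⟩
    rw [mul_assoc]
    refine hT.norm_hom_le hD (mul_nonneg hC (mul_nonneg (norm_nonneg _ _) (norm_nonneg _ _)))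
      fun v => ?_
    rw [app_bilinRight, mul_assoc, mul_assoc]
    exact (h _ _ _).trans (mul_le_mul_of_nonneg_left (mul_le_mul_of_nonneg_left
      (hT.norm_app_le hB _ _) (norm_nonneg _ _)) hC)

omit [T2Space M] in
lemma IsParallel.grad_eq {L : ∀ x, A.Fib x →ₗ[ℝ] B.Fib x} (hL : IsParallel R A B L) {s : A.Sec}
    (hs : A.IsSmooth s) :
    grad R B (fun x => L x (s x)) = fun x => MetricBundle.postcomp R.tangent L x (grad R A s x) :=
  funext fun x => hom_ext _ _ fun v => hL.dir hs x v

omit [T2Space M] in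
lemma IsParallelBilin.grad_eq {μ : ∀ x, A.Fib x →ₗ[ℝ] B.Fib x →ₗ[ℝ] D.Fib x}
    (hμ : IsParallelBilin R A B D μ) {s : A.Sec} {t : B.Sec} (hs : A.IsSmooth s)
    (ht : B.IsSmooth t) :
    grad R D (fun x => μ x (s x) (t x)) = fun x => bilinLeft R.tangent μ x (grad R A s x) (t x) +
      bilinRight R.tangent μ x (s x) (grad R B t x) :=
  funext fun x => hom_ext _ _ fun v => by
    rw [map_add, LinearMap.add_apply]
    exact hμ.dir hs ht x v

end T2

/-! ### Weighted bounds for all covariant derivatives -/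

/-- The functions `ρ^{d+j} |∇^j s|`, `j ≤ J`, are bounded. The recursion is over the bundle, with
`∇s` as a section of `T^*M ⊗ A`. -/
def HasBounds (R : RiemannianStructure n M) (ρ : M → ℝ) :
    ℕ → ℕ → ∀ A : MetricBundle n M, A.Sec → Prop
  | 0, d, A, s => ∃ C, ∀ x, ρ x ^ d * A.norm x (s x) ≤ C
  | J + 1, d, A, s => (∃ C, ∀ x, ρ x ^ d * A.norm x (s x) ≤ C) ∧
      HasBounds R ρ J (d + 1) (Hom R.tangent A) (grad R A s)

namespace HasBounds

variable {ρ : M → ℝ} {J d e : ℕ}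

lemma zeroth {s : A.Sec} (h : HasBounds R ρ J d A s) : ∃ C, ∀ x, ρ x ^ d * A.norm x (s x) ≤ C := by
  cases J with
  | zero => exact h
  | succ J => exact h.1

lemma of_succ : ∀ {J d : ℕ} {A : MetricBundle n M} {s : A.Sec}, HasBounds R ρ (J + 1) d A s →
    HasBounds R ρ J d A s
  | 0, _, _, _, h => h.1
  | _ + 1, _, _, _, h => ⟨h.1, of_succ h.2⟩

variable [T2Space M] (hρ : ∀ x, 0 < ρ x)
include hρ

lemma add : ∀ {J d : ℕ} {A : MetricBundle n M} {s t : A.Sec}, IsGeometric R A → A.IsSmooth s →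
    A.IsSmooth t → HasBounds R ρ J d A s → HasBounds R ρ J d A t →
    HasBounds R ρ J d A (fun x => s x + t x) := by
  intro J
  induction J with
  | zero =>
    rintro d A s t hA - - ⟨C, hC⟩ ⟨C', hC'⟩
    refine ⟨C + C', fun x => ?_⟩
    calc _ ≤ ρ x ^ d * (A.norm x (s x) + A.norm x (t x)) :=
          mul_le_mul_of_nonneg_left (hA.norm_add_le _ _ _) (pow_pos (hρ x) d).le
      _ ≤ _ := by rw [mul_add]; exact add_le_add (hC x) (hC' x)
  | succ J ih =>
    rintro d A s t hA hs ht ⟨⟨C, hC⟩, h⟩ ⟨⟨C', hC'⟩, h'⟩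
    refine ⟨⟨C + C', fun x => ?_⟩, ?_⟩
    · calc _ ≤ ρ x ^ d * (A.norm x (s x) + A.norm x (t x)) :=
            mul_le_mul_of_nonneg_left (hA.norm_add_le _ _ _) (pow_pos (hρ x) d).le
        _ ≤ _ := by rw [mul_add]; exact add_le_add (hC x) (hC' x)
    · have : grad R A (fun x => s x + t x) = fun x => grad R A s x + grad R A t x :=
        funext fun x => hom_ext _ _ fun v => by
          rw [map_add, LinearMap.add_apply]; exact hA.dir_add hs ht x v
      rw [this]
      exact ih (R.isGeometric_tangent.hom hA) (hA.isSmooth_grad hs) (hA.isSmooth_grad ht) h h'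

lemma parallel : ∀ {J d : ℕ} {A B : MetricBundle n M} {L : ∀ x, A.Fib x →ₗ[ℝ] B.Fib x} {s : A.Sec},
    IsGeometric R A → IsGeometric R B → IsParallel R A B L → A.IsSmooth s → HasBounds R ρ J d A s →
    HasBounds R ρ J d B (fun x => L x (s x)) := by
  intro J
  have key : ∀ {d : ℕ} {A B : MetricBundle n M} {L : ∀ x, A.Fib x →ₗ[ℝ] B.Fib x} {s : A.Sec},
      IsParallel R A B L → (∃ C, ∀ x, ρ x ^ d * A.norm x (s x) ≤ C) →
      ∃ C, ∀ x, ρ x ^ d * B.norm x (L x (s x)) ≤ C := by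
    rintro d A B L s hL ⟨C', hC'⟩
    obtain ⟨C, hC, h⟩ := hL.bound
    refine ⟨C * C', fun x => ?_⟩
    calc _ ≤ ρ x ^ d * (C * A.norm x (s x)) :=
          mul_le_mul_of_nonneg_left (h _ _) (pow_pos (hρ x) d).le
      _ = C * (ρ x ^ d * A.norm x (s x)) := by ring
      _ ≤ _ := mul_le_mul_of_nonneg_left (hC' x) hC
  induction J with
  | zero => exact fun _ _ hL _ h => key hL h
  | succ J ih =>
    rintro d A B L s hA hB hL hs ⟨h0, h⟩
    refine ⟨key hL h0, ?_⟩
    rw [hL.grad_eq hs]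
    exact ih (R.isGeometric_tangent.hom hA) (R.isGeometric_tangent.hom hB)
      (hL.postcomp R.isGeometric_tangent hA hB) (hA.isSmooth_grad hs) h

/-- The Leibniz rule: the derivatives of `μ(s, t)` are weighted like products of those of `s` and
`t`. -/
lemma bilin : ∀ {J d e : ℕ} {A B D : MetricBundle n M}
    {μ : ∀ x, A.Fib x →ₗ[ℝ] B.Fib x →ₗ[ℝ] D.Fib x} {s : A.Sec} {t : B.Sec},
    IsGeometric R A → IsGeometric R B → IsGeometric R D → IsParallelBilin R A B D μ →
    A.IsSmooth s → B.IsSmooth t → HasBounds R ρ J d A s → HasBounds R ρ J e B t →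
    HasBounds R ρ J (d + e) D (fun x => μ x (s x) (t x)) := by
  intro J
  have key : ∀ {d e : ℕ} {A B D : MetricBundle n M}
      {μ : ∀ x, A.Fib x →ₗ[ℝ] B.Fib x →ₗ[ℝ] D.Fib x} {s : A.Sec} {t : B.Sec},
      IsParallelBilin R A B D μ → (∃ C, ∀ x, ρ x ^ d * A.norm x (s x) ≤ C) →
      (∃ C, ∀ x, ρ x ^ e * B.norm x (t x) ≤ C) →
      ∃ C, ∀ x, ρ x ^ (d + e) * D.norm x (μ x (s x) (t x)) ≤ C := by
    rintro d e A B D μ s t hμ ⟨C₁, h₁⟩ ⟨C₂, h₂⟩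
    obtain ⟨C, hC, h⟩ := hμ.bound
    refine ⟨C * (C₁ * C₂), fun x => ?_⟩
    have hd := pow_pos (hρ x) d
    have he := pow_pos (hρ x) e
    calc _ ≤ ρ x ^ (d + e) * (C * (A.norm x (s x) * B.norm x (t x))) :=
          mul_le_mul_of_nonneg_left (h _ _ _) (pow_pos (hρ x) _).le
      _ = C * ((ρ x ^ d * A.norm x (s x)) * (ρ x ^ e * B.norm x (t x))) := by ring
      _ ≤ _ := mul_le_mul_of_nonneg_left (mul_le_mul (h₁ x) (h₂ x)
          (mul_nonneg he.le (norm_nonneg _ _))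
          ((mul_nonneg hd.le (norm_nonneg _ _)).trans (h₁ x))) hC
  induction J with
  | zero => exact fun _ _ _ hμ _ _ h h' => key hμ h h'
  | succ J ih =>
    rintro d e A B D μ s t hA hB hD hμ hs ht h h'
    have hT := R.isGeometric_tangent
    refine ⟨key hμ h.1 h'.1, ?_⟩
    -- `∇(μ(s, t)) = μ(∇s, t) + μ(s, ∇t)`, where both terms are parallel bilinear expressions
    -- of the same kind
    rw [hμ.grad_eq hs ht]
    refine add hρ (hT.hom hD) ((hμ.left hT hA hD).smooth (hA.isSmooth_grad hs) ht)
      ((hμ.right hT hB hD).smooth hs (hB.isSmooth_grad ht)) ?_ ?_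
    · rw [add_right_comm]
      exact ih (hT.hom hA) hB (hT.hom hD) (hμ.left hT hA hD) (hA.isSmooth_grad hs) ht h.2
        h'.of_succ
    · rw [add_assoc]
      exact ih hA (hT.hom hB) (hT.hom hD) (hμ.right hT hB hD) hs (hB.isSmooth_grad ht) h.of_succ
        h'.2

end HasBounds

/-- The recursive bounds are the bounds for the iterated covariant derivatives. -/
lemma hasBounds_iff (ρ : M → ℝ) (d : ℕ) (A : MetricBundle n M) (s : A.Sec) :
    (∀ J, HasBounds R ρ J d A s) ↔
      ∀ k, ∃ C : ℝ, ∀ x, ρ x ^ (d + k) * (A.tens R k).norm x (A.nabla R k s x) ≤ C := by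
  constructor
  · intro h k
    have : ∀ k J, HasBounds R ρ J (d + k) (A.tens R k) (A.nabla R k s) := by
      intro k
      induction k with
      | zero => exact h
      | succ k ih => exact fun J => (ih (J + 1)).2
    exact this k 0
  · intro h J
    have : ∀ J k, HasBounds R ρ J (d + k) (A.tens R k) (A.nabla R k s) := by
      intro J
      induction J with
      | zero => exact h
      | succ J ih => exact fun k => ⟨h k, ih (k + 1)⟩
    exact this J 0

lemma isTotallyBounded_iff {s : A.Sec} :
    IsTotallyBounded R A s ↔ A.IsSmooth s ∧ ∀ J, HasBounds R (fun _ => 1) J 0 A s := by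
  rw [hasBounds_iff, IsTotallyBounded]
  simp only [one_pow, one_mul]

end

section

variable {n : ℕ} {M : Type*} [TopologicalSpace M] [ChartedSpace (EuclideanSpace ℝ (Fin n)) M]
  [IsManifold (𝓡 n) ∞ M] {R : RiemannianStructure n M} {A B D : MetricBundle n M}

open IsGeometric

/-! ### Parseval frames of the tangent bundle and contractions -/

/-- Finitely many smooth vector fields that form a Parseval frame of every tangent space. -/
structure IsParseval (R : RiemannianStructure n M) {ι : Type*} [Fintype ι]
    (X : ι → R.tangent.Sec) : Prop where
  smooth : ∀ i, R.tangent.IsSmooth (X i)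
  expand : ∀ x (v : R.tangent.Fib x), ∑ i, R.tangent.inner x (X i x) v • X i x = v

/-- The transpose of an isometric embedding `TM → M × ℝ^N` maps the standard basis to a Parseval
frame. Of the condition (FFC) only this consequence is needed. -/
lemma exists_isParseval [T2Space M] (hM : R.FrechetFiniteness) :
    ∃ (N : ℕ) (X : Fin N → R.tangent.Sec), IsParseval R X := by
  obtain ⟨N, Φ, ⟨hΦ, -⟩, hiso⟩ := hM
  have hT := R.isGeometric_tangent
  let Ψ : ∀ x, R.tangent.Fib x → EuclideanSpace ℝ (Fin N) := fun x v => Φ x v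
  -- `X i` represents the functional `v ↦ (Φ v)_i`
  have riesz : ∀ (i : Fin N) (x : M), ∃ Y : R.tangent.Fib x, ∀ v,
      R.tangent.inner x v Y = Ψ x v i := by
    intro i x
    obtain ⟨o, -, ho⟩ := hT.exists_orthonormal x
    let ℓ : R.tangent.Fib x →ₗ[ℝ] ℝ :=
      (EuclideanSpace.proj i : EuclideanSpace ℝ (Fin N) →L[ℝ] ℝ).toLinearMap ∘ₗ
        app R.tangent (trivial n M (EuclideanSpace ℝ (Fin N))) (Φ x)
    refine ⟨∑ k, ℓ (o k) • o k, fun v => ?_⟩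
    change _ = ℓ v
    conv_rhs => rw [← ho v, map_sum]
    rw [(hT.isInner x).sum_right]
    refine Finset.sum_congr rfl fun k _ => ?_
    rw [(hT.isInner x).smul_right, map_smul, smul_eq_mul, mul_comm, (hT.isInner x).symm]
  choose X hX using riesz
  refine ⟨N, X, fun i => hT.isSmooth_of_inner fun s hs => ?_, fun x v => (hT.isInner x).ext fun u => ?_⟩
  · simp only [hX]
    have h1 : ContMDiff (𝓡 n) 𝓘(ℝ, EuclideanSpace ℝ (Fin N)) ∞ (fun x => Ψ x (s x)) :=
      isSmooth_trivial_iff.1 (IsSmooth.app (A := R.tangent) hΦ hs)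
    exact (EuclideanSpace.proj i : EuclideanSpace ℝ (Fin N) →L[ℝ] ℝ).contMDiff.comp h1
  · have h2 : R.tangent.inner x u v = ∑ i, Ψ x v i *
        Ψ x u i := by
      refine (hiso x u v).symm.trans ?_
      exact PiLp.inner_apply (𝕜 := ℝ) _ _
    rw [(hT.isInner x).sum_right, h2]
    refine Finset.sum_congr rfl fun i _ => ?_
    rw [(hT.isInner x).smul_right, hX, (hT.isInner x).symm, hX]

section Contractions

variable {ι : Type*} [Fintype ι] {X : ι → R.tangent.Sec}

/-- A vector of a Parseval frame occurs in the expansion of its own squared norm. -/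
lemma IsParseval.norm_le_one (hX : IsParseval R X) (i : ι) (x : M) :
    R.tangent.norm x (X i x) ≤ 1 := by
  have hT := R.isGeometric_tangent
  have h1 := hT.inner_self_expand (hX.expand x) (X i x)
  have h2 : R.tangent.inner x (X i x) (X i x) ^ 2 ≤
      ∑ j, R.tangent.inner x (X j x) (X i x) ^ 2 :=
    Finset.single_le_sum (f := fun j => R.tangent.inner x (X j x) (X i x) ^ 2)
      (fun _ _ => sq_nonneg _) (Finset.mem_univ i)
  rw [← h1, ← hT.sq_norm] at h2
  by_contra! h
  nlinarith [pow_lt_pow_left₀ h zero_le_one (n := 2) two_ne_zero]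

/-- The codifferential computed with any pair of dual bases. -/
lemma codiff_eq {φ : (Hom R.tangent A).Sec} {x : M} {s t : ι → R.tangent.Fib x}
    (h : ∀ v, ∑ i, R.tangent.inner x (s i) v • t i = v) :
    codiff R A φ x = -∑ i, app R.tangent A (dir R (Hom R.tangent A) φ x (s i)) (t i) := by
  have := R.isGeometric_tangent.sum_gramInv_eq h
    (app R.tangent A ∘ₗ dir R (Hom R.tangent A) φ x)
  exact congrArg Neg.neg this

/-- The contraction `Hom(T, Hom(A, Hom(T, B))) → Hom(A, B)` of the two arguments in `T`. -/
def contract (X : ι → R.tangent.Sec) (A B : MetricBundle n M) (x : M) :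
    (Hom R.tangent (Hom A (Hom R.tangent B))).Fib x →ₗ[ℝ] (Hom A B).Fib x where
  toFun ζ := ofLin A B (∑ i, (app R.tangent B).flip (X i x) ∘ₗ
    app A (Hom R.tangent B) (app R.tangent (Hom A (Hom R.tangent B)) ζ (X i x)))
  map_add' ζ ζ' := hom_ext A B fun ξ => by simp [Finset.sum_add_distrib]
  map_smul' c ζ := hom_ext A B fun ξ => by simp [Finset.smul_sum]

@[simp]
lemma app_contract {x : M} (ζ : (Hom R.tangent (Hom A (Hom R.tangent B))).Fib x) (ξ : A.Fib x) :
    app A B (contract X A B x ζ) ξ = ∑ i, app R.tangent B (app A (Hom R.tangent B)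
      (app R.tangent (Hom A (Hom R.tangent B)) ζ (X i x)) ξ) (X i x) := by
  simp [contract]

/-- The isomorphism `Hom(A, Hom(T, B)) → Hom(Hom(T, A), B)` given by the metric of `T`. -/
def flatten (X : ι → R.tangent.Sec) (A B : MetricBundle n M) (x : M) :
    (Hom A (Hom R.tangent B)).Fib x →ₗ[ℝ] (Hom (Hom R.tangent A) B).Fib x where
  toFun a := ofLin (Hom R.tangent A) B (∑ i, (app R.tangent B).flip (X i x) ∘ₗ
    app A (Hom R.tangent B) a ∘ₗ (app R.tangent A).flip (X i x))
  map_add' ζ ζ' := hom_ext (Hom R.tangent A) B fun ξ => by simp [Finset.sum_add_distrib]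
  map_smul' c ζ := hom_ext (Hom R.tangent A) B fun ξ => by simp [Finset.smul_sum]

@[simp]
lemma app_flatten {x : M} (a : (Hom A (Hom R.tangent B)).Fib x) (ζ : (Hom R.tangent A).Fib x) :
    app (Hom R.tangent A) B (flatten X A B x a) ζ = ∑ i, app R.tangent B (app A (Hom R.tangent B)
      a (app R.tangent A ζ (X i x))) (X i x) := by
  simp [flatten]

variable [T2Space M]

/-- The contraction is parallel since the derivatives of the `X i` cancel. -/
theorem IsParseval.isParallel_contract (hX : IsParseval R X) (hA : IsGeometric R A)
    (hB : IsGeometric R B) :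
    IsParallel R (Hom R.tangent (Hom A (Hom R.tangent B))) (Hom A B) (contract X A B) := by
  have hT := R.isGeometric_tangent
  have smooth : ∀ {ζ : (Hom R.tangent (Hom A (Hom R.tangent B))).Sec},
      (Hom R.tangent (Hom A (Hom R.tangent B))).IsSmooth ζ →
      (Hom A B).IsSmooth (fun x => contract X A B x (ζ x)) := by
    intro ζ hζ
    refine isSmooth_hom fun s hs => ?_
    simp only [app_contract]
    exact IsSmooth.sum _ fun i _ => ((hζ.app (hX.smooth i)).app hs).app (hX.smooth i)
  refine ⟨smooth, ?_, ?_⟩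
  · intro ζ hζ x v
    refine hA.hom_ext_smooth fun s hs => ?_
    rw [hA.app_dir hB (smooth hζ) hs]
    simp only [app_contract]
    have h1 := fun i => hζ.app (hX.smooth i)
    have h2 := fun i => (h1 i).app hs
    rw [hB.dir_sum _ fun i _ => (h2 i).app (hX.smooth i)]
    simp only [hT.dir_app hB (h2 _) (hX.smooth _), hA.dir_app (hT.hom hB) (h1 _) hs,
      hT.dir_app (hA.hom (hT.hom hB)) hζ (hX.smooth _), map_add, LinearMap.add_apply]
    -- the terms with derivatives of the frame have sum zero
    have h3 := hT.sum_dual_dir hX.smooth hX.smooth (x := x) (.of_forall hX.expand) v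
      (app R.tangent B ∘ₗ (app A (Hom R.tangent B)).flip (s x) ∘ₗ
        app R.tangent (Hom A (Hom R.tangent B)) (ζ x))
    simp only [LinearMap.comp_apply, LinearMap.flip_apply] at h3
    rw [← sub_eq_zero, ← h3, ← Finset.sum_sub_distrib, ← Finset.sum_sub_distrib]
    refine Finset.sum_congr rfl fun i _ => ?_
    abel
  · refine ⟨√(Module.finrank ℝ A.Model) * Fintype.card ι, by positivity, fun x ζ => ?_⟩
    rw [mul_assoc]
    refine hA.norm_hom_le hB (mul_nonneg (Nat.cast_nonneg _) (norm_nonneg _ _)) fun ξ => ?_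
    rw [app_contract]
    refine (hB.norm_sum_le _ _ _).trans ?_
    rw [mul_assoc, ← nsmul_eq_mul, ← Finset.card_univ, ← Finset.sum_const]
    refine Finset.sum_le_sum fun i _ => ?_
    have h1 := hT.norm_app_le hB (app A (Hom R.tangent B)
      (app R.tangent (Hom A (Hom R.tangent B)) ζ (X i x)) ξ) (X i x)
    have h2 := hA.norm_app_le (hT.hom hB) (app R.tangent (Hom A (Hom R.tangent B)) ζ (X i x)) ξ
    have h3 := hT.norm_app_le (hA.hom (hT.hom hB)) ζ (X i x)
    have hle := hX.norm_le_one i x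
    calc _ ≤ _ := h1
      _ ≤ (Hom R.tangent B).norm x (app A (Hom R.tangent B)
      (app R.tangent (Hom A (Hom R.tangent B)) ζ (X i x)) ξ) := mul_le_of_le_one_right (norm_nonneg _ _) hle
      _ ≤ _ := h2
      _ ≤ _ := mul_le_mul_of_nonneg_right (h3.trans (mul_le_of_le_one_right (norm_nonneg _ _) hle))
        (norm_nonneg _ _)

/-- The isomorphism is parallel since the derivatives of the `X i` cancel. -/
theorem IsParseval.isParallel_flatten (hX : IsParseval R X) (hA : IsGeometric R A)
    (hB : IsGeometric R B) :
    IsParallel R (Hom A (Hom R.tangent B)) (Hom (Hom R.tangent A) B) (flatten X A B) := by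
  have hT := R.isGeometric_tangent
  have smooth : ∀ {a : (Hom A (Hom R.tangent B)).Sec}, (Hom A (Hom R.tangent B)).IsSmooth a →
      (Hom (Hom R.tangent A) B).IsSmooth (fun x => flatten X A B x (a x)) := by
    intro a ha
    refine isSmooth_hom fun s hs => ?_
    simp only [app_flatten]
    exact IsSmooth.sum _ fun i _ => (ha.app (hs.app (hX.smooth i))).app (hX.smooth i)
  refine ⟨smooth, ?_, ?_⟩
  · intro a ha x v
    refine (hT.hom hA).hom_ext_smooth fun s hs => ?_
    rw [(hT.hom hA).app_dir hB (smooth ha) hs]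
    simp only [app_flatten]
    have h1 := fun i => hs.app (hX.smooth i)
    have h2 := fun i => ha.app (h1 i)
    rw [hB.dir_sum _ fun i _ => (h2 i).app (hX.smooth i)]
    simp only [hT.dir_app hB (h2 _) (hX.smooth _), hA.dir_app (hT.hom hB) ha (h1 _),
      hT.dir_app hA hs (hX.smooth _), map_add, LinearMap.add_apply]
    -- the terms with derivatives of the frame have sum zero
    have h3 := hT.sum_dual_dir hX.smooth hX.smooth (x := x) (.of_forall hX.expand) v
      (app R.tangent B ∘ₗ app A (Hom R.tangent B) (a x) ∘ₗ app R.tangent A (s x))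
    simp only [LinearMap.comp_apply] at h3
    rw [← sub_eq_zero, ← h3, ← Finset.sum_sub_distrib, ← Finset.sum_sub_distrib]
    refine Finset.sum_congr rfl fun i _ => ?_
    abel
  · refine ⟨√(Module.finrank ℝ (Hom R.tangent A).Model) * Fintype.card ι, by positivity,
      fun x a => ?_⟩
    rw [mul_assoc]
    refine (hT.hom hA).norm_hom_le hB (mul_nonneg (Nat.cast_nonneg _) (norm_nonneg _ _))
      fun ζ => ?_
    rw [app_flatten]
    refine (hB.norm_sum_le _ _ _).trans ?_
    rw [mul_assoc, ← nsmul_eq_mul, ← Finset.card_univ, ← Finset.sum_const]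
    refine Finset.sum_le_sum fun i _ => ?_
    have h1 := hT.norm_app_le hB (app A (Hom R.tangent B) a (app R.tangent A ζ (X i x))) (X i x)
    have h2 := hA.norm_app_le (hT.hom hB) a (app R.tangent A ζ (X i x))
    have h3 := hT.norm_app_le hA ζ (X i x)
    have hle := hX.norm_le_one i x
    calc _ ≤ _ := h1
      _ ≤ (Hom R.tangent B).norm x (app A (Hom R.tangent B) a (app R.tangent A ζ (X i x))) :=
        mul_le_of_le_one_right (norm_nonneg _ _) hle
      _ ≤ _ := h2
      _ ≤ _ := mul_le_mul_of_nonneg_left (h3.trans (mul_le_of_le_one_right (norm_nonneg _ _) hle))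
        (norm_nonneg _ _)

/-- The product rule `∇^*(a u) = -tr(∇a) u - a · ∇u`. -/
lemma IsParseval.codiff_app (hX : IsParseval R X) (hA : IsGeometric R A)
    (hB : IsGeometric R B) {a : (Hom A (Hom R.tangent B)).Sec} {u : A.Sec}
    (ha : (Hom A (Hom R.tangent B)).IsSmooth a) (hu : A.IsSmooth u) (x : M) :
    codiff R B (fun y => app A (Hom R.tangent B) (a y) (u y)) x =
      -app A B (contract X A B x (grad R (Hom A (Hom R.tangent B)) a x)) (u x) -
        app (Hom R.tangent A) B (flatten X A B x (a x)) (grad R A u x) := by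
  have hT := R.isGeometric_tangent
  rw [codiff_eq (hX.expand x), app_contract, app_flatten, ← neg_add', ← Finset.sum_add_distrib]
  congr 1
  refine Finset.sum_congr rfl fun i _ => ?_
  rw [hA.dir_app (hT.hom hB) ha hu, map_add, LinearMap.add_apply, app_grad, app_grad]

end Contractions

end

section

variable {n : ℕ} {M : Type*} [TopologicalSpace M] [ChartedSpace (EuclideanSpace ℝ (Fin n)) M]
  [IsManifold (𝓡 n) ∞ M] {R : RiemannianStructure n M} {A B D : MetricBundle n M}

open IsGeometric

/-! ### Differential operators built from covariant derivatives -/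

/-- The bundle map `T^{*⊗k}M ⊗ A → T^{*⊗k}M ⊗ B` induced by a bundle map `A → B`. -/
def tensMap (R : RiemannianStructure n M) {A B : MetricBundle n M}
    (L : ∀ x, A.Fib x →ₗ[ℝ] B.Fib x) : ∀ k x, (A.tens R k).Fib x →ₗ[ℝ] (B.tens R k).Fib x
  | 0 => L
  | k + 1 => postcomp R.tangent (tensMap R L k)

/-- The coefficients `c` of an operator `∑_{l ≤ k} c_l ∇^l`, of class `C_b^∞`, that intertwine the
endomorphisms `I` of `A` and `J` of `B` (the complex structures in the applications). The
coefficients with `l > k` vanish. -/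
structure IsCoeffs (R : RiemannianStructure n M) (A B : MetricBundle n M)
    (I : ∀ x, A.Fib x →ₗ[ℝ] A.Fib x) (J : ∀ x, B.Fib x →ₗ[ℝ] B.Fib x) (k : ℕ)
    (c : ∀ l, (Hom (A.tens R l) B).Sec) : Prop where
  smooth : ∀ l, (Hom (A.tens R l) B).IsSmooth (c l)
  bounds : ∀ l K, HasBounds R (fun _ => 1) K 0 (Hom (A.tens R l) B) (c l)
  comm : ∀ l x ξ, app (A.tens R l) B (c l x) (tensMap R I l x ξ) = J x (app (A.tens R l) B (c l x) ξ)
  vanish : ∀ l, k < l → c l = 0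

/-- The operator `u ↦ ∑_{l ≤ k} c_l ∇^l u`. -/
def opApply (R : RiemannianStructure n M) (A B : MetricBundle n M) (k : ℕ)
    (c : ∀ l, (Hom (A.tens R l) B).Sec) (u : A.Sec) : B.Sec :=
  fun x => ∑ l ∈ Finset.range (k + 1), app (A.tens R l) B (c l x) (A.nabla R l u x)

/-- `Q` is an operator of the form `∑_{l ≤ k} c_l ∇^l` on smooth sections. -/
def IsOperator (R : RiemannianStructure n M) (A B : MetricBundle n M)
    (I : ∀ x, A.Fib x →ₗ[ℝ] A.Fib x) (J : ∀ x, B.Fib x →ₗ[ℝ] B.Fib x) (k : ℕ)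
    (Q : A.Sec → B.Sec) : Prop :=
  ∃ c, IsCoeffs R A B I J k c ∧ ∀ u, A.IsSmooth u → Q u = opApply R A B k c u

/-- For the weight `1` the initial exponent is irrelevant. -/
lemma HasBounds.one_shift {K d e : ℕ} {s : A.Sec} (h : HasBounds R (fun _ => 1) K d A s) :
    HasBounds R (fun _ => 1) K e A s := by
  induction K generalizing d e A with
  | zero =>
    obtain ⟨C, h⟩ := h
    exact ⟨C, fun x => by simpa using h x⟩
  | succ K ih =>
    obtain ⟨⟨C, h⟩, h'⟩ := h
    exact ⟨⟨C, fun x => by simpa using h x⟩, ih h'⟩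

section T2

variable [T2Space M]

lemma IsParallel.tensMap (hA : IsGeometric R A) (hB : IsGeometric R B)
    {L : ∀ x, A.Fib x →ₗ[ℝ] B.Fib x} (hL : IsParallel R A B L) :
    ∀ k, IsParallel R (A.tens R k) (B.tens R k) (tensMap R L k)
  | 0 => hL
  | k + 1 => (IsParallel.tensMap hA hB hL k).postcomp R.isGeometric_tangent
      (R.isGeometric_tangent.tens hA k) (R.isGeometric_tangent.tens hB k)

/-- Parallel maps commute with iterated covariant derivatives. -/
lemma IsParallel.nabla_eq (hA : IsGeometric R A) (hB : IsGeometric R B)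
    {L : ∀ x, A.Fib x →ₗ[ℝ] B.Fib x} (hL : IsParallel R A B L) {u : A.Sec} (hu : A.IsSmooth u) :
    ∀ k, (B.nabla R k (fun x => L x (u x)) = fun x => MetricBundle.tensMap R L k x (A.nabla R k u x)) ∧
      (A.tens R k).IsSmooth (A.nabla R k u)
  | 0 => ⟨rfl, hu⟩
  | k + 1 => by
    obtain ⟨h1, h2⟩ := IsParallel.nabla_eq hA hB hL hu k
    have hk := R.isGeometric_tangent.tens hA k
    refine ⟨?_, hk.isSmooth_grad h2⟩
    have h3 := (hL.tensMap hA hB k).grad_eq h2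
    rw [← h1] at h3
    exact h3

lemma IsGeometric.isSmooth_nabla (hA : IsGeometric R A) {u : A.Sec} (hu : A.IsSmooth u) :
    ∀ k, (A.tens R k).IsSmooth (A.nabla R k u)
  | 0 => hu
  | k + 1 => (R.isGeometric_tangent.tens hA k).isSmooth_grad (hA.isSmooth_nabla hu k)

lemma HasBounds.zero (hA : IsGeometric R A) (ρ : M → ℝ) (d : ℕ) : ∀ K,
    HasBounds R ρ K d A (fun _ => 0) := by
  intro K
  induction K generalizing d A with
  | zero => exact ⟨0, fun x => by rw [hA.norm_zero, mul_zero]⟩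
  | succ K ih =>
    refine ⟨⟨0, fun x => by rw [hA.norm_zero, mul_zero]⟩, ?_⟩
    have : grad R A (fun _ => 0) = fun _ => 0 := funext fun x => hom_ext _ _ fun v =>
      (hA.dir_zero x v).trans (by simp)
    rw [this]
    exact ih (R.isGeometric_tangent.hom hA) _

lemma HasBounds.neg (hA : IsGeometric R A) {ρ : M → ℝ} {d : ℕ} {s : A.Sec} (hs : A.IsSmooth s) :
    ∀ {K}, HasBounds R ρ K d A s → HasBounds R ρ K d A (fun x => -s x) := by
  intro K
  induction K generalizing d A with
  | zero => rintro ⟨C, h⟩; exact ⟨C, fun x => by rw [hA.norm_neg]; exact h x⟩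
  | succ K ih =>
    rintro ⟨⟨C, h⟩, h'⟩
    refine ⟨⟨C, fun x => by rw [hA.norm_neg]; exact h x⟩, ?_⟩
    have : grad R A (fun x => -s x) = fun x => -grad R A s x := funext fun x => hom_ext _ _ fun v =>
      (hA.dir_neg hs x v).trans (by simp [app_grad])
    rw [this]
    exact ih (R.isGeometric_tangent.hom hA) (hA.isSmooth_grad hs) h'

omit [T2Space M] in
lemma IsGeometric.grad_zero (hA : IsGeometric R A) : grad R A (fun _ => 0) = 0 :=
  funext fun x => hom_ext _ _ fun v => (hA.dir_zero x v).trans (by simp)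

lemma IsGeometric.isSmooth_codiff (hA : IsGeometric R A) {ι : Type*} [Fintype ι]
    {X : ι → R.tangent.Sec} (hX : IsParseval R X) {φ : (Hom R.tangent A).Sec}
    (hφ : (Hom R.tangent A).IsSmooth φ) : A.IsSmooth (codiff R A φ) := by
  have : codiff R A φ = -fun x => ∑ i, app R.tangent A (app R.tangent _ (grad R (Hom R.tangent A) φ x)
      (X i x)) (X i x) := funext fun x => codiff_eq (hX.expand x)
  rw [this]
  exact (IsSmooth.sum _ fun i _ => (((R.isGeometric_tangent.hom hA).isSmooth_grad hφ).app
    (hX.smooth i)).app (hX.smooth i)).neg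

end T2

section Operators

variable [T2Space M] {ι : Type*} [Fintype ι] {X : ι → R.tangent.Sec}
  {I : ∀ x, A.Fib x →ₗ[ℝ] A.Fib x} {J : ∀ x, B.Fib x →ₗ[ℝ] B.Fib x}

/-- The map `flatten`, as an operator from sections of `Hom(T^{*⊗l}M ⊗ A, T^*M ⊗ B)` to sections of
`Hom(T^{*⊗(l+1)}M ⊗ A, B)`. -/
def flattenSec (X : ι → R.tangent.Sec) {l : ℕ} (a : (Hom (A.tens R l) (Hom R.tangent B)).Sec) :
    (Hom (A.tens R (l + 1)) B).Sec := fun x => flatten X (A.tens R l) B x (a x)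

omit [T2Space M] in
lemma app_flattenSec {l : ℕ} (a : (Hom (A.tens R l) (Hom R.tangent B)).Sec) (x : M)
    (ξ : (A.tens R (l + 1)).Fib x) : app (A.tens R (l + 1)) B (flattenSec X a x) ξ =
      ∑ i, app R.tangent B (app (A.tens R l) (Hom R.tangent B) (a x)
        (app R.tangent (A.tens R l) ξ (X i x))) (X i x) := app_flatten (A := A.tens R l) _ _

/-- The coefficients of `∇^* ∘ ∑ c_l ∇^l`. -/
def codiffCoeffs (X : ι → R.tangent.Sec) (c : ∀ l, (Hom (A.tens R l) (Hom R.tangent B)).Sec) :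
    ∀ l, (Hom (A.tens R l) B).Sec
  | 0 => fun x => -contract X (A.tens R 0) B x (grad R _ (c 0) x)
  | l + 1 => fun x => -contract X (A.tens R (l + 1)) B x (grad R _ (c (l + 1)) x) +
      -flattenSec X (c l) x

/-- The coefficients of `∇^* ∘ ∑ c_l ∇^l` are of class `C_b^∞` since they arise from `c` and `∇c`
by parallel contractions. -/
lemma IsParseval.isCoeffs_codiffCoeffs (hX : IsParseval R X) (hA : IsGeometric R A)
    (hB : IsGeometric R B) (hI : IsParallel R A A I) (hJ : IsParallel R B B J) {k : ℕ}
    {c : ∀ l, (Hom (A.tens R l) (Hom R.tangent B)).Sec}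
    (hc : IsCoeffs R A (Hom R.tangent B) I (postcomp R.tangent J) k c) :
    IsCoeffs R A B I J (k + 1) (codiffCoeffs X c) := by
  have hT := R.isGeometric_tangent
  have hAt := fun l => hT.tens hA l
  have hTB := hT.hom hB
  have hgs : ∀ l, (Hom (A.tens R l) B).IsSmooth
      (fun x => -contract X (A.tens R l) B x (grad R _ (c l) x)) := fun l =>
    ((hX.isParallel_contract (hAt l) hB).smooth (((hAt l).hom hTB).isSmooth_grad (hc.smooth l))).neg
  have hfs : ∀ l, (Hom (A.tens R (l + 1)) B).IsSmooth
      (fun x => -flattenSec X (c l) x) := fun l =>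
    ((hX.isParallel_flatten (hAt l) hB).smooth (hc.smooth l)).neg
  have hgb : ∀ l K, HasBounds R (fun _ => 1) K 0 (Hom (A.tens R l) B)
      (fun x => -contract X (A.tens R l) B x (grad R _ (c l) x)) := fun l K => by
    have h1 := (hc.bounds l (K + 1)).2
    have h2 := h1.parallel (fun _ => one_pos) (hT.hom ((hAt l).hom hTB)) ((hAt l).hom hB)
      (hX.isParallel_contract (hAt l) hB) (((hAt l).hom hTB).isSmooth_grad (hc.smooth l))
    exact HasBounds.one_shift (HasBounds.neg ((hAt l).hom hB)
      ((hX.isParallel_contract (hAt l) hB).smooth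
        (((hAt l).hom hTB).isSmooth_grad (hc.smooth l))) h2)
  have hfb : ∀ l K, HasBounds R (fun _ => 1) K 0 (Hom (A.tens R (l + 1)) B)
      (fun x => -flattenSec X (c l) x) := fun l K =>
    ((hc.bounds l K).parallel (fun _ => one_pos) ((hAt l).hom hTB) ((hAt (l + 1)).hom hB)
      (hX.isParallel_flatten (hAt l) hB) (hc.smooth l)).neg ((hAt (l + 1)).hom hB)
      ((hX.isParallel_flatten (hAt l) hB).smooth (hc.smooth l))
  -- the derivative of a coefficient intertwines the complex structures as well, since these are
  -- parallel
  have hgc : ∀ l x ξ, app (A.tens R l) B (-contract X (A.tens R l) B x (grad R _ (c l) x))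
      (tensMap R I l x ξ) = J x (app (A.tens R l) B
        (-contract X (A.tens R l) B x (grad R _ (c l) x)) ξ) := by
    intro l x ξ
    obtain ⟨s, hs, rfl⟩ := (hAt l).exists_extend x ξ
    have hIl := hI.tensMap hA hA l
    have key : ∀ v, app (A.tens R l) (Hom R.tangent B) (dir R _ (c l) x v) (tensMap R I l x (s x)) =
        postcomp R.tangent J x (app (A.tens R l) (Hom R.tangent B) (dir R _ (c l) x v) (s x)) := by
      intro v
      rw [(hAt l).app_dir hTB (hc.smooth l) hs, (hAt l).app_dir hTB (hc.smooth l) (hIl.smooth hs)]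
      simp only [hc.comm l]
      rw [(hJ.postcomp hT hB hB).dir ((hc.smooth l).app hs), hIl.dir hs, hc.comm, map_sub]
    rw [map_neg, LinearMap.neg_apply, LinearMap.neg_apply, map_neg, app_contract, app_contract,
      map_sum]
    simp only [app_grad, key, app_postcomp]
  have hfc : ∀ l x ξ, app (A.tens R (l + 1)) B (-flattenSec X (c l) x)
      (tensMap R I (l + 1) x ξ) = J x (app (A.tens R (l + 1)) B
        (-flattenSec X (c l) x) ξ) := by
    intro l x ξ
    rw [map_neg, LinearMap.neg_apply, LinearMap.neg_apply, map_neg]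
    rw [app_flattenSec, app_flattenSec, map_sum]
    refine congrArg Neg.neg ?_
    refine Finset.sum_congr rfl fun i _ => ?_
    refine (congrArg (fun z => app R.tangent B z (X i x)) (hc.comm l x _)).trans ?_
    rw [app_postcomp]
  refine ⟨?_, ?_, ?_, ?_⟩
  · rintro (_ | l)
    · exact hgs 0
    · exact (hgs (l + 1)).add (hfs l)
  · rintro (_ | l) K
    · exact hgb 0 K
    · exact (hgb (l + 1) K).add (fun _ => one_pos) ((hAt (l + 1)).hom hB) (hgs (l + 1)) (hfs l)
        (hfb l K)
  · rintro (_ | l) x ξ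
    · exact hgc 0 x ξ
    · have h1 := hgc (l + 1) x ξ
      have h2 := hfc l x ξ
      simp only [codiffCoeffs, map_add, LinearMap.add_apply] at h1 h2 ⊢
      rw [h1, h2]
  · rintro (_ | l) hl
    · omega
    · have h1 : c l = 0 := hc.vanish l (by omega)
      have h2 : c (l + 1) = 0 := hc.vanish (l + 1) (by omega)
      funext x
      have h3 : grad R _ (c (l + 1)) x = 0 := by
        rw [h2]
        exact congrFun ((hAt (l + 1)).hom hTB).grad_zero x
      simp only [codiffCoeffs]
      have h4 : flattenSec X (0 : (Hom (A.tens R l) (Hom R.tangent B)).Sec) x = 0 :=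
        map_zero (flatten X (A.tens R l) B x)
      rw [h3, h1, h4]
      simp

/-- The composition of `∇^*` with a differential operator. -/
lemma IsParseval.isOperator_codiff (hX : IsParseval R X) (hA : IsGeometric R A)
    (hB : IsGeometric R B) (hI : IsParallel R A A I) (hJ : IsParallel R B B J) {k : ℕ}
    {Q : A.Sec → (Hom R.tangent B).Sec}
    (hQ : IsOperator R A (Hom R.tangent B) I (postcomp R.tangent J) k Q) :
    IsOperator R A B I J (k + 1) (fun u => codiff R B (Q u)) := by
  have hT := R.isGeometric_tangent
  obtain ⟨c, hc, hQc⟩ := hQ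
  have hc' := hX.isCoeffs_codiffCoeffs hA hB hI hJ hc
  refine ⟨codiffCoeffs X c, hc', fun u hu => funext fun x => ?_⟩
  have hu' := fun l => hA.isSmooth_nabla hu l
  change codiff R B (Q u) x = _
  rw [hQc u hu, codiff_eq (hX.expand x)]
  have h1 : ∀ v, dir R (Hom R.tangent B) (opApply R A (Hom R.tangent B) k c u) x v =
      ∑ l ∈ Finset.range (k + 1), dir R (Hom R.tangent B)
        (fun y => app (A.tens R l) (Hom R.tangent B) (c l y) (A.nabla R l u y)) x v := fun v =>
    (hT.hom hB).dir_sum _ (fun l _ => (hc.smooth l).app (hu' l)) x v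
  simp only [h1, map_sum, LinearMap.sum_apply]
  rw [Finset.sum_comm, ← Finset.sum_neg_distrib]
  -- the product rule: each summand contributes one term of order `l` and one of order `l + 1`
  have h2 : ∀ l, -∑ i, app R.tangent B (dir R (Hom R.tangent B) (fun y =>
      app (A.tens R l) (Hom R.tangent B) (c l y) (A.nabla R l u y)) x (X i x)) (X i x) =
      app (A.tens R l) B (-contract X (A.tens R l) B x (grad R _ (c l) x)) (A.nabla R l u x) +
      app (A.tens R (l + 1)) B (-flattenSec X (c l) x) (A.nabla R (l + 1) u x) := by
    intro l
    rw [← codiff_eq (hX.expand x), hX.codiff_app (hT.tens hA l) hB (hc.smooth l) (hu' l), map_neg,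
      map_neg, LinearMap.neg_apply, LinearMap.neg_apply, sub_eq_add_neg]
    rfl
  simp only [h2]
  rw [opApply, Finset.sum_range_succ' _ (k + 1), Finset.sum_add_distrib]
  simp only [codiffCoeffs, map_add, LinearMap.add_apply, Finset.sum_add_distrib]
  rw [Finset.sum_range_succ' (fun l => app (A.tens R l) B
    (-contract X (A.tens R l) B x (grad R _ (c l) x)) (A.nabla R l u x)),
    Finset.sum_range_succ (fun l => app (A.tens R (l + 1)) B
    (-contract X (A.tens R (l + 1)) B x (grad R _ (c (l + 1)) x)) (A.nabla R (l + 1) u x))]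
  -- the coefficient of order `k + 1` has no contribution from a derivative of `c (k + 1) = 0`
  have h3 : grad R _ (c (k + 1)) x = 0 := by
    rw [hc.vanish (k + 1) (by omega)]
    exact congrFun ((hT.tens hA (k + 1)).hom (hT.hom hB)).grad_zero x
  rw [h3]
  simp only [map_zero, neg_zero, LinearMap.zero_apply, add_zero]
  abel

/-- The composition of `(∇^j)^*` with a differential operator. -/
lemma IsParseval.isOperator_nablaStar (hX : IsParseval R X) (hA : IsGeometric R A)
    (hB : IsGeometric R B) (hI : IsParallel R A A I) (hJ : IsParallel R B B J) {k : ℕ} :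
    ∀ {j : ℕ} {Q : A.Sec → (B.tens R j).Sec},
    IsOperator R A (B.tens R j) I (tensMap R J j) k Q →
    IsOperator R A B I J (k + j) (fun u => B.nablaStar R j (Q u)) := by
  intro j
  induction j generalizing k with
  | zero => exact fun h => h
  | succ j ih =>
    intro Q hQ
    have h := hX.isOperator_codiff hA (R.isGeometric_tangent.tens hB j) hI (hJ.tensMap hB hB j) hQ
    have e : k + (j + 1) = k + 1 + j := by omega
    rw [e]
    exact ih h

omit [T2Space M] in
lemma IsOperator.mono {k l : ℕ} (hkl : k ≤ l) {Q : A.Sec → B.Sec}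
    (hQ : IsOperator R A B I J k Q) : IsOperator R A B I J l Q := by
  obtain ⟨c, hc, hQc⟩ := hQ
  refine ⟨c, ⟨hc.smooth, hc.bounds, hc.comm, fun j hj => hc.vanish j (hkl.trans_lt hj)⟩,
    fun u hu => (hQc u hu).trans (funext fun x => ?_)⟩
  refine Finset.sum_subset (Finset.range_subset_range.2 (by omega)) fun j _ hj => ?_
  rw [hc.vanish j (by simpa using hj)]
  simp

lemma IsOperator.sum (hA : IsGeometric R A) (hB : IsGeometric R B) {k : ℕ} {κ : Type*}
    (S : Finset κ) {Q : κ → A.Sec → B.Sec} (hQ : ∀ i ∈ S, IsOperator R A B I J k (Q i)) :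
    IsOperator R A B I J k (fun u x => ∑ i ∈ S, Q i u x) := by
  classical
  have hh := fun l => (R.isGeometric_tangent.tens hA l).hom hB
  induction S using Finset.induction_on with
  | empty =>
    refine ⟨fun l => 0, ⟨fun l => isSmooth_zero _, fun l K => HasBounds.zero (hh l) _ _ _,
      fun l x ξ => by simp, fun _ _ => rfl⟩, fun u _ => funext fun x => by simp [opApply]⟩
  | insert i S hi ih =>
    obtain ⟨c, hc, hQc⟩ := ih fun j hj => hQ j (Finset.mem_insert_of_mem hj)
    obtain ⟨c', hc', hQc'⟩ := hQ i (Finset.mem_insert_self _ _)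
    refine ⟨fun l => fun x => c' l x + c l x, ⟨fun l => (hc'.smooth l).add (hc.smooth l),
      fun l K => (hc'.bounds l K).add (fun _ => one_pos) (hh l) (hc'.smooth l) (hc.smooth l)
        (hc.bounds l K), fun l x ξ => ?_, fun l hl => ?_⟩, fun u hu => funext fun x => ?_⟩
    · rw [map_add, LinearMap.add_apply, hc.comm, hc'.comm, LinearMap.add_apply, map_add]
    · funext x
      rw [hc.vanish l hl, hc'.vanish l hl]
      simp
    · change ∑ j ∈ insert i S, Q j u x = _
      rw [Finset.sum_insert hi, congrFun (hQc' u hu) x]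
      have := congrFun (hQc u hu) x
      change ∑ j ∈ S, Q j u x = _ at this
      rw [this]
      simp [opApply, Finset.sum_add_distrib]

/-- The operator `u ↦ a ∇^i u`. -/
lemma isOperator_single (hA : IsGeometric R A) (hB : IsGeometric R B) (i : ℕ)
    {a : (Hom (A.tens R i) B).Sec} (ha : (Hom (A.tens R i) B).IsSmooth a)
    (hab : ∀ K, HasBounds R (fun _ => 1) K 0 (Hom (A.tens R i) B) a)
    (hac : ∀ x ξ, app (A.tens R i) B (a x) (tensMap R I i x ξ) =
      J x (app (A.tens R i) B (a x) ξ)) :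
    IsOperator R A B I J i (fun u x => app (A.tens R i) B (a x) (A.nabla R i u x)) := by
  classical
  have hh := fun l => (R.isGeometric_tangent.tens hA l).hom hB
  have h0 : ∀ l, i ≠ l → Function.update (β := fun l => (Hom (A.tens R l) B).Sec) 0 i a l = 0 :=
    fun l hl => by rw [Function.update_of_ne hl.symm]; rfl
  refine ⟨Function.update 0 i a, ⟨fun l => ?_, fun l K => ?_, fun l x ξ => ?_, fun l hl => ?_⟩,
    fun u _ => funext fun x => ?_⟩
  · by_cases h : i = l
    · subst h; rwa [Function.update_self]
    · rw [h0 l h]; exact isSmooth_zero _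
  · by_cases h : i = l
    · subst h; rw [Function.update_self]; exact hab K
    · rw [h0 l h]; exact HasBounds.zero (hh l) _ _ _
  · by_cases h : i = l
    · subst h; rw [Function.update_self]; exact hac x ξ
    · rw [h0 l h]; simp
  · exact h0 l hl.ne
  · rw [opApply, Finset.sum_eq_single i]
    · rw [Function.update_self]
    · intro l _ hl
      rw [h0 l hl.symm]; simp
    · simp

end Operators

end

section

variable {n : ℕ} {M : Type*} [TopologicalSpace M] [ChartedSpace (EuclideanSpace ℝ (Fin n)) M]
  [IsManifold (𝓡 n) ∞ M] {R : RiemannianStructure n M}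

/-! ### Coordinate vector fields -/

/-- The vector field that is constant with value `v` in the preferred chart at `x₀`. -/
def coordField (R : RiemannianStructure n M) (x₀ : M) (v : EuclideanSpace ℝ (Fin n)) :
    R.tangent.Sec :=
  fun x => (trivializationAt R.tangent.Model R.tangent.Fib x₀).symm x v

/-- The components of a tangent vector at `x` in the preferred chart at `x₀`. -/
def coordMap (R : RiemannianStructure n M) (x₀ x : M) :
    R.tangent.Fib x →ₗ[ℝ] EuclideanSpace ℝ (Fin n) :=
  ((trivializationAt R.tangent.Model R.tangent.Fib x₀).continuousLinearMapAt ℝ x).toLinearMap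

omit [IsManifold (𝓡 n) ∞ M] in
lemma contMDiffOn_symm (A : MetricBundle n M) (x₀ : M) (v : A.Model) :
    ContMDiffOn (𝓡 n) ((𝓡 n).prod 𝓘(ℝ, A.Model)) ∞
      (fun x => TotalSpace.mk' A.Model x ((trivializationAt A.Model A.Fib x₀).symm x v))
      (trivializationAt A.Model A.Fib x₀).baseSet := by
  refine ((trivializationAt A.Model A.Fib x₀).contMDiffOn_section_baseSet_iff).2 ?_
  refine (contMDiffOn_const (c := v)).congr fun y hy => ?_
  rw [(trivializationAt A.Model A.Fib x₀).apply_mk_symm hy]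

lemma contMDiffOn_coordField (x₀ : M) (v : EuclideanSpace ℝ (Fin n)) :
    ContMDiffOn (𝓡 n) ((𝓡 n).prod 𝓘(ℝ, R.tangent.Model)) ∞
      (fun x => TotalSpace.mk' R.tangent.Model x (coordField R x₀ v x))
      (chartAt (EuclideanSpace ℝ (Fin n)) x₀).source := contMDiffOn_symm R.tangent x₀ v

section

variable {x₀ x : M} (hx : x ∈ (chartAt (EuclideanSpace ℝ (Fin n)) x₀).source)
include hx

lemma coordMap_coordField (v : EuclideanSpace ℝ (Fin n)) :
    coordMap R x₀ x (coordField R x₀ v x) = v := by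
  have hx' : x ∈ (trivializationAt R.tangent.Model R.tangent.Fib x₀).baseSet := hx
  have := (trivializationAt R.tangent.Model R.tangent.Fib x₀).continuousLinearMapAt_symmL
    (R := ℝ) hx' v
  exact (congrArg ((trivializationAt R.tangent.Model R.tangent.Fib x₀).continuousLinearMapAt ℝ x)
    (Trivialization.symmL_apply (R := ℝ) _ hx' (v : R.tangent.Model)).symm).trans this

lemma coordField_coordMap (v : R.tangent.Fib x) : coordField R x₀ (coordMap R x₀ x v) x = v := by
  have := (trivializationAt R.tangent.Model R.tangent.Fib x₀).symmL_continuousLinearMapAt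
    (R := ℝ) hx v
  rwa [Trivialization.symmL_apply (R := ℝ) _ hx] at this

lemma coordField_eq_mfderivWithin (v : EuclideanSpace ℝ (Fin n)) :
    coordField R x₀ v x = mfderivWithin 𝓘(ℝ, EuclideanSpace ℝ (Fin n)) (𝓡 n)
      (extChartAt (𝓡 n) x₀).symm (Set.range (𝓡 n)) (extChartAt (𝓡 n) x₀ x) v := by
  have := DFunLike.congr_fun (TangentBundle.symmL_trivializationAt (I := 𝓡 n) hx) v
  rwa [Trivialization.symmL_apply (R := ℝ) _ hx] at this

lemma coordMap_eq_mfderiv (v : R.tangent.Fib x) :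
    coordMap R x₀ x v = mfderiv (𝓡 n) 𝓘(ℝ, EuclideanSpace ℝ (Fin n)) (extChartAt (𝓡 n) x₀) x v :=
  DFunLike.congr_fun (TangentBundle.continuousLinearMapAt_trivializationAt (I := 𝓡 n) hx) v

lemma der_coordField {f : M → ℝ} (hf : MDifferentiableAt (𝓡 n) 𝓘(ℝ, ℝ) f x)
    (v : EuclideanSpace ℝ (Fin n)) :
    der R f x (coordField R x₀ v x) =
      fderiv ℝ (f ∘ (extChartAt (𝓡 n) x₀).symm) (extChartAt (𝓡 n) x₀ x) v := by
  have hx' : x ∈ (extChartAt (𝓡 n) x₀).source := by simpa using hx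
  have hy := (extChartAt (𝓡 n) x₀).map_source hx'
  have A : (extChartAt (𝓡 n) x₀).symm (extChartAt (𝓡 n) x₀ x) = x :=
    (extChartAt (𝓡 n) x₀).left_inv hx'
  have h1 : MDifferentiableWithinAt 𝓘(ℝ, EuclideanSpace ℝ (Fin n)) (𝓡 n)
      (extChartAt (𝓡 n) x₀).symm (Set.range (𝓡 n)) (extChartAt (𝓡 n) x₀ x) :=
    mdifferentiableWithinAt_extChartAt_symm hy
  have hf' : MDifferentiableAt (𝓡 n) 𝓘(ℝ, ℝ) f
      ((extChartAt (𝓡 n) x₀).symm (extChartAt (𝓡 n) x₀ x)) := by rwa [A]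
  have hr : Set.range (𝓡 n) = Set.univ := (𝓡 n).range_eq_univ
  rw [hr, mdifferentiableWithinAt_univ] at h1
  have h2 := mfderiv_comp (extChartAt (𝓡 n) x₀ x) hf' h1
  rw [coordField_eq_mfderivWithin hx, hr, mfderivWithin_univ]
  rw [mfderiv_eq_fderiv] at h2
  have h3 := DFunLike.congr_fun h2 v
  refine Eq.trans ?_ h3.symm
  rw [A]
  rfl

/-- Coordinate fields commute. -/
lemma mlieBracket_coordField (v w : EuclideanSpace ℝ (Fin n)) :
    VectorField.mlieBracket (𝓡 n) (coordField R x₀ v) (coordField R x₀ w) x = 0 := by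
  -- a coordinate field is the pullback of a constant field under the chart, and pullbacks commute
  -- with Lie brackets
  have key : ∀ v : EuclideanSpace ℝ (Fin n), coordField R x₀ v =ᶠ[𝓝 x]
      VectorField.mpullback (𝓡 n) 𝓘(ℝ, EuclideanSpace ℝ (Fin n)) (extChartAt (𝓡 n) x₀)
        (fun _ => v) := by
    intro v
    filter_upwards [(chartAt (EuclideanSpace ℝ (Fin n)) x₀).open_source.mem_nhds hx] with y hy
    have hi : (mfderiv (𝓡 n) 𝓘(ℝ, EuclideanSpace ℝ (Fin n)) (extChartAt (𝓡 n) x₀) y).IsInvertible :=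
      isInvertible_mfderiv_extChartAt (by simpa using hy)
    refine Eq.trans ?_ (VectorField.mpullback_apply).symm
    refine (hi.inverse_apply_eq.2 ?_).symm
    have := coordMap_eq_mfderiv hy (coordField R x₀ v y)
    rw [coordMap_coordField hy] at this
    exact this
  have hc : ∀ v : EuclideanSpace ℝ (Fin n), MDifferentiableAt 𝓘(ℝ, EuclideanSpace ℝ (Fin n))
      (𝓘(ℝ, EuclideanSpace ℝ (Fin n)).prod 𝓘(ℝ, EuclideanSpace ℝ (Fin n)))
      (fun y : EuclideanSpace ℝ (Fin n) => TotalSpace.mk' (EuclideanSpace ℝ (Fin n))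
        (E := TangentSpace 𝓘(ℝ, EuclideanSpace ℝ (Fin n))) y v) (extChartAt (𝓡 n) x₀ x) := by
    intro v
    rw [mdifferentiableAt_totalSpace]
    refine ⟨mdifferentiableAt_id, ?_⟩
    simpa using mdifferentiableAt_const
  have : IsManifold (𝓡 n) (minSmoothness ℝ 2) M := by
    rw [minSmoothness_of_isRCLikeNormedField]
    exact IsManifold.of_le (n := ∞) (WithTop.coe_le_coe.2 (le_top (a := (2 : ℕ∞))))
  rw [Filter.EventuallyEq.mlieBracket_vectorField_eq (key v) (key w),
    ← VectorField.mpullback_mlieBracket (n := ∞) (hc v) (hc w)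
      (contMDiffAt_extChartAt' hx) (by
        rw [minSmoothness_of_isRCLikeNormedField]
        exact WithTop.coe_le_coe.2 (le_top (a := (2 : ℕ∞)))),
    VectorField.mpullback_apply]
  have h0 := congrFun (VectorField.mlieBracketWithin_eq_lieBracketWithin (𝕜 := ℝ)
    (E := EuclideanSpace ℝ (Fin n)) (V := fun _ => v) (W := fun _ => w) (s := Set.univ))
    (extChartAt (𝓡 n) x₀ x)
  have h1 := VectorField.mlieBracketWithin_univ (I := 𝓘(ℝ, EuclideanSpace ℝ (Fin n)))
    (M := EuclideanSpace ℝ (Fin n))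
    (V := fun _ => v) (W := fun _ => w)
  refine (congrArg _ (((congrFun h1 _).symm.trans h0).trans ?_)).trans (map_zero _)
  simp only [VectorField.lieBracketWithin, fderivWithin_fun_const, Pi.zero_apply, zero_apply,
    sub_self]
  rfl

end

/-- The derivative of a change of coordinates. -/
lemma hasFDerivAt_coordChange (R : RiemannianStructure n M) {x₀ x₁ x : M}
    (h₀ : x ∈ (chartAt (EuclideanSpace ℝ (Fin n)) x₀).source)
    (h₁ : x ∈ (chartAt (EuclideanSpace ℝ (Fin n)) x₁).source) :
    ∃ L : EuclideanSpace ℝ (Fin n) →L[ℝ] EuclideanSpace ℝ (Fin n),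
      (∀ v, L v = coordMap R x₁ x (coordField R x₀ v x)) ∧
      HasFDerivAt (extChartAt (𝓡 n) x₁ ∘ (extChartAt (𝓡 n) x₀).symm) L (extChartAt (𝓡 n) x₀ x) := by
  have hx' : x ∈ (extChartAt (𝓡 n) x₀).source := by simpa using h₀
  have hy := (extChartAt (𝓡 n) x₀).map_source hx'
  have A : (extChartAt (𝓡 n) x₀).symm (extChartAt (𝓡 n) x₀ x) = x :=
    (extChartAt (𝓡 n) x₀).left_inv hx'
  have h1 : MDifferentiableWithinAt 𝓘(ℝ, EuclideanSpace ℝ (Fin n)) (𝓡 n)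
      (extChartAt (𝓡 n) x₀).symm (Set.range (𝓡 n)) (extChartAt (𝓡 n) x₀ x) :=
    mdifferentiableWithinAt_extChartAt_symm hy
  have hf' : MDifferentiableAt (𝓡 n) 𝓘(ℝ, EuclideanSpace ℝ (Fin n)) (extChartAt (𝓡 n) x₁)
      ((extChartAt (𝓡 n) x₀).symm (extChartAt (𝓡 n) x₀ x)) := by
    rw [A]; exact mdifferentiableAt_extChartAt h₁
  have hr : Set.range (𝓡 n) = Set.univ := (𝓡 n).range_eq_univ
  rw [hr, mdifferentiableWithinAt_univ] at h1
  have h2 := mfderiv_comp (extChartAt (𝓡 n) x₀ x) hf' h1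
  rw [mfderiv_eq_fderiv] at h2
  have h4 := (hf'.comp (extChartAt (𝓡 n) x₀ x) h1).differentiableAt
  refine ⟨_, fun v => ?_, h4.hasFDerivAt⟩
  rw [coordMap_eq_mfderiv h₁, coordField_eq_mfderivWithin h₀, hr, mfderivWithin_univ]
  refine (DFunLike.congr_fun h2 v).trans ?_
  rw [A]
  rfl

end

section

variable {n : ℕ} {M : Type*} [TopologicalSpace M] [ChartedSpace (EuclideanSpace ℝ (Fin n)) M]
  [IsManifold (𝓡 n) ∞ M] {R : RiemannianStructure n M}

/-! ### The volume measure in charts -/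

/-- The matrix `(g_{ij})` of the metric in the preferred chart at `x₀`. -/
def gramMatrix (R : RiemannianStructure n M) (x₀ x : M) : Matrix (Fin n) (Fin n) ℝ :=
  Matrix.of fun i j => R.tangent.inner x (coordField R x₀ (EuclideanSpace.single i 1) x)
    (coordField R x₀ (EuclideanSpace.single j 1) x)

/-- The density of the volume measure in the preferred chart at `x₀`. -/
def density (R : RiemannianStructure n M) (x₀ x : M) : ℝ := √(gramMatrix R x₀ x).det

section

variable {x₀ x : M} (hx : x ∈ (chartAt (EuclideanSpace ℝ (Fin n)) x₀).source)
include hx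

/-- The coordinate vectors form a basis of the tangent space. -/
lemma exists_basis_coordField : ∃ b : Module.Basis (Fin n) ℝ (R.tangent.Fib x),
    (∀ i, b i = coordField R x₀ (EuclideanSpace.single i 1) x) ∧
    ∀ i v, b.repr v i = coordMap R x₀ x v i := by
  have h1 : Function.Bijective (coordMap R x₀ x) :=
    ⟨Function.LeftInverse.injective (coordField_coordMap hx),
      Function.RightInverse.surjective (coordMap_coordField hx)⟩
  let b := (EuclideanSpace.basisFun (Fin n) ℝ).toBasis.map
    (LinearEquiv.ofBijective _ h1).symm
  refine ⟨b, fun i => ?_, fun i v => ?_⟩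
  · simp only [b, Module.Basis.map_apply]
    rw [LinearEquiv.symm_apply_eq]
    simp [coordMap_coordField hx]
  · simp only [b]
    rw [Module.Basis.map_repr]
    simp

lemma coordField_expand (v : R.tangent.Fib x) :
    ∑ i, coordMap R x₀ x v i • coordField R x₀ (EuclideanSpace.single i 1) x = v := by
  obtain ⟨b, hb, hb'⟩ := exists_basis_coordField (R := R) hx
  conv_rhs => rw [← b.sum_repr v]
  simp only [hb, hb']

lemma posDef_gramMatrix : (gramMatrix R x₀ x).PosDef := by
  obtain ⟨b, hb, -⟩ := exists_basis_coordField (R := R) hx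
  have hT := R.isGeometric_tangent.isInner x
  refine Matrix.PosDef.of_dotProduct_mulVec_pos ?_ fun c hc => ?_
  · ext i j
    simp [gramMatrix, hT.symm]
  · have h1 : star c ⬝ᵥ (gramMatrix R x₀ x).mulVec c =
        R.tangent.inner x (∑ i, c i • b i) (∑ i, c i • b i) := by
      simp only [hT.sum_left, hT.sum_right, hT.smul_left, hT.smul_right, hb]
      simp only [dotProduct, Matrix.mulVec, gramMatrix, Matrix.of_apply, Finset.mul_sum,
        star_trivial]
      exact Finset.sum_congr rfl fun i _ => Finset.sum_congr rfl fun j _ => by ring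
    rw [h1]
    refine hT.pos _ fun h0 => hc ?_
    funext i
    exact Fintype.linearIndependent_iff.1 b.linearIndependent c h0 i

lemma density_pos : 0 < density R x₀ x := Real.sqrt_pos.2 (posDef_gramMatrix hx).det_pos

omit hx in
/-- The transformation rule for the density. -/
lemma density_eq {x₁ : M} (hx₁ : x ∈ (chartAt (EuclideanSpace ℝ (Fin n)) x₁).source)
    (L : EuclideanSpace ℝ (Fin n) →L[ℝ] EuclideanSpace ℝ (Fin n))
    (hL : ∀ v, L v = coordMap R x₁ x (coordField R x₀ v x)) :
    density R x₀ x = |L.det| * density R x₁ x := by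
  have hT := R.isGeometric_tangent.isInner x
  let b := (EuclideanSpace.basisFun (Fin n) ℝ).toBasis
  let a := LinearMap.toMatrix b b L.toLinearMap
  have ha : ∀ i j, a i j = L (EuclideanSpace.single j 1) i := fun i j => by
    simp [a, b, LinearMap.toMatrix_apply]
  -- the Gram matrices are related by the Jacobian matrix `a` of the coordinate change
  have h1 : gramMatrix R x₀ x = a.transpose * gramMatrix R x₁ x * a := by
    ext i j
    have h2 : ∀ i, coordField R x₀ (EuclideanSpace.single i 1) x =
        ∑ k, a k i • coordField R x₁ (EuclideanSpace.single k 1) x := fun i => by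
      simp only [ha, hL]
      rw [coordField_expand hx₁]
    simp only [gramMatrix, Matrix.of_apply, Matrix.mul_apply, Matrix.transpose_apply, h2,
      hT.sum_left, hT.sum_right, hT.smul_left, hT.smul_right, Finset.sum_mul]
    rw [Finset.sum_comm]
    exact Finset.sum_congr rfl fun i _ => Finset.sum_congr rfl fun j _ => by ring
  have h3 : L.det = a.det := by
    rw [ContinuousLinearMap.det, LinearMap.det_toMatrix]
  rw [density, density, h1, Matrix.det_mul, Matrix.det_mul, Matrix.det_transpose, h3,
    mul_right_comm, ← sq, Real.sqrt_mul (sq_nonneg _), Real.sqrt_sq_eq_abs]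

end

lemma contMDiffOn_gramMatrix [T2Space M] (R : RiemannianStructure n M) (x₀ : M) (i j : Fin n) :
    ContMDiffOn (𝓡 n) 𝓘(ℝ, ℝ) ∞ (fun x => gramMatrix R x₀ x i j)
      (chartAt (EuclideanSpace ℝ (Fin n)) x₀).source := by
  intro x hx
  have hU := (chartAt (EuclideanSpace ℝ (Fin n)) x₀).open_source.mem_nhds hx
  have h1 := fun k => exists_isSmooth_eventuallyEq (A := R.tangent) hU
    (contMDiffOn_coordField (R := R) x₀ (EuclideanSpace.single k 1))
  choose E hE hE' using h1
  refine ContMDiffAt.contMDiffWithinAt ?_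
  refine ((R.isGeometric_tangent.smooth_inner (hE i) (hE j)) x).congr_of_eventuallyEq ?_
  filter_upwards [hE' i, hE' j] with y h1 h2
  rw [h1, h2]
  rfl

lemma contMDiffOn_density [T2Space M] (R : RiemannianStructure n M) (x₀ : M) :
    ContMDiffOn (𝓡 n) 𝓘(ℝ, ℝ) ∞ (density R x₀)
      (chartAt (EuclideanSpace ℝ (Fin n)) x₀).source := by
  intro x hx
  have h1 : ContMDiffWithinAt (𝓡 n) 𝓘(ℝ, ℝ) ∞ (fun x => (gramMatrix R x₀ x).det)
      (chartAt (EuclideanSpace ℝ (Fin n)) x₀).source x := by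
    simp only [Matrix.det_apply]
    refine ContMDiffWithinAt.sum fun σ _ => ?_
    simp only [zsmul_eq_mul, Units.smul_def]
    exact contMDiffWithinAt_const.mul
      (ContMDiffWithinAt.prod fun i _ => contMDiffOn_gramMatrix R x₀ _ _ x hx)
  exact (Real.contDiffAt_sqrt (posDef_gramMatrix hx).det_pos.ne').contMDiffAt.comp_contMDiffWithinAt
    x h1

section Measure

variable [MeasurableSpace M] [BorelSpace M]

omit [MeasurableSpace M] [BorelSpace M] in
lemma aemeasurable_density [T2Space M] (x₀ : M) :
    AEMeasurable (fun y => density R x₀ ((extChartAt (𝓡 n) x₀).symm y))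
      (volume.restrict (extChartAt (𝓡 n) x₀).target) := by
  refine ContinuousOn.aemeasurable ?_ (isOpen_extChartAt_target x₀).measurableSet
  refine (contMDiffOn_density R x₀).continuousOn.comp (continuousOn_extChartAt_symm x₀) ?_
  intro y hy
  simpa using (extChartAt (𝓡 n) x₀).map_target hy

omit [IsManifold (𝓡 n) ∞ M] in
lemma aemeasurable_extChartAt_symm (x₀ : M) : AEMeasurable (extChartAt (𝓡 n) x₀).symm
    (volume.restrict (extChartAt (𝓡 n) x₀).target) :=
  (continuousOn_extChartAt_symm x₀).aemeasurable (isOpen_extChartAt_target x₀).measurableSet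

lemma chartVolume_apply (x₀ : M) {S : Set M} (hS : MeasurableSet S) :
    R.chartVolume x₀ S = ∫⁻ y in extChartAt (𝓡 n) x₀ '' ((extChartAt (𝓡 n) x₀).source ∩ S),
      ENNReal.ofReal (density R x₀ ((extChartAt (𝓡 n) x₀).symm y)) := by
  have h : R.chartVolume x₀ = Measure.map (extChartAt (𝓡 n) x₀).symm
    ((volume.restrict (extChartAt (𝓡 n) x₀).target).withDensity fun y =>
      ENNReal.ofReal (density R x₀ ((extChartAt (𝓡 n) x₀).symm y))) := rfl
  rw [h, Measure.map_apply_of_aemeasurable ((aemeasurable_extChartAt_symm x₀).mono_ac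
    (withDensity_absolutelyContinuous _ _)) hS, withDensity_apply',
    Measure.restrict_restrict' (isOpen_extChartAt_target x₀).measurableSet,
    (extChartAt (𝓡 n) x₀).image_source_inter_eq', Set.inter_comm]

omit [IsManifold (𝓡 n) ∞ M] in
lemma measurableSet_image_extChartAt (x₀ : M) {S : Set M} (hS : MeasurableSet S) :
    MeasurableSet (extChartAt (𝓡 n) x₀ '' ((extChartAt (𝓡 n) x₀).source ∩ S)) := by
  rw [(extChartAt (𝓡 n) x₀).image_source_inter_eq']
  have h1 : Measurable ((extChartAt (𝓡 n) x₀).target.domRestrict (extChartAt (𝓡 n) x₀).symm) :=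
    (continuousOn_iff_continuous_domRestrict.1 (continuousOn_extChartAt_symm x₀)).measurable
  have h2 := (isOpen_extChartAt_target (I := 𝓡 n) x₀).measurableSet.subtype_image (h1 hS)
  convert h2 using 1
  ext y
  simp [and_comm]

/-- The measures defined by two charts agree on sets in both domains, by the change of variables
formula and `density_eq`. -/
lemma chartVolume_congr (x₀ x₁ : M) {S : Set M} (hS : MeasurableSet S)
    (h₀ : S ⊆ (chartAt (EuclideanSpace ℝ (Fin n)) x₀).source)
    (h₁ : S ⊆ (chartAt (EuclideanSpace ℝ (Fin n)) x₁).source) :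
    R.chartVolume x₀ S = R.chartVolume x₁ S := by
  have h₀' : S ⊆ (extChartAt (𝓡 n) x₀).source := by simpa using h₀
  have h₁' : S ⊆ (extChartAt (𝓡 n) x₁).source := by simpa using h₁
  have hm := measurableSet_image_extChartAt (n := n) x₀ hS
  rw [chartVolume_apply x₀ hS, chartVolume_apply x₁ hS]
  rw [Set.inter_eq_right.2 h₀'] at hm ⊢
  rw [Set.inter_eq_right.2 h₁']
  set τ := extChartAt (𝓡 n) x₁ ∘ (extChartAt (𝓡 n) x₀).symm with hτ
  have him : extChartAt (𝓡 n) x₁ '' S = τ '' (extChartAt (𝓡 n) x₀ '' S) := by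
    rw [Set.image_image]
    refine Set.image_congr fun x hx => ?_
    simp only [hτ, Function.comp_apply, (extChartAt (𝓡 n) x₀).left_inv (h₀' hx)]
  have hinj : Set.InjOn τ (extChartAt (𝓡 n) x₀ '' S) := by
    rintro _ ⟨x, hx, rfl⟩ _ ⟨y, hy, rfl⟩ hxy
    simp only [hτ, Function.comp_apply, (extChartAt (𝓡 n) x₀).left_inv (h₀' hx),
      (extChartAt (𝓡 n) x₀).left_inv (h₀' hy)] at hxy
    rw [(extChartAt (𝓡 n) x₁).injOn (h₁' hx) (h₁' hy) hxy]
  have hd : ∀ y ∈ extChartAt (𝓡 n) x₀ '' S, HasFDerivWithinAt τ (fderiv ℝ τ y)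
        (extChartAt (𝓡 n) x₀ '' S) y ∧
      density R x₀ ((extChartAt (𝓡 n) x₀).symm y) =
        |(fderiv ℝ τ y).det| * density R x₁ ((extChartAt (𝓡 n) x₁).symm (τ y)) := by
    rintro _ ⟨x, hx, rfl⟩
    obtain ⟨L, hL, hL'⟩ := hasFDerivAt_coordChange R (h₀ hx) (h₁ hx)
    rw [hL'.fderiv]
    refine ⟨hL'.hasFDerivWithinAt, ?_⟩
    simp only [hτ, Function.comp_apply, (extChartAt (𝓡 n) x₀).left_inv (h₀' hx),
      (extChartAt (𝓡 n) x₁).left_inv (h₁' hx)]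
    exact density_eq (h₁ hx) L hL
  rw [him, lintegral_image_eq_lintegral_abs_det_fderiv_mul volume hm (fun y hy => (hd y hy).1) hinj]
  refine setLIntegral_congr_fun hm fun y hy => ?_
  rw [(hd y hy).2, ENNReal.ofReal_mul (abs_nonneg _)]

variable [SecondCountableTopology M]

/-- The Riemannian measure has the density `√det g` in every chart, not only in those of the
countable cover by which it is defined. -/
theorem vol_restrict_source (R : RiemannianStructure n M) (x₀ : M) :
    R.vol.restrict (chartAt (EuclideanSpace ℝ (Fin n)) x₀).source = R.chartVolume x₀ := by
  ext S hS
  have hopen := fun x : M => (chartAt (EuclideanSpace ℝ (Fin n)) x).open_source.measurableSet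
  rw [Measure.restrict_apply hS]
  set T := S ∩ (chartAt (EuclideanSpace ℝ (Fin n)) x₀).source with hT
  have hTm : MeasurableSet T := hS.inter (hopen x₀)
  have h1 : R.chartVolume x₀ S = R.chartVolume x₀ T := by
    rw [chartVolume_apply x₀ hS, chartVolume_apply x₀ hTm, hT, extChartAt_source,
      Set.inter_comm S, ← Set.inter_assoc, Set.inter_self]
  rw [h1]
  have hcov := (exists_countable_charts n M).choose_spec.2
  let : Encodable (exists_countable_charts n M).choose :=
    (exists_countable_charts n M).choose_spec.1.toEncodable
  -- the sets `P x` form the measurable partition, subordinate to the countable cover, over which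
  -- the measure is defined
  let P : (exists_countable_charts n M).choose → Set M := fun x =>
    (chartAt (EuclideanSpace ℝ (Fin n)) x.1).source \
        ⋃ y : (exists_countable_charts n M).choose, ⋃ _ : Encodable.encode y < Encodable.encode x,
          (chartAt (EuclideanSpace ℝ (Fin n)) y.1).source
  have hP : ∀ x, MeasurableSet (P x) := fun x =>
    (hopen x.1).diff (.iUnion fun y => .iUnion fun _ => hopen y.1)
  have hvol : R.vol = Measure.sum fun x : (exists_countable_charts n M).choose =>
      (R.chartVolume x.1).restrict (P x) := rfl
  have hdisj : Pairwise (Function.onFun Disjoint P) := by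
    have key : ∀ x y, Encodable.encode x < Encodable.encode y → Disjoint (P x) (P y) := by
      intro x y hxy
      refine Set.disjoint_left.2 fun z hz hz' => hz'.2 ?_
      exact Set.mem_iUnion₂.2 ⟨x, hxy, hz.1⟩
    intro x y hxy
    rcases lt_trichotomy (Encodable.encode x) (Encodable.encode y) with h | h | h
    · exact key x y h
    · exact absurd (Encodable.encode_injective h) hxy
    · exact (key y x h).symm
  have hun : ⋃ x, P x = Set.univ := by
    refine Set.eq_univ_of_forall fun z => ?_
    have hz : ∃ k, ∃ x : (exists_countable_charts n M).choose, Encodable.encode x = k ∧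
        z ∈ (chartAt (EuclideanSpace ℝ (Fin n)) x.1).source := by
      have : z ∈ ⋃ x ∈ (exists_countable_charts n M).choose,
          (chartAt (EuclideanSpace ℝ (Fin n)) x).source := by rw [hcov]; trivial
      obtain ⟨x, hx, hzx⟩ := Set.mem_iUnion₂.1 this
      exact ⟨_, ⟨x, hx⟩, rfl, hzx⟩
    classical
    obtain ⟨x, hxk, hzx⟩ := Nat.find_spec hz
    refine Set.mem_iUnion.2 ⟨x, hzx, fun h => ?_⟩
    obtain ⟨y, hy, hzy⟩ := Set.mem_iUnion₂.1 h
    rw [hxk] at hy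
    exact Nat.find_min hz hy ⟨y, rfl, hzy⟩
  rw [hvol, Measure.sum_apply _ hTm]
  have h2 : ∀ x : (exists_countable_charts n M).choose,
      ((R.chartVolume x.1).restrict (P x)) T = R.chartVolume x₀ (T ∩ P x) := fun x => by
    rw [Measure.restrict_apply hTm]
    exact chartVolume_congr _ _ (hTm.inter (hP x)) (Set.inter_subset_right.trans Set.sdiff_subset)
      (Set.inter_subset_left.trans Set.inter_subset_right)
  simp only [h2]
  rw [← measure_iUnion (fun x y hxy => (hdisj hxy).mono Set.inter_subset_right
    Set.inter_subset_right) (fun x => hTm.inter (hP x)), ← Set.inter_iUnion, hun, Set.inter_univ]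

instance isLocallyFiniteMeasure_vol [T2Space M] (R : RiemannianStructure n M) :
    IsLocallyFiniteMeasure R.vol := by
  -- the density is bounded on compact subsets of a chart
  refine ⟨fun x₀ => ?_⟩
  have htar := (isOpen_extChartAt_target (I := 𝓡 n) x₀).mem_nhds (mem_extChartAt_target x₀)
  obtain ⟨K, hKn, hKt, hK⟩ := local_compact_nhds htar
  let U := (extChartAt (𝓡 n) x₀).source ∩ extChartAt (𝓡 n) x₀ ⁻¹' (interior K)
  have hU : IsOpen U := (continuousOn_extChartAt x₀).isOpen_inter_preimage
    (isOpen_extChartAt_source x₀) isOpen_interior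
  refine ⟨U, hU.mem_nhds ⟨mem_extChartAt_source x₀, mem_interior_iff_mem_nhds.2 hKn⟩, ?_⟩
  have h1 : R.vol U = R.chartVolume x₀ U := by
    rw [← vol_restrict_source, Measure.restrict_apply hU.measurableSet]
    congr 1
    refine (Set.inter_eq_left.2 ?_).symm
    intro x hx
    simpa using hx.1
  rw [h1, chartVolume_apply x₀ hU.measurableSet]
  have h2 : extChartAt (𝓡 n) x₀ '' ((extChartAt (𝓡 n) x₀).source ∩ U) ⊆ K := by
    rintro _ ⟨x, hx, rfl⟩
    exact interior_subset hx.2.2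
  refine (lintegral_mono_set h2).trans_lt ?_
  have h3 : ContinuousOn (fun y => density R x₀ ((extChartAt (𝓡 n) x₀).symm y)) K :=
    (contMDiffOn_density R x₀).continuousOn.comp
      ((continuousOn_extChartAt_symm x₀).mono hKt) fun y hy => by
        simpa using (extChartAt (𝓡 n) x₀).map_target (hKt hy)
  obtain ⟨C, hC⟩ := hK.exists_bound_of_continuousOn h3
  calc _ ≤ ∫⁻ _ in K, ENNReal.ofReal C := by
        refine setLIntegral_mono' hK.measurableSet fun y hy => ENNReal.ofReal_le_ofReal ?_
        exact (le_abs_self _).trans (hC y hy)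
    _ = ENNReal.ofReal C * volume K := by rw [setLIntegral_const]
    _ < ⊤ := ENNReal.mul_lt_top ENNReal.ofReal_lt_top hK.measure_lt_top

/-- Integrals of functions that are supported in a chart domain. -/
lemma integral_eq_chart [T2Space M] (x₀ : M) {f : M → ℝ} (hf : Continuous f)
    (hs : ∀ x ∉ (chartAt (EuclideanSpace ℝ (Fin n)) x₀).source, f x = 0) :
    ∫ x, f x ∂(R.vol) = ∫ y in (extChartAt (𝓡 n) x₀).target,
      density R x₀ ((extChartAt (𝓡 n) x₀).symm y) * f ((extChartAt (𝓡 n) x₀).symm y) := by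
  have h : R.chartVolume x₀ = Measure.map (extChartAt (𝓡 n) x₀).symm
    ((volume.restrict (extChartAt (𝓡 n) x₀).target).withDensity fun y =>
      ENNReal.ofReal (density R x₀ ((extChartAt (𝓡 n) x₀).symm y))) := rfl
  rw [← setIntegral_eq_integral_of_forall_compl_eq_zero hs, vol_restrict_source, h,
    integral_map ((aemeasurable_extChartAt_symm x₀).mono_ac (withDensity_absolutelyContinuous _ _))
      hf.aestronglyMeasurable,
    integral_withDensity_eq_integral_toReal_smul₀ (aemeasurable_density x₀).ennreal_ofReal
      (.of_forall fun _ => ENNReal.ofReal_lt_top)]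
  simp only [smul_eq_mul]
  congr 1
  funext y
  rw [ENNReal.toReal_ofReal (show 0 ≤ density R x₀ _ from Real.sqrt_nonneg _)]

end Measure

end

section

variable {n : ℕ} {M : Type*} [TopologicalSpace M] [ChartedSpace (EuclideanSpace ℝ (Fin n)) M]
  [IsManifold (𝓡 n) ∞ M] {R : RiemannianStructure n M} {A : MetricBundle n M}

/-! ### The divergence theorem -/

/-- The divergence of a vector field, that is the trace of its covariant derivative. -/
def divergence (R : RiemannianStructure n M) (X : R.tangent.Sec) (x : M) : ℝ :=
  LinearMap.trace ℝ (R.tangent.Fib x) (dir R R.tangent X x)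

/-- The trace of an endomorphism computed with any pair of dual bases. -/
lemma trace_eq_sum_dual {x : M} {ι : Type*} [Fintype ι] {s t : ι → R.tangent.Fib x}
    (h : ∀ v, ∑ i, R.tangent.inner x (s i) v • t i = v)
    (L : R.tangent.Fib x →ₗ[ℝ] R.tangent.Fib x) :
    LinearMap.trace ℝ (R.tangent.Fib x) L = ∑ i, R.tangent.inner x (s i) (L (t i)) := by
  classical
  have hT := R.isGeometric_tangent.isInner x
  let b := Module.finBasis ℝ (R.tangent.Fib x)
  rw [LinearMap.trace_eq_matrix_trace ℝ b, Matrix.trace]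
  simp only [Matrix.diag_apply, LinearMap.toMatrix_apply]
  have h1 : ∀ k, b.repr (L (b k)) k =
      ∑ i, R.tangent.inner x (s i) (b.repr (L (t i)) k • b k) := fun k => by
    conv_lhs => rw [← h (b k)]
    simp only [map_sum, map_smul, Finsupp.coe_finsetSum, Finset.sum_apply, Finsupp.smul_apply,
      hT.smul_right, smul_eq_mul]
    exact Finset.sum_congr rfl fun i _ => mul_comm _ _
  simp only [h1]
  rw [Finset.sum_comm]
  refine Finset.sum_congr rfl fun i _ => ?_
  rw [← hT.sum_right, b.sum_repr]

lemma der_prod {ι : Type*} [DecidableEq ι] (S : Finset ι) {f : ι → M → ℝ}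
    (hf : ∀ i, ContMDiff (𝓡 n) 𝓘(ℝ, ℝ) ∞ (f i)) (x : M) (v : R.tangent.Fib x) :
    der R (fun y => ∏ i ∈ S, f i y) x v =
      ∑ i ∈ S, (∏ j ∈ S.erase i, f j x) * der R (f i) x v := by
  induction S using Finset.induction_on with
  | empty => simpa using der_const (R := R) 1 x v
  | insert i S hi ih =>
    have h1 : (fun y => ∏ j ∈ insert i S, f j y) = fun y => f i y * ∏ j ∈ S, f j y :=
      funext fun y => Finset.prod_insert hi
    have h2 : ContMDiff (𝓡 n) 𝓘(ℝ, ℝ) ∞ (fun y => ∏ j ∈ S, f j y) :=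
      contMDiff_finsetProd fun j _ => hf j
    rw [h1, der_mul (hf i) h2, ih, Finset.sum_insert hi,
      Finset.erase_insert hi, add_comm, Finset.mul_sum]
    congr 1
    refine Finset.sum_congr rfl fun j hj => ?_
    have hij : i ≠ j := fun h => hi (h ▸ hj)
    rw [Finset.erase_insert_of_ne hij, Finset.prod_insert fun h => hi (Finset.mem_of_mem_erase h),
      mul_assoc]

/-- Jacobi's formula for the derivative of a determinant. -/
lemma der_det {G : Fin n → Fin n → M → ℝ} (hG : ∀ i j, ContMDiff (𝓡 n) 𝓘(ℝ, ℝ) ∞ (G i j))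
    (x : M) (v : R.tangent.Fib x) :
    der R (fun y => (Matrix.of fun i j => G i j y).det) x v =
      ((Matrix.of fun i j => G i j x).adjugate * Matrix.of fun i j => der R (G i j) x v).trace := by
  have h1 : (fun y => (Matrix.of fun i j => G i j y).det) = fun y =>
      ∑ σ : Equiv.Perm (Fin n), ((σ.sign : ℤ) : ℝ) * ∏ i, G (σ i) i y := by
    funext y
    rw [Matrix.det_apply']
    simp
  have hp : ∀ σ : Equiv.Perm (Fin n), ContMDiff (𝓡 n) 𝓘(ℝ, ℝ) ∞ fun y => ∏ i, G (σ i) i y :=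
    fun σ => contMDiff_finsetProd fun j _ => hG _ _
  have hq : ∀ σ : Equiv.Perm (Fin n), ContMDiff (𝓡 n) 𝓘(ℝ, ℝ) ∞
      fun y => ((σ.sign : ℤ) : ℝ) * ∏ i, G (σ i) i y := fun σ => contMDiff_const.mul (hp σ)
  rw [h1, der_sum _ fun σ _ => hq σ]
  simp only [der_mul contMDiff_const (hp _), der_const, mul_zero, add_zero,
    der_prod _ fun i => hG _ i]
  rw [Matrix.trace]
  have h2 : ∀ k, ((Matrix.of fun i j => G i j x).adjugate * Matrix.of fun i j =>
      der R (G i j) x v).diag k = ∑ σ : Equiv.Perm (Fin n), ((σ.sign : ℤ) : ℝ) *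
        ((∏ j ∈ Finset.univ.erase k, G (σ j) j x) * der R (G (σ k) k) x v) := by
    intro k
    have h3 : ((Matrix.of fun i j => G i j x).adjugate * Matrix.of fun i j =>
      der R (G i j) x v).diag k =
        ((Matrix.of fun i j => G i j x).updateCol k fun i => der R (G i k) x v).det := by
      rw [← Matrix.cramer_apply, Matrix.cramer_eq_adjugate_mulVec]
      rfl
    rw [h3, Matrix.det_apply']
    refine Finset.sum_congr rfl fun σ _ => ?_
    congr 1
    rw [← Finset.mul_prod_erase _ _ (Finset.mem_univ k), mul_comm, Matrix.updateCol_self]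
    congr 1
    refine Finset.prod_congr rfl fun j hj => ?_
    rw [Matrix.updateCol_ne (Finset.ne_of_mem_erase hj)]
    rfl
  simp only [h2]
  rw [Finset.sum_comm]
  refine Finset.sum_congr rfl fun σ _ => ?_
  rw [Finset.mul_sum]

section

variable [T2Space M] {x₀ x : M} (hx : x ∈ (chartAt (EuclideanSpace ℝ (Fin n)) x₀).source)
include hx

/-- Globally smooth vector fields that agree with the coordinate fields near `x`. -/
lemma exists_coordField_global : ∃ E : Fin n → R.tangent.Sec, (∀ i, R.tangent.IsSmooth (E i)) ∧
    ∀ᶠ y in 𝓝 x, ∀ i, E i y = coordField R x₀ (EuclideanSpace.single i 1) y := by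
  have hU := (chartAt (EuclideanSpace ℝ (Fin n)) x₀).open_source.mem_nhds hx
  have h1 := fun k => exists_isSmooth_eventuallyEq (A := R.tangent) hU
    (contMDiffOn_coordField (R := R) x₀ (EuclideanSpace.single k 1))
  choose E hE hE' using h1
  exact ⟨E, hE, Filter.eventually_all.2 hE'⟩

omit [T2Space M] in
/-- The coordinate fields have symmetric covariant derivatives, since the connection is
torsion-free. -/
lemma dir_coordField_symm {E : Fin n → R.tangent.Sec} (hE : ∀ i, R.tangent.IsSmooth (E i))
    (hE' : ∀ᶠ y in 𝓝 x, ∀ i, E i y = coordField R x₀ (EuclideanSpace.single i 1) y)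
    (i j : Fin n) : dir R R.tangent (E i) x (E j x) = dir R R.tangent (E j) x (E i x) := by
  have h1 := R.conn.torsion_eq_zero_iff.1 R.torsion_free
    ((hE j).mdifferentiableAt (x := x) (by simp)) ((hE i).mdifferentiableAt (x := x) (by simp))
  have h2 : VectorField.mlieBracket (𝓡 n) (E j) (E i) x = 0 := by
    rw [Filter.EventuallyEq.mlieBracket_vectorField_eq (V := coordField R x₀ (EuclideanSpace.single j 1))
      (W := coordField R x₀ (EuclideanSpace.single i 1)) (hE'.mono fun y hy => hy j)
      (hE'.mono fun y hy => hy i)]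
    exact mlieBracket_coordField hx _ _
  rw [h2, sub_eq_zero] at h1
  exact h1

omit [T2Space M] in
lemma trace_eq_sum_coord (L : R.tangent.Fib x →ₗ[ℝ] R.tangent.Fib x) :
    LinearMap.trace ℝ (R.tangent.Fib x) L =
      ∑ k, coordMap R x₀ x (L (coordField R x₀ (EuclideanSpace.single k 1) x)) k := by
  classical
  obtain ⟨b, hb, hb'⟩ := exists_basis_coordField (R := R) hx
  rw [LinearMap.trace_eq_matrix_trace ℝ b, Matrix.trace]
  simp only [Matrix.diag_apply, LinearMap.toMatrix_apply, hb, hb']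

/-- The logarithmic derivative of the density is the trace of the Christoffel symbols. -/
lemma der_density {E : Fin n → R.tangent.Sec} (hE : ∀ i, R.tangent.IsSmooth (E i))
    (hE' : ∀ᶠ y in 𝓝 x, ∀ i, E i y = coordField R x₀ (EuclideanSpace.single i 1) y)
    (v : R.tangent.Fib x) :
    der R (density R x₀) x v =
      density R x₀ x * ∑ k, coordMap R x₀ x (dir R R.tangent (E k) x v) k := by
  have hT := R.isGeometric_tangent
  have hI := hT.isInner x
  have hU := (chartAt (EuclideanSpace ℝ (Fin n)) x₀).open_source.mem_nhds hx
  obtain ⟨w, hw, hw'⟩ := exists_contMDiff_eventuallyEq hU (contMDiffOn_density R x₀)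
  have hEx := hE'.self_of_nhds
  have hsq : ∀ᶠ y in 𝓝 x, w y * w y =
      (Matrix.of fun i j => R.tangent.inner y (E i y) (E j y)).det := by
    filter_upwards [hw', hE', hU] with y h1 h2 h3
    simp only [h1, h2]
    exact Real.mul_self_sqrt (posDef_gramMatrix h3).det_pos.le
  set G := gramMatrix R x₀ x with hG
  let Γ : Matrix (Fin n) (Fin n) ℝ :=
    Matrix.of fun m k => coordMap R x₀ x (dir R R.tangent (E k) x v) m
  have hΓ : ∀ k, dir R R.tangent (E k) x v = ∑ m, Γ m k • E m x := fun k => by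
    simp only [hEx]
    exact (coordField_expand hx _).symm
  have hGE : ∀ i j, G i j = R.tangent.inner x (E i x) (E j x) := fun i j => by
    rw [hEx i, hEx j]; rfl
  -- `Γ` is the matrix of `E k ↦ ∇_v E k`, and metric compatibility reads `∂_v G = Γᵀ G + G Γ`; by
  -- the formula of Jacobi, `∂_v det G = 2 det G · tr Γ`
  have hD : (Matrix.of fun i j => der R (fun y => R.tangent.inner y (E i y) (E j y)) x v) =
      Γ.transpose * G + G * Γ := by
    ext i j
    rw [Matrix.of_apply, hT.der_inner (hE i) (hE j), hΓ, hΓ, hI.sum_left, hI.sum_right,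
      Matrix.add_apply, Matrix.mul_apply, Matrix.mul_apply]
    simp only [hI.smul_left, hI.smul_right, hGE, Matrix.transpose_apply, mul_comm]
  have hdet := der_det (R := R) (fun i j => hT.smooth_inner (hE i) (hE j)) x v
  have hGx : (Matrix.of fun i j => R.tangent.inner x (E i x) (E j x)) = G := by
    ext i j; exact (hGE i j).symm
  rw [hD, hGx, ← DFunLike.congr_fun (der_congr (R := R) hsq) v, der_mul hw hw, Matrix.mul_add,
    Matrix.trace_add, ← Matrix.mul_assoc, ← Matrix.mul_assoc, Matrix.adjugate_mul,
    Matrix.trace_mul_cycle, Matrix.mul_adjugate, Matrix.smul_mul, Matrix.one_mul, Matrix.smul_mul,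
    Matrix.one_mul, Matrix.trace_smul, Matrix.trace_smul, Matrix.trace_transpose] at hdet
  have hwx : w x = density R x₀ x := hw'.self_of_nhds
  have hpos := density_pos (R := R) hx
  have hGdet : G.det = density R x₀ x * density R x₀ x :=
    (Real.mul_self_sqrt (posDef_gramMatrix hx).det_pos.le).symm
  rw [← DFunLike.congr_fun (der_congr (R := R) hw') v]
  have htr : Γ.trace = ∑ k, coordMap R x₀ x (dir R R.tangent (E k) x v) k := rfl
  rw [hwx, hGdet, htr] at hdet
  simp only [smul_eq_mul] at hdet
  have : density R x₀ x * (der R w x v -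
      density R x₀ x * ∑ k, coordMap R x₀ x (dir R R.tangent (E k) x v) k) = 0 := by linarith
  rcases mul_eq_zero.1 this with h | h
  · exact absurd h hpos.ne'
  · exact sub_eq_zero.1 h

end

lemma contMDiffOn_coordMap (x₀ : M) {X : R.tangent.Sec} (hX : R.tangent.IsSmooth X) (i : Fin n) :
    ContMDiffOn (𝓡 n) 𝓘(ℝ, ℝ) ∞ (fun x => coordMap R x₀ x (X x) i)
      (chartAt (EuclideanSpace ℝ (Fin n)) x₀).source := by
  have h1 := ((trivializationAt R.tangent.Model R.tangent.Fib
    x₀).contMDiffOn_section_baseSet_iff).1 (ContMDiff.contMDiffOn hX)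
  have h2 : ContMDiffOn (𝓡 n) 𝓘(ℝ, EuclideanSpace ℝ (Fin n)) ∞ (fun x => coordMap R x₀ x (X x))
      (trivializationAt R.tangent.Model R.tangent.Fib x₀).baseSet := by
    refine h1.congr fun y hy => ?_
    exact congrFun (Trivialization.coe_linearMapAt_of_mem (R := ℝ) _ hy) (X y)
  exact (EuclideanSpace.proj i : EuclideanSpace ℝ (Fin n) →L[ℝ] ℝ).contMDiff.comp_contMDiffOn h2

/-- The divergence of `h X` in local coordinates. -/
lemma sum_der_coord [T2Space M] {x₀ x : M}
    (hx : x ∈ (chartAt (EuclideanSpace ℝ (Fin n)) x₀).source) {X : R.tangent.Sec} {h : M → ℝ}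
    (hX : R.tangent.IsSmooth X) (hh : ContMDiff (𝓡 n) 𝓘(ℝ, ℝ) ∞ h) :
    ∑ i, der R (fun y => h y * (coordMap R x₀ y (X y) i * density R x₀ y)) x
        (coordField R x₀ (EuclideanSpace.single i 1) x) =
      density R x₀ x * (der R h x (X x) + h x * divergence R X x) := by
  have hT := R.isGeometric_tangent
  have hU := (chartAt (EuclideanSpace ℝ (Fin n)) x₀).open_source.mem_nhds hx
  obtain ⟨w, hw, hw'⟩ := exists_contMDiff_eventuallyEq hU (contMDiffOn_density R x₀)
  have := fun i => exists_contMDiff_eventuallyEq hU (contMDiffOn_coordMap (R := R) x₀ hX i)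
  choose c hc hc' using this
  obtain ⟨E, hE, hE'⟩ := exists_coordField_global (R := R) hx
  have hEx := hE'.self_of_nhds
  have hcx : ∀ i, c i x = coordMap R x₀ x (X x) i := fun i => (hc' i).self_of_nhds
  have hXE : ∀ᶠ y in 𝓝 x, X y = ∑ i, c i y • E i y := by
    filter_upwards [Filter.eventually_all.2 hc', hE', hU] with y h1 h2 h3
    simp only [h1, h2]
    exact (coordField_expand h3 _).symm
  have hdX : ∀ v, dir R R.tangent X x v =
      ∑ i, (c i x • dir R R.tangent (E i) x v + der R (c i) x v • E i x) := fun v => by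
    rw [hT.dir_congr (t := fun y => ∑ i, c i y • E i y)
      (IsSmooth.sum _ fun i _ => (hE i).smul (hc i)) hXE,
      hT.dir_sum _ fun i _ => (hE i).smul (hc i)]
    exact Finset.sum_congr rfl fun i _ => hT.dir_smul (hc i) (hE i) x v
  have hdiv : divergence R X x = ∑ i, (c i x * ∑ k, coordMap R x₀ x (dir R R.tangent (E k) x (E i x)) k)
      + ∑ i, der R (c i) x (E i x) := by
    rw [divergence, trace_eq_sum_coord hx]
    simp only [← hEx, hdX, map_sum, map_add, map_smul, WithLp.ofLp_sum, Finset.sum_apply,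
      WithLp.ofLp_add, Pi.add_apply, WithLp.ofLp_smul, Pi.smul_apply, smul_eq_mul,
      Finset.sum_add_distrib]
    congr 1
    · rw [Finset.sum_comm]
      simp only [Finset.mul_sum]
      refine Finset.sum_congr rfl fun i _ => Finset.sum_congr rfl fun k _ => ?_
      -- torsion-freeness exchanges the two lower indices of the Christoffel symbols
      rw [dir_coordField_symm hx hE hE']
    · refine Finset.sum_congr rfl fun k _ => ?_
      simp only [hEx, coordMap_coordField hx]
      simp [PiLp.single_apply]
  have hXx : der R h x (X x) = ∑ i, c i x * der R h x (E i x) := by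
    conv_lhs => rw [hXE.self_of_nhds, map_sum]
    simp only [map_smul, smul_eq_mul]
  have hterm : ∀ i, der R (fun y => h y * (coordMap R x₀ y (X y) i * density R x₀ y)) x
        (coordField R x₀ (EuclideanSpace.single i 1) x) =
      h x * (c i x * (density R x₀ x * ∑ k, coordMap R x₀ x (dir R R.tangent (E k) x (E i x)) k) +
        density R x₀ x * der R (c i) x (E i x)) + (c i x * density R x₀ x) * der R h x (E i x) := by
    intro i
    have h1 : ∀ᶠ y in 𝓝 x, h y * (coordMap R x₀ y (X y) i * density R x₀ y) =
        h y * (c i y * w y) := by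
      filter_upwards [hc' i, hw'] with y h1 h2
      rw [h1, h2]
    have h2 : ContMDiff (𝓡 n) 𝓘(ℝ, ℝ) ∞ (fun y => c i y * w y) := (hc i).mul hw
    rw [der_congr (R := R) h1, der_mul hh h2, der_mul (hc i) hw, hw'.self_of_nhds,
      der_congr (R := R) hw', der_density hx hE hE', hEx i]
  simp only [hterm]
  rw [hdiv, hXx]
  simp only [Finset.sum_add_distrib, mul_add, Finset.mul_sum]
  rw [add_comm]
  congr 1
  · exact Finset.sum_congr rfl fun i _ => by ring
  · congr 1
    · refine Finset.sum_congr rfl fun i _ => Finset.sum_congr rfl fun k _ => by ring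
    · exact Finset.sum_congr rfl fun i _ => by ring

/-- Partial derivatives of compactly supported functions have integral zero. -/
lemma integral_fderiv_eq_zero {f : EuclideanSpace ℝ (Fin n) → ℝ} (hf : ContDiff ℝ 1 f)
    (hc : HasCompactSupport f) (v : EuclideanSpace ℝ (Fin n)) : ∫ y, fderiv ℝ f y v = 0 := by
  have hi : Integrable (fun y => fderiv ℝ f y v) :=
    ((hf.continuous_fderiv one_ne_zero).clm_apply continuous_const).integrable_of_hasCompactSupport
      (hc.fderiv_apply ℝ v)
  have := integral_mul_fderiv_eq_neg_fderiv_mul_of_integrable (μ := volume) (f := fun _ => (1 : ℝ))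
    (g := f) (v := v) (by simp) (by simpa using hi)
    (by simpa using hf.continuous.integrable_of_hasCompactSupport hc)
    (fun x _ => differentiableAt_const _) (fun x _ => hf.differentiable one_ne_zero x)
  simpa using this

section Integral

variable [T2Space M] [MeasurableSpace M] [BorelSpace M] [SecondCountableTopology M]
  {ι : Type*} [Fintype ι] {X : ι → R.tangent.Sec}

omit [T2Space M] [MeasurableSpace M] [BorelSpace M] [SecondCountableTopology M] in
/-- The frame gives a global formula for the divergence, from which its smoothness is immediate.
-/
lemma IsParseval.contMDiff_divergence (hX : IsParseval R X) {Y : R.tangent.Sec}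
    (hY : R.tangent.IsSmooth Y) : ContMDiff (𝓡 n) 𝓘(ℝ, ℝ) ∞ (divergence R Y) := by
  have hT := R.isGeometric_tangent
  have : divergence R Y = fun x => ∑ i, R.tangent.inner x (X i x)
      (app R.tangent R.tangent (grad R R.tangent Y x) (X i x)) :=
    funext fun x => trace_eq_sum_dual (hX.expand x) _
  rw [this]
  exact contMDiff_finsetSum fun i _ => hT.smooth_inner (hX.smooth i)
    ((hT.isSmooth_grad hY).app (hX.smooth i))

/-- The divergence theorem for vector fields `h Y` with support in a chart domain. -/
lemma IsParseval.integral_div_chart (hX : IsParseval R X) (x₀ : M) {Y : R.tangent.Sec} {h : M → ℝ}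
    (hY : R.tangent.IsSmooth Y) (hh : ContMDiff (𝓡 n) 𝓘(ℝ, ℝ) ∞ h) {K : Set M} (hK : IsCompact K)
    (hKs : K ⊆ (chartAt (EuclideanSpace ℝ (Fin n)) x₀).source) (hKh : ∀ x ∉ K, h x = 0) :
    ∫ x, (der R h x (Y x) + h x * divergence R Y x) ∂(R.vol) = 0 := by
  set e := extChartAt (𝓡 n) x₀ with he
  have hsrc : e.source = (chartAt (EuclideanSpace ℝ (Fin n)) x₀).source := extChartAt_source _ _
  have hcont : Continuous fun x => der R h x (Y x) + h x * divergence R Y x :=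
    ((contMDiff_der hh hY).add (hh.mul (hX.contMDiff_divergence hY))).continuous
  have hzero : ∀ x ∉ K, der R h x (Y x) + h x * divergence R Y x = 0 := by
    intro x hx
    have h1 : ∀ᶠ y in 𝓝 x, h y = 0 := by
      filter_upwards [hK.isClosed.isOpen_compl.mem_nhds hx] with y hy using hKh y hy
    rw [der_congr (R := R) h1, der_const, hKh x hx]
    ring
  rw [integral_eq_chart x₀ hcont fun x hx => hzero x fun h' => hx (hKs h')]
  let Fi : Fin n → M → ℝ := fun i y => h y * (coordMap R x₀ y (Y y) i * density R x₀ y)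
  have hFi : ∀ i, ContMDiffOn (𝓡 n) 𝓘(ℝ, ℝ) ∞ (Fi i) e.source := fun i => by
    rw [hsrc]
    exact (hh.contMDiffOn).mul ((contMDiffOn_coordMap x₀ hY i).mul (contMDiffOn_density R x₀))
  have htar : IsOpen e.target := isOpen_extChartAt_target x₀
  have hKc : IsCompact (e '' K) := hK.image_of_continuousOn
    ((continuousOn_extChartAt x₀).mono (hKs.trans hsrc.ge))
  have hKt : e '' K ⊆ e.target := by
    rintro _ ⟨x, hx, rfl⟩
    exact e.map_source (hsrc ▸ hKs hx)
  -- the components of `h Y` times the density, extended by zero outside the chart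
  let f : Fin n → EuclideanSpace ℝ (Fin n) → ℝ := fun i => e.target.indicator (Fi i ∘ e.symm)
  have hf0 : ∀ i, ∀ y ∉ e '' K, f i y = 0 := by
    intro i y hy
    by_cases hyt : y ∈ e.target
    · have : e.symm y ∉ K := fun h' => hy ⟨e.symm y, h', e.right_inv hyt⟩
      simp [f, hyt, Fi, hKh _ this]
    · exact Set.indicator_of_notMem hyt _
  have hft : ∀ i, ∀ y ∈ e.target, f i =ᶠ[𝓝 y] Fi i ∘ e.symm := by
    intro i y hy
    filter_upwards [htar.mem_nhds hy] with z hz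
    exact Set.indicator_of_mem hz _
  have hfs : ∀ i, ContDiff ℝ 1 (f i) := by
    intro i
    refine contDiff_iff_contDiffAt.2 fun y => ?_
    by_cases hy : y ∈ e '' K
    · have hyt := hKt hy
      have h1 : ContMDiffOn 𝓘(ℝ, EuclideanSpace ℝ (Fin n)) 𝓘(ℝ, ℝ) ∞ (Fi i ∘ e.symm) e.target :=
        (hFi i).comp (contMDiffOn_extChartAt_symm x₀) fun z hz => e.map_target hz
      have h2 : ContDiffAt ℝ ∞ (Fi i ∘ e.symm) y :=
        (contMDiffOn_iff_contDiffOn.1 h1).contDiffAt (htar.mem_nhds hyt)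
      exact (h2.of_le (by exact_mod_cast le_top)).congr_of_eventuallyEq (hft i y hyt)
    · have h0 : ContDiffAt ℝ 1 (fun _ : EuclideanSpace ℝ (Fin n) => (0 : ℝ)) y := contDiffAt_const
      refine h0.congr_of_eventuallyEq ?_
      filter_upwards [hKc.isClosed.isOpen_compl.mem_nhds hy] with z hz using hf0 i z hz
  have hfc : ∀ i, HasCompactSupport (f i) := fun i => HasCompactSupport.intro hKc (hf0 i)
  have hint : ∀ i, Integrable (fun y => fderiv ℝ (f i) y (EuclideanSpace.single i 1)) := fun i =>
    (((hfs i).continuous_fderiv one_ne_zero).clm_apply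
      continuous_const).integrable_of_hasCompactSupport ((hfc i).fderiv_apply ℝ _)
  -- the integrand in the chart is a sum of partial derivatives
  have hsum : ∀ y, e.target.indicator (fun y => density R x₀ (e.symm y) *
      (der R h (e.symm y) (Y (e.symm y)) + h (e.symm y) * divergence R Y (e.symm y))) y =
      ∑ i, fderiv ℝ (f i) y (EuclideanSpace.single i 1) := by
    intro y
    by_cases hy : y ∈ e.target
    · rw [Set.indicator_of_mem hy]
      have hx : e.symm y ∈ (chartAt (EuclideanSpace ℝ (Fin n)) x₀).source := hsrc ▸ e.map_target hy
      rw [← sum_der_coord hx hY hh]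
      refine Finset.sum_congr rfl fun i _ => ?_
      rw [der_coordField hx, (hft i y hy).fderiv_eq, ← he, e.right_inv hy]
      exact ((hFi i).contMDiffAt ((isOpen_extChartAt_source x₀).mem_nhds
        (e.map_target hy))).mdifferentiableAt (by simp)
    · rw [Set.indicator_of_notMem hy]
      refine (Finset.sum_eq_zero fun i _ => ?_).symm
      have : f i =ᶠ[𝓝 y] fun _ => 0 := by
        filter_upwards [hKc.isClosed.isOpen_compl.mem_nhds fun h' => hy (hKt h')] with z hz
        exact hf0 i z hz
      rw [this.fderiv_eq]
      simp
  rw [← integral_indicator htar.measurableSet]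
  refine (integral_congr_ae (.of_forall hsum)).trans ?_
  rw [integral_finsetSum _ fun i _ => hint i]
  exact Finset.sum_eq_zero fun i _ => integral_fderiv_eq_zero (hfs i) (hfc i) _

/-- The divergence theorem for compactly supported vector fields `h Y`. The function `h` is cut
into pieces supported in chart domains. -/
theorem IsParseval.integral_div (hX : IsParseval R X) {Y : R.tangent.Sec} {h : M → ℝ}
    (hY : R.tangent.IsSmooth Y) (hh : ContMDiff (𝓡 n) 𝓘(ℝ, ℝ) ∞ h) {K : Set M} (hK : IsCompact K)
    (hKh : ∀ x ∉ K, h x = 0) :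
    ∫ x, (der R h x (Y x) + h x * divergence R Y x) ∂(R.vol) = 0 := by
  classical
  have ψ : ∀ x : M, SmoothBumpFunction (𝓡 n) x := fun x => Classical.arbitrary _
  -- replacing `h` by `h ∏ (1 - ψ c)` changes the integral only by integrals of fields with
  -- support in charts
  have key : ∀ t : Finset M,
      ∫ x, (der R h x (Y x) + h x * divergence R Y x) ∂(R.vol) =
      ∫ x, (der R (fun x => h x * ∏ c ∈ t, (1 - ψ c x)) x (Y x) +
        (h x * ∏ c ∈ t, (1 - ψ c x)) * divergence R Y x) ∂(R.vol) := by
    intro t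
    have hp : ∀ t : Finset M, ContMDiff (𝓡 n) 𝓘(ℝ, ℝ) ∞ (fun x => h x * ∏ c ∈ t, (1 - ψ c x)) :=
      fun t => hh.mul (contMDiff_finsetProd fun c _ => contMDiff_const.sub (ψ c).contMDiff)
    have hint : ∀ {k : M → ℝ}, ContMDiff (𝓡 n) 𝓘(ℝ, ℝ) ∞ k → (∀ x ∉ K, k x = 0) →
        Integrable (fun x => der R k x (Y x) + k x * divergence R Y x) R.vol := by
      intro k hk hk0
      refine ((contMDiff_der hk hY).add
        (hk.mul (hX.contMDiff_divergence hY))).continuous.integrable_of_hasCompactSupport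
        (HasCompactSupport.intro hK fun x hx => ?_)
      have h1 : ∀ᶠ y in 𝓝 x, k y = 0 := by
        filter_upwards [hK.isClosed.isOpen_compl.mem_nhds hx] with y hy using hk0 y hy
      rw [Pi.add_apply, Pi.mul_apply, der_congr (R := R) h1, der_const, hk0 x hx]
      ring
    induction t using Finset.induction_on with
    | empty => simp
    | insert c t hc ih =>
      rw [ih]
      set k := fun x => h x * ∏ c ∈ t, (1 - ψ c x) with hk
      have hks : ContMDiff (𝓡 n) 𝓘(ℝ, ℝ) ∞ (fun x => k x * ψ c x) := (hp t).mul (ψ c).contMDiff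
      have hk0 : ∀ x ∉ K, k x = 0 := fun x hx => by simp [hk, hKh x hx]
      have h0 := hX.integral_div_chart c hY hks (ψ c).hasCompactSupport
        (ψ c).tsupport_subset_chartAt_source fun x hx => by
          rw [image_eq_zero_of_notMem_tsupport hx, mul_zero]
      have heq : (fun x => h x * ∏ c ∈ insert c t, (1 - ψ c x)) = fun x => k x + (-1) * (k x * ψ c x) := by
        funext x
        rw [Finset.prod_insert hc, hk]
        ring
      have hd : ∀ x, der R (fun x => k x + (-1) * (k x * ψ c x)) x (Y x) =
          der R k x (Y x) - der R (fun x => k x * ψ c x) x (Y x) := fun x => by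
        have hm : ContMDiff (𝓡 n) 𝓘(ℝ, ℝ) ∞ (fun x => (-1) * (k x * ψ c x)) :=
          contMDiff_const.mul hks
        rw [der_add (hp t) hm, der_mul contMDiff_const hks, der_const]
        ring
      have heq' : ∀ x, h x * ∏ c ∈ insert c t, (1 - ψ c x) = k x + (-1) * (k x * ψ c x) :=
        congrFun heq
      rw [heq]
      simp only [heq', hd]
      have : ∀ x, der R k x (Y x) - der R (fun x => k x * ψ c x) x (Y x) +
          (k x + -1 * (k x * ψ c x)) * divergence R Y x =
          (der R k x (Y x) + k x * divergence R Y x) -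
          (der R (fun x => k x * ψ c x) x (Y x) + (k x * ψ c x) * divergence R Y x) :=
        fun x => by ring
      simp only [this]
      rw [integral_sub (hint (hp t) hk0) (hint hks fun x hx => by simp [hk0 x hx]), h0, sub_zero]
  -- finitely many of the sets `{ψ c = 1}` cover `K`, and then the product vanishes there
  obtain ⟨t, -, ht⟩ := hK.elim_nhds_subcover (fun c => {x | ψ c x = 1})
    fun c _ => (ψ c).eventuallyEq_one
  have hz : (fun x => h x * ∏ c ∈ t, (1 - ψ c x)) = fun _ => 0 := by
    funext x
    by_cases hx : x ∈ K
    · obtain ⟨c, hc, hcx⟩ := Set.mem_iUnion₂.1 (ht hx)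
      rw [Finset.prod_eq_zero hc (by rw [show ψ c x = 1 from hcx, sub_self]), mul_zero]
    · rw [hKh x hx, zero_mul]
  have hz' : ∀ x, h x * ∏ c ∈ t, (1 - ψ c x) = 0 := congrFun hz
  rw [key t, hz]
  simp [hz', der_const]

end Integral

end

section

variable {n : ℕ} {M : Type*} [TopologicalSpace M] [ChartedSpace (EuclideanSpace ℝ (Fin n)) M]
  [IsManifold (𝓡 n) ∞ M] {R : RiemannianStructure n M} {A B : MetricBundle n M}
  {ι : Type*} [Fintype ι] {X : ι → R.tangent.Sec}

/-! ### Integration by parts for smooth sections -/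

section Pointwise

variable [T2Space M]

/-- The vector fields `⟨u, φ X_i⟩ X_i` have total divergence `⟨∇u, φ⟩ - ⟨u, ∇^*φ⟩`. -/
lemma IsParseval.sum_div_eq (hX : IsParseval R X) (hA : IsGeometric R A) {u : A.Sec}
    {φ : (Hom R.tangent A).Sec} (hu : A.IsSmooth u) (hφ : (Hom R.tangent A).IsSmooth φ) (x : M) :
    (Hom R.tangent A).inner x (grad R A u x) (φ x) - A.inner x (u x) (codiff R A φ x) =
      ∑ i, (der R (fun y => A.inner y (u y) (app R.tangent A (φ y) (X i y))) x (X i x) +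
        A.inner x (u x) (app R.tangent A (φ x) (X i x)) * divergence R (X i) x) := by
  have hT := R.isGeometric_tangent
  have hI := hA.isInner x
  have hφX := fun i => hφ.app (hX.smooth i)
  have h1 : ∀ i, der R (fun y => A.inner y (u y) (app R.tangent A (φ y) (X i y))) x (X i x) =
      A.inner x (dir R A u x (X i x)) (app R.tangent A (φ x) (X i x)) +
      (A.inner x (u x) (app R.tangent A (dir R (Hom R.tangent A) φ x (X i x)) (X i x)) +
        A.inner x (u x) (app R.tangent A (φ x) (dir R R.tangent (X i) x (X i x)))) := fun i => by
    rw [hA.der_inner hu (hφX i), hT.dir_app hA hφ (hX.smooth i), hI.add_right]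
  -- `∑ (∇_{X_i} X_i + div(X_i) X_i) = 0`, the divergence of the parallel tensor `∑ X_i ⊗ X_i`
  have h2 : ∑ i, (dir R R.tangent (X i) x (X i x) + divergence R (X i) x • X i x) = 0 := by
    have h3 : ∀ j, ∑ i, (R.tangent.inner x (X j x) (dir R R.tangent (X i) x (X j x)) • X i x +
        R.tangent.inner x (X j x) (X i x) • dir R R.tangent (X i) x (X j x)) = 0 := fun j => by
      have hi := hT.isInner x
      exact hT.sum_dual_dir hX.smooth hX.smooth (x := x) (.of_forall hX.expand) (X j x)
        (LinearMap.mk₂ ℝ (fun v w => R.tangent.inner x (X j x) v • w)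
          (fun v v' w => by rw [hi.add_right, add_smul])
          (fun c v w => by rw [hi.smul_right, mul_smul])
          (fun v w w' => smul_add _ _ _) (fun c v w => smul_comm _ _ _))
    have h4 : ∀ i, ∑ j, R.tangent.inner x (X j x) (X i x) • dir R R.tangent (X i) x (X j x) =
        dir R R.tangent (X i) x (X i x) := fun i => by
      conv_rhs => rw [← hX.expand x (X i x), map_sum]
      simp only [map_smul]
    have h5 : ∀ i, divergence R (X i) x • X i x =
        ∑ j, R.tangent.inner x (X j x) (dir R R.tangent (X i) x (X j x)) • X i x := fun i => by
      rw [divergence, trace_eq_sum_dual (hX.expand x), Finset.sum_smul]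
    simp only [h5]
    rw [Finset.sum_add_distrib, ← Finset.sum_congr rfl fun i _ => h4 i,
      Finset.sum_comm (f := fun i j => R.tangent.inner x (X j x) (X i x) •
        dir R R.tangent (X i) x (X j x)),
      Finset.sum_comm (f := fun i j => R.tangent.inner x (X j x)
        (dir R R.tangent (X i) x (X j x)) • X i x), ← Finset.sum_add_distrib]
    refine Finset.sum_eq_zero fun j _ => ?_
    rw [← Finset.sum_add_distrib, ← h3 j]
    exact Finset.sum_congr rfl fun i _ => add_comm _ _
  have h6 : ∑ i, (A.inner x (u x) (app R.tangent A (φ x) (dir R R.tangent (X i) x (X i x))) +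
      A.inner x (u x) (app R.tangent A (φ x) (X i x)) * divergence R (X i) x) = 0 := by
    have := congrArg (fun v => A.inner x (u x) (app R.tangent A (φ x) v)) h2
    simp only [map_sum, map_add, map_smul, hI.sum_right, hI.add_right, hI.smul_right, map_zero,
      hI.zero_right] at this
    rw [← this]
    exact Finset.sum_congr rfl fun i _ => by ring
  simp only [h1]
  rw [hT.inner_hom hA (hX.expand x), codiff_eq (hX.expand x), hI.neg_right, hI.sum_right,
    sub_neg_eq_add, ← add_zero (_ + _), ← h6, ← Finset.sum_add_distrib, ← Finset.sum_add_distrib]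
  refine Finset.sum_congr rfl fun i _ => ?_
  rw [app_grad]
  ring

omit [IsManifold (𝓡 n) ∞ M] [T2Space M] in
lemma IsTest.app {a : (Hom A B).Sec} {s : A.Sec} (ha : (Hom A B).IsSmooth a) (hs : A.IsTest s) :
    B.IsTest (fun x => app A B (a x) (s x)) := by
  obtain ⟨h, K, hK, hK'⟩ := hs
  exact ⟨ha.app h, K, hK, fun x hx => (congrArg _ (hK' x hx)).trans (map_zero _)⟩

lemma IsTest.grad (hA : IsGeometric R A) {s : A.Sec} (hs : A.IsTest s) :
    (Hom R.tangent A).IsTest (grad R A s) := by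
  obtain ⟨h, K, hK, hK'⟩ := hs
  refine ⟨hA.isSmooth_grad h, K, hK, fun x hx => ?_⟩
  have h1 : ∀ᶠ y in 𝓝 x, s y = 0 := by
    filter_upwards [hK.isClosed.isOpen_compl.mem_nhds hx] with y hy using hK' y hy
  rw [hA.cov_congr (t := fun _ => 0) (isSmooth_zero A) h1]
  exact congrFun hA.grad_zero x

lemma IsTest.codiff (hX : IsParseval R X) (hA : IsGeometric R A) {φ : (Hom R.tangent A).Sec}
    (hφ : (Hom R.tangent A).IsTest φ) : A.IsTest (codiff R A φ) := by
  obtain ⟨h, K, hK, hK'⟩ := hφ.grad (R.isGeometric_tangent.hom hA)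
  refine ⟨hA.isSmooth_codiff hX hφ.1, K, hK, fun x hx => ?_⟩
  rw [codiff_eq (hX.expand x)]
  have h0 : ∀ v, dir R (Hom R.tangent A) φ x v = 0 := fun v => by
    rw [← app_grad, hK' x hx]; simp
  simp [h0]

lemma IsTest.nabla (hA : IsGeometric R A) {u : A.Sec} (hu : A.IsTest u) :
    ∀ k, (A.tens R k).IsTest (A.nabla R k u)
  | 0 => hu
  | k + 1 => (IsTest.nabla hA hu k).grad (R.isGeometric_tangent.tens hA k)

lemma IsTest.nablaStar (hX : IsParseval R X) (hA : IsGeometric R A) :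
    ∀ {k : ℕ} {φ : (A.tens R k).Sec}, (A.tens R k).IsTest φ → A.IsTest (A.nablaStar R k φ)
  | 0, _, hφ => hφ
  | k + 1, _, hφ => IsTest.nablaStar (k := k) hX hA
      (IsTest.codiff hX (R.isGeometric_tangent.tens hA k) hφ)

end Pointwise

section Integral

variable [T2Space M] [MeasurableSpace M] [BorelSpace M] [SecondCountableTopology M]

lemma IsGeometric.integrable_inner (hA : IsGeometric R A) {s t : A.Sec} (hs : A.IsSmooth s)
    (ht : A.IsTest t) : Integrable (fun x => A.inner x (s x) (t x)) R.vol := by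
  obtain ⟨h, K, hK, hK'⟩ := ht
  refine (hA.smooth_inner hs h).continuous.integrable_of_hasCompactSupport
    (HasCompactSupport.intro hK fun x hx => ?_)
  rw [hK' x hx, (hA.isInner x).zero_right]

/-- Green's formula. -/
theorem IsParseval.integral_inner_grad (hX : IsParseval R X) (hA : IsGeometric R A) {u : A.Sec}
    {φ : (Hom R.tangent A).Sec} (hu : A.IsSmooth u) (hφ : (Hom R.tangent A).IsTest φ) :
    ∫ x, (Hom R.tangent A).inner x (grad R A u x) (φ x) ∂(R.vol) =
      ∫ x, A.inner x (u x) (codiff R A φ x) ∂(R.vol) := by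
  have hT := R.isGeometric_tangent
  have hφX := fun i => hφ.1.app (hX.smooth i)
  have hs := fun i => hA.smooth_inner hu (hφX i)
  obtain ⟨K, hK, hK'⟩ := hφ.2
  have h0 : ∀ i, ∀ x ∉ K, A.inner x (u x) (app R.tangent A (φ x) (X i x)) = 0 := fun i x hx => by
    rw [hK' x hx, map_zero, LinearMap.zero_apply, (hA.isInner x).zero_right]
  rw [← sub_eq_zero, ← integral_sub ((hT.hom hA).integrable_inner (hA.isSmooth_grad hu) hφ)
    (hA.integrable_inner hu (IsTest.codiff hX hA hφ))]
  simp only [hX.sum_div_eq hA hu hφ.1]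
  rw [integral_finsetSum]
  · exact Finset.sum_eq_zero fun i _ => hX.integral_div (hX.smooth i) (hs i) hK (h0 i)
  · intro i _
    refine ((contMDiff_der (hs i) (hX.smooth i)).add ((hs i).mul
      (hX.contMDiff_divergence (hX.smooth i)))).continuous.integrable_of_hasCompactSupport
      (HasCompactSupport.intro hK fun x hx => ?_)
    have h1 : ∀ᶠ y in 𝓝 x, A.inner y (u y) (app R.tangent A (φ y) (X i y)) = 0 := by
      filter_upwards [hK.isClosed.isOpen_compl.mem_nhds hx] with y hy using h0 i y hy
    rw [Pi.add_apply, Pi.mul_apply, der_congr (R := R) h1, der_const, h0 i x hx]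
    ring

/-- Integration by parts: `(∇^k)^*` is the formal adjoint of `∇^k`. -/
theorem IsParseval.integral_inner_nabla (hX : IsParseval R X) (hA : IsGeometric R A) {u : A.Sec}
    (hu : A.IsSmooth u) : ∀ {k : ℕ} {φ : (A.tens R k).Sec}, (A.tens R k).IsTest φ →
    ∫ x, (A.tens R k).inner x (A.nabla R k u x) (φ x) ∂(R.vol) =
      ∫ x, A.inner x (u x) (A.nablaStar R k φ x) ∂(R.vol)
  | 0, _, _ => rfl
  | k + 1, φ, hφ => by
    have hk := R.isGeometric_tangent.tens hA k
    have h1 := hX.integral_inner_grad hk (hA.isSmooth_nabla hu k) hφ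
    exact h1.trans (hX.integral_inner_nabla hA hu (IsTest.codiff hX hk hφ))

end Integral

end

section

variable {n : ℕ} {M : Type*} [TopologicalSpace M] [ChartedSpace (EuclideanSpace ℝ (Fin n)) M]
  [IsManifold (𝓡 n) ∞ M] [T2Space M] [MeasurableSpace M] [BorelSpace M]
  [SecondCountableTopology M] {R : RiemannianStructure n M} {A B D : MetricBundle n M}

/-! ### Measurable and locally integrable sections -/

omit [T2Space M] [IsManifold (𝓡 n) ∞ M] [ChartedSpace (EuclideanSpace ℝ (Fin n)) M] in
/-- Measurability can be checked locally. -/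
lemma aestronglyMeasurable_of_locally {E : Type*} [TopologicalSpace E]
    [TopologicalSpace.PseudoMetrizableSpace E] {μ : Measure M} {f : M → E} {S : Set M}
    (h : ∀ x ∈ S, ∃ U ∈ 𝓝 x, ∃ f', AEStronglyMeasurable f' (μ.restrict U) ∧ ∀ y ∈ U, f y = f' y) :
    AEStronglyMeasurable f (μ.restrict S) := by
  have h1 : ∀ x, ∃ U ∈ 𝓝[S] x, x ∈ S → AEStronglyMeasurable f (μ.restrict U) := by
    intro x
    by_cases hx : x ∈ S
    · obtain ⟨U, hU, f', hf', hff'⟩ := h x hx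
      refine ⟨interior U, mem_nhdsWithin_of_mem_nhds (interior_mem_nhds.2 hU), fun _ => ?_⟩
      refine (hf'.mono_set interior_subset).congr ?_
      filter_upwards [ae_restrict_mem isOpen_interior.measurableSet] with y hy
      exact (hff' y (interior_subset hy)).symm
    · exact ⟨Set.univ, Filter.univ_mem, fun hx' => absurd hx' hx⟩
  choose U hU hU' using h1
  obtain ⟨t, hts, htc, ht⟩ := TopologicalSpace.countable_cover_nhdsWithin fun x (_ : x ∈ S) => hU x
  refine AEStronglyMeasurable.mono_set ht ?_
  have : Countable t := htc.to_subtype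
  rw [Set.biUnion_eq_iUnion, aestronglyMeasurable_iUnion_iff]
  exact fun x => hU' x (hts x.2)

/-- A section is measurable if and only if its inner products with smooth sections are. -/
lemma IsGeometric.isMeas_iff (hA : IsGeometric R A) {s : A.Sec} : A.IsMeas R s ↔
    ∀ t, A.IsSmooth t → AEStronglyMeasurable (fun x => A.inner x (t x) (s x)) R.vol := by
  constructor
  · intro hs t ht
    rw [← Measure.restrict_univ (μ := R.vol)]
    refine aestronglyMeasurable_of_locally fun x₀ _ => ?_
    obtain ⟨e, he, he'⟩ := A.exists_frame x₀
    have hb := (trivializationAt A.Model A.Fib x₀).open_baseSet.mem_nhds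
      (FiberBundle.mem_baseSet_trivializationAt' (F := A.Model) (E := A.Fib) x₀)
    refine ⟨_, Filter.inter_mem he' hb, fun y => ∑ i, (Module.finBasis ℝ A.Model).coord i
      (trivializationAt A.Model A.Fib x₀ ⟨y, s y⟩).2 * A.inner y (t y) (e i y), ?_, ?_⟩
    · refine Finset.aestronglyMeasurable_fun_sum _ fun i _ => ?_
      refine AEStronglyMeasurable.mul ?_ (hA.smooth_inner ht (he i)).continuous.aestronglyMeasurable
      exact (LinearMap.continuous_of_finiteDimensional _).comp_aestronglyMeasurable
        ((hs x₀).mono_set Set.inter_subset_right)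
    · rintro y ⟨hy, hyb⟩
      -- in the frame of the trivialization, the coefficients of `s` are its coordinates
      have h1 : s y = ∑ i, (Module.finBasis ℝ A.Model).coord i
          (trivializationAt A.Model A.Fib x₀ ⟨y, s y⟩).2 • e i y := by
        have hy' : ∀ i, e i y = A.frame x₀ i y := hy
        have h2 : (trivializationAt A.Model A.Fib x₀ ⟨y, s y⟩).2 =
            (trivializationAt A.Model A.Fib x₀).continuousLinearMapAt ℝ y (s y) :=
          (congrFun (Trivialization.coe_linearMapAt_of_mem (R := ℝ) _ hyb) (s y)).symm
        have h3 := (trivializationAt A.Model A.Fib x₀).symmL_continuousLinearMapAt (R := ℝ) hyb (s y)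
        rw [← h2] at h3
        conv_lhs => rw [← h3, ← (Module.finBasis ℝ A.Model).sum_repr
          (trivializationAt A.Model A.Fib x₀ ⟨y, s y⟩).2, map_sum]
        refine Finset.sum_congr rfl fun i _ => ?_
        rw [map_smul, Trivialization.symmL_apply (R := ℝ) _ hyb, hy', frame]
        rfl
      conv_lhs => rw [h1, (hA.isInner y).sum_right]
      exact Finset.sum_congr rfl fun i _ => (hA.isInner y).smul_right _ _ _
  · intro hs x₀
    refine aestronglyMeasurable_of_locally fun x hx => ?_
    -- conversely `s = ∑ ⟨σ i, s⟩ τ i` near `x`, with measurable coefficients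
    obtain ⟨σ, τ, hσ, hτ, hd⟩ := hA.exists_dual x
    have hb := (trivializationAt A.Model A.Fib x₀).open_baseSet.mem_nhds hx
    refine ⟨_, Filter.inter_mem hd hb, fun y => ∑ i, A.inner y (σ i y) (s y) •
      (trivializationAt A.Model A.Fib x₀ ⟨y, τ i y⟩).2, ?_, ?_⟩
    · refine Finset.aestronglyMeasurable_fun_sum _ fun i _ => ?_
      refine AEStronglyMeasurable.smul (hs _ (hσ i)).restrict (AEStronglyMeasurable.mono_set
        Set.inter_subset_right ?_)
      refine ContinuousOn.aestronglyMeasurable ?_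
        (trivializationAt A.Model A.Fib x₀).open_baseSet.measurableSet
      exact (((trivializationAt A.Model A.Fib x₀).contMDiffOn_section_baseSet_iff).1
        (ContMDiff.contMDiffOn (hτ i))).continuousOn
    · rintro y ⟨hy, hyb⟩
      have h2 : ∀ ξ : A.Fib y, (trivializationAt A.Model A.Fib x₀ ⟨y, ξ⟩).2 =
          (trivializationAt A.Model A.Fib x₀).continuousLinearMapAt ℝ y ξ := fun ξ =>
        (congrFun (Trivialization.coe_linearMapAt_of_mem (R := ℝ) _ hyb) ξ).symm
      simp only [h2]
      have hy' : ∀ v, ∑ i, A.inner y (σ i y) v • τ i y = v := hy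
      conv_lhs => rw [← hy' (s y), map_sum]
      exact Finset.sum_congr rfl fun i _ => map_smul _ _ _

/-- Functions on `M` that are linear in a measurable section are measurable. -/
lemma IsGeometric.aestronglyMeasurable_of_linear (hA : IsGeometric R A) {s : A.Sec}
    (hs : A.IsMeas R s) (ℓ : ∀ x, A.Fib x →ₗ[ℝ] ℝ)
    (hℓ : ∀ t, A.IsSmooth t → AEStronglyMeasurable (fun x => ℓ x (t x)) R.vol) :
    AEStronglyMeasurable (fun x => ℓ x (s x)) R.vol := by
  rw [← Measure.restrict_univ (μ := R.vol)]
  refine aestronglyMeasurable_of_locally fun x _ => ?_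
  obtain ⟨σ, τ, hσ, hτ, hd⟩ := hA.exists_dual x
  refine ⟨_, hd, fun y => ∑ i, A.inner y (σ i y) (s y) * ℓ y (τ i y), ?_, ?_⟩
  · exact Finset.aestronglyMeasurable_fun_sum _ fun i _ =>
      ((hA.isMeas_iff.1 hs _ (hσ i)).mul (hℓ _ (hτ i))).restrict
  · intro y hy
    have hy' : ∀ v, ∑ i, A.inner y (σ i y) v • τ i y = v := hy
    conv_lhs => rw [← hy' (s y), map_sum]
    exact Finset.sum_congr rfl fun i _ => map_smul _ _ _

lemma IsGeometric.aestronglyMeasurable_inner (hA : IsGeometric R A) {s t : A.Sec}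
    (hs : A.IsMeas R s) (ht : A.IsMeas R t) :
    AEStronglyMeasurable (fun x => A.inner x (s x) (t x)) R.vol := by
  have hI := fun x => hA.isInner x
  refine hA.aestronglyMeasurable_of_linear ht (fun x =>
    { toFun := fun v => A.inner x (s x) v
      map_add' := fun v w => (hI x).add_right _ _ _
      map_smul' := fun c v => (hI x).smul_right _ _ _ }) fun t' ht' => ?_
  simp only [LinearMap.coe_mk, AddHom.coe_mk, (hI _).symm (s _)]
  exact hA.isMeas_iff.1 hs t' ht'

lemma IsGeometric.aestronglyMeasurable_norm (hA : IsGeometric R A) {s : A.Sec}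
    (hs : A.IsMeas R s) : AEStronglyMeasurable (fun x => A.norm x (s x)) R.vol :=
  Real.continuous_sqrt.comp_aestronglyMeasurable (hA.aestronglyMeasurable_inner hs hs)

namespace IsMeas

lemma of_smooth (hA : IsGeometric R A) {s : A.Sec} (hs : A.IsSmooth s) : A.IsMeas R s :=
  hA.isMeas_iff.2 fun _ ht => (hA.smooth_inner ht hs).continuous.aestronglyMeasurable

lemma add (hA : IsGeometric R A) {s t : A.Sec} (hs : A.IsMeas R s) (ht : A.IsMeas R t) :
    A.IsMeas R (fun x => s x + t x) := by
  rw [hA.isMeas_iff] at hs ht ⊢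
  intro r hr
  simp only [(hA.isInner _).add_right]
  exact (hs r hr).add (ht r hr)

lemma smul (hA : IsGeometric R A) {f : M → ℝ} {s : A.Sec} (hf : AEStronglyMeasurable f R.vol)
    (hs : A.IsMeas R s) : A.IsMeas R (fun x => f x • s x) := by
  rw [hA.isMeas_iff] at hs ⊢
  intro r hr
  simp only [(hA.isInner _).smul_right]
  exact hf.mul (hs r hr)

lemma congr_ae (hA : IsGeometric R A) {s t : A.Sec} (hs : A.IsMeas R s)
    (h : ∀ᵐ x ∂(R.vol), s x = t x) : A.IsMeas R t := by
  rw [hA.isMeas_iff] at hs ⊢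
  intro r hr
  refine (hs r hr).congr ?_
  filter_upwards [h] with x hx
  rw [hx]

lemma map (hA : IsGeometric R A) (hB : IsGeometric R B) {L : ∀ x, A.Fib x →ₗ[ℝ] B.Fib x}
    (hL : ∀ t, A.IsSmooth t → B.IsSmooth (fun x => L x (t x))) {s : A.Sec} (hs : A.IsMeas R s) :
    B.IsMeas R (fun x => L x (s x)) := by
  rw [hB.isMeas_iff]
  intro r hr
  have hI := fun x => hB.isInner x
  exact hA.aestronglyMeasurable_of_linear hs (fun x =>
    { toFun := fun v => B.inner x (r x) (L x v)
      map_add' := fun v w => by rw [map_add, (hI x).add_right]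
      map_smul' := fun c v => by rw [map_smul, (hI x).smul_right]; rfl }) fun t' ht' =>
        (hB.smooth_inner hr (hL t' ht')).continuous.aestronglyMeasurable

end IsMeas

omit [T2Space M] [MeasurableSpace M] [BorelSpace M] [SecondCountableTopology M] in
lemma IsGeometric.continuous_norm (hA : IsGeometric R A) {s : A.Sec} (hs : A.IsSmooth s) :
    Continuous (fun x => A.norm x (s x)) :=
  (hA.smooth_inner hs hs).continuous.sqrt

namespace IsLocL1

lemma of_smooth (hA : IsGeometric R A) {s : A.Sec} (hs : A.IsSmooth s) : A.IsLocL1 R s :=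
  ⟨.of_smooth hA hs, (hA.continuous_norm hs).locallyIntegrable⟩

lemma mono (hA : IsGeometric R A) {s : A.Sec} (hs : A.IsMeas R s) {g : M → ℝ}
    (hg : LocallyIntegrable g R.vol) (h : ∀ᵐ x ∂(R.vol), A.norm x (s x) ≤ g x) : A.IsLocL1 R s := by
  refine ⟨hs, hg.mono (hA.aestronglyMeasurable_norm hs) ?_⟩
  filter_upwards [h] with x hx
  rw [Real.norm_of_nonneg (r := A.norm x (s x)) (Real.sqrt_nonneg _)]
  exact hx.trans (le_abs_self _)

lemma add (hA : IsGeometric R A) {s t : A.Sec} (hs : A.IsLocL1 R s) (ht : A.IsLocL1 R t) :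
    A.IsLocL1 R (fun x => s x + t x) :=
  mono hA (hs.1.add hA ht.1) (hs.2.add ht.2) (.of_forall fun x => hA.norm_add_le x _ _)

lemma continuous_mul {g f : M → ℝ} (hg : Continuous g) (hf : LocallyIntegrable f R.vol) :
    LocallyIntegrable (fun x => g x * f x) R.vol := by
  have := ChartedSpace.locallyCompactSpace (EuclideanSpace ℝ (Fin n)) M
  rw [← locallyIntegrableOn_univ] at hf ⊢
  exact hf.continuousOn_mul hg.continuousOn isClosed_univ.isLocallyClosed

lemma smul (hA : IsGeometric R A) {f : M → ℝ} (hf : Continuous f) {s : A.Sec}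
    (hs : A.IsLocL1 R s) : A.IsLocL1 R (fun x => f x • s x) :=
  mono hA (hs.1.smul hA hf.aestronglyMeasurable) (continuous_mul hf.abs hs.2)
    (.of_forall fun x => (hA.norm_smul x _ _).le)

lemma app (hA : IsGeometric R A) (hB : IsGeometric R B) {a : (Hom A B).Sec}
    (ha : (Hom A B).IsSmooth a) {s : A.Sec} (hs : A.IsLocL1 R s) :
    B.IsLocL1 R (fun x => MetricBundle.app A B (a x) (s x)) :=
  mono hB (hs.1.map hA hB (L := fun x => MetricBundle.app A B (a x)) fun _ ht => ha.app ht)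
    (continuous_mul ((hA.hom hB).continuous_norm ha) hs.2)
    (.of_forall fun _ => hA.norm_app_le hB _ _)

lemma integrable_inner (hA : IsGeometric R A) {s t : A.Sec} (hs : A.IsLocL1 R s)
    (ht : A.IsTest t) : Integrable (fun x => A.inner x (s x) (t x)) R.vol := by
  obtain ⟨hts, K, hK, hK'⟩ := ht
  have h1 := (continuous_mul (hA.continuous_norm hts) hs.2).integrableOn_isCompact hK
  have h0 : ∀ x ∉ K, A.inner x (s x) (t x) = 0 := fun x hx => by
    rw [hK' x hx, (hA.isInner x).zero_right]
  rw [← integrableOn_iff_integrable_of_support_subset (s := K)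
    (fun _ hx => by_contra fun h => hx (h0 _ h))]
  refine Integrable.mono h1 (hA.aestronglyMeasurable_inner hs.1 (.of_smooth hA hts)).restrict
    (.of_forall fun x => ?_)
  rw [Real.norm_eq_abs, mul_comm]
  exact (hA.abs_inner_le x _ _).trans (le_abs_self _)

end IsLocL1

/-- The fundamental lemma of the calculus of variations, for sections. -/
lemma IsGeometric.ae_eq_zero_of_test (hA : IsGeometric R A) {s : A.Sec} (hs : A.IsLocL1 R s)
    (h : ∀ φ, A.IsTest φ → ∫ x, A.inner x (s x) (φ x) ∂(R.vol) = 0) : ∀ᵐ x ∂(R.vol), s x = 0 := by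
  -- testing with `g • t` reduces the claim to the scalar function `⟨t, s⟩`
  have h1 : ∀ t, A.IsSmooth t → ∀ᵐ x ∂(R.vol), A.inner x (t x) (s x) = 0 := by
    intro t ht
    have hloc : LocallyIntegrable (fun x => A.inner x (t x) (s x)) R.vol := by
      refine (IsLocL1.continuous_mul (hA.continuous_norm ht) hs.2).mono
        (hA.isMeas_iff.1 hs.1 t ht) (.of_forall fun x => ?_)
      rw [Real.norm_eq_abs]
      exact (hA.abs_inner_le x _ _).trans (le_abs_self _)
    have := ChartedSpace.locallyCompactSpace (EuclideanSpace ℝ (Fin n)) M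
    refine ae_eq_zero_of_integral_contMDiff_smul_eq_zero (𝓡 n) hloc fun g hg hgc => ?_
    rw [← h (fun x => g x • t x) ⟨IsSmooth.smul hg ht, tsupport g, hgc, fun x hx => by
      change g x • t x = 0
      rw [image_eq_zero_of_notMem_tsupport hx, zero_smul]⟩]
    refine integral_congr_ae (.of_forall fun x => ?_)
    simp only [(hA.isInner x).smul_right, smul_eq_mul, (hA.isInner x).symm (s x)]
  -- locally a section vanishes where its inner products with a frame vanish
  rw [ae_iff]
  refine measure_null_of_locally_null _ fun x _ => ?_
  obtain ⟨σ, τ, hσ, hτ, hd⟩ := hA.exists_dual x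
  refine ⟨_, Filter.inter_mem self_mem_nhdsWithin (mem_nhdsWithin_of_mem_nhds hd), ?_⟩
  have h2 : ∀ᵐ x ∂(R.vol), ∀ i, A.inner x (σ i x) (s x) = 0 := ae_all_iff.2 fun i => h1 _ (hσ i)
  refine measure_mono_null ?_ (ae_iff.1 h2)
  rintro y ⟨hy, hyd⟩ hy0
  have hy' : ∀ v, ∑ i, A.inner y (σ i y) v • τ i y = v := hyd
  refine hy ?_
  rw [← hy' (s y)]
  exact Finset.sum_eq_zero fun i _ => by rw [hy0 i, zero_smul]

end

section

variable {n : ℕ} {M : Type*} [TopologicalSpace M] [ChartedSpace (EuclideanSpace ℝ (Fin n)) M]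
  [IsManifold (𝓡 n) ∞ M] [T2Space M] {R : RiemannianStructure n M} {A B D : MetricBundle n M}
  {ι : Type*} [Fintype ι] {X : ι → R.tangent.Sec}

open IsGeometric

/-! ### Adjoints of homomorphisms -/

omit [T2Space M] in
lemma inner_adjoint (hA : IsGeometric R A) (hB : IsGeometric R B) (a : (Hom A B).Sec) (s : B.Sec)
    (x : M) (ξ : A.Fib x) :
    A.inner x ξ (adjoint A B a s x) = B.inner x (app A B (a x) ξ) (s x) := by
  have hI := hA.isInner x
  obtain ⟨o, -, ho⟩ := hA.exists_orthonormal x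
  have h : adjoint A B a s x = ∑ i, B.inner x (app A B (a x) (o i)) (s x) • o i := by
    refine Eq.trans ?_ (hA.sum_gramInv_eq ho
      (LinearMap.mk₂ ℝ (fun v w => B.inner x (app A B (a x) v) (s x) • w)
        (fun v v' w => by rw [map_add, (hB.isInner x).add_left, add_smul])
        (fun c v w => by rw [map_smul, (hB.isInner x).smul_left]; exact mul_smul _ _ _)
        (fun v w w' => smul_add _ _ _) (fun c v w => smul_comm _ _ _)))
    exact Finset.sum_congr rfl fun i _ => Finset.sum_congr rfl fun j _ => mul_smul _ _ _
  conv_rhs => rw [← ho ξ, map_sum, (hB.isInner x).sum_left]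
  rw [h, hI.sum_right]
  refine Finset.sum_congr rfl fun i _ => ?_
  rw [hI.smul_right, map_smul, (hB.isInner x).smul_left, hI.symm ξ, mul_comm]

lemma isSmooth_adjoint (hA : IsGeometric R A) (hB : IsGeometric R B) {a : (Hom A B).Sec} {s : B.Sec}
    (ha : (Hom A B).IsSmooth a) (hs : B.IsSmooth s) : A.IsSmooth (adjoint A B a s) :=
  hA.isSmooth_of_inner fun t ht => by
    simp only [inner_adjoint hA hB]
    exact hB.smooth_inner (ha.app ht) hs

omit [T2Space M] in
/-- The adjoint of a homomorphism at a point, as a linear map. -/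
lemma exists_adjoint (hA : IsGeometric R A) (hB : IsGeometric R B) {x : M} (a : (Hom A B).Fib x) :
    ∃ L : B.Fib x →ₗ[ℝ] A.Fib x, ∀ ξ η, A.inner x ξ (L η) = B.inner x (app A B a ξ) η := by
  have hI := hA.isInner x
  have hJ := hB.isInner x
  obtain ⟨o, -, ho⟩ := hA.exists_orthonormal x
  refine ⟨∑ i, LinearMap.smulRight
    { toFun := fun η => B.inner x (app A B a (o i)) η
      map_add' := hJ.add_right _
      map_smul' := fun c η => hJ.smul_right _ _ _ } (o i), fun ξ η => ?_⟩
  conv_rhs => rw [← ho ξ, map_sum, hJ.sum_left]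
  rw [LinearMap.sum_apply, hI.sum_right]
  refine Finset.sum_congr rfl fun i _ => ?_
  rw [LinearMap.smulRight_apply, hI.smul_right, map_smul, hJ.smul_left, hI.symm ξ, mul_comm]
  rfl

/-- The derivative of the coefficient `a` in the product rule for `∇(a ξ)`, in weak form. -/
lemma IsParseval.inner_grad_app (hX : IsParseval R X) (hA : IsGeometric R A) (hB : IsGeometric R B)
    {a : (Hom A B).Sec} (ha : (Hom A B).IsSmooth a) {φ : (Hom R.tangent B).Sec}
    (hφ : (Hom R.tangent B).IsSmooth φ) {ψ : (Hom R.tangent A).Sec}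
    (hψ : (Hom R.tangent A).IsSmooth ψ)
    (h : ∀ x v (ξ : A.Fib x), A.inner x ξ (app R.tangent A (ψ x) v) =
      B.inner x (app A B (a x) ξ) (app R.tangent B (φ x) v)) (x : M) (ξ : A.Fib x) :
    (Hom R.tangent B).inner x (bilinLeft R.tangent (fun _ => app A B) x
      (grad R (Hom A B) a x) ξ) (φ x) =
      B.inner x (app A B (a x) ξ) (codiff R B φ x) - A.inner x ξ (codiff R A ψ x) := by
  have hT := R.isGeometric_tangent
  obtain ⟨u, hu, rfl⟩ := hA.exists_extend x ξ
  have h1 := hX.sum_div_eq hA hu hψ x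
  have h2 := hX.sum_div_eq hB (ha.app hu) hφ x
  simp only [h] at h1
  rw [← h2, hT.inner_hom hA (hX.expand x), hT.inner_hom hB (hX.expand x)] at h1
  simp only [h, app_grad, hA.dir_app hB ha hu, (hB.isInner x).add_left] at h1
  rw [Finset.sum_add_distrib] at h1
  rw [hT.inner_hom hB (hX.expand x)]
  simp only [app_bilinLeft, app_grad]
  linarith

/-! ### Weak covariant derivatives -/

/-- Evaluation `Hom(A, B) × A → B` is parallel; this is the product rule for the induced
connection. -/
lemma isParallelBilin_app (hA : IsGeometric R A) (hB : IsGeometric R B) :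
    IsParallelBilin R (Hom A B) A B (fun _ => app A B) where
  smooth ha hs := ha.app hs
  dir ha hs x v := hA.dir_app hB ha hs x v
  bound := ⟨1, zero_le_one, fun x a ξ => by rw [one_mul]; exact hA.norm_app_le hB a ξ⟩

section Weak

variable [MeasurableSpace M] [BorelSpace M] [SecondCountableTopology M]

/-- `∇u = v` in the sense of distributions, for locally integrable `u` and `v`. -/
structure IsWeakGrad (R : RiemannianStructure n M) (A : MetricBundle n M) (u : A.Sec)
    (v : (Hom R.tangent A).Sec) : Prop where
  left : A.IsLocL1 R u
  right : (Hom R.tangent A).IsLocL1 R v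
  eq : ∀ φ, (Hom R.tangent A).IsTest φ →
    ∫ x, (Hom R.tangent A).inner x (v x) (φ x) ∂(R.vol) =
      ∫ x, A.inner x (u x) (codiff R A φ x) ∂(R.vol)

lemma IsLocL1.linear (hA : IsGeometric R A) (hB : IsGeometric R B)
    {L : ∀ x, A.Fib x →ₗ[ℝ] B.Fib x} (hL : ∀ s, A.IsSmooth s → B.IsSmooth (fun x => L x (s x)))
    {u : A.Sec} (hu : A.IsLocL1 R u) : B.IsLocL1 R (fun x => L x (u x)) :=
  IsLocL1.app hA hB (a := fun x => ofLin A B (L x)) (isSmooth_hom hL) hu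

/-- The product rule for weak derivatives. -/
lemma IsWeakGrad.app (hX : IsParseval R X) (hA : IsGeometric R A) (hB : IsGeometric R B)
    {a : (Hom A B).Sec} (ha : (Hom A B).IsSmooth a) {u : A.Sec} {v : (Hom R.tangent A).Sec}
    (h : IsWeakGrad R A u v) :
    IsWeakGrad R B (fun x => MetricBundle.app A B (a x) (u x))
      (fun x => bilinLeft R.tangent (fun _ => MetricBundle.app A B) x (grad R (Hom A B) a x) (u x) +
        bilinRight R.tangent (fun _ => MetricBundle.app A B) x (a x) (v x)) := by
  have hT := R.isGeometric_tangent
  have hTB := hT.hom hB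
  have hμ := isParallelBilin_app hA hB
  have h1 := IsLocL1.linear hA hTB (L := fun x => bilinLeft R.tangent
    (fun _ => MetricBundle.app A B) x (grad R (Hom A B) a x))
    (fun s hs => (hμ.left hT (hA.hom hB) hB).smooth ((hA.hom hB).isSmooth_grad ha) hs) h.left
  have h2 := IsLocL1.linear (hT.hom hA) hTB (L := fun x => bilinRight R.tangent
    (fun _ => MetricBundle.app A B) x (a x))
    (fun s hs => (hμ.right hT hA hB).smooth ha hs) h.right
  have h3 := h.left.app hA hB ha
  refine ⟨h3, h1.add hTB h2, fun φ hφ => ?_⟩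
  -- `ψ = a^* ∘ φ` is the test section that corresponds to `φ`
  choose L hL using fun x => exists_adjoint hA hB (a x)
  let ψ : (Hom R.tangent A).Sec := fun x => ofLin R.tangent A (L x ∘ₗ MetricBundle.app R.tangent B (φ x))
  have hψ' : ∀ x v (ξ : A.Fib x), A.inner x ξ (MetricBundle.app R.tangent A (ψ x) v) =
      B.inner x (MetricBundle.app A B (a x) ξ) (MetricBundle.app R.tangent B (φ x) v) :=
    fun x v ξ => hL x ξ _
  have hψ : (Hom R.tangent A).IsTest ψ := by
    refine ⟨isSmooth_hom fun Y hY => hA.isSmooth_of_inner fun t ht => ?_, ?_⟩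
    · simp only [hψ']
      exact hB.smooth_inner (ha.app ht) (hφ.1.app hY)
    · obtain ⟨K, hK, hK'⟩ := hφ.2
      refine ⟨K, hK, fun x hx => hom_ext _ _ fun v => (hA.isInner x).ext fun ξ => ?_⟩
      rw [hψ', hK' x hx]
      simp [(hB.isInner x).zero_right, (hA.isInner x).zero_right]
  have e1 : ∀ x, (Hom R.tangent B).inner x (bilinRight R.tangent (fun _ => MetricBundle.app A B) x
      (a x) (v x)) (φ x) = (Hom R.tangent A).inner x (v x) (ψ x) := fun x => by
    rw [hT.inner_hom hA (hX.expand x), hT.inner_hom hB (hX.expand x)]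
    exact Finset.sum_congr rfl fun i _ => by rw [app_bilinRight, hψ']
  have i1 := h3.integrable_inner hB (IsTest.codiff hX hB hφ)
  have i2 := h.left.integrable_inner hA (IsTest.codiff hX hA hψ)
  have i3 := h.right.integrable_inner (hT.hom hA) hψ
  have e2 := integral_add (i1.sub i2) i3
  have e3 := integral_sub i1 i2
  have e4 := h.eq ψ hψ
  refine Eq.trans (integral_congr_ae (.of_forall fun x => ?_)) (e2.trans ?_)
  · change (Hom R.tangent B).inner x (_ + _) (φ x) = _
    rw [(hTB.isInner x).add_left, e1, hX.inner_grad_app hA hB ha hφ.1 hψ.1 hψ']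
    rfl
  · rw [e4]
    exact (congrArg (· + _) e3).trans (sub_add_cancel _ _)

/-- The product rule for a parallel bilinear map of a smooth section and a weakly differentiable
one. The map `μ(s, ·)` is treated as a section of `Hom(B, D)`. -/
lemma IsWeakGrad.bilin (hX : IsParseval R X) (hB : IsGeometric R B)
    (hD : IsGeometric R D) {μ : ∀ x, A.Fib x →ₗ[ℝ] B.Fib x →ₗ[ℝ] D.Fib x}
    (hμ : IsParallelBilin R A B D μ) {s : A.Sec} (hs : A.IsSmooth s) {u : B.Sec}
    {v : (Hom R.tangent B).Sec} (h : IsWeakGrad R B u v) :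
    IsWeakGrad R D (fun x => μ x (s x) (u x)) (fun x => bilinLeft R.tangent μ x (grad R A s x) (u x) +
      bilinRight R.tangent μ x (s x) (v x)) := by
  have ha : (Hom B D).IsSmooth (fun x => ofLin B D (μ x (s x))) :=
    isSmooth_hom fun t ht => hμ.smooth hs ht
  have key : ∀ x, bilinLeft R.tangent μ x (grad R A s x) (u x) = bilinLeft R.tangent
      (fun _ => MetricBundle.app B D) x (grad R (Hom B D) (fun x => ofLin B D (μ x (s x))) x) (u x) :=
    fun x => hom_ext _ _ fun w => by
      rw [app_bilinLeft, app_bilinLeft, app_grad, app_grad]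
      obtain ⟨t, ht, htx⟩ := hB.exists_extend x (u x)
      rw [← htx, hB.app_dir hD ha ht, eq_sub_iff_add_eq]
      exact (hμ.dir hs ht x w).symm
  simp only [key]
  exact h.app hX hB hD ha

lemma IsWeakGrad.add (hA : IsGeometric R A) (hX : IsParseval R X) {u u' : A.Sec}
    {v v' : (Hom R.tangent A).Sec} (h : IsWeakGrad R A u v) (h' : IsWeakGrad R A u' v') :
    IsWeakGrad R A (fun x => u x + u' x) (fun x => v x + v' x) := by
  have hT := R.isGeometric_tangent
  refine ⟨h.left.add hA h'.left, h.right.add (hT.hom hA) h'.right, fun φ hφ => ?_⟩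
  have hc := IsTest.codiff hX hA hφ
  simp only [((hT.hom hA).isInner _).add_left, (hA.isInner _).add_left]
  rw [integral_add (h.right.integrable_inner (hT.hom hA) hφ) (h'.right.integrable_inner
    (hT.hom hA) hφ), integral_add (h.left.integrable_inner hA hc) (h'.left.integrable_inner hA hc),
    h.eq φ hφ, h'.eq φ hφ]

lemma IsLocL1.congr_ae (hA : IsGeometric R A) {s t : A.Sec} (hs : A.IsLocL1 R s)
    (h : ∀ᵐ x ∂(R.vol), s x = t x) : A.IsLocL1 R t :=
  .mono hA (hs.1.congr_ae hA h) hs.2 (by filter_upwards [h] with x hx; rw [hx])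

lemma IsWeakGrad.congr_ae (hA : IsGeometric R A) {u u' : A.Sec} {v : (Hom R.tangent A).Sec}
    (h : IsWeakGrad R A u v) (hu : ∀ᵐ x ∂(R.vol), u x = u' x) : IsWeakGrad R A u' v :=
  ⟨h.left.congr_ae hA hu, h.right, fun φ hφ => (h.eq φ hφ).trans
    (integral_congr_ae (by filter_upwards [hu] with x hx; rw [hx]))⟩

namespace IsWeakNabla

variable {k : ℕ} {u : A.Sec} {v v' : (A.tens R k).Sec}

/-- Weak derivatives are unique. -/
lemma unique (hA : IsGeometric R A) (h : A.IsWeakNabla R k u v) (h' : A.IsWeakNabla R k u v') :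
    ∀ᵐ x ∂(R.vol), v x = v' x := by
  have hk := R.isGeometric_tangent.tens hA k
  have hn : (A.tens R k).IsLocL1 R (fun x => (-1 : ℝ) • v' x) := h'.2.1.smul hk continuous_const
  have h1 : (A.tens R k).IsLocL1 R (fun x => v x + (-1 : ℝ) • v' x) := h.2.1.add hk hn
  have := hk.ae_eq_zero_of_test h1 fun φ hφ => by
    simp only [(hk.isInner _).add_left, (hk.isInner _).smul_left]
    rw [integral_add (h.2.1.integrable_inner hk hφ) ((h'.2.1.integrable_inner hk hφ).const_mul _),
      integral_const_mul]
    have e1 := h.2.2 φ hφ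
    have e2 := h'.2.2 φ hφ
    linarith
  filter_upwards [this] with x hx
  rwa [neg_one_smul, ← sub_eq_add_neg, sub_eq_zero] at hx

omit [T2Space M] [BorelSpace M] in
lemma weakNabla (h : A.IsWeakNabla R k u v) : A.IsWeakNabla R k u (A.weakNabla R k u) := by
  have h' : ∃ v, A.IsWeakNabla R k u v := ⟨v, h⟩
  rw [MetricBundle.weakNabla, dif_pos h']
  exact h'.choose_spec

lemma weakNabla_ae (hA : IsGeometric R A) (h : A.IsWeakNabla R k u v) :
    ∀ᵐ x ∂(R.vol), A.weakNabla R k u x = v x := h.weakNabla.unique hA h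

omit [T2Space M] [BorelSpace M] in
lemma zero (h : A.IsLocL1 R u) : A.IsWeakNabla R 0 u u := ⟨h, h, fun _ _ => rfl⟩

/-- Classical derivatives are weak derivatives. -/
lemma of_smooth (hX : IsParseval R X) (hA : IsGeometric R A) (hu : A.IsSmooth u) :
    A.IsWeakNabla R k u (A.nabla R k u) :=
  ⟨.of_smooth hA hu, .of_smooth (R.isGeometric_tangent.tens hA k) (hA.isSmooth_nabla hu k),
    fun _ hφ => hX.integral_inner_nabla hA hu hφ⟩

omit [BorelSpace M] in
/-- Weak gradients of weak derivatives are weak derivatives of the next order. -/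
lemma succ (hX : IsParseval R X) (hA : IsGeometric R A) (h : A.IsWeakNabla R k u v)
    {w : (Hom R.tangent (A.tens R k)).Sec} (hw : IsWeakGrad R (A.tens R k) v w) :
    A.IsWeakNabla R (k + 1) u w :=
  ⟨h.1, hw.right, fun φ hφ => (hw.eq φ hφ).trans
    (h.2.2 _ (IsTest.codiff hX (R.isGeometric_tangent.tens hA k) hφ))⟩

omit [BorelSpace M] in
/-- Consecutive weak derivatives are weak gradients of each other, so that weak derivatives can be
studied one order at a time. -/
lemma isWeakGrad (hX : IsParseval R X) (hA : IsGeometric R A) (h : A.IsWeakNabla R k u v)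
    {w : (A.tens R (k + 1)).Sec} (hw : A.IsWeakNabla R (k + 1) u w) :
    IsWeakGrad R (A.tens R k) v w :=
  ⟨h.2.1, hw.2.1, fun φ hφ => (hw.2.2 φ hφ).trans
    (h.2.2 _ (IsTest.codiff hX (R.isGeometric_tangent.tens hA k) hφ)).symm⟩

lemma add (hX : IsParseval R X) (hA : IsGeometric R A) {u' : A.Sec} (h : A.IsWeakNabla R k u v)
    (h' : A.IsWeakNabla R k u' v') :
    A.IsWeakNabla R k (fun x => u x + u' x) (fun x => v x + v' x) := by
  have hk := R.isGeometric_tangent.tens hA k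
  refine ⟨h.1.add hA h'.1, h.2.1.add hk h'.2.1, fun φ hφ => ?_⟩
  have hc := IsTest.nablaStar hX hA hφ
  simp only [(hk.isInner _).add_left, (hA.isInner _).add_left]
  rw [integral_add (h.2.1.integrable_inner hk hφ) (h'.2.1.integrable_inner hk hφ),
    integral_add (h.1.integrable_inner hA hc) (h'.1.integrable_inner hA hc),
    h.2.2 φ hφ, h'.2.2 φ hφ]

lemma smul (hA : IsGeometric R A) (c : ℝ) (h : A.IsWeakNabla R k u v) :
    A.IsWeakNabla R k (fun x => c • u x) (fun x => c • v x) := by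
  have hk := R.isGeometric_tangent.tens hA k
  refine ⟨h.1.smul hA continuous_const, h.2.1.smul hk continuous_const, fun φ hφ => ?_⟩
  simp only [(hk.isInner _).smul_left, (hA.isInner _).smul_left]
  rw [integral_const_mul, integral_const_mul, h.2.2 φ hφ]

end IsWeakNabla

end Weak

end

section

variable {n : ℕ} {M : Type*} [TopologicalSpace M] [ChartedSpace (EuclideanSpace ℝ (Fin n)) M]
  [IsManifold (𝓡 n) ∞ M] [T2Space M] [MeasurableSpace M] [BorelSpace M]
  [SecondCountableTopology M] {R : RiemannianStructure n M} {A B D : MetricBundle n M}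
  {ι : Type*} [Fintype ι] {X : ι → R.tangent.Sec}

open IsGeometric

/-! ### Weighted pointwise bounds for weak derivatives -/

/-- Multiplication by functions, `(M × ℝ) × A → A`. -/
def scalarMul (A : MetricBundle n M) (x : M) :
    (trivial n M ℝ).Fib x →ₗ[ℝ] A.Fib x →ₗ[ℝ] A.Fib x :=
  LinearMap.mk₂ ℝ (fun (c : ℝ) ξ => c • ξ) (fun c c' ξ => add_smul (R := ℝ) c c' ξ)
    (fun c c' ξ => mul_smul (α := ℝ) c c' ξ) (fun c ξ ξ' => smul_add (M := ℝ) c ξ ξ')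
    (fun c c' ξ => smul_comm (M := ℝ) (N := ℝ) c' c ξ)

omit [T2Space M] [MeasurableSpace M] [BorelSpace M] [SecondCountableTopology M] in
lemma isParallelBilin_scalarMul (hA : IsGeometric R A) :
    IsParallelBilin R (trivial n M ℝ) A A (scalarMul A) where
  smooth hf hs := IsSmooth.smul (isSmooth_trivial_iff.1 hf) hs
  dir hf hs x v := (hA.dir_smul (isSmooth_trivial_iff.1 hf) hs x v).trans (add_comm _ _)
  bound := ⟨1, zero_le_one, fun x c ξ => by
    rw [one_mul]
    refine (hA.norm_smul x (c : ℝ) ξ).trans_le (mul_le_mul_of_nonneg_right ?_ (norm_nonneg _ _))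
    exact (Real.sqrt_mul_self_eq_abs (c : ℝ)).ge⟩

/-- The weak derivatives `∇^j u`, `j ≤ J`, exist and `σ ρ^{d+j} |∇^j u| ≤ g` almost everywhere. The
recursion is over the bundle, with `∇u` as a section of `T^*M ⊗ A`. -/
def HasWeakBounds (R : RiemannianStructure n M) (σ ρ : M → ℝ) :
    ℕ → ℕ → ∀ A : MetricBundle n M, (M → ℝ) → A.Sec → Prop
  | 0, d, A, g, u => A.IsLocL1 R u ∧ ∀ᵐ x ∂(R.vol), σ x * ρ x ^ d * A.norm x (u x) ≤ g x
  | J + 1, d, A, g, u => (A.IsLocL1 R u ∧ ∀ᵐ x ∂(R.vol), σ x * ρ x ^ d * A.norm x (u x) ≤ g x) ∧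
      ∃ v, IsWeakGrad R A u v ∧ HasWeakBounds R σ ρ J (d + 1) (Hom R.tangent A) g v

namespace HasWeakBounds

variable {σ ρ g : M → ℝ} {J d e : ℕ}

omit [T2Space M] [BorelSpace M] in
lemma zeroth {u : A.Sec} (h : HasWeakBounds R σ ρ J d A g u) :
    A.IsLocL1 R u ∧ ∀ᵐ x ∂(R.vol), σ x * ρ x ^ d * A.norm x (u x) ≤ g x := by
  cases J with
  | zero => exact h
  | succ J => exact h.1

omit [T2Space M] [BorelSpace M] in
lemma of_succ : ∀ {J d : ℕ} {A : MetricBundle n M} {u : A.Sec},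
    HasWeakBounds R σ ρ (J + 1) d A g u → HasWeakBounds R σ ρ J d A g u
  | 0, _, _, _, h => h.1
  | _ + 1, _, _, _, ⟨h, v, hv, hv'⟩ => ⟨h, v, hv, of_succ hv'⟩

omit [T2Space M] [BorelSpace M] in
lemma mono {g' : M → ℝ} (hg : ∀ᵐ x ∂(R.vol), g x ≤ g' x) : ∀ {J d : ℕ} {A : MetricBundle n M}
    {u : A.Sec}, HasWeakBounds R σ ρ J d A g u → HasWeakBounds R σ ρ J d A g' u
  | 0, _, _, _, ⟨h, h'⟩ => ⟨h, by filter_upwards [h', hg] with x h1 h2 using h1.trans h2⟩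
  | _ + 1, _, _, _, ⟨⟨h, h'⟩, v, hv, hv'⟩ =>
    ⟨⟨h, by filter_upwards [h', hg] with x h1 h2 using h1.trans h2⟩, v, hv, mono hg hv'⟩

omit [T2Space M] [BorelSpace M] in
lemma nonneg (hσ : ∀ x, 0 < σ x) (hρ : ∀ x, 0 < ρ x) {u : A.Sec}
    (h : HasWeakBounds R σ ρ J d A g u) : ∀ᵐ x ∂(R.vol), 0 ≤ g x := by
  filter_upwards [h.zeroth.2] with x hx
  exact (mul_nonneg (mul_nonneg (hσ x).le (pow_pos (hρ x) d).le) (norm_nonneg _ _)).trans hx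

lemma congr_ae (hA : IsGeometric R A) {u u' : A.Sec} (h : HasWeakBounds R σ ρ J d A g u)
    (hu : ∀ᵐ x ∂(R.vol), u x = u' x) : HasWeakBounds R σ ρ J d A g u' := by
  have h0 : ∀ᵐ x ∂(R.vol), σ x * ρ x ^ d * A.norm x (u' x) ≤ g x := by
    filter_upwards [h.zeroth.2, hu] with x h1 h2
    rwa [← h2]
  cases J with
  | zero => exact ⟨h.1.congr_ae hA hu, h0⟩
  | succ J =>
    obtain ⟨h1, v, hv, hv'⟩ := h
    exact ⟨⟨h1.1.congr_ae hA hu, h0⟩, v, hv.congr_ae hA hu, hv'⟩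

variable (hσ : ∀ x, 0 < σ x) (hρ : ∀ x, 0 < ρ x)
include hσ hρ

lemma add (hX : IsParseval R X) {g' : M → ℝ} : ∀ {J d : ℕ} {A : MetricBundle n M} {u u' : A.Sec},
    IsGeometric R A → HasWeakBounds R σ ρ J d A g u → HasWeakBounds R σ ρ J d A g' u' →
    HasWeakBounds R σ ρ J d A (fun x => g x + g' x) (fun x => u x + u' x) := by
  intro J
  have key : ∀ {d : ℕ} {A : MetricBundle n M} {u u' : A.Sec}, IsGeometric R A →
      HasWeakBounds R σ ρ 0 d A g u → HasWeakBounds R σ ρ 0 d A g' u' →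
      HasWeakBounds R σ ρ 0 d A (fun x => g x + g' x) (fun x => u x + u' x) := by
    rintro d A u u' hA ⟨h1, h2⟩ ⟨h1', h2'⟩
    refine ⟨h1.add hA h1', ?_⟩
    filter_upwards [h2, h2'] with x hx hx'
    have hc : 0 ≤ σ x * ρ x ^ d := (mul_pos (hσ x) (pow_pos (hρ x) d)).le
    calc _ ≤ σ x * ρ x ^ d * (A.norm x (u x) + A.norm x (u' x)) :=
          mul_le_mul_of_nonneg_left (hA.norm_add_le _ _ _) hc
      _ ≤ _ := by rw [mul_add]; exact add_le_add hx hx'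
  induction J with
  | zero => exact key
  | succ J ih =>
    rintro d A u u' hA ⟨h1, v, hv, h2⟩ ⟨h1', v', hv', h2'⟩
    exact ⟨key hA h1 h1', _, hv.add hA hX hv', ih (R.isGeometric_tangent.hom hA) h2 h2'⟩

/-- The Leibniz rule, with a constant that depends on `s` only. -/
lemma bilin (hX : IsParseval R X) : ∀ {J d e : ℕ} {A B D : MetricBundle n M}
    {μ : ∀ x, A.Fib x →ₗ[ℝ] B.Fib x →ₗ[ℝ] D.Fib x} {s : A.Sec},
    IsGeometric R A → IsGeometric R B → IsGeometric R D → IsParallelBilin R A B D μ →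
    A.IsSmooth s → HasBounds R ρ J e A s → ∃ C : ℝ, 0 ≤ C ∧ ∀ (u : B.Sec) (g : M → ℝ),
      HasWeakBounds R σ ρ J d B g u →
      HasWeakBounds R σ ρ J (d + e) D (fun x => C * g x) (fun x => μ x (s x) (u x)) := by
  intro J
  have key : ∀ {d e : ℕ} {A B D : MetricBundle n M}
      {μ : ∀ x, A.Fib x →ₗ[ℝ] B.Fib x →ₗ[ℝ] D.Fib x} {s : A.Sec},
      IsGeometric R B → IsGeometric R D → IsParallelBilin R A B D μ → A.IsSmooth s →
      (∃ C, ∀ x, ρ x ^ e * A.norm x (s x) ≤ C) → ∃ C : ℝ, 0 ≤ C ∧ ∀ (u : B.Sec) (g : M → ℝ),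
        HasWeakBounds R σ ρ 0 d B g u →
        HasWeakBounds R σ ρ 0 (d + e) D (fun x => C * g x) (fun x => μ x (s x) (u x)) := by
    rintro d e A B D μ s hB hD hμ hs ⟨C₁, h₁⟩
    obtain ⟨C, hC, h⟩ := hμ.bound
    refine ⟨C * |C₁|, by positivity, fun u g ⟨hu, hu'⟩ =>
      ⟨.linear hB hD (L := fun x => μ x (s x)) (fun t ht => hμ.smooth hs ht) hu, ?_⟩⟩
    filter_upwards [hu'] with x hx
    have hd := pow_pos (hρ x) d
    have he := pow_pos (hρ x) e
    have hw := hσ x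
    calc _ ≤ σ x * ρ x ^ (d + e) * (C * (A.norm x (s x) * B.norm x (u x))) :=
          mul_le_mul_of_nonneg_left (h _ _ _) (mul_pos hw (pow_pos (hρ x) _)).le
      _ = C * ((ρ x ^ e * A.norm x (s x)) * (σ x * ρ x ^ d * B.norm x (u x))) := by ring
      _ ≤ C * (|C₁| * g x) := mul_le_mul_of_nonneg_left (mul_le_mul ((h₁ x).trans (le_abs_self _))
          hx (mul_nonneg (mul_pos hw hd).le (norm_nonneg _ _)) (abs_nonneg _)) hC
      _ = _ := (mul_assoc _ _ _).symm
  induction J with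
  | zero => exact fun _ hB hD hμ hs h => key hB hD hμ hs h
  | succ J ih =>
    rintro d e A B D μ s hA hB hD hμ hs h
    have hT := R.isGeometric_tangent
    have hμl := hμ.left hT hA hD
    have hμr := hμ.right hT hB hD
    obtain ⟨C₀, hC₀, h₀⟩ := key (d := d) hB hD hμ hs h.1
    obtain ⟨C₁, hC₁, h₁⟩ := ih (d := d) (hT.hom hA) hB (hT.hom hD) hμl (hA.isSmooth_grad hs) h.2
    obtain ⟨C₂, hC₂, h₂⟩ := ih (d := d + 1) hA (hT.hom hB) (hT.hom hD) hμr hs h.of_succ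
    refine ⟨C₀ + (C₁ + C₂), by positivity, fun u g hu => ?_⟩
    have hg := hu.nonneg hσ hρ
    obtain ⟨hu0, v, hv, hv'⟩ := id hu
    -- the weak gradient `μ(∇s, u) + μ(s, ∇u)` has two terms of lower order
    refine ⟨(h₀ u g hu0).mono (J := 0) ?_, _, hv.bilin hX hB hD hμ hs, mono ?_
      (add hσ hρ hX (hT.hom hD) (h₁ u g hu.of_succ) (?_ :
        HasWeakBounds R σ ρ J (d + (e + 1)) (Hom R.tangent D) (fun x => C₂ * g x) _))⟩
    · filter_upwards [hg] with x hx
      nlinarith [mul_nonneg (add_nonneg hC₁ hC₂) hx]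
    · filter_upwards [hg] with x hx
      nlinarith [mul_nonneg hC₀ hx]
    · rw [← add_assoc, add_right_comm]
      exact h₂ v g hv'

omit hσ in
/-- Multiplication by a smooth positive function `f` for which all `ρ^{j+1} |∇^j θ|` are bounded,
where `θ = f⁻¹ df`. -/
lemma weight (hX : IsParseval R X) {f : M → ℝ} (hf : ContMDiff (𝓡 n) 𝓘(ℝ, ℝ) ∞ f)
    (hf0 : ∀ x, 0 < f x)
    {θ : (Hom R.tangent (trivial n M ℝ)).Sec} (hθs : (Hom R.tangent (trivial n M ℝ)).IsSmooth θ)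
    (hθ : ∀ x, θ x = (f x)⁻¹ • grad R (trivial n M ℝ) f x)
    (hθb : ∀ J, HasBounds R ρ J 1 (Hom R.tangent (trivial n M ℝ)) θ) :
    ∀ {J d : ℕ} {A : MetricBundle n M}, IsGeometric R A → ∃ C : ℝ, 0 ≤ C ∧
      ∀ (u : A.Sec) (g : M → ℝ), HasWeakBounds R (fun _ => 1) ρ J d A g u →
      HasWeakBounds R (fun x => (f x)⁻¹) ρ J d A (fun x => C * g x) (fun x => f x • u x) := by
  intro J
  have key : ∀ {d : ℕ} {A : MetricBundle n M} {u : A.Sec} {g : M → ℝ}, IsGeometric R A →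
      HasWeakBounds R (fun _ => 1) ρ 0 d A g u →
      HasWeakBounds R (fun x => (f x)⁻¹) ρ 0 d A g (fun x => f x • u x) := by
    rintro d A u g hA ⟨hu, hu'⟩
    refine ⟨hu.smul hA hf.continuous, ?_⟩
    filter_upwards [hu'] with x hx
    rw [hA.norm_smul, abs_of_pos (hf0 x)]
    refine Eq.trans_le ?_ hx
    have := (hf0 x).ne'
    field_simp
  induction J with
  | zero =>
    intro d A hA
    exact ⟨1, zero_le_one, fun u g h => by simpa only [one_mul] using key hA h⟩
  | succ J ih =>
    intro d A hA
    have hT := R.isGeometric_tangent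
    have hR := isGeometric_trivial R
    have hμ := isParallelBilin_scalarMul hA
    obtain ⟨C₁, hC₁, h₁⟩ := bilin (σ := fun _ => 1) (fun _ => one_pos) hρ hX (J := J) (d := d)
      (hT.hom hR) hA (hT.hom hA) (hμ.left hT hR hA) hθs (hθb J)
    obtain ⟨C₂, hC₂, h₂⟩ := ih (d := d + 1) (hT.hom hA)
    refine ⟨1 + C₂ * (1 + C₁), by positivity, fun u g hu => ?_⟩
    have hg := hu.nonneg (fun _ => one_pos) hρ
    obtain ⟨hu0, v, hv, hv'⟩ := id hu
    have h3 := add (fun _ => one_pos) hρ hX (hT.hom hA) (h₁ u g hu.of_succ) hv'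
    have h4 := hv.bilin hX hA hA hμ (s := f) (isSmooth_trivial_iff.2 hf)
    -- `∇(f u) = f (θ ⊗ u + ∇u)`, so the induction hypothesis applies to the gradient
    have e : (fun x => bilinLeft R.tangent (scalarMul A) x (grad R (trivial n M ℝ) f x) (u x) +
        bilinRight R.tangent (scalarMul A) x (f x) (v x)) =
        fun x => f x • (bilinLeft R.tangent (scalarMul A) x (θ x) (u x) + v x) := by
      funext x
      rw [smul_add, hθ, map_smul, LinearMap.smul_apply, smul_inv_smul₀ (hf0 x).ne']
      rfl
    rw [e] at h4
    refine ⟨(key hA hu0).mono (J := 0) ?_, _, h4, mono ?_ (h₂ _ _ h3)⟩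
    · filter_upwards [hg] with x hx
      nlinarith [mul_nonneg (mul_nonneg hC₂ (add_nonneg zero_le_one hC₁)) hx]
    · filter_upwards [hg] with x hx
      nlinarith

end HasWeakBounds

omit [BorelSpace M] in
/-- The bounds for the iterated weak derivatives that are contained in the recursive bounds. -/
lemma HasWeakBounds.exists_isWeakNabla (hX : IsParseval R X) (hA : IsGeometric R A) {σ ρ g : M → ℝ}
    {J d : ℕ} {u : A.Sec} (h : HasWeakBounds R σ ρ J d A g u) : ∀ k ≤ J, ∃ v,
      A.IsWeakNabla R k u v ∧ HasWeakBounds R σ ρ (J - k) (d + k) (A.tens R k) g v := by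
  intro k
  induction k with
  | zero => exact fun _ => ⟨u, .zero h.zeroth.1, h⟩
  | succ k ih =>
    intro hk
    obtain ⟨v, hv, hv'⟩ := ih (by omega)
    obtain ⟨l, hl⟩ : ∃ l, J - k = l + 1 := ⟨J - k - 1, by omega⟩
    rw [hl] at hv'
    obtain ⟨-, w, hw, hw'⟩ := hv'
    refine ⟨w, hv.succ hX hA hw, ?_⟩
    rw [show J - (k + 1) = l by omega]
    exact hw'

/-- The sum `∑_{k ≤ m} ρ^k |∇^k (f⁻¹ u)|`, whose square controls, and is controlled by, the density of
the squared Sobolev norm. -/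
def sobolevDensity (R : RiemannianStructure n M) (A : MetricBundle n M) (f ρ : M → ℝ) (m : ℕ)
    (u : A.Sec) (x : M) : ℝ :=
  ∑ k ∈ Finset.range (m + 1),
    (A.tens R k).norm x (ρ x ^ k • A.weakNabla R k (fun y => (f y)⁻¹ • u y) x)

variable {f ρ : M → ℝ} {m : ℕ}

/-- Membership in the Sobolev space gives recursive bounds, with the density as majorant. -/
lemma MemSobolev.hasWeakBounds (hX : IsParseval R X) (hA : IsGeometric R A) (hρ : ∀ x, 0 < ρ x)
    {u : A.Sec} (hu : A.MemSobolev R f ρ m u) :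
    HasWeakBounds R (fun _ => 1) ρ m 0 A (sobolevDensity R A f ρ m u) (fun x => (f x)⁻¹ • u x) := by
  have hk := fun k => R.isGeometric_tangent.tens hA k
  choose! v hv using hu
  have hw := fun k hk => (hv k hk).1.weakNabla
  have key : ∀ j k, k + j = m → HasWeakBounds R (fun _ => 1) ρ j k (A.tens R k)
      (sobolevDensity R A f ρ m u) (A.weakNabla R k (fun x => (f x)⁻¹ • u x)) := by
    intro j
    have h0 : ∀ k ≤ m, HasWeakBounds R (fun _ => 1) ρ 0 k (A.tens R k)
        (sobolevDensity R A f ρ m u) (A.weakNabla R k (fun x => (f x)⁻¹ • u x)) := fun k hkm =>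
      ⟨(hw k hkm).2.1, .of_forall fun x => by
        have h1 := (hk k).norm_smul x (ρ x ^ k) (A.weakNabla R k (fun x => (f x)⁻¹ • u x) x)
        rw [abs_of_pos (pow_pos (hρ x) k)] at h1
        rw [one_mul, ← h1]
        exact Finset.single_le_sum (f := fun k => (A.tens R k).norm x
          (ρ x ^ k • A.weakNabla R k (fun y => (f y)⁻¹ • u y) x))
          (fun _ _ => norm_nonneg _ _) (Finset.mem_range.2 (by omega))⟩
    induction j with
    | zero => exact fun k h => h0 k (by omega)
    | succ j ih =>
      exact fun k h => ⟨h0 k (by omega), _, (hw k (by omega)).isWeakGrad hX hA (hw (k + 1) (by omega)),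
        ih (k + 1) (by omega)⟩
  refine (key m 0 (zero_add m)).congr_ae hA ?_
  exact (hw 0 (Nat.zero_le _)).unique hA (.zero (hw 0 (Nat.zero_le _)).1)

/-- The derivatives of `u ∈ f H^m` exist, with weighted bounds. -/
lemma exists_bound_weakNabla (hX : IsParseval R X) (hA : IsGeometric R A) (hρ : ∀ x, 0 < ρ x)
    (hf : ContMDiff (𝓡 n) 𝓘(ℝ, ℝ) ∞ f) (hf0 : ∀ x, 0 < f x)
    {θ : (Hom R.tangent (trivial n M ℝ)).Sec} (hθs : (Hom R.tangent (trivial n M ℝ)).IsSmooth θ)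
    (hθ : ∀ x, θ x = (f x)⁻¹ • grad R (trivial n M ℝ) f x)
    (hθb : ∀ J, HasBounds R ρ J 1 (Hom R.tangent (trivial n M ℝ)) θ) (m : ℕ) :
    ∃ C : ℝ, 0 ≤ C ∧ ∀ u, A.MemSobolev R f ρ m u → ∀ k ≤ m,
      A.IsWeakNabla R k u (A.weakNabla R k u) ∧
      ∀ᵐ x ∂(R.vol), (f x)⁻¹ * ρ x ^ k * (A.tens R k).norm x (A.weakNabla R k u x) ≤
        C * sobolevDensity R A f ρ m u x := by
  obtain ⟨C, hC, h⟩ := HasWeakBounds.weight hρ hX hf hf0 hθs hθ hθb (J := m) (d := 0) hA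
  refine ⟨C, hC, fun u hu k hk => ?_⟩
  have h1 := h _ _ (hu.hasWeakBounds hX hA hρ)
  -- `u = f (f⁻¹ u)`, where the derivatives of `f⁻¹ u` are controlled by definition
  have e : (fun x => f x • (f x)⁻¹ • u x) = u := funext fun x => smul_inv_smul₀ (hf0 x).ne' _
  rw [e] at h1
  obtain ⟨v, hv, hv'⟩ := h1.exists_isWeakNabla hX hA k hk
  refine ⟨hv.weakNabla, ?_⟩
  filter_upwards [hv'.zeroth.2, hv.weakNabla_ae hA] with x h1 h2
  rw [zero_add] at h1
  rwa [h2]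

omit [T2Space M] [BorelSpace M] in
lemma sobolevDensity_nonneg (u : A.Sec) (x : M) : 0 ≤ sobolevDensity R A f ρ m u x :=
  Finset.sum_nonneg fun _ _ => norm_nonneg _ _

lemma MemSobolev.memLp_norm (hA : IsGeometric R A) (hρ : Continuous ρ) {u : A.Sec}
    (hu : A.MemSobolev R f ρ m u) {k : ℕ} (hk : k ≤ m) :
    MemLp (fun x => (A.tens R k).norm x (ρ x ^ k • A.weakNabla R k (fun y => (f y)⁻¹ • u y) x))
      2 R.vol := by
  obtain ⟨v, hv, hv'⟩ := hu k hk
  have hk' := R.isGeometric_tangent.tens hA k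
  refine (memLp_two_iff_integrable_sq (hk'.aestronglyMeasurable_norm
    (hv.weakNabla.2.1.1.smul hk' (hρ.pow k).aestronglyMeasurable))).2 ?_
  refine hv'.2.congr ?_
  filter_upwards [hv.weakNabla_ae hA] with x hx
  rw [hx, hk'.sq_norm]
  rfl

lemma MemSobolev.memLp_density (hA : IsGeometric R A) (hρ : Continuous ρ) {u : A.Sec}
    (hu : A.MemSobolev R f ρ m u) : MemLp (sobolevDensity R A f ρ m u) 2 R.vol :=
  memLp_finsetSum _ fun _ hk => hu.memLp_norm hA hρ (Nat.lt_succ_iff.1 (Finset.mem_range.1 hk))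

/-- The square of a sum of `m + 1` terms is at most `m + 1` times the sum of the squares. -/
lemma MemSobolev.integral_density_sq_le (hA : IsGeometric R A) (hρ : Continuous ρ) {u : A.Sec}
    (hu : A.MemSobolev R f ρ m u) :
    ∫ x, sobolevDensity R A f ρ m u x ^ 2 ∂(R.vol) ≤ (m + 1) * A.sobolevNorm R f ρ m u ^ 2 := by
  rw [sobolevNorm, Real.sq_sqrt (Finset.sum_nonneg fun _ _ => integral_nonneg fun _ => sq_nonneg _),
    ← integral_finsetSum, ← integral_const_mul]
  · refine integral_mono (hu.memLp_density hA hρ).integrable_sq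
      ((integrable_finsetSum _ fun k hk => (hu.memLp_norm hA hρ
        (Nat.lt_succ_iff.1 (Finset.mem_range.1 hk))).integrable_sq).const_mul _) fun x => ?_
    refine (sq_sum_le_card_mul_sum_sq).trans_eq ?_
    simp
  · exact fun k hk => (hu.memLp_norm hA hρ (Nat.lt_succ_iff.1 (Finset.mem_range.1 hk))).integrable_sq

end

section

variable {n : ℕ} {M : Type*} [TopologicalSpace M] [ChartedSpace (EuclideanSpace ℝ (Fin n)) M]
  [IsManifold (𝓡 n) ∞ M] {R R₀ : RiemannianStructure n M} {A B D : MetricBundle n M}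
  {ι : Type*} [Fintype ι] {X : ι → R.tangent.Sec}

open IsGeometric

/-! ### Conformal change of the metric -/

/-- The bundle of one-forms. -/
abbrev cotangent (R : RiemannianStructure n M) : MetricBundle n M :=
  Hom R.tangent (trivial n M ℝ)

/-- The pairing of one-forms and vectors. -/
def pairing (R : RiemannianStructure n M) (x : M) :
    (cotangent R).Fib x →ₗ[ℝ] R.tangent.Fib x →ₗ[ℝ] ℝ := app R.tangent (trivial n M ℝ)

/-- The isomorphism `T^*M → TM` given by the metric. -/
def sharp (X : ι → R.tangent.Sec) (x : M) : (cotangent R).Fib x →ₗ[ℝ] R.tangent.Fib x where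
  toFun θ := ∑ i, pairing R x θ (X i x) • X i x
  map_add' θ θ' := by simp only [map_add, LinearMap.add_apply, add_smul, Finset.sum_add_distrib]
  map_smul' c θ := by
    simp only [map_smul, LinearMap.smul_apply, smul_eq_mul, mul_smul, Finset.smul_sum,
      RingHom.id_apply]

lemma sharp_apply (x : M) (θ : (cotangent R).Fib x) :
    sharp X x θ = ∑ i, pairing R x θ (X i x) • X i x := rfl

lemma IsParseval.inner_sharp (hX : IsParseval R X) (x : M) (θ : (cotangent R).Fib x)
    (v : R.tangent.Fib x) : R.tangent.inner x (sharp X x θ) v = pairing R x θ v := by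
  have hI := R.isGeometric_tangent.isInner x
  conv_rhs => rw [← hX.expand x v, map_sum]
  rw [sharp_apply, hI.sum_left]
  refine Finset.sum_congr rfl fun i _ => ?_
  rw [hI.smul_left, map_smul, smul_eq_mul, mul_comm]

/-- The difference of the Levi-Civita connections of `ρ⁻² g` and of `g`, as a bilinear map of
`θ = ρ⁻¹ dρ` and of the section that is differentiated. -/
def christoffel (X : ι → R.tangent.Sec) (x : M) :
    (cotangent R).Fib x →ₗ[ℝ] R.tangent.Fib x →ₗ[ℝ] (Hom R.tangent R.tangent).Fib x :=
  have hI := R.isGeometric_tangent.isInner x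
  LinearMap.mk₂ ℝ (fun θ Y => ofLin R.tangent R.tangent
    { toFun := fun Z => R.tangent.inner x Z Y • sharp X x θ -
        (pairing R x θ Z • Y + pairing R x θ Y • Z)
      map_add' := fun Z Z' => by simp only [hI.add_left, map_add]; module
      map_smul' := fun c Z => by
        simp only [hI.smul_left, map_smul, RingHom.id_apply, smul_eq_mul]; module })
    (fun θ θ' Y => hom_ext _ _ fun Z => by
      simp only [map_add, LinearMap.add_apply, app_ofLin, LinearMap.coe_mk, AddHom.coe_mk]; module)
    (fun c θ Y => hom_ext _ _ fun Z => by
      simp only [map_smul, LinearMap.smul_apply, app_ofLin, LinearMap.coe_mk, AddHom.coe_mk,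
        smul_eq_mul]; module)
    (fun θ Y Y' => hom_ext _ _ fun Z => by
      simp only [map_add, LinearMap.add_apply, app_ofLin, LinearMap.coe_mk, AddHom.coe_mk,
        hI.add_right]; module)
    (fun c θ Y => hom_ext _ _ fun Z => by
      simp only [map_smul, LinearMap.smul_apply, app_ofLin, LinearMap.coe_mk, AddHom.coe_mk,
        hI.smul_right, smul_eq_mul]; module)

lemma app_christoffel (x : M) (θ : (cotangent R).Fib x) (Y Z : R.tangent.Fib x) :
    app R.tangent R.tangent (christoffel X x θ Y) Z = R.tangent.inner x Z Y • sharp X x θ -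
      (pairing R x θ Z • Y + pairing R x θ Y • Z) := rfl

section T2

variable [T2Space M]

omit [T2Space M] in
lemma contMDiff_pairing {θ : (cotangent R).Sec} {Y : R.tangent.Sec} (hθ : (cotangent R).IsSmooth θ)
    (hY : R.tangent.IsSmooth Y) : ContMDiff (𝓡 n) 𝓘(ℝ, ℝ) ∞ (fun x => pairing R x (θ x) (Y x)) :=
  isSmooth_trivial_iff.1 (hθ.app hY)

lemma der_pairing {θ : (cotangent R).Sec} {Y : R.tangent.Sec} (hθ : (cotangent R).IsSmooth θ)
    (hY : R.tangent.IsSmooth Y) (x : M) (v : R.tangent.Fib x) :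
    der R (fun y => pairing R y (θ y) (Y y)) x v =
      pairing R x (dir R (cotangent R) θ x v) (Y x) + pairing R x (θ x) (dir R R.tangent Y x v) :=
  R.isGeometric_tangent.dir_app (isGeometric_trivial R) hθ hY x v

/-- The isomorphism `T^*M → TM` given by the metric is parallel, because the metric is. -/
lemma IsParseval.isParallel_sharp (hX : IsParseval R X) :
    IsParallel R (cotangent R) R.tangent (sharp X) where
  smooth {θ} hθ := IsSmooth.sum _ fun i _ =>
    IsSmooth.smul (contMDiff_pairing hθ (hX.smooth i)) (hX.smooth i)
  dir {θ} hθ x v := by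
    have hT := R.isGeometric_tangent
    have hR := isGeometric_trivial R
    refine (hT.isInner x).ext fun w => ?_
    obtain ⟨W, hW, rfl⟩ := hT.exists_extend x w
    have hs : R.tangent.IsSmooth (fun y => sharp X y (θ y)) := IsSmooth.sum _ fun i _ =>
      IsSmooth.smul (contMDiff_pairing hθ (hX.smooth i)) (hX.smooth i)
    have h1 := hT.der_inner hs hW x v
    simp only [hX.inner_sharp, der_pairing hθ hW] at h1
    rw [(hT.isInner x).symm, (hT.isInner x).symm (W x), hX.inner_sharp]
    linarith
  bound := by
    have hT := R.isGeometric_tangent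
    have hR := isGeometric_trivial R
    refine ⟨1, zero_le_one, fun x θ => ?_⟩
    have h1 : R.tangent.norm x (sharp X x θ) ^ 2 ≤
        (cotangent R).norm x θ * R.tangent.norm x (sharp X x θ) := by
      rw [hT.sq_norm, hX.inner_sharp]
      exact (Real.le_sqrt_of_sq_le (sq _).le).trans (hT.norm_app_le hR θ (sharp X x θ))
    rw [one_mul]
    by_contra! h
    nlinarith [norm_nonneg (A := cotangent R) x θ]

lemma abs_pairing_le (x : M) (θ : (cotangent R).Fib x) (v : R.tangent.Fib x) :
    |pairing R x θ v| ≤ (cotangent R).norm x θ * R.tangent.norm x v :=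
  (Real.sqrt_mul_self_eq_abs _).ge.trans (R.isGeometric_tangent.norm_app_le (isGeometric_trivial R) θ v)

/-- The Christoffel tensor of the conformal change is a polynomial in the metric and `θ`, so it
depends on `θ` in a parallel way. -/
lemma IsParseval.isParallelBilin_christoffel (hX : IsParseval R X) :
    IsParallelBilin R (cotangent R) R.tangent (Hom R.tangent R.tangent) (christoffel X) := by
  have hT := R.isGeometric_tangent
  have smooth : ∀ {θ : (cotangent R).Sec} {Y Z : R.tangent.Sec}, (cotangent R).IsSmooth θ →
      R.tangent.IsSmooth Y → R.tangent.IsSmooth Z →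
      R.tangent.IsSmooth (fun x => app R.tangent R.tangent (christoffel X x (θ x) (Y x)) (Z x)) :=
    fun hθ hY hZ => (IsSmooth.smul (hT.smooth_inner hZ hY) (hX.isParallel_sharp.smooth hθ)).sub
      ((IsSmooth.smul (contMDiff_pairing hθ hZ) hY).add
        (IsSmooth.smul (contMDiff_pairing hθ hY) hZ))
  refine ⟨fun hθ hY => isSmooth_hom fun Z hZ => smooth hθ hY hZ, fun {θ Y} hθ hY x v => ?_, ?_⟩
  · refine hT.hom_ext_smooth fun Z hZ => ?_
    rw [hT.app_dir hT (isSmooth_hom fun Z hZ => smooth hθ hY hZ) hZ]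
    simp only [app_christoffel]
    have s1 := hX.isParallel_sharp.smooth hθ
    have p1 := contMDiff_pairing hθ hZ
    have p2 := contMDiff_pairing hθ hY
    rw [hT.dir_sub (t := fun y => _ + _) (IsSmooth.smul (hT.smooth_inner hZ hY) s1)
      ((IsSmooth.smul p1 hY).add (IsSmooth.smul p2 hZ)),
      hT.dir_add (IsSmooth.smul p1 hY) (IsSmooth.smul p2 hZ), hT.dir_smul (hT.smooth_inner hZ hY) s1,
      hT.dir_smul p1 hY, hT.dir_smul p2 hZ, hX.isParallel_sharp.dir hθ, der_pairing hθ hZ,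
      der_pairing hθ hY, hT.der_inner hZ hY, map_add, LinearMap.add_apply]
    simp only [app_christoffel]
    module
  · obtain ⟨C, hC, h⟩ := hX.isParallel_sharp.bound
    refine ⟨√(Module.finrank ℝ R.tangent.Model) * (C + 2), by positivity, fun x θ Y => ?_⟩
    rw [mul_assoc]
    have n1 := norm_nonneg (A := cotangent R) x θ
    have n2 := norm_nonneg (A := R.tangent) x Y
    refine hT.norm_hom_le hT (by positivity) fun Z => ?_
    have n3 := norm_nonneg (A := R.tangent) x Z
    rw [app_christoffel, sub_eq_add_neg]
    refine (hT.norm_add_le _ _ _).trans ?_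
    rw [hT.norm_neg]
    refine (add_le_add_right (hT.norm_add_le _ _ _) _).trans ?_
    simp only [hT.norm_smul]
    have b1 := mul_le_mul (hT.abs_inner_le x Z Y) (h x θ) (norm_nonneg _ _) (by positivity)
    have b2 := mul_le_mul_of_nonneg_right (abs_pairing_le x θ Z) n2
    have b3 := mul_le_mul_of_nonneg_right (abs_pairing_le x θ Y) n3
    nlinarith

end T2

section Homs

/-- The difference of the connections on `Hom(T, A)` that belong to `ρ⁻² g` and to `g`, where `μ` is
the difference of the connections on `A`. -/
def homChristoffel (X : ι → R.tangent.Sec)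
    (μ : ∀ x, (cotangent R).Fib x →ₗ[ℝ] A.Fib x →ₗ[ℝ] (Hom R.tangent A).Fib x) (x : M) :
    (cotangent R).Fib x →ₗ[ℝ] (Hom R.tangent A).Fib x →ₗ[ℝ]
      (Hom R.tangent (Hom R.tangent A)).Fib x :=
  LinearMap.mk₂ ℝ (fun θ φ => ofLin R.tangent (Hom R.tangent A)
    { toFun := fun Z => ofLin R.tangent A
        { toFun := fun Y => app R.tangent A (μ x θ (app R.tangent A φ Y)) Z -
            app R.tangent A φ (app R.tangent R.tangent (christoffel X x θ Y) Z)
          map_add' := fun Y Y' => by simp only [map_add, LinearMap.add_apply]; abel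
          map_smul' := fun c Y => by
            simp only [map_smul, LinearMap.smul_apply, RingHom.id_apply, smul_sub] }
      map_add' := fun Z Z' => hom_ext _ _ fun Y => by
        simp only [map_add, LinearMap.add_apply, app_ofLin, LinearMap.coe_mk, AddHom.coe_mk]; abel
      map_smul' := fun c Z => hom_ext _ _ fun Y => by
        simp only [map_smul, LinearMap.smul_apply, RingHom.id_apply, app_ofLin, LinearMap.coe_mk,
          AddHom.coe_mk, smul_sub] })
    (fun θ θ' φ => hom_ext _ _ fun Z => hom_ext _ _ fun Y => by
      simp only [map_add, LinearMap.add_apply, app_ofLin, LinearMap.coe_mk, AddHom.coe_mk]; abel)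
    (fun c θ φ => hom_ext _ _ fun Z => hom_ext _ _ fun Y => by
      simp only [map_smul, LinearMap.smul_apply, app_ofLin, LinearMap.coe_mk, AddHom.coe_mk,
        smul_sub])
    (fun θ φ φ' => hom_ext _ _ fun Z => hom_ext _ _ fun Y => by
      simp only [map_add, LinearMap.add_apply, app_ofLin, LinearMap.coe_mk, AddHom.coe_mk]; abel)
    (fun c θ φ => hom_ext _ _ fun Z => hom_ext _ _ fun Y => by
      simp only [map_smul, LinearMap.smul_apply, app_ofLin, LinearMap.coe_mk, AddHom.coe_mk,
        smul_sub])

lemma app_homChristoffel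
    {μ : ∀ x, (cotangent R).Fib x →ₗ[ℝ] A.Fib x →ₗ[ℝ] (Hom R.tangent A).Fib x} (x : M)
    (θ : (cotangent R).Fib x) (φ : (Hom R.tangent A).Fib x) (Z Y : R.tangent.Fib x) :
    app R.tangent A (app R.tangent (Hom R.tangent A) (homChristoffel X μ x θ φ) Z) Y =
      app R.tangent A (μ x θ (app R.tangent A φ Y)) Z -
        app R.tangent A φ (app R.tangent R.tangent (christoffel X x θ Y) Z) := rfl

variable [T2Space M]

/-- The difference of the connections on `Hom(T, A)` depends on `θ` in a parallel way if the one
on `A` does. -/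
lemma IsParseval.isParallelBilin_homChristoffel (hX : IsParseval R X) (hA : IsGeometric R A)
    {μ : ∀ x, (cotangent R).Fib x →ₗ[ℝ] A.Fib x →ₗ[ℝ] (Hom R.tangent A).Fib x}
    (hμ : IsParallelBilin R (cotangent R) A (Hom R.tangent A) μ) :
    IsParallelBilin R (cotangent R) (Hom R.tangent A) (Hom R.tangent (Hom R.tangent A))
      (homChristoffel X μ) := by
  have hT := R.isGeometric_tangent
  have hTA := hT.hom hA
  have hC := hX.isParallelBilin_christoffel
  have s1 : ∀ {θ : (cotangent R).Sec} {φ : (Hom R.tangent A).Sec} {Z Y : R.tangent.Sec},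
      (cotangent R).IsSmooth θ → (Hom R.tangent A).IsSmooth φ → R.tangent.IsSmooth Z →
      R.tangent.IsSmooth Y → A.IsSmooth (fun x => app R.tangent A (app R.tangent (Hom R.tangent A)
        (homChristoffel X μ x (θ x) (φ x)) (Z x)) (Y x)) :=
    fun hθ hφ hZ hY => ((hμ.smooth hθ (hφ.app hY)).app hZ).sub
      (hφ.app ((hC.smooth hθ hY).app hZ))
  have s2 : ∀ {θ : (cotangent R).Sec} {φ : (Hom R.tangent A).Sec} {Z : R.tangent.Sec},
      (cotangent R).IsSmooth θ → (Hom R.tangent A).IsSmooth φ → R.tangent.IsSmooth Z →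
      (Hom R.tangent A).IsSmooth (fun x => app R.tangent (Hom R.tangent A)
        (homChristoffel X μ x (θ x) (φ x)) (Z x)) :=
    fun hθ hφ hZ => isSmooth_hom fun Y hY => s1 hθ hφ hZ hY
  refine ⟨fun hθ hφ => isSmooth_hom fun Z hZ => s2 hθ hφ hZ, fun {θ φ} hθ hφ x v => ?_, ?_⟩
  · refine hT.hom_ext_smooth fun Z hZ => hT.hom_ext_smooth fun Y hY => ?_
    rw [hT.app_dir hTA (isSmooth_hom fun Z hZ => s2 hθ hφ hZ) hZ, map_sub, LinearMap.sub_apply,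
      hT.app_dir hA (s2 hθ hφ hZ) hY]
    simp only [map_add, LinearMap.add_apply, app_homChristoffel]
    have a1 := hμ.smooth hθ (hφ.app hY)
    have a2 := hC.smooth hθ hY
    rw [hA.dir_sub (a1.app hZ) (hφ.app (a2.app hZ)), hT.dir_app hA a1 hZ,
      hT.dir_app hA hφ (a2.app hZ), hT.dir_app hT a2 hZ, hμ.dir hθ (hφ.app hY), hC.dir hθ hY,
      hT.dir_app hA hφ hY]
    simp only [map_add, LinearMap.add_apply]
    abel
  · obtain ⟨C, h0, h⟩ := hμ.bound
    obtain ⟨C', h0', h'⟩ := hC.bound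
    set N := √(Module.finrank ℝ R.tangent.Model)
    have hN : 0 ≤ N := Real.sqrt_nonneg _
    refine ⟨N * (N * (C + C')), by positivity, fun x θ φ => ?_⟩
    have n1 := norm_nonneg (A := cotangent R) x θ
    have n2 := norm_nonneg (A := Hom R.tangent A) x φ
    rw [mul_assoc]
    refine hT.norm_hom_le hTA (by positivity) fun Z => ?_
    have n3 := norm_nonneg (A := R.tangent) x Z
    refine (hT.norm_hom_le hA (K := (C + C') * ((cotangent R).norm x θ * (Hom R.tangent A).norm x φ) *
      R.tangent.norm x Z) (by positivity) fun Y => ?_).trans_eq (by ring)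
    have n4 := norm_nonneg (A := R.tangent) x Y
    rw [app_homChristoffel, sub_eq_add_neg]
    refine (hA.norm_add_le _ _ _).trans ?_
    rw [hA.norm_neg]
    have b1 : A.norm x (app R.tangent A (μ x θ (app R.tangent A φ Y)) Z) ≤
        C * ((cotangent R).norm x θ * ((Hom R.tangent A).norm x φ * R.tangent.norm x Y)) *
          R.tangent.norm x Z :=
      (hT.norm_app_le hA _ _).trans (mul_le_mul_of_nonneg_right ((h _ _ _).trans
        (mul_le_mul_of_nonneg_left (mul_le_mul_of_nonneg_left (hT.norm_app_le hA _ _) n1) h0)) n3)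
    have b2 : A.norm x (app R.tangent A φ (app R.tangent R.tangent (christoffel X x θ Y) Z)) ≤
        (Hom R.tangent A).norm x φ * (C' * ((cotangent R).norm x θ * R.tangent.norm x Y) *
          R.tangent.norm x Z) :=
      (hT.norm_app_le hA _ _).trans (mul_le_mul_of_nonneg_left ((hT.norm_app_le hT _ _).trans
        (mul_le_mul_of_nonneg_right (h' _ _ _) n3)) n2)
    exact (add_le_add b1 b2).trans_eq (by ring)

end Homs

end

section

variable {n : ℕ} {M : Type*} [TopologicalSpace M] [ChartedSpace (EuclideanSpace ℝ (Fin n)) M]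
  [IsManifold (𝓡 n) ∞ M] [T2Space M] {R R₀ : RiemannianStructure n M} {A : MetricBundle n M}
  {ι : Type*} [Fintype ι] {X : ι → R.tangent.Sec}

open IsGeometric

/-! ### Admissible weights for a conformal metric -/

/-- The Levi-Civita connection of `R₀` on the vector fields of `R`. The tangent bundles of `R` and `R₀`
have the same fibres. -/
def conn₀ (R R₀ : RiemannianStructure n M) (Y : R.tangent.Sec) (x : M) :
    R.tangent.Fib x →ₗ[ℝ] R.tangent.Fib x := dir R₀ R₀.tangent Y x

omit [T2Space M] in
/-- The Levi-Civita connections of two metrics have the same antisymmetric part. -/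
lemma dir_sub_dir_symm {Y Z : R.tangent.Sec} (hY : R.tangent.IsSmooth Y) (hZ : R.tangent.IsSmooth Z)
    (x : M) : conn₀ R R₀ Y x (Z x) - conn₀ R R₀ Z x (Y x) =
      dir R R.tangent Y x (Z x) - dir R R.tangent Z x (Y x) :=
  ((R₀.conn.torsion_eq_zero_iff.1 R₀.torsion_free (hZ.mdifferentiableAt (x := x) (by simp))
    (hY.mdifferentiableAt (x := x) (by simp))).trans
  (R.conn.torsion_eq_zero_iff.1 R.torsion_free (hZ.mdifferentiableAt (x := x) (by simp))
    (hY.mdifferentiableAt (x := x) (by simp))).symm)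

/-- The one-form `f⁻¹ df`. -/
def logDeriv (R : RiemannianStructure n M) (f : M → ℝ) : (cotangent R).Sec :=
  fun x => (f x)⁻¹ • grad R (trivial n M ℝ) f x

omit [T2Space M] in
lemma pairing_logDeriv (f : M → ℝ) (x : M) (v : R.tangent.Fib x) :
    pairing R x (logDeriv R f x) v = (f x)⁻¹ * der R f x v := rfl

lemma isSmooth_logDeriv {f : M → ℝ} (hf : ContMDiff (𝓡 n) 𝓘(ℝ, ℝ) ∞ f) (hf0 : ∀ x, 0 < f x) :
    (cotangent R).IsSmooth (logDeriv R f) :=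
  IsSmooth.smul (hf.inv₀ fun x => (hf0 x).ne')
    ((isGeometric_trivial R).isSmooth_grad (isSmooth_trivial_iff.2 hf))

/-- The Levi-Civita connection of `ρ⁻² g`. -/
lemma IsParseval.conn_conformal (hX : IsParseval R X) {ρ : M → ℝ}
    (h : ∀ x, R₀.metric.inner x = (ρ x ^ 2)⁻¹ • R.metric.inner x)
    (hρ : ContMDiff (𝓡 n) 𝓘(ℝ, ℝ) ∞ ρ) (hρ0 : ∀ x, 0 < ρ x) {Y : R.tangent.Sec}
    (hY : R.tangent.IsSmooth Y) (x : M) (v : R.tangent.Fib x) :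
    conn₀ R R₀ Y x v = dir R R.tangent Y x v +
      app R.tangent R.tangent (christoffel X x (logDeriv R ρ x) (Y x)) v := by
  have hT := R.isGeometric_tangent
  have hT₀ := R₀.isGeometric_tangent
  have hI := hT.isInner x
  -- The difference `D` of the two sides is symmetric by torsion-freeness, and skew with respect to
  -- the metric by metric compatibility. A trilinear form that is symmetric in two arguments and skew
  -- in two others vanishes.
  let D : R.tangent.Sec → R.tangent.Fib x → R.tangent.Fib x := fun Y v =>
    conn₀ R R₀ Y x v - (dir R R.tangent Y x v +
      app R.tangent R.tangent (christoffel X x (logDeriv R ρ x) (Y x)) v)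
  have symm : ∀ {Y Z : R.tangent.Sec}, R.tangent.IsSmooth Y → R.tangent.IsSmooth Z →
      D Y (Z x) = D Z (Y x) := by
    intro Y Z hY hZ
    have h1 := dir_sub_dir_symm (R₀ := R₀) hY hZ x
    have h2 : app R.tangent R.tangent (christoffel X x (logDeriv R ρ x) (Y x)) (Z x) =
        app R.tangent R.tangent (christoffel X x (logDeriv R ρ x) (Z x)) (Y x) := by
      rw [app_christoffel, app_christoffel, hI.symm, add_comm (_ • Y x)]
    simp only [D]
    rw [h2, ← sub_sub, ← sub_sub, sub_left_inj]
    exact sub_eq_sub_iff_sub_eq_sub.1 h1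
  have skew : ∀ {Y Z : R.tangent.Sec}, R.tangent.IsSmooth Y → R.tangent.IsSmooth Z →
      ∀ v, R.tangent.inner x (D Y v) (Z x) + R.tangent.inner x (Y x) (D Z v) = 0 := by
    intro Y Z hY hZ v
    have h2 : ∀ y (v w : R.tangent.Fib y), R₀.tangent.inner y v w =
        (ρ y ^ 2)⁻¹ * R.tangent.inner y v w := fun y v w =>
      DFunLike.congr_fun (DFunLike.congr_fun (h y) v) w
    have h1 : der R (fun y => (ρ y ^ 2)⁻¹ * R.tangent.inner y (Y y) (Z y)) x v =
        (ρ x ^ 2)⁻¹ * R.tangent.inner x (conn₀ R R₀ Y x v) (Z x) +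
          (ρ x ^ 2)⁻¹ * R.tangent.inner x (Y x) (conn₀ R R₀ Z x v) := by
      have := hT₀.der_inner (s := Y) (t := Z) hY hZ x v
      simp only [h2] at this
      exact this.trans (congrArg₂ (· + ·) (h2 x _ _) (h2 x _ _))
    have hc : ContMDiff (𝓡 n) 𝓘(ℝ, ℝ) ∞ (fun y => (ρ y ^ 2)⁻¹) :=
      (hρ.pow 2).inv₀ fun y => (pow_pos (hρ0 y) 2).ne'
    -- the derivative of `ρ⁻²`, obtained from `ρ⁻² ρ² = 1`
    have h3 : der R (fun y => (ρ y ^ 2)⁻¹ * (ρ y * ρ y)) x v = 0 := by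
      rw [← der_const (R := R) 1 x v]
      congr 2
      funext y
      have := (hρ0 y).ne'
      field_simp
    rw [der_mul (g := fun y => ρ y * ρ y) hc (hρ.mul hρ), der_mul hρ hρ] at h3
    rw [der_mul hc (hT.smooth_inner hY hZ), hT.der_inner hY hZ] at h1
    simp only [D, hI.sub_left, hI.sub_right, hI.add_left, hI.add_right, app_christoffel,
      hI.smul_left, hI.smul_right, hX.inner_sharp, hI.symm (Y x) (sharp X x _), pairing_logDeriv,
      hI.symm (Y x) v]
    have hr := (hρ0 x).ne'
    field_simp at h1 h3 ⊢
    linear_combination -ρ x * h1 + R.tangent.inner x (Y x) (Z x) * h3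
  have zero : ∀ {Y Z W : R.tangent.Sec}, R.tangent.IsSmooth Y → R.tangent.IsSmooth Z →
      R.tangent.IsSmooth W → R.tangent.inner x (D Y (Z x)) (W x) = 0 := by
    intro Y Z W hY hZ hW
    have e1 := skew hY hW (Z x)
    have e2 := skew hW hZ (Y x)
    have e3 := skew hZ hY (W x)
    rw [symm hY hZ] at e1 ⊢
    rw [symm hW hY] at e2
    rw [symm hZ hW] at e3
    rw [hI.symm (Y x)] at e1
    rw [hI.symm (W x)] at e2
    rw [hI.symm (Z x)] at e3
    linarith
  rw [← sub_eq_zero]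
  obtain ⟨Z, hZ, rfl⟩ := hT.exists_extend x v
  refine hI.ext fun w => ?_
  obtain ⟨W, hW, rfl⟩ := hT.exists_extend x w
  rw [hI.symm, hI.zero_right]
  exact zero hY hZ hW

/-- The bundle underlying `A` with another metric and another connection. -/
def withMetric (A : MetricBundle n M) (i : ∀ x, A.Fib x → A.Fib x → ℝ)
    (c : (∀ x, A.Fib x) → ∀ x, TangentSpace (𝓡 n) x →L[ℝ] A.Fib x) : MetricBundle n M :=
  { A with inner := i, cov := c }

/-- The metric `i` and the connection `c` on `A` behave under the passage from `g` to the metric of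
`R₀` as on `d`-fold covariant tensors: `i = ρ^{2d} ⟨·,·⟩`, and `c` differs from the connection of `A`
by a parallel bilinear expression `μ` in `θ` and the section. -/
structure IsConformal (R R₀ : RiemannianStructure n M) (ρ : M → ℝ) (θ : (cotangent R).Sec) (d : ℕ)
    (A : MetricBundle n M) (i : ∀ x, A.Fib x → A.Fib x → ℝ)
    (c : (∀ x, A.Fib x) → ∀ x, TangentSpace (𝓡 n) x →L[ℝ] A.Fib x)
    (μ : ∀ x, (cotangent R).Fib x →ₗ[ℝ] A.Fib x →ₗ[ℝ] (Hom R.tangent A).Fib x) : Prop where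
  geometric : IsGeometric R A
  geometric₀ : IsGeometric R₀ (A.withMetric i c)
  bilin : IsParallelBilin R (cotangent R) A (Hom R.tangent A) μ
  inner : ∀ x (ξ : A.Fib x), i x ξ ξ = ρ x ^ (2 * d) * A.inner x ξ ξ
  cov : ∀ s, A.IsSmooth s → ∀ x, c s x = grad R A s x + μ x (θ x) (s x)

/-- Functions are tensors of degree `0`: their metric and connection do not depend on `g`. -/
lemma isConformal_trivial (R R₀ : RiemannianStructure n M) (ρ : M → ℝ) (θ : (cotangent R).Sec) :
    IsConformal R R₀ ρ θ 0 (trivial n M ℝ) (trivial n M ℝ).inner (trivial n M ℝ).cov 0 where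
  geometric := isGeometric_trivial R
  geometric₀ := isGeometric_trivial R₀
  bilin :=
    { smooth := fun _ _ => isSmooth_zero _
      dir := fun _ _ x v => by
        refine ((R.isGeometric_tangent.hom (isGeometric_trivial R)).dir_zero x v).trans ?_
        simp
      bound := ⟨0, le_rfl, fun x ξ η => by
        rw [zero_mul]
        exact ((R.isGeometric_tangent.hom (isGeometric_trivial R)).norm_zero x).le⟩ }
  inner x ξ := by rw [mul_zero, pow_zero, one_mul]
  cov s hs x := (add_zero (grad R (trivial n M ℝ) s x)).symm

section

variable {ρ : M → ℝ} {θ : (cotangent R).Sec} {d : ℕ} {i : ∀ x, A.Fib x → A.Fib x → ℝ}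
  {c : (∀ x, A.Fib x) → ∀ x, TangentSpace (𝓡 n) x →L[ℝ] A.Fib x}
  {μ : ∀ x, (cotangent R).Fib x →ₗ[ℝ] A.Fib x →ₗ[ℝ] (Hom R.tangent A).Fib x}

/-- Passing from `A` to `T^*M ⊗ A` raises the degree by one. -/
lemma IsConformal.hom (hX : IsParseval R X)
    (h : ∀ x, R₀.metric.inner x = (ρ x ^ 2)⁻¹ • R.metric.inner x)
    (hρ : ContMDiff (𝓡 n) 𝓘(ℝ, ℝ) ∞ ρ) (hρ0 : ∀ x, 0 < ρ x)
    (hA : IsConformal R R₀ ρ (logDeriv R ρ) d A i c μ) :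
    IsConformal R R₀ ρ (logDeriv R ρ) (d + 1) (Hom R.tangent A)
      (Hom R₀.tangent (A.withMetric i c)).inner (Hom R₀.tangent (A.withMetric i c)).cov
      (homChristoffel X μ) where
  geometric := R.isGeometric_tangent.hom hA.geometric
  geometric₀ := R₀.isGeometric_tangent.hom hA.geometric₀
  bilin := hX.isParallelBilin_homChristoffel hA.geometric hA.bilin
  inner x φ := by
    have hT := R.isGeometric_tangent
    have hI := hT.isInner x
    have hT₀ := R₀.isGeometric_tangent
    obtain ⟨o, -, ho⟩ := hT.exists_orthonormal x
    have h2 : ∀ v w : R.tangent.Fib x, R₀.tangent.inner x v w =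
        (ρ x ^ 2)⁻¹ * R.tangent.inner x v w := fun v w =>
      DFunLike.congr_fun (DFunLike.congr_fun (h x) v) w
    have hr := (hρ0 x).ne'
    -- the vectors `ρ • o k` form an orthonormal basis for `ρ⁻² g`
    have ho' : ∀ v : R.tangent.Fib x, ∑ k, R₀.tangent.inner x (ρ x • o k : R.tangent.Fib x) v •
        (ρ x • o k : R.tangent.Fib x) = v := fun v => by
      conv_rhs => rw [← ho v]
      refine Finset.sum_congr rfl fun k _ => ?_
      rw [h2, hI.smul_left, smul_smul]
      congr 1
      field_simp
    have h3 := hT₀.inner_hom hA.geometric₀ (x := x) (s := fun k => (ρ x • o k : R.tangent.Fib x))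
      (t := fun k => (ρ x • o k : R.tangent.Fib x)) ho' φ φ
    refine h3.trans ?_
    rw [hT.inner_hom hA.geometric ho, Finset.mul_sum]
    refine Finset.sum_congr rfl fun k _ => (hA.inner x (app R.tangent A φ (ρ x • o k))).trans ?_
    rw [map_smul, (hA.geometric.isInner x).smul_left, (hA.geometric.isInner x).smul_right]
    ring
  cov φ hφ x := by
    have hT := R.isGeometric_tangent
    have hT₀ := R₀.isGeometric_tangent
    have hG := hA.geometric
    refine hom_ext R.tangent (Hom R.tangent A) fun Z => hT.hom_ext_smooth fun Y hY => ?_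
    rw [map_add, LinearMap.add_apply, map_add, LinearMap.add_apply, app_homChristoffel, app_grad,
      hT.app_dir hG hφ hY]
    have h1 := hT₀.app_dir hA.geometric₀ (a := φ) (s := Y) hφ hY x Z
    have h2 : (dir R₀ (A.withMetric i c) (fun y => app R.tangent A (φ y) (Y y)) x Z : A.Fib x) =
        dir R A (fun y => app R.tangent A (φ y) (Y y)) x Z +
          app R.tangent A (μ x (logDeriv R ρ x) (app R.tangent A (φ x) (Y x))) Z :=
      congrArg (fun a => app R.tangent A a Z) (hA.cov _ (hφ.app hY) x)
    have h3 : app R.tangent A (φ x) (conn₀ R R₀ Y x Z) = app R.tangent A (φ x)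
        (dir R R.tangent Y x Z) + app R.tangent A (φ x)
        (app R.tangent R.tangent (christoffel X x (logDeriv R ρ x) (Y x)) Z) := by
      rw [hX.conn_conformal h hρ hρ0 hY, map_add]
    refine h1.trans ((congrArg₂ (fun a b : A.Fib x => a - b) h2 h3).trans ?_)
    abel

/-- Bounds for the covariant derivatives of `ρ⁻² g` imply weighted bounds for those of `g`. -/
lemma IsConformal.hasBounds (hX : IsParseval R X)
    (h : ∀ x, R₀.metric.inner x = (ρ x ^ 2)⁻¹ • R.metric.inner x)
    (hρ : ContMDiff (𝓡 n) 𝓘(ℝ, ℝ) ∞ ρ) (hρ0 : ∀ x, 0 < ρ x) : ∀ {J : ℕ},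
    (∀ j < J, HasBounds R ρ j 1 (cotangent R) (logDeriv R ρ)) →
    ∀ {d e : ℕ} {A : MetricBundle n M} {i : ∀ x, A.Fib x → A.Fib x → ℝ}
      {c : (∀ x, A.Fib x) → ∀ x, TangentSpace (𝓡 n) x →L[ℝ] A.Fib x}
      {μ : ∀ x, (cotangent R).Fib x →ₗ[ℝ] A.Fib x →ₗ[ℝ] (Hom R.tangent A).Fib x},
    IsConformal R R₀ ρ (logDeriv R ρ) d A i c μ → ∀ {s : A.Sec}, A.IsSmooth s →
    HasBounds R₀ (fun _ => 1) J e (A.withMetric i c) s → HasBounds R ρ J d A s := by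
  intro J
  have key : ∀ {d e : ℕ} {A : MetricBundle n M} {i : ∀ x, A.Fib x → A.Fib x → ℝ}
      {c : (∀ x, A.Fib x) → ∀ x, TangentSpace (𝓡 n) x →L[ℝ] A.Fib x}
      {μ : ∀ x, (cotangent R).Fib x →ₗ[ℝ] A.Fib x →ₗ[ℝ] (Hom R.tangent A).Fib x},
      IsConformal R R₀ ρ (logDeriv R ρ) d A i c μ → ∀ {s : A.Sec},
      HasBounds R₀ (fun _ => 1) 0 e (A.withMetric i c) s → HasBounds R ρ 0 d A s := by
    rintro d e A i c μ hA s ⟨C, hC⟩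
    refine ⟨C, fun x => (Eq.le ?_).trans (hC x)⟩
    have h1 : (A.withMetric i c).norm x (s x) = ρ x ^ d * A.norm x (s x) := by
      refine (congrArg Real.sqrt (hA.inner x (s x))).trans ?_
      rw [pow_mul', Real.sqrt_mul (sq_nonneg _), Real.sqrt_sq (pow_pos (hρ0 x) d).le]
      rfl
    rw [h1, one_pow, one_mul]
  induction J with
  | zero => exact fun _ _ _ _ _ _ _ hA _ _ hs => key hA hs
  | succ J ih =>
    intro hθ d e A i c μ hA s hs hb
    have hG := hA.geometric
    have hTG := R.isGeometric_tangent.hom hG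
    have hθs := isSmooth_logDeriv (R := R) hρ hρ0
    refine ⟨key hA hb.1, ?_⟩
    -- with respect to `g` the derivative of `s` is `∇⁰ s - μ(θ, s)`, where the first term is
    -- bounded by assumption and the second by the Leibniz rule
    have h1 := ih (fun j hj => hθ j (by omega)) hA hs hb.of_succ
    have hg : (Hom R.tangent A).IsSmooth
        (fun x => grad R A s x + μ x (logDeriv R ρ x) (s x)) :=
      (hG.isSmooth_grad hs).add (hA.bilin.smooth hθs hs)
    have e1 : grad R₀ (A.withMetric i c) s = fun x => grad R A s x + μ x (logDeriv R ρ x) (s x) :=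
      funext fun x => hA.cov s hs x
    have h2 : HasBounds R ρ J (d + 1) (Hom R.tangent A)
        (fun x => grad R A s x + μ x (logDeriv R ρ x) (s x)) := by
      refine ih (fun j hj => hθ j (by omega)) (e := e + 1) (hA.hom hX h hρ hρ0) hg ?_
      rw [← e1]
      exact hb.2
    have h3 : HasBounds R ρ J (d + 1) (Hom R.tangent A) (fun x => μ x (logDeriv R ρ x) (s x)) := by
      rw [add_comm]
      exact HasBounds.bilin hρ0 (R.isGeometric_tangent.hom (isGeometric_trivial R)) hG hTG hA.bilin
        hθs hs (hθ J (Nat.lt_succ_self J)) h1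
    have h4 := HasBounds.add hρ0 hTG hg (hA.bilin.smooth hθs hs).neg h2
      (h3.neg hTG (hA.bilin.smooth hθs hs))
    have e2 : grad R A s = fun x => grad R A s x + μ x (logDeriv R ρ x) (s x) +
        (-fun x => μ x (logDeriv R ρ x) (s x)) x := funext fun x => by
      rw [Pi.neg_apply, add_neg_cancel_right]
    rw [e2]
    exact h4

/-- An admissible weight for `ρ⁻² g`, where `ρ` is itself admissible, has a logarithmic derivative
with weighted bounds for `g`. -/
theorem hasBounds_logDeriv (hX : IsParseval R X)
    (h : ∀ x, R₀.metric.inner x = (ρ x ^ 2)⁻¹ • R.metric.inner x) (hρ : R₀.IsAdmissible ρ)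
    {f : M → ℝ} (hf : R₀.IsAdmissible f) (J : ℕ) :
    HasBounds R ρ J 1 (cotangent R) (logDeriv R f) := by
  have hC := (isConformal_trivial R R₀ ρ (logDeriv R ρ)).hom hX h hρ.1 hρ.2.1
  -- first `f = ρ`: the bounds for the derivatives of `ρ⁻¹ dρ` of order below `j` give those of
  -- order `j`
  have hθ : ∀ J, ∀ j < J, HasBounds R ρ j 1 (cotangent R) (logDeriv R ρ) := by
    intro J
    induction J with
    | zero => exact fun j hj => absurd hj (Nat.not_lt_zero j)
    | succ J ih =>
      intro j hj
      exact hC.hasBounds hX h hρ.1 hρ.2.1 (fun k hk => ih k (by omega)) (isSmooth_logDeriv hρ.1 hρ.2.1)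
        ((isTotallyBounded_iff.1 hρ.2.2).2 j)
  exact hC.hasBounds hX h hρ.1 hρ.2.1 (hθ J) (isSmooth_logDeriv hf.1 hf.2.1)
    ((isTotallyBounded_iff.1 hf.2.2).2 J)

end

end

section

variable {n : ℕ} {M : Type*} [TopologicalSpace M] [ChartedSpace (EuclideanSpace ℝ (Fin n)) M]
  [IsManifold (𝓡 n) ∞ M] [T2Space M] {R : RiemannianStructure n M} {A B : MetricBundle n M}
  {ι : Type*} [Fintype ι] {X : ι → R.tangent.Sec}

open IsGeometric

/-! ### Skew parallel endomorphisms -/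

/-- A skew parallel endomorphism of a bundle. -/
structure IsSkew (R : RiemannianStructure n M) (A : MetricBundle n M)
    (L : ∀ x, A.Fib x →ₗ[ℝ] A.Fib x) : Prop where
  parallel : IsParallel R A A L
  skew : ∀ x ξ η, A.inner x (L x ξ) η = -A.inner x ξ (L x η)

section Skew

variable {L : ∀ x, A.Fib x →ₗ[ℝ] A.Fib x}

lemma IsSkew.postcomp (hA : IsGeometric R A) (hL : IsSkew R A L) :
    IsSkew R (Hom R.tangent A) (postcomp R.tangent L) where
  parallel := hL.parallel.postcomp R.isGeometric_tangent hA hA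
  skew x ξ η := by
    have hT := R.isGeometric_tangent
    obtain ⟨o, -, ho⟩ := hT.exists_orthonormal x
    rw [hT.inner_hom hA ho, hT.inner_hom hA ho, ← Finset.sum_neg_distrib]
    exact Finset.sum_congr rfl fun i _ => hL.skew x _ _

lemma IsSkew.tensMap (hA : IsGeometric R A) (hL : IsSkew R A L) :
    ∀ k, IsSkew R (A.tens R k) (tensMap R L k)
  | 0 => hL
  | k + 1 => (IsSkew.tensMap hA hL k).postcomp (R.isGeometric_tangent.tens hA k)

/-- Parallel endomorphisms commute with the codifferential. -/
lemma IsParallel.codiff_eq (hX : IsParseval R X) (hA : IsGeometric R A) (hL : IsParallel R A A L)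
    {φ : (Hom R.tangent A).Sec} (hφ : (Hom R.tangent A).IsSmooth φ) :
    codiff R A (fun x => MetricBundle.postcomp R.tangent L x (φ x)) = fun x => L x (codiff R A φ x) := by
  funext x
  rw [MetricBundle.codiff_eq (hX.expand x), MetricBundle.codiff_eq (hX.expand x), map_neg, map_sum]
  refine congrArg Neg.neg (Finset.sum_congr rfl fun i _ => ?_)
  rw [(hL.postcomp R.isGeometric_tangent hA hA).dir hφ]
  rfl

/-- Parallel endomorphisms commute with the formal adjoints `(∇^k)^*`. -/
lemma IsParallel.nablaStar_eq (hX : IsParseval R X) (hA : IsGeometric R A) (hL : IsParallel R A A L) :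
    ∀ {k : ℕ} {φ : (A.tens R k).Sec}, (A.tens R k).IsSmooth φ →
      A.nablaStar R k (fun x => MetricBundle.tensMap R L k x (φ x)) =
        fun x => L x (A.nablaStar R k φ x)
  | 0, _, _ => rfl
  | k + 1, φ, hφ => by
    have hk := R.isGeometric_tangent.tens hA k
    have h1 := (hL.tensMap hA hA k).codiff_eq hX hk hφ
    have h2 := IsParallel.nablaStar_eq hX hA hL (k := k) (hk.isSmooth_codiff hX hφ)
    exact (congrArg (A.nablaStar R k) h1).trans h2

variable [MeasurableSpace M] [BorelSpace M] [SecondCountableTopology M]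

/-- A skew parallel endomorphism commutes with weak derivatives: it can be moved to the test
section and back. -/
lemma IsWeakNabla.map_skew (hX : IsParseval R X) (hA : IsGeometric R A) (hL : IsSkew R A L) {k : ℕ}
    {u : A.Sec} {v : (A.tens R k).Sec} (h : A.IsWeakNabla R k u v) :
    A.IsWeakNabla R k (fun x => L x (u x)) (fun x => tensMap R L k x (v x)) := by
  have hk := R.isGeometric_tangent.tens hA k
  have hLk := hL.tensMap hA k
  refine ⟨h.1.linear hA hA fun s hs => hL.parallel.smooth hs,
    h.2.1.linear hk hk fun s hs => hLk.parallel.smooth hs, fun φ hφ => ?_⟩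
  have hφ' : (A.tens R k).IsTest (fun x => tensMap R L k x (φ x)) := by
    obtain ⟨h1, K, hK, hK'⟩ := hφ
    exact ⟨hLk.parallel.smooth h1, K, hK, fun x hx => by
      change tensMap R L k x (φ x) = 0
      rw [hK' x hx, map_zero]⟩
  simp only [hL.skew, hLk.skew]
  rw [integral_neg, integral_neg, h.2.2 _ hφ', hL.parallel.nablaStar_eq hX hA hφ.1]

end Skew

/-! ### The complex structure of a Hermitian bundle -/

section Complex

variable {F : Type*} [NormedAddCommGroup F] [NormedSpace ℂ F] [FiniteDimensional ℂ F]
  {E : M → Type*} [TopologicalSpace (TotalSpace F E)] [∀ x, NormedAddCommGroup (E x)]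
  [∀ x, InnerProductSpace ℂ (E x)] [FiberBundle F E] [VectorBundle ℂ F E] [VectorBundle ℝ F E]
  [ContMDiffVectorBundle ∞ F E (𝓡 n)] (H : HermitianStructure n F E)

/-- Multiplication by `i` on the fibres, as a linear map. -/
def mulILin (R : RiemannianStructure n M) (x : M) : H.bundle.Fib x →ₗ[ℝ] H.bundle.Fib x :=
  (mulI R H 0 x : H.bundle.Fib x →L[ℝ] H.bundle.Fib x).toLinearMap

omit [T2Space M] in
lemma tensMap_mulILin : ∀ k x (ξ : (H.bundle.tens R k).Fib x),
    tensMap R (mulILin H R) k x ξ = mulI R H k x ξ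
  | 0, _, _ => rfl
  | k + 1, x, ξ => hom_ext R.tangent (H.bundle.tens R k) fun v =>
      tensMap_mulILin k x (app R.tangent (H.bundle.tens R k) ξ v)

omit [T2Space M] in
lemma inner_mulILin (x : M) (ξ η : E x) :
    H.bundle.inner x ξ (mulILin H R x η) = -(Inner.inner ℂ (E := E x) ξ η).im := by
  change (Inner.inner ℂ (E := E x) ξ (Complex.I • η)).re = _
  rw [inner_smul_right, Complex.I_mul_re]

/-- Multiplication by `i` is parallel, since the connection is complex linear, and skew for the
real part of the Hermitian metric. -/
lemma isSkew_mulILin : IsSkew R H.bundle (mulILin H R) := by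
  have hA := H.isGeometric_bundle R
  have hs : ∀ x (ξ η : E x), H.bundle.inner x (mulILin H R x ξ) η =
      -H.bundle.inner x ξ (mulILin H R x η) := fun x ξ η => by
    rw [inner_mulILin, neg_neg]
    change (Inner.inner ℂ (E := E x) (Complex.I • ξ) η).re = _
    rw [inner_smul_left, Complex.conj_I, neg_mul, Complex.neg_re, Complex.I_mul_re, neg_neg]
  refine ⟨⟨fun {s} hs' => hA.isSmooth_of_inner fun t ht => ?_, fun {s} hs' x v => ?_,
    ⟨1, zero_le_one, fun x ξ => ?_⟩⟩, hs⟩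
  · exact (Complex.imCLM.contMDiff.comp (H.smooth_inner t s ht hs')).neg.congr
      fun x => inner_mulILin H x (t x) (s x)
  · exact H.complex_conn x v s (hs'.mdifferentiableAt (by simp))
  · rw [one_mul]
    have h1 : ∀ ξ : E x, (Inner.inner ℂ (Complex.I • ξ) (Complex.I • ξ)).re =
        (Inner.inner ℂ ξ ξ).re := fun ξ => by
      rw [inner_smul_left, inner_smul_right, Complex.conj_I, ← mul_assoc, neg_mul, Complex.I_mul_I,
        neg_neg, one_mul]
    exact Real.sqrt_le_sqrt (h1 ξ).le

lemma isSkew_mulI (k : ℕ) : IsSkew R (H.bundle.tens R k)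
    (fun x => (mulI R H k x : (H.bundle.tens R k).Fib x →L[ℝ] (H.bundle.tens R k).Fib x).toLinearMap) := by
  have h := (isSkew_mulILin (R := R) H).tensMap (H.isGeometric_bundle R) k
  have e : tensMap R (mulILin H R) k = fun x =>
      (mulI R H k x : (H.bundle.tens R k).Fib x →L[ℝ] (H.bundle.tens R k).Fib x).toLinearMap :=
    funext fun x => LinearMap.ext fun ξ => tensMap_mulILin H k x ξ
  rwa [e] at h

omit [T2Space M] in
lemma mulI_mulI : ∀ k x (ξ : (H.bundle.tens R k).Fib x), mulI R H k x (mulI R H k x ξ) = -ξ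
  | 0, x, ξ =>
    have h : ∀ ζ : E x, Complex.I • Complex.I • ζ = -ζ := fun ζ => by
      rw [smul_smul, Complex.I_mul_I, neg_one_smul]
    h ξ
  | k + 1, x, ξ => hom_ext R.tangent (H.bundle.tens R k) fun v =>
      (mulI_mulI k x (app R.tangent (H.bundle.tens R k) ξ v)).trans
        (DFunLike.congr_fun (map_neg (app R.tangent (H.bundle.tens R k)) ξ) v).symm

variable {k : ℕ} {x : M}

lemma herm_add_left (ξ ξ' η : (H.bundle.tens R k).Fib x) :
    herm R H k x (ξ + ξ') η = herm R H k x ξ η + herm R H k x ξ' η := by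
  have hI := (R.isGeometric_tangent.tens (H.isGeometric_bundle R) k).isInner x
  simp only [herm, hI.add_left, Complex.ofReal_add]
  ring

lemma herm_add_right (ξ η η' : (H.bundle.tens R k).Fib x) :
    herm R H k x ξ (η + η') = herm R H k x ξ η + herm R H k x ξ η' := by
  have hI := (R.isGeometric_tangent.tens (H.isGeometric_bundle R) k).isInner x
  simp only [herm, map_add, hI.add_right, Complex.ofReal_add]
  ring

/-- Multiplication by complex numbers on the fibres of `T^{*⊗k}M ⊗ E`. -/
def cmul (R : RiemannianStructure n M) (k : ℕ) (x : M) (z : ℂ) (ξ : (H.bundle.tens R k).Fib x) :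
    (H.bundle.tens R k).Fib x := z.re • ξ + z.im • mulI R H k x ξ

lemma herm_cmul_left (z : ℂ) (ξ η : (H.bundle.tens R k).Fib x) :
    herm R H k x (cmul H R k x z ξ) η = z * herm R H k x ξ η := by
  have hI := (R.isGeometric_tangent.tens (H.isGeometric_bundle R) k).isInner x
  have h1 := (isSkew_mulI (R := R) H k).skew x ξ η
  have h2 := (isSkew_mulI (R := R) H k).skew x ξ (mulI R H k x η)
  simp only [ContinuousLinearMap.coe_coe, mulI_mulI, hI.neg_right, neg_neg] at h1 h2
  simp only [herm, cmul, hI.add_left, hI.smul_left, h1, h2]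
  apply Complex.ext <;> simp
  ring

lemma herm_cmul_right (z : ℂ) (ξ η : (H.bundle.tens R k).Fib x) :
    herm R H k x ξ (cmul H R k x z η) = (starRingEnd ℂ) z * herm R H k x ξ η := by
  have hI := (R.isGeometric_tangent.tens (H.isGeometric_bundle R) k).isInner x
  simp only [herm, cmul, map_add, map_smul, mulI_mulI, hI.add_right, hI.smul_right, hI.neg_right]
  apply Complex.ext <;> simp

lemma norm_mulI (ξ : (H.bundle.tens R k).Fib x) :
    (H.bundle.tens R k).norm x (mulI R H k x ξ) = (H.bundle.tens R k).norm x ξ := by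
  have hI := (R.isGeometric_tangent.tens (H.isGeometric_bundle R) k).isInner x
  have h2 := (isSkew_mulI (R := R) H k).skew x ξ (mulI R H k x ξ)
  simp only [ContinuousLinearMap.coe_coe, mulI_mulI, hI.neg_right, neg_neg] at h2
  rw [norm, norm, h2]

lemma norm_herm_le (ξ η : (H.bundle.tens R k).Fib x) :
    ‖herm R H k x ξ η‖ ≤ 2 * ((H.bundle.tens R k).norm x ξ * (H.bundle.tens R k).norm x η) := by
  have hk := R.isGeometric_tangent.tens (H.isGeometric_bundle R) k
  have h1 := hk.abs_inner_le x ξ η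
  have h2 := hk.abs_inner_le x ξ (mulI R H k x η)
  rw [norm_mulI] at h2
  refine (_root_.norm_add_le _ _).trans ?_
  rw [norm_mul, Complex.norm_I, one_mul, Complex.norm_real, Complex.norm_real, Real.norm_eq_abs,
    Real.norm_eq_abs]
  linarith

omit [T2Space M] in
lemma app_cmul {F' : Type*} [NormedAddCommGroup F'] [NormedSpace ℂ F'] [FiniteDimensional ℂ F']
    {E' : M → Type*} [TopologicalSpace (TotalSpace F' E')] [∀ x, NormedAddCommGroup (E' x)]
    [∀ x, InnerProductSpace ℂ (E' x)] [FiberBundle F' E'] [VectorBundle ℂ F' E']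
    [VectorBundle ℝ F' E'] [ContMDiffVectorBundle ∞ F' E' (𝓡 n)] (H' : HermitianStructure n F' E')
    {i j : ℕ} {a : ∀ x, (H.bundle.tens R i).Fib x →L[ℝ] (H'.bundle.tens R j).Fib x}
    (ha : ∀ x ξ, a x (mulI R H i x ξ) = mulI R H' j x (a x ξ)) (z : ℂ)
    (ξ : (H.bundle.tens R i).Fib x) : a x (cmul H R i x z ξ) = cmul H' R j x z (a x ξ) := by
  rw [cmul, map_add, map_smul, map_smul, ha, cmul]

variable [MeasurableSpace M] [BorelSpace M] [SecondCountableTopology M]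

/-- Weak derivatives are complex linear. -/
lemma IsWeakNabla.cmul_add (hX : IsParseval R X) {u u' : ∀ x, E x}
    {v v' : (H.bundle.tens R k).Sec} (h : H.bundle.IsWeakNabla R k u v)
    (h' : H.bundle.IsWeakNabla R k u' v') (z : ℂ) :
    H.bundle.IsWeakNabla R k (fun x => z • u x + u' x)
      (fun x => cmul H R k x z (v x) + v' x) := by
  have hA := H.isGeometric_bundle R
  have h1 := h.map_skew hX hA (isSkew_mulILin H)
  have h2 := ((h.smul hA z.re).add hX hA (h1.smul hA z.im)).add hX hA h'
  simp only [tensMap_mulILin] at h2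
  have e : (fun x => z • u x + u' x) =
      fun x => z.re • u x + z.im • Complex.I • u x + u' x := funext fun x => by
    refine congrArg (· + u' x) ?_
    conv_lhs => rw [← Complex.re_add_im z, add_smul, mul_smul, Complex.coe_smul, Complex.coe_smul]
  rw [e]
  exact h2

end Complex

end

section

variable {n : ℕ} {M : Type*} [TopologicalSpace M] [ChartedSpace (EuclideanSpace ℝ (Fin n)) M]
  [IsManifold (𝓡 n) ∞ M] [T2Space M] [MeasurableSpace M] [BorelSpace M]
  [SecondCountableTopology M] {R : RiemannianStructure n M}
  {ι : Type*} [Fintype ι] {X : ι → R.tangent.Sec}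
  {F : Type*} [NormedAddCommGroup F] [NormedSpace ℂ F] [FiniteDimensional ℂ F]
  {E : M → Type*} [TopologicalSpace (TotalSpace F E)] [∀ x, NormedAddCommGroup (E x)]
  [∀ x, InnerProductSpace ℂ (E x)] [FiberBundle F E] [VectorBundle ℂ F E] [VectorBundle ℝ F E]
  [ContMDiffVectorBundle ∞ F E (𝓡 n)]
  {F' : Type*} [NormedAddCommGroup F'] [NormedSpace ℂ F'] [FiniteDimensional ℂ F']
  {E' : M → Type*} [TopologicalSpace (TotalSpace F' E')] [∀ x, NormedAddCommGroup (E' x)]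
  [∀ x, InnerProductSpace ℂ (E' x)] [FiberBundle F' E'] [VectorBundle ℂ F' E']
  [VectorBundle ℝ F' E'] [ContMDiffVectorBundle ∞ F' E' (𝓡 n)]
  {H : HermitianStructure n F E} {H' : HermitianStructure n F' E'} {m : ℕ}
  {a : ∀ i j x, (H.bundle.tens R i).Fib x →L[ℝ] (H'.bundle.tens R j).Fib x}

open IsGeometric

/-! ### The Dirichlet form on Sobolev sections -/

/-- The bounds for the exponents `0` and `2 m` imply those for the exponents in between. -/
lemma weight_le {f h ρ C : ℝ} (hf : 0 < f) (hh : 0 < h) (hρ : 0 < ρ) {m l : ℕ} (hl : l ≤ 2 * m)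
    (h1 : f ≤ C * h) (h2 : f ≤ C * (h * ρ ^ (2 * m))) : f ≤ C * (h * ρ ^ l) := by
  have hC : 0 ≤ C := by
    by_contra! hC
    nlinarith
  rcases le_total 1 ρ with h3 | h3
  · refine h1.trans (mul_le_mul_of_nonneg_left ?_ hC)
    exact le_mul_of_one_le_right hh.le (one_le_pow₀ h3)
  · refine h2.trans (mul_le_mul_of_nonneg_left (mul_le_mul_of_nonneg_left ?_ hh.le) hC)
    exact pow_le_pow_of_le_one hρ.le h3 hl

lemma aestronglyMeasurable_herm {k : ℕ} {ξ η : (H.bundle.tens R k).Sec}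
    (hξ : (H.bundle.tens R k).IsMeas R ξ) (hη : (H.bundle.tens R k).IsMeas R η) :
    AEStronglyMeasurable (fun x => herm R H k x (ξ x) (η x)) R.vol := by
  have hk := R.isGeometric_tangent.tens (H.isGeometric_bundle R) k
  have hJ := hη.map hk hk fun t ht => (isSkew_mulI (R := R) H k).parallel.smooth ht
  exact (Complex.continuous_ofReal.comp_aestronglyMeasurable
    (hk.aestronglyMeasurable_inner hξ hη)).add ((Complex.continuous_ofReal.comp_aestronglyMeasurable
      (hk.aestronglyMeasurable_inner hξ hJ)).const_mul Complex.I)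

omit [MeasurableSpace M] [BorelSpace M] [SecondCountableTopology M] in
lemma _root_.NablaSobolev.IsCoeff.exists_bound {i j : ℕ}
    {b : ∀ x, (H.bundle.tens R i).Fib x →L[ℝ] (H'.bundle.tens R j).Fib x}
    (hb : IsCoeff R H H' i j b) : ∃ C : ℝ, 0 ≤ C ∧ ∀ x ξ,
      (H'.bundle.tens R j).norm x (b x ξ) ≤ C * (H.bundle.tens R i).norm x ξ := by
  obtain ⟨C, hC⟩ := ((isTotallyBounded_iff.1 hb.1).2 0).zeroth
  refine ⟨|C|, abs_nonneg _, fun x ξ => ?_⟩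
  have h1 := (R.isGeometric_tangent.tens (H.isGeometric_bundle R) i).norm_app_le
    (R.isGeometric_tangent.tens (H'.isGeometric_bundle R) j) (x := x) (b x) ξ
  have h2 := hC x
  rw [one_pow, one_mul] at h2
  exact h1.trans (mul_le_mul_of_nonneg_right (h2.trans (le_abs_self _)) (norm_nonneg _ _))

/-- The conditions on the weights `f`, `h` and `ρ` for the metric `g` itself: they are those for
admissible weights of `ρ⁻² g`. -/
structure IsWeightTriple (R : RiemannianStructure n M) (m : ℕ) (f h ρ : M → ℝ) : Prop where
  smooth_f : ContMDiff (𝓡 n) 𝓘(ℝ, ℝ) ∞ f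
  smooth_h : ContMDiff (𝓡 n) 𝓘(ℝ, ℝ) ∞ h
  continuous_ρ : Continuous ρ
  pos_f : ∀ x, 0 < f x
  pos_h : ∀ x, 0 < h x
  pos_ρ : ∀ x, 0 < ρ x
  bounds_f : ∀ J, HasBounds R ρ J 1 (cotangent R) (logDeriv R f)
  bounds_h : ∀ J, HasBounds R ρ J 1 (cotangent R) (logDeriv R h)
  le : ∃ C : ℝ, ∀ x, f x ≤ C * h x ∧ f x ≤ C * (h x * ρ x ^ (2 * m))

omit [T2Space M] [MeasurableSpace M] [BorelSpace M] [SecondCountableTopology M] in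
/-- The weight `h⁻¹` is as good as `h`. -/
lemma logDeriv_inv {h : M → ℝ} (hh : ContMDiff (𝓡 n) 𝓘(ℝ, ℝ) ∞ h) (h0 : ∀ x, 0 < h x) :
    logDeriv R h⁻¹ = fun x => -logDeriv R h x := by
  funext x
  refine hom_ext _ _ fun v => ?_
  have h1 : der R (fun y => h y * h⁻¹ y) x v = 0 := by
    rw [← der_const (R := R) 1 x v]
    congr 2
    funext y
    exact mul_inv_cancel₀ (h0 y).ne'
  rw [der_mul (g := h⁻¹) hh (hh.inv₀ fun y => (h0 y).ne')] at h1
  change (h⁻¹ x)⁻¹ * der R h⁻¹ x v = -((h x)⁻¹ * der R h x v)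
  have := (h0 x).ne'
  simp only [Pi.inv_apply, inv_inv] at h1 ⊢
  field_simp at h1 ⊢
  linarith

variable {f h ρ : M → ℝ}

/-- Pointwise bounds for the first argument of the form. -/
lemma IsWeightTriple.exists_bound_left (hX : IsParseval R X) (hw : IsWeightTriple R m f h ρ)
    {A : MetricBundle n M} (hA : IsGeometric R A) :
    ∃ C : ℝ, 0 ≤ C ∧ ∀ u, A.MemSobolev R f ρ m u → ∀ k ≤ m,
      A.IsWeakNabla R k u (A.weakNabla R k u) ∧
      ∀ᵐ x ∂(R.vol), (f x)⁻¹ * ρ x ^ k * (A.tens R k).norm x (A.weakNabla R k u x) ≤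
        C * sobolevDensity R A f ρ m u x :=
  exists_bound_weakNabla hX hA hw.pos_ρ hw.smooth_f hw.pos_f
    (isSmooth_logDeriv hw.smooth_f hw.pos_f) (fun _ => rfl) hw.bounds_f m

/-- Pointwise bounds for the second argument of the form, which has the weight `h⁻¹`. -/
lemma IsWeightTriple.exists_bound_right (hX : IsParseval R X) (hw : IsWeightTriple R m f h ρ)
    {A : MetricBundle n M} (hA : IsGeometric R A) :
    ∃ C : ℝ, 0 ≤ C ∧ ∀ u, A.MemSobolev R h⁻¹ ρ m u → ∀ k ≤ m,
      A.IsWeakNabla R k u (A.weakNabla R k u) ∧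
      ∀ᵐ x ∂(R.vol), (h⁻¹ x)⁻¹ * ρ x ^ k * (A.tens R k).norm x (A.weakNabla R k u x) ≤
        C * sobolevDensity R A h⁻¹ ρ m u x := by
  have hhi : ContMDiff (𝓡 n) 𝓘(ℝ, ℝ) ∞ h⁻¹ := hw.smooth_h.inv₀ fun x => (hw.pos_h x).ne'
  refine exists_bound_weakNabla hX hA hw.pos_ρ hhi (fun x => inv_pos.2 (hw.pos_h x))
    (isSmooth_logDeriv hhi fun x => inv_pos.2 (hw.pos_h x)) (fun _ => rfl) (fun J => ?_) m
  rw [logDeriv_inv hw.smooth_h hw.pos_h]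
  exact (hw.bounds_h J).neg (R.isGeometric_tangent.hom (isGeometric_trivial R))
    (isSmooth_logDeriv hw.smooth_h hw.pos_h)

/-- The integrand of the Dirichlet form is bounded by a product of two square integrable functions. -/
lemma exists_bound_weakBidiff (hX : IsParseval R X) (hw : IsWeightTriple R m f h ρ)
    (ha : ∀ i ≤ m, ∀ j ≤ m, IsCoeff R H H' i j (a i j)) :
    ∃ C : ℝ, 0 ≤ C ∧ ∀ u w, H.bundle.MemSobolev R f ρ m u → H'.bundle.MemSobolev R h⁻¹ ρ m w →
      ∀ᵐ x ∂(R.vol), ‖weakBidiff R H H' m a u w x‖ ≤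
        C * (sobolevDensity R H.bundle f ρ m u x * sobolevDensity R H'.bundle h⁻¹ ρ m w x) := by
  have hA := H.isGeometric_bundle R
  have hB := H'.isGeometric_bundle R
  obtain ⟨C₁, hC₁, h₁⟩ := hw.exists_bound_left hX hA
  obtain ⟨C₂, hC₂, h₂⟩ := hw.exists_bound_right hX hB
  obtain ⟨C₀, h₀⟩ := hw.le
  choose! K hK hK' using fun i hi j hj => (ha i hi j hj).exists_bound
  refine ⟨∑ i ∈ Finset.range (m + 1), ∑ j ∈ Finset.range (m + 1), 2 * (K i j * |C₀| * (C₁ * C₂)),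
    Finset.sum_nonneg fun i hi => Finset.sum_nonneg fun j hj => ?_, fun u w hu hv => ?_⟩
  · have := hK i (Nat.lt_succ_iff.1 (Finset.mem_range.1 hi)) j (Nat.lt_succ_iff.1 (Finset.mem_range.1 hj))
    positivity
  have e₁ : ∀ᵐ x ∂(R.vol), ∀ i, i ≤ m → (f x)⁻¹ * ρ x ^ i * (H.bundle.tens R i).norm x
      (H.bundle.weakNabla R i u x) ≤ C₁ * sobolevDensity R H.bundle f ρ m u x := by
    refine ae_all_iff.2 fun i => ?_
    by_cases hi : i ≤ m
    · filter_upwards [(h₁ u hu i hi).2] with x hx using fun _ => hx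
    · exact .of_forall fun x h => absurd h hi
  have e₂ : ∀ᵐ x ∂(R.vol), ∀ j, j ≤ m → (h⁻¹ x)⁻¹ * ρ x ^ j * (H'.bundle.tens R j).norm x
      (H'.bundle.weakNabla R j w x) ≤ C₂ * sobolevDensity R H'.bundle h⁻¹ ρ m w x := by
    refine ae_all_iff.2 fun j => ?_
    by_cases hj : j ≤ m
    · filter_upwards [(h₂ w hv j hj).2] with x hx using fun _ => hx
    · exact .of_forall fun x h => absurd h hj
  filter_upwards [e₁, e₂] with x hx₁ hx₂
  rw [weakBidiff, bidiffForm, Finset.sum_mul]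
  refine (_root_.norm_sum_le _ _).trans (Finset.sum_le_sum fun i hi => ?_)
  rw [Finset.sum_mul]
  refine (_root_.norm_sum_le _ _).trans (Finset.sum_le_sum fun j hj => ?_)
  have hi' := Nat.lt_succ_iff.1 (Finset.mem_range.1 hi)
  have hj' := Nat.lt_succ_iff.1 (Finset.mem_range.1 hj)
  have hf0 := hw.pos_f x
  have hh0 := hw.pos_h x
  have hr0 := hw.pos_ρ x
  have b1 := hx₁ i hi'
  have b2 := hx₂ j hj'
  have b3 := hK' i hi' j hj' x (H.bundle.weakNabla R i u x)
  have b0 := weight_le hf0 hh0 hr0 (show i + j ≤ 2 * m by omega) (h₀ x).1 (h₀ x).2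
  -- the powers of `ρ` in the bounds for `∇^i u` and `∇^j w` cost `ρ^{-(i + j)}`, where
  -- `i + j ≤ 2 m`
  have b4 : f x * (h x)⁻¹ * (ρ x ^ i)⁻¹ * (ρ x ^ j)⁻¹ ≤ |C₀| := by
    rw [pow_add] at b0
    have := (le_abs_self C₀)
    rw [← div_eq_mul_inv, ← div_eq_mul_inv, ← div_eq_mul_inv, div_div, div_div, div_le_iff₀ (by positivity)]
    refine b0.trans ?_
    gcongr
  set p := (H.bundle.tens R i).norm x (H.bundle.weakNabla R i u x)
  set q := (H'.bundle.tens R j).norm x (H'.bundle.weakNabla R j w x)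
  have hp : 0 ≤ p := norm_nonneg _ _
  have hq : 0 ≤ q := norm_nonneg _ _
  have hk := hK i hi' j hj'
  set G := sobolevDensity R H.bundle f ρ m u x
  set G' := sobolevDensity R H'.bundle h⁻¹ ρ m w x
  rw [Pi.inv_apply, inv_inv] at b2
  have b5 : p * q ≤ |C₀| * ((C₁ * G) * (C₂ * G')) := by
    calc p * q = (f x * (h x)⁻¹ * (ρ x ^ i)⁻¹ * (ρ x ^ j)⁻¹) *
          (((f x)⁻¹ * ρ x ^ i * p) * (h x * ρ x ^ j * q)) := by
          have := hf0.ne'; have := hh0.ne'; have := hr0.ne'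
          field_simp
      _ ≤ _ := by
          have : 0 ≤ C₁ * G := le_trans (by positivity) b1
          gcongr
  calc _ ≤ 2 * ((H'.bundle.tens R j).norm x (a i j x (H.bundle.weakNabla R i u x)) * q) :=
        norm_herm_le H' _ _
    _ ≤ 2 * ((K i j * p) * q) := by gcongr
    _ = 2 * (K i j * (p * q)) := by ring
    _ ≤ 2 * (K i j * (|C₀| * ((C₁ * G) * (C₂ * G')))) := by gcongr
    _ = _ := by ring

/-- The Dirichlet form converges absolutely on Sobolev sections. -/
lemma integrable_weakBidiff (hX : IsParseval R X) (hw : IsWeightTriple R m f h ρ)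
    (ha : ∀ i ≤ m, ∀ j ≤ m, IsCoeff R H H' i j (a i j)) {u : H.bundle.Sec} {w : H'.bundle.Sec}
    (hu : H.bundle.MemSobolev R f ρ m u) (hv : H'.bundle.MemSobolev R h⁻¹ ρ m w) :
    Integrable (weakBidiff R H H' m a u w) R.vol := by
  have hA := H.isGeometric_bundle R
  have hB := H'.isGeometric_bundle R
  obtain ⟨C, -, hC⟩ := exists_bound_weakBidiff hX hw ha
  obtain ⟨_, _, h₁⟩ := hw.exists_bound_left hX hA
  obtain ⟨_, _, h₂⟩ := hw.exists_bound_right hX hB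
  refine (((hu.memLp_density hA hw.continuous_ρ).integrable_mul
    (hv.memLp_density hB hw.continuous_ρ)).const_mul C).mono' ?_ (hC u w hu hv)
  change AEStronglyMeasurable (fun x => ∑ i ∈ Finset.range (m + 1), ∑ j ∈ Finset.range (m + 1),
    herm R H' j x (a i j x (H.bundle.weakNabla R i u x)) (H'.bundle.weakNabla R j w x)) _
  refine Finset.aestronglyMeasurable_fun_sum (M := ℂ) _ fun i hi =>
    Finset.aestronglyMeasurable_fun_sum (M := ℂ) _ fun j hj => ?_
  have hi' := Nat.lt_succ_iff.1 (Finset.mem_range.1 hi)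
  have hj' := Nat.lt_succ_iff.1 (Finset.mem_range.1 hj)
  have hAi := R.isGeometric_tangent.tens hA i
  have hBj := R.isGeometric_tangent.tens hB j
  exact aestronglyMeasurable_herm (((h₁ u hu i hi').1.2.1.app hAi hBj (ha i hi' j hj').1.1).1)
    (h₂ w hv j hj').1.2.1.1

/-- The Dirichlet form is bounded, by the Cauchy--Schwarz inequality. The factor `m + 1` is that
of `MemSobolev.integral_density_sq_le`. -/
lemma exists_norm_dirichletForm_le (hX : IsParseval R X) (hw : IsWeightTriple R m f h ρ)
    (ha : ∀ i ≤ m, ∀ j ≤ m, IsCoeff R H H' i j (a i j)) :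
    ∃ C : ℝ, ∀ u w, H.bundle.MemSobolev R f ρ m u → H'.bundle.MemSobolev R h⁻¹ ρ m w →
      ‖dirichletForm R H H' m a u w‖ ≤
        C * H.bundle.sobolevNorm R f ρ m u * H'.bundle.sobolevNorm R h⁻¹ ρ m w := by
  have hA := H.isGeometric_bundle R
  have hB := H'.isGeometric_bundle R
  obtain ⟨C, hC0, hC⟩ := exists_bound_weakBidiff hX hw ha
  refine ⟨C * (m + 1), fun u w hu hv => ?_⟩
  have hu' := hu.memLp_density hA hw.continuous_ρ
  have hv' := hv.memLp_density hB hw.continuous_ρ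
  have h1 := norm_integral_le_of_norm_le ((hu'.integrable_mul hv').const_mul C) (hC u w hu hv)
  rw [integral_const_mul] at h1
  refine h1.trans ?_
  have h2 := integral_mul_le_Lp_mul_Lq_of_nonneg (p := 2) (q := 2) (μ := R.vol)
    ⟨by norm_num, by norm_num, by norm_num⟩
    (.of_forall fun x => sobolevDensity_nonneg (R := R) u x)
    (.of_forall fun x => sobolevDensity_nonneg (R := R) w x)
    (by simpa using hu') (by simpa using hv')
  simp only [Real.rpow_two, ← Real.sqrt_eq_rpow] at h2
  have h3 := hu.integral_density_sq_le hA hw.continuous_ρ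
  have h4 := hv.integral_density_sq_le hB hw.continuous_ρ
  have hm : (0 : ℝ) ≤ m + 1 := by positivity
  have h5 := Real.sqrt_le_sqrt h3
  have h6 := Real.sqrt_le_sqrt h4
  rw [Real.sqrt_mul hm, Real.sqrt_sq (show 0 ≤ H.bundle.sobolevNorm R f ρ m u from
    Real.sqrt_nonneg _)] at h5
  rw [Real.sqrt_mul hm, Real.sqrt_sq (show 0 ≤ H'.bundle.sobolevNorm R h⁻¹ ρ m w from
    Real.sqrt_nonneg _)] at h6
  have h7 := h2.trans (mul_le_mul h5 h6 (Real.sqrt_nonneg _)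
    (mul_nonneg (Real.sqrt_nonneg _) (Real.sqrt_nonneg _)))
  refine (mul_le_mul_of_nonneg_left h7 hC0).trans_eq ?_
  have h8 := Real.mul_self_sqrt hm
  linear_combination (C * H.bundle.sobolevNorm R f ρ m u * H'.bundle.sobolevNorm R h⁻¹ ρ m w) * h8

omit [MeasurableSpace M] [BorelSpace M] [SecondCountableTopology M] in
lemma bidiffForm_left (ha : ∀ i ≤ m, ∀ j ≤ m, IsCoeff R H H' i j (a i j)) (x : M) (z : ℂ)
    (ξ ξ' : ∀ i, (H.bundle.tens R i).Fib x) (η : ∀ j, (H'.bundle.tens R j).Fib x) :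
    bidiffForm R H H' m a x (fun i => cmul H R i x z (ξ i) + ξ' i) η =
      z * bidiffForm R H H' m a x ξ η + bidiffForm R H H' m a x ξ' η := by
  simp only [bidiffForm, Finset.mul_sum, ← Finset.sum_add_distrib]
  refine Finset.sum_congr rfl fun i hi => Finset.sum_congr rfl fun j hj => ?_
  rw [map_add, herm_add_left, app_cmul H H' (ha i (Nat.lt_succ_iff.1 (Finset.mem_range.1 hi)) j
    (Nat.lt_succ_iff.1 (Finset.mem_range.1 hj))).2, herm_cmul_left]

omit [MeasurableSpace M] [BorelSpace M] [SecondCountableTopology M] in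
lemma bidiffForm_right (x : M) (z : ℂ)
    (ξ : ∀ i, (H.bundle.tens R i).Fib x) (η η' : ∀ j, (H'.bundle.tens R j).Fib x) :
    bidiffForm R H H' m a x ξ (fun j => cmul H' R j x z (η j) + η' j) =
      (starRingEnd ℂ) z * bidiffForm R H H' m a x ξ η + bidiffForm R H H' m a x ξ η' := by
  simp only [bidiffForm, Finset.mul_sum, ← Finset.sum_add_distrib]
  refine Finset.sum_congr rfl fun i hi => Finset.sum_congr rfl fun j hj => ?_
  rw [herm_add_right, herm_cmul_right]

omit [T2Space M] [MeasurableSpace M] [BorelSpace M] [SecondCountableTopology M] in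
lemma bidiffForm_congr {x : M} {ξ ξ' : ∀ i, (H.bundle.tens R i).Fib x}
    {η η' : ∀ j, (H'.bundle.tens R j).Fib x} (hξ : ∀ i ≤ m, ξ i = ξ' i) (hη : ∀ j ≤ m, η j = η' j) :
    bidiffForm R H H' m a x ξ η = bidiffForm R H H' m a x ξ' η' :=
  Finset.sum_congr rfl fun i hi => Finset.sum_congr rfl fun j hj => by
    rw [hξ i (Nat.lt_succ_iff.1 (Finset.mem_range.1 hi)),
      hη j (Nat.lt_succ_iff.1 (Finset.mem_range.1 hj))]

/-- The chosen weak derivatives are complex linear almost everywhere. -/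
lemma weakNabla_cmul_add (hX : IsParseval R X) {u u' : ∀ x, E x}
    (hu : ∀ k ≤ m, H.bundle.IsWeakNabla R k u (H.bundle.weakNabla R k u))
    (hu' : ∀ k ≤ m, H.bundle.IsWeakNabla R k u' (H.bundle.weakNabla R k u')) (z : ℂ) :
    ∀ᵐ x ∂(R.vol), ∀ k ≤ m, H.bundle.weakNabla R k (z • u + u') x =
      cmul H R k x z (H.bundle.weakNabla R k u x) + H.bundle.weakNabla R k u' x := by
  refine ae_all_iff.2 fun k => ?_
  by_cases hk : k ≤ m
  · have h1 := IsWeakNabla.cmul_add H hX (hu k hk) (hu' k hk) z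
    filter_upwards [h1.weakNabla_ae (H.isGeometric_bundle R)] with x hx using fun _ => hx
  · exact .of_forall fun x h => absurd h hk

lemma dirichletForm_left (hX : IsParseval R X) (hw : IsWeightTriple R m f h ρ)
    (ha : ∀ i ≤ m, ∀ j ≤ m, IsCoeff R H H' i j (a i j)) (z : ℂ) {u u' : ∀ x, E x} {w : ∀ x, E' x}
    (hu : H.bundle.MemSobolev R f ρ m u) (hu' : H.bundle.MemSobolev R f ρ m u')
    (hv : H'.bundle.MemSobolev R h⁻¹ ρ m w) :
    dirichletForm R H H' m a (z • u + u') w =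
      z * dirichletForm R H H' m a u w + dirichletForm R H H' m a u' w := by
  obtain ⟨_, _, h₁⟩ := hw.exists_bound_left hX (H.isGeometric_bundle R)
  simp only [dirichletForm]
  rw [← integral_const_mul, ← integral_add ((integrable_weakBidiff hX hw ha hu hv).const_mul z)
    (integrable_weakBidiff hX hw ha hu' hv)]
  refine integral_congr_ae ?_
  filter_upwards [weakNabla_cmul_add hX (fun k hk => (h₁ u hu k hk).1)
    (fun k hk => (h₁ u' hu' k hk).1) z] with x hx
  exact (bidiffForm_congr hx fun _ _ => rfl).trans (bidiffForm_left ha x z _ _ _)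

lemma dirichletForm_right (hX : IsParseval R X) (hw : IsWeightTriple R m f h ρ)
    (ha : ∀ i ≤ m, ∀ j ≤ m, IsCoeff R H H' i j (a i j)) (z : ℂ) {u : ∀ x, E x} {w w' : ∀ x, E' x}
    (hu : H.bundle.MemSobolev R f ρ m u) (hv : H'.bundle.MemSobolev R h⁻¹ ρ m w)
    (hv' : H'.bundle.MemSobolev R h⁻¹ ρ m w') :
    dirichletForm R H H' m a u (z • w + w') =
      (starRingEnd ℂ) z * dirichletForm R H H' m a u w + dirichletForm R H H' m a u w' := by
  obtain ⟨_, _, h₁⟩ := hw.exists_bound_right hX (H'.isGeometric_bundle R)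
  simp only [dirichletForm]
  rw [← integral_const_mul, ← integral_add ((integrable_weakBidiff hX hw ha hu hv).const_mul _)
    (integrable_weakBidiff hX hw ha hu hv')]
  refine integral_congr_ae ?_
  filter_upwards [weakNabla_cmul_add hX (fun k hk => (h₁ w hv k hk).1)
    (fun k hk => (h₁ w' hv' k hk).1) z] with x hx
  exact (bidiffForm_congr (fun _ _ => rfl) hx).trans (bidiffForm_right x z _ _ _)

/-- `P_𝔟` is a bounded map into the dual space. -/
lemma isNegSobolev_dirichletForm (hX : IsParseval R X) (hw : IsWeightTriple R m f h ρ)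
    (ha : ∀ i ≤ m, ∀ j ≤ m, IsCoeff R H H' i j (a i j)) :
    ∃ C : ℝ, ∀ u, H.bundle.MemSobolev R f ρ m u →
      IsNegSobolev R H' h ρ m (fun w => dirichletForm R H H' m a u w)
        (C * H.bundle.sobolevNorm R f ρ m u) := by
  obtain ⟨C, hC⟩ := exists_norm_dirichletForm_le hX hw ha
  refine ⟨C, fun u hu => ⟨fun w w' hv hv' => ?_, fun z w hv => ?_, fun w hv => hC u w hu hv.1⟩⟩
  · have := dirichletForm_right hX hw ha 1 hu hv.1 hv'.1
    rw [map_one, one_mul] at this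
    have e : ∀ w w' : ∀ x, E' x, w + w' = (1 : ℂ) • w + w' := fun w w' => by rw [one_smul]
    exact Eq.trans (congrArg (dirichletForm R H H' m a u) (e w w')) this
  -- homogeneity follows from the combined linearity statement by writing `z w = (z - 1) w + w`
  · have := dirichletForm_right hX hw ha (z - 1) hu hv.1 hv.1
    rw [map_sub, map_one, sub_mul, one_mul, sub_add_cancel] at this
    have e : ∀ w : ∀ x, E' x, z • w = (z - 1) • w + w := fun w => by
      rw [sub_smul, one_smul, sub_add_cancel]
    exact Eq.trans (congrArg (dirichletForm R H H' m a u) (e w)) this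

end

section

variable {n : ℕ} {M : Type*} [TopologicalSpace M] [ChartedSpace (EuclideanSpace ℝ (Fin n)) M]
  [IsManifold (𝓡 n) ∞ M] [T2Space M] [MeasurableSpace M] [BorelSpace M]
  [SecondCountableTopology M] {R : RiemannianStructure n M} {A B : MetricBundle n M}
  {ι : Type*} [Fintype ι] {X : ι → R.tangent.Sec}

open IsGeometric

/-! ### Integration by parts in bidifferential forms -/

section Real

omit [MeasurableSpace M] [BorelSpace M] [SecondCountableTopology M] in
lemma IsTest.adjoint (hA : IsGeometric R A) (hB : IsGeometric R B) {a : (Hom A B).Sec}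
    (ha : (Hom A B).IsSmooth a) {s : B.Sec} (hs : B.IsTest s) :
    A.IsTest (MetricBundle.adjoint A B a s) := by
  obtain ⟨h, K, hK, hK'⟩ := hs
  refine ⟨isSmooth_adjoint hA hB ha h, K, hK, fun x hx => ?_⟩
  refine Finset.sum_eq_zero fun i _ => Finset.sum_eq_zero fun j _ => ?_
  change (A.gramInv x i j * B.inner x (MetricBundle.app A B (a x) (A.frame x i x)) (s x)) • A.frame x j x = 0
  rw [hK' x hx, (hB.isInner x).zero_right, mul_zero, zero_smul]

omit [T2Space M] [MeasurableSpace M] [BorelSpace M] [SecondCountableTopology M]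
  [IsManifold (𝓡 n) ∞ M] in
lemma IsTest.sum {κ : Type*} {S : Finset κ} {s : κ → A.Sec} (hs : ∀ i ∈ S, A.IsTest (s i)) :
    A.IsTest (fun x => ∑ i ∈ S, s i x) := by
  classical
  induction S using Finset.induction_on with
  | empty => exact ⟨isSmooth_zero A, ∅, isCompact_empty, fun x _ => rfl⟩
  | insert i S hi ih =>
    obtain ⟨h, K, hK, hK'⟩ := ih fun j hj => hs j (Finset.mem_insert_of_mem hj)
    obtain ⟨h', K', hK1, hK1'⟩ := hs i (Finset.mem_insert_self _ _)
    simp only [Finset.sum_insert hi]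
    refine ⟨h'.add h, K' ∪ K, hK1.union hK, fun x hx => ?_⟩
    rw [Set.mem_union, not_or] at hx
    exact (congrArg₂ (· + ·) (hK1' x hx.1) (hK' x hx.2)).trans (add_zero _)

lemma integral_inner_sum_right (hA : IsGeometric R A) {u : A.Sec} (hu : A.IsLocL1 R u) {κ : Type*}
    {S : Finset κ} {s : κ → A.Sec} (hs : ∀ i ∈ S, A.IsTest (s i)) :
    ∫ x, A.inner x (u x) (∑ i ∈ S, s i x) ∂(R.vol) =
      ∑ i ∈ S, ∫ x, A.inner x (u x) (s i x) ∂(R.vol) := by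
  simp only [(hA.isInner _).sum_right]
  exact integral_finsetSum _ fun i hi => hu.integrable_inner hA (hs i hi)

omit [BorelSpace M] in
/-- The transpose of `u ↦ a ∇^k u` is `η ↦ (∇^k)^* a^* η`. -/
lemma IsWeakNabla.integral_inner_app (hA : IsGeometric R A) (hB : IsGeometric R B) {k : ℕ}
    {u : A.Sec} {v : (A.tens R k).Sec} (h : A.IsWeakNabla R k u v) {a : (Hom (A.tens R k) B).Sec}
    (ha : (Hom (A.tens R k) B).IsSmooth a) {η : B.Sec} (hη : B.IsTest η) :
    ∫ x, B.inner x (app (A.tens R k) B (a x) (v x)) (η x) ∂(R.vol) =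
      ∫ x, A.inner x (u x) (A.nablaStar R k (MetricBundle.adjoint (A.tens R k) B a η) x) ∂(R.vol) := by
  have hk := R.isGeometric_tangent.tens hA k
  simp only [← inner_adjoint hk hB]
  exact h.2.2 _ (hη.adjoint hk hB ha)

variable {m k : ℕ} {a : ∀ i j, (Hom (A.tens R i) (B.tens R j)).Sec}
  {c : ∀ l, (Hom (A.tens R l) B).Sec}

/-- The derivatives of the second argument of a bidifferential form are moved to the first one. -/
lemma sum_integral_inner_nabla (hX : IsParseval R X) (hA : IsGeometric R A) (hB : IsGeometric R B)
    (ha : ∀ i ≤ m, ∀ j ≤ m, (Hom (A.tens R i) (B.tens R j)).IsSmooth (a i j))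
    {u : A.Sec} (hu : A.IsTest u) {w : B.Sec} (hw : B.IsTest w) :
    ∑ i ∈ Finset.range (m + 1), ∑ j ∈ Finset.range (m + 1),
        ∫ x, (B.tens R j).inner x (app (A.tens R i) (B.tens R j) (a i j x) (A.nabla R i u x))
          (B.nabla R j w x) ∂(R.vol) =
      ∫ x, B.inner x (∑ i ∈ Finset.range (m + 1), ∑ j ∈ Finset.range (m + 1),
        B.nablaStar R j (fun y => app (A.tens R i) (B.tens R j) (a i j y) (A.nabla R i u y)) x)
          (w x) ∂(R.vol) := by
  have ht : ∀ i ∈ Finset.range (m + 1), ∀ j ∈ Finset.range (m + 1), (B.tens R j).IsTest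
      (fun y => app (A.tens R i) (B.tens R j) (a i j y) (A.nabla R i u y)) := fun i hi j hj =>
    IsTest.app (ha i (Nat.lt_succ_iff.1 (Finset.mem_range.1 hi)) j
      (Nat.lt_succ_iff.1 (Finset.mem_range.1 hj))) (hu.nabla hA i)
  have hT := fun i hi j hj => IsTest.nablaStar hX hB (ht i hi j hj)
  have hw' : B.IsLocL1 R w := .of_smooth hB hw.1
  simp only [(hB.isInner _).symm _ (w _)]
  rw [integral_inner_sum_right hB hw' fun i hi => IsTest.sum (hT i hi)]
  refine Finset.sum_congr rfl fun i hi => ?_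
  rw [integral_inner_sum_right hB hw' (hT i hi)]
  refine Finset.sum_congr rfl fun j hj => ?_
  rw [← hX.integral_inner_nabla hB hw.1 (ht i hi j hj)]
  simp only [((R.isGeometric_tangent.tens hB j).isInner _).symm]

/-- If an operator `∑ c_l ∇^l` represents a bidifferential form on test sections, then it represents
the form in the sense of distributions: the transposes of both are differential operators applied to
the second argument, and these agree because they agree when tested. -/
lemma sum_integral_inner_weak (hX : IsParseval R X) (hA : IsGeometric R A) (hB : IsGeometric R B)
    (ha : ∀ i ≤ m, ∀ j ≤ m, (Hom (A.tens R i) (B.tens R j)).IsSmooth (a i j))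
    (hc : ∀ l, (Hom (A.tens R l) B).IsSmooth (c l))
    (h : ∀ u, A.IsTest u → ∀ w, B.IsTest w →
      ∑ i ∈ Finset.range (m + 1), ∑ j ∈ Finset.range (m + 1),
        ∫ x, (B.tens R j).inner x (app (A.tens R i) (B.tens R j) (a i j x) (A.nabla R i u x))
          (B.nabla R j w x) ∂(R.vol) = ∫ x, B.inner x (opApply R A B k c u x) (w x) ∂(R.vol))
    {u : A.Sec} {v : ∀ i, (A.tens R i).Sec} (hu : A.IsLocL1 R u)
    (hv : ∀ i ≤ m, A.IsWeakNabla R i u (v i)) {w : B.Sec} (hw : B.IsTest w) :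
    ∑ i ∈ Finset.range (m + 1), ∑ j ∈ Finset.range (m + 1),
        ∫ x, (B.tens R j).inner x (app (A.tens R i) (B.tens R j) (a i j x) (v i x))
          (B.nabla R j w x) ∂(R.vol) =
      ∑ l ∈ Finset.range (k + 1), ∫ x, A.inner x (u x)
        (A.nablaStar R l (MetricBundle.adjoint (A.tens R l) B (c l) w) x) ∂(R.vol) := by
  have hAk := fun i => R.isGeometric_tangent.tens hA i
  have hBk := fun j => R.isGeometric_tangent.tens hB j
  have ha' : ∀ i ∈ Finset.range (m + 1), ∀ j ∈ Finset.range (m + 1),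
      (Hom (A.tens R i) (B.tens R j)).IsSmooth (a i j) := fun i hi j hj =>
    ha i (Nat.lt_succ_iff.1 (Finset.mem_range.1 hi)) j (Nat.lt_succ_iff.1 (Finset.mem_range.1 hj))
  -- the transposes of the two sides, applied to `w`
  set S : ℕ → ℕ → A.Sec := fun i j => A.nablaStar R i
    (MetricBundle.adjoint (A.tens R i) (B.tens R j) (a i j) (B.nabla R j w)) with hS
  set S' : ℕ → A.Sec := fun l => A.nablaStar R l (MetricBundle.adjoint (A.tens R l) B (c l) w)
    with hS'
  have tS : ∀ i ∈ Finset.range (m + 1), ∀ j ∈ Finset.range (m + 1), A.IsTest (S i j) :=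
    fun i hi j hj => IsTest.nablaStar hX hA ((hw.nabla hB j).adjoint (hAk i) (hBk j) (ha' i hi j hj))
  have tS' : ∀ l ∈ Finset.range (k + 1), A.IsTest (S' l) := fun l _ =>
    IsTest.nablaStar hX hA (hw.adjoint (hAk l) hB (hc l))
  have key : ∀ {u : A.Sec} {v : ∀ i, (A.tens R i).Sec}, A.IsLocL1 R u →
      (∀ i ≤ m, A.IsWeakNabla R i u (v i)) →
      ∑ i ∈ Finset.range (m + 1), ∑ j ∈ Finset.range (m + 1),
        ∫ x, (B.tens R j).inner x (app (A.tens R i) (B.tens R j) (a i j x) (v i x))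
          (B.nabla R j w x) ∂(R.vol) =
      ∫ x, A.inner x (u x) (∑ i ∈ Finset.range (m + 1), ∑ j ∈ Finset.range (m + 1), S i j x)
        ∂(R.vol) := by
    intro u v hu hv
    rw [integral_inner_sum_right hA hu fun i hi => IsTest.sum (tS i hi)]
    refine Finset.sum_congr rfl fun i hi => ?_
    rw [integral_inner_sum_right hA hu (tS i hi)]
    exact Finset.sum_congr rfl fun j hj => (hv i (Nat.lt_succ_iff.1 (Finset.mem_range.1 hi))).integral_inner_app
      hA (hBk j) (ha' i hi j hj) (hw.nabla hB j)
  have hop : ∀ φ, A.IsTest φ → ∫ x, B.inner x (opApply R A B k c φ x) (w x) ∂(R.vol) =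
      ∫ x, A.inner x (φ x) (∑ l ∈ Finset.range (k + 1), S' l x) ∂(R.vol) := by
    intro φ hφ
    rw [integral_inner_sum_right hA (.of_smooth hA hφ.1) tS']
    simp only [opApply, (hB.isInner _).sum_left]
    rw [integral_finsetSum _ fun l _ => hB.integrable_inner ((hc l).app (hA.isSmooth_nabla hφ.1 l)) hw]
    exact Finset.sum_congr rfl fun l _ => (IsWeakNabla.of_smooth hX hA hφ.1).integral_inner_app
      hA hB (hc l) hw
  have tT := IsTest.sum fun i hi => IsTest.sum (tS i hi)
  have tT' := IsTest.sum tS'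
  -- the two transposes agree when tested, by the hypothesis `h`
  have hae : ∀ᵐ x ∂(R.vol), (∑ i ∈ Finset.range (m + 1), ∑ j ∈ Finset.range (m + 1), S i j x) +
      (-1 : ℝ) • ∑ l ∈ Finset.range (k + 1), S' l x = 0 := by
    refine hA.ae_eq_zero_of_test ((IsLocL1.of_smooth hA tT.1).add hA
      (.of_smooth hA (tT'.1.const_smul (-1)))) fun φ hφ => ?_
    simp only [(hA.isInner _).symm _ (φ _), (hA.isInner _).add_right, (hA.isInner _).smul_right]
    rw [integral_add (hA.integrable_inner hφ.1 tT) ((hA.integrable_inner hφ.1 tT').const_mul _),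
      integral_const_mul, ← key (.of_smooth hA hφ.1) fun i _ => IsWeakNabla.of_smooth hX hA hφ.1,
      h φ hφ w hw, hop φ hφ]
    ring
  rw [key hu hv, ← integral_inner_sum_right hA hu tS']
  refine integral_congr_ae ?_
  filter_upwards [hae] with x hx
  rw [neg_one_smul, add_neg_eq_zero] at hx
  rw [hx]

end Real

end

section

variable {n : ℕ} {M : Type*} [TopologicalSpace M] [ChartedSpace (EuclideanSpace ℝ (Fin n)) M]
  [IsManifold (𝓡 n) ∞ M] [T2Space M] [MeasurableSpace M] [BorelSpace M]
  [SecondCountableTopology M] {R : RiemannianStructure n M}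
  {ι : Type*} [Fintype ι] {X : ι → R.tangent.Sec}
  {F : Type*} [NormedAddCommGroup F] [NormedSpace ℂ F] [FiniteDimensional ℂ F]
  {E : M → Type*} [TopologicalSpace (TotalSpace F E)] [∀ x, NormedAddCommGroup (E x)]
  [∀ x, InnerProductSpace ℂ (E x)] [FiberBundle F E] [VectorBundle ℂ F E] [VectorBundle ℝ F E]
  [ContMDiffVectorBundle ∞ F E (𝓡 n)]
  {F' : Type*} [NormedAddCommGroup F'] [NormedSpace ℂ F'] [FiniteDimensional ℂ F']
  {E' : M → Type*} [TopologicalSpace (TotalSpace F' E')] [∀ x, NormedAddCommGroup (E' x)]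
  [∀ x, InnerProductSpace ℂ (E' x)] [FiberBundle F' E'] [VectorBundle ℂ F' E']
  [VectorBundle ℝ F' E'] [ContMDiffVectorBundle ∞ F' E' (𝓡 n)]
  {H : HermitianStructure n F E} {H' : HermitianStructure n F' E'} {m : ℕ}
  {a : ∀ i j x, (H.bundle.tens R i).Fib x →L[ℝ] (H'.bundle.tens R j).Fib x}

open IsGeometric

/-! ### The Dirichlet form and its operator on test sections -/

omit [MeasurableSpace M] [BorelSpace M] [SecondCountableTopology M] in
lemma IsTest.mulI {k : ℕ} {η : (H.bundle.tens R k).Sec} (hη : (H.bundle.tens R k).IsTest η) :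
    (H.bundle.tens R k).IsTest (fun x => mulI R H k x (η x)) := by
  obtain ⟨h, K, hK, hK'⟩ := hη
  refine ⟨(isSkew_mulI (R := R) H k).parallel.smooth h, K, hK, fun x hx => ?_⟩
  change NablaSobolev.mulI R H k x (η x) = 0
  rw [hK' x hx, map_zero]

omit [MeasurableSpace M] [BorelSpace M] [SecondCountableTopology M] in
lemma nabla_mulI {w : H.bundle.Sec} (hw : H.bundle.IsSmooth w) (j : ℕ) (x : M) :
    H.bundle.nabla R j (fun y => mulI R H 0 y (w y)) x = mulI R H j x (H.bundle.nabla R j w x) := by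
  have hA := H.isGeometric_bundle R
  have h := ((isSkew_mulILin (R := R) H).parallel.nabla_eq hA hA hw j).1
  exact (congrFun h x).trans (tensMap_mulILin H j x _)

lemma integrable_herm {k : ℕ} {ξ η : (H.bundle.tens R k).Sec}
    (hξ : (H.bundle.tens R k).IsLocL1 R ξ) (hη : (H.bundle.tens R k).IsTest η) :
    Integrable (fun x => herm R H k x (ξ x) (η x)) R.vol := by
  have hk := R.isGeometric_tangent.tens (H.isGeometric_bundle R) k
  exact (hξ.integrable_inner hk hη).ofReal.add ((hξ.integrable_inner hk hη.mulI).ofReal.const_mul _)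

/-- The Hermitian metric recovered from its real part. -/
lemma integral_herm {k : ℕ} {ξ η : (H.bundle.tens R k).Sec}
    (hξ : (H.bundle.tens R k).IsLocL1 R ξ) (hη : (H.bundle.tens R k).IsTest η) :
    ∫ x, herm R H k x (ξ x) (η x) ∂(R.vol) =
      ((∫ x, (H.bundle.tens R k).inner x (ξ x) (η x) ∂(R.vol) : ℝ) : ℂ) +
        Complex.I * ((∫ x, (H.bundle.tens R k).inner x (ξ x) (mulI R H k x (η x)) ∂(R.vol) : ℝ) : ℂ) := by
  have hk := R.isGeometric_tangent.tens (H.isGeometric_bundle R) k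
  simp only [herm]
  rw [integral_add (hξ.integrable_inner hk hη).ofReal
    ((hξ.integrable_inner hk hη.mulI).ofReal.const_mul _), integral_const_mul, integral_complex_ofReal,
    integral_complex_ofReal]

/-- The real part of a Dirichlet form, as a function of the derivatives `ξ i` of the first
argument, which may be classical or weak. -/
def realForm (R : RiemannianStructure n M) (H : HermitianStructure n F E)
    (H' : HermitianStructure n F' E') (m : ℕ)
    (a : ∀ i j x, (H.bundle.tens R i).Fib x →L[ℝ] (H'.bundle.tens R j).Fib x)
    (ξ : ∀ i, (H.bundle.tens R i).Sec) (w : H'.bundle.Sec) : ℝ :=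
  ∑ i ∈ Finset.range (m + 1), ∑ j ∈ Finset.range (m + 1),
    ∫ x, (H'.bundle.tens R j).inner x (app (H.bundle.tens R i) (H'.bundle.tens R j) (a i j x) (ξ i x))
      (H'.bundle.nabla R j w x) ∂(R.vol)

/-- The imaginary part of the form is its real part with `w` replaced by `i w`. -/
lemma integral_bidiffForm (ha : ∀ i ≤ m, ∀ j ≤ m, IsCoeff R H H' i j (a i j))
    {ξ : ∀ i, (H.bundle.tens R i).Sec} (hξ : ∀ i ≤ m, (H.bundle.tens R i).IsLocL1 R (ξ i))
    {w : H'.bundle.Sec} (hw : H'.bundle.IsTest w) :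
    ∫ x, bidiffForm R H H' m a x (fun i => ξ i x) (fun j => H'.bundle.nabla R j w x) ∂(R.vol) =
      (realForm R H H' m a ξ w : ℂ) +
        Complex.I * (realForm R H H' m a ξ (fun x => mulI R H' 0 x (w x)) : ℂ) := by
  have hAk := fun i => R.isGeometric_tangent.tens (H.isGeometric_bundle R) i
  have hB := H'.isGeometric_bundle R
  have hl : ∀ i ∈ Finset.range (m + 1), ∀ j ∈ Finset.range (m + 1), (H'.bundle.tens R j).IsLocL1 R
      (fun x => a i j x (ξ i x)) := fun i hi j hj =>
    (hξ i (Nat.lt_succ_iff.1 (Finset.mem_range.1 hi))).app (hAk i) (R.isGeometric_tangent.tens hB j)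
      (ha i (Nat.lt_succ_iff.1 (Finset.mem_range.1 hi)) j
        (Nat.lt_succ_iff.1 (Finset.mem_range.1 hj))).1.1
  simp only [bidiffForm]
  rw [integral_finsetSum _ fun i hi => integrable_finsetSum _ fun j hj =>
    integrable_herm (hl i hi j hj) (hw.nabla hB j)]
  simp only [realForm, Complex.ofReal_sum, Finset.mul_sum, ← Finset.sum_add_distrib]
  refine Finset.sum_congr rfl fun i hi => ?_
  rw [integral_finsetSum _ fun j hj => integrable_herm (hl i hi j hj) (hw.nabla hB j)]
  refine Finset.sum_congr rfl fun j hj => ?_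
  rw [integral_herm (hl i hi j hj) (hw.nabla hB j)]
  simp only [nabla_mulI hw.1]
  rfl

/-- The divergence form operator `∑_{i,j} (∇^j)^* a_{ij} ∇^i`. -/
def divergenceOp (R : RiemannianStructure n M) (H : HermitianStructure n F E)
    (H' : HermitianStructure n F' E') (m : ℕ)
    (a : ∀ i j x, (H.bundle.tens R i).Fib x →L[ℝ] (H'.bundle.tens R j).Fib x)
    (u : H.bundle.Sec) : H'.bundle.Sec :=
  fun x => ∑ i ∈ Finset.range (m + 1), ∑ j ∈ Finset.range (m + 1), H'.bundle.nablaStar R j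
    (fun y => app (H.bundle.tens R i) (H'.bundle.tens R j) (a i j y) (H.bundle.nabla R i u y)) x

omit [MeasurableSpace M] [BorelSpace M] [SecondCountableTopology M] in
/-- Expanding the formal adjoints writes the divergence form operator as `∑ c_l ∇^l`, with
coefficients of class `C_b^∞`. -/
lemma isOperator_divergenceOp (hX : IsParseval R X) (ha : ∀ i ≤ m, ∀ j ≤ m, IsCoeff R H H' i j (a i j)) :
    IsOperator R H.bundle H'.bundle (mulILin H R) (mulILin H' R) (2 * m)
      (divergenceOp R H H' m a) := by
  have hA := H.isGeometric_bundle R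
  have hB := H'.isGeometric_bundle R
  refine IsOperator.sum hA hB _ (Q := fun i u x => ∑ j ∈ Finset.range (m + 1), H'.bundle.nablaStar R j
    (fun y => app (H.bundle.tens R i) (H'.bundle.tens R j) (a i j y) (H.bundle.nabla R i u y)) x)
    fun i hi => IsOperator.sum hA hB _ (Q := fun j u => H'.bundle.nablaStar R j
    (fun y => app (H.bundle.tens R i) (H'.bundle.tens R j) (a i j y) (H.bundle.nabla R i u y)))
    fun j hj => ?_
  have hi' := Nat.lt_succ_iff.1 (Finset.mem_range.1 hi)
  have hj' := Nat.lt_succ_iff.1 (Finset.mem_range.1 hj)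
  have h := isTotallyBounded_iff.1 (ha i hi' j hj').1
  refine (hX.isOperator_nablaStar hA hB (isSkew_mulILin H).parallel (isSkew_mulILin H').parallel
    (isOperator_single hA (R.isGeometric_tangent.tens hB j) i h.1 h.2 fun x ξ => ?_)).mono (by omega)
  rw [tensMap_mulILin, tensMap_mulILin]
  exact (ha i hi' j hj').2 x ξ

variable {c : ∀ l, (Hom (H.bundle.tens R l) H'.bundle).Sec}

omit [T2Space M] [MeasurableSpace M] [BorelSpace M] [SecondCountableTopology M] in
lemma IsCoeffs.isCoeff
    (hc : IsCoeffs R H.bundle H'.bundle (mulILin H R) (mulILin H' R) (2 * m) c) (j : ℕ) :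
    IsCoeff R H H' j 0 (c j) := by
  refine ⟨isTotallyBounded_iff.2 ⟨hc.smooth j, hc.bounds j⟩, fun x ξ => ?_⟩
  have h := hc.comm j x ξ
  rw [tensMap_mulILin] at h
  exact h

/-- On test sections the expanded operator represents the real part of the form. -/
lemma realForm_nabla (hX : IsParseval R X) (ha : ∀ i ≤ m, ∀ j ≤ m, IsCoeff R H H' i j (a i j))
    (hQ : ∀ u, H.bundle.IsSmooth u →
      divergenceOp R H H' m a u = opApply R H.bundle H'.bundle (2 * m) c u)
    {u : H.bundle.Sec} {w : H'.bundle.Sec}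
    (hu : H.bundle.IsTest u) (hw : H'.bundle.IsTest w) :
    realForm R H H' m a (fun i => H.bundle.nabla R i u) w =
      ∫ x, H'.bundle.inner x (opApply R H.bundle H'.bundle (2 * m) c u x) (w x) ∂(R.vol) := by
  rw [← hQ u hu.1]
  exact sum_integral_inner_nabla hX (H.isGeometric_bundle R) (H'.isGeometric_bundle R)
    (fun i hi j hj => (ha i hi j hj).1.1) hu hw

/-- In a test section the weak derivatives can be replaced by classical ones. -/
lemma dirichletForm_of_isTest (hX : IsParseval R X)
    {u : H.bundle.Sec} {w : H'.bundle.Sec} (hw : H'.bundle.IsTest w) :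
    dirichletForm R H H' m a u w = ∫ x, bidiffForm R H H' m a x
      (fun i => H.bundle.weakNabla R i u x) (fun j => H'.bundle.nabla R j w x) ∂(R.vol) := by
  have hB := H'.isGeometric_bundle R
  refine integral_congr_ae ?_
  have h : ∀ᵐ x ∂(R.vol), ∀ j, H'.bundle.weakNabla R j w x = H'.bundle.nabla R j w x :=
    ae_all_iff.2 fun j => (IsWeakNabla.of_smooth hX hB hw.1).weakNabla_ae hB
  filter_upwards [h] with x hx
  exact bidiffForm_congr (fun _ _ => rfl) fun j _ => hx j

/-- On test sections the weak form agrees with the classical one. -/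
lemma dirichletForm_eq_integral_bidiff (hX : IsParseval R X)
    {u : H.bundle.Sec} {w : H'.bundle.Sec} (hu : H.bundle.IsTest u) (hw : H'.bundle.IsTest w) :
    dirichletForm R H H' m a u w = ∫ x, bidiff R H H' m a u w x ∂(R.vol) := by
  have hA := H.isGeometric_bundle R
  rw [dirichletForm_of_isTest hX hw]
  refine integral_congr_ae ?_
  have h : ∀ᵐ x ∂(R.vol), ∀ j, H.bundle.weakNabla R j u x = H.bundle.nabla R j u x :=
    ae_all_iff.2 fun j => (IsWeakNabla.of_smooth hX hA hu.1).weakNabla_ae hA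
  filter_upwards [h] with x hx
  exact bidiffForm_congr (fun j _ => hx j) fun _ _ => rfl

/-- The operator represents the Dirichlet form on test sections. -/
lemma integral_bidiff (hX : IsParseval R X) (ha : ∀ i ≤ m, ∀ j ≤ m, IsCoeff R H H' i j (a i j))
    (hc : IsCoeffs R H.bundle H'.bundle (mulILin H R) (mulILin H' R) (2 * m) c)
    (hQ : ∀ u, H.bundle.IsSmooth u →
      divergenceOp R H H' m a u = opApply R H.bundle H'.bundle (2 * m) c u)
    {u : H.bundle.Sec} {w : H'.bundle.Sec}
    (hu : H.bundle.IsTest u) (hw : H'.bundle.IsTest w) :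
    ∫ x, bidiff R H H' m a u w x ∂(R.vol) =
      ∫ x, herm R H' 0 x (diffOp R H H' (2 * m) c u x) (w x) ∂(R.vol) := by
  have hA := H.isGeometric_bundle R
  have hB := H'.isGeometric_bundle R
  have h1 := integral_bidiffForm (w := w) ha (ξ := fun i => H.bundle.nabla R i u)
    (fun i _ => .of_smooth (R.isGeometric_tangent.tens hA i) (hA.isSmooth_nabla hu.1 i)) hw
  rw [realForm_nabla hX ha hQ hu hw, realForm_nabla hX ha hQ hu (IsTest.mulI (k := 0) hw)] at h1
  refine Eq.trans h1 (Eq.symm ?_)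
  have h2 : H'.bundle.IsSmooth (opApply R H.bundle H'.bundle (2 * m) c u) :=
    IsSmooth.sum _ fun l _ => (hc.smooth l).app (hA.isSmooth_nabla hu.1 l)
  exact integral_herm (k := 0) (.of_smooth hB h2) hw

omit [MeasurableSpace M] [BorelSpace M] [SecondCountableTopology M] in
/-- The adjoint of a complex linear map is complex linear. -/
lemma adjoint_mulI {j : ℕ} {b : ∀ x, (H.bundle.tens R j).Fib x →L[ℝ] (H'.bundle.tens R 0).Fib x}
    (hb : IsCoeff R H H' j 0 b) (w : H'.bundle.Sec) :
    adjoint (H.bundle.tens R j) (H'.bundle.tens R 0) b (fun x => mulI R H' 0 x (w x)) =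
      fun x => mulI R H j x (adjoint (H.bundle.tens R j) (H'.bundle.tens R 0) b w x) := by
  have hj := R.isGeometric_tangent.tens (H.isGeometric_bundle R) j
  have h0 := H'.isGeometric_bundle R
  funext x
  refine (hj.isInner x).ext fun ξ => ?_
  have h1 := (isSkew_mulI (R := R) H j).skew x ξ
    (adjoint (H.bundle.tens R j) (H'.bundle.tens R 0) b w x)
  have h2 := (isSkew_mulI (R := R) H' 0).skew x (b x ξ) (w x)
  have h3 := inner_adjoint hj h0 b (fun x => mulI R H' 0 x (w x)) x ξ
  have h4 := inner_adjoint hj h0 b w x (mulI R H j x ξ)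
  have h5 : (H'.bundle.tens R 0).inner x (b x (mulI R H j x ξ)) (w x) =
    (H'.bundle.tens R 0).inner x (mulI R H' 0 x (b x ξ)) (w x) := by rw [hb.2]
  have h6 := h1.symm.trans (h4.trans (h5.trans h2))
  exact h3.trans (neg_injective h6).symm

/-- On Sobolev sections the form is given by the operator in the sense of distributions. -/
lemma dirichletForm_eq_diffOpDistribution (hX : IsParseval R X)
    (ha : ∀ i ≤ m, ∀ j ≤ m, IsCoeff R H H' i j (a i j))
    (hc : IsCoeffs R H.bundle H'.bundle (mulILin H R) (mulILin H' R) (2 * m) c)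
    (hQ : ∀ u, H.bundle.IsSmooth u →
      divergenceOp R H H' m a u = opApply R H.bundle H'.bundle (2 * m) c u)
    {u : H.bundle.Sec} {w : H'.bundle.Sec}
    (hu : ∀ k ≤ m, H.bundle.IsWeakNabla R k u (H.bundle.weakNabla R k u))
    (hw : H'.bundle.IsTest w) :
    dirichletForm R H H' m a u w = diffOpDistribution R H H' (2 * m) c u w := by
  have hA := H.isGeometric_bundle R
  have hB := H'.isGeometric_bundle R
  have hu0 := (hu 0 (Nat.zero_le m)).1
  have hreal : ∀ {w : H'.bundle.Sec}, H'.bundle.IsTest w →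
      realForm R H H' m a (fun i => H.bundle.weakNabla R i u) w =
        ∑ l ∈ Finset.range (2 * m + 1), ∫ x, H.bundle.inner x (u x) (H.bundle.nablaStar R l
          (adjoint (H.bundle.tens R l) H'.bundle (c l) w) x) ∂(R.vol) := fun hw =>
    sum_integral_inner_weak hX hA hB (fun i hi j hj => (ha i hi j hj).1.1) hc.smooth
      (fun u hu w hw => realForm_nabla hX ha hQ hu hw) hu0 hu hw
  rw [dirichletForm_of_isTest hX hw, integral_bidiffForm ha (fun i hi => (hu i hi).2.1) hw, hreal hw,
    hreal (IsTest.mulI (k := 0) hw), Complex.ofReal_sum, Complex.ofReal_sum,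
    Finset.mul_sum, ← Finset.sum_add_distrib]
  refine Finset.sum_congr rfl fun l _ => ?_
  have hl := R.isGeometric_tangent.tens hA l
  have ht := hw.adjoint hl hB (hc.smooth l)
  have hs := IsTest.nablaStar hX hA ht
  refine Eq.trans ?_ (integral_herm (k := 0) hu0 hs).symm
  congr 4
  funext x
  refine congrArg (H.bundle.inner x (u x)) ?_
  -- the formal adjoints commute with `i`, so the real identity for `i w` is the imaginary part of
  -- the claim
  have h1 := (isSkew_mulILin (R := R) H).parallel.nablaStar_eq hX hA ht.1
  simp only [tensMap_mulILin] at h1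
  refine Eq.trans ?_ (congrFun h1 x)
  exact congrFun (congrArg (H.bundle.nablaStar R l) (adjoint_mulI (hc.isCoeff l) w)) x

/-- For a weight triple, the form extends to the weighted Sobolev spaces as a bounded form, and
the operator represents it. -/
theorem IsWeightTriple.isExtension {f h ρ : M → ℝ} (hX : IsParseval R X)
    (hwt : IsWeightTriple R m f h ρ) (ha : ∀ i ≤ m, ∀ j ≤ m, IsCoeff R H H' i j (a i j))
    (hc : IsCoeffs R H.bundle H'.bundle (mulILin H R) (mulILin H' R) (2 * m) c)
    (hQ : ∀ u, H.bundle.IsSmooth u →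
      divergenceOp R H H' m a u = opApply R H.bundle H'.bundle (2 * m) c u) :
    IsExtension R H H' m a c f h ρ where
  integrable u w hu hw := integrable_weakBidiff hX hwt ha hu hw.1
  linear z u₁ u₂ w h₁ h₂ hw := dirichletForm_left hX hwt ha z h₁ h₂ hw.1
  bounded := isNegSobolev_dirichletForm hX hwt ha
  eq_diffOp u w hu hw := by
    obtain ⟨_, _, h₁⟩ := hwt.exists_bound_left hX (H.isGeometric_bundle R)
    exact dirichletForm_eq_diffOpDistribution hX ha hc hQ (fun k hk => (h₁ u hu k hk).1) hw

omit [MeasurableSpace M] [BorelSpace M] [SecondCountableTopology M] in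
/-- The constant weights `1` form a weight triple; this is the unweighted case. -/
lemma isWeightTriple_one (m : ℕ) : IsWeightTriple R m 1 1 1 := by
  have h0 : logDeriv R (1 : M → ℝ) = fun _ => 0 := by
    funext x
    refine hom_ext _ _ fun v => ?_
    change (1 : ℝ)⁻¹ * der R (fun _ => (1 : ℝ)) x v = 0
    rw [der_const, mul_zero]
  have hb : ∀ J, HasBounds R 1 J 1 (cotangent R) (logDeriv R 1) := fun J => by
    rw [h0]
    exact HasBounds.zero (R.isGeometric_tangent.hom (isGeometric_trivial R)) _ _ _
  exact ⟨contMDiff_const, contMDiff_const, continuous_const, fun _ => one_pos, fun _ => one_pos,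
    fun _ => one_pos, hb, hb, 1, fun x => by simp⟩

end

end MetricBundle
end NablaSobolev

theorem mainTheorem12 {n : ℕ} {M : Type*} [TopologicalSpace M]
    [ChartedSpace (EuclideanSpace ℝ (Fin n)) M] [IsManifold (𝓡 n) ∞ M] [T2Space M]
    [SecondCountableTopology M] [MeasurableSpace M] [BorelSpace M]
    (R : NablaSobolev.RiemannianStructure n M) (hM : R.FrechetFiniteness)
    {F : Type*} [NormedAddCommGroup F] [NormedSpace ℂ F] [FiniteDimensional ℂ F]
    {E : M → Type*} [TopologicalSpace (TotalSpace F E)] [∀ x, NormedAddCommGroup (E x)]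
    [∀ x, InnerProductSpace ℂ (E x)] [FiberBundle F E] [VectorBundle ℂ F E] [VectorBundle ℝ F E]
    [ContMDiffVectorBundle ∞ F E (𝓡 n)]
    {F' : Type*} [NormedAddCommGroup F'] [NormedSpace ℂ F'] [FiniteDimensional ℂ F']
    {E' : M → Type*} [TopologicalSpace (TotalSpace F' E')] [∀ x, NormedAddCommGroup (E' x)]
    [∀ x, InnerProductSpace ℂ (E' x)] [FiberBundle F' E'] [VectorBundle ℂ F' E']
    [VectorBundle ℝ F' E'] [ContMDiffVectorBundle ∞ F' E' (𝓡 n)]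
    (H : NablaSobolev.HermitianStructure n F E) (H' : NablaSobolev.HermitianStructure n F' E')
    (m : ℕ)
    (a : ∀ i j x, (H.bundle.tens R i).Fib x →L[ℝ] (H'.bundle.tens R j).Fib x)
    (ha : ∀ i ≤ m, ∀ j ≤ m, NablaSobolev.IsCoeff R H H' i j (a i j)) :
    ∃ c : ∀ j x, (H.bundle.tens R j).Fib x →L[ℝ] (H'.bundle.tens R 0).Fib x,
      (∀ j ≤ 2 * m, NablaSobolev.IsCoeff R H H' j 0 (c j)) ∧
      (∀ u w, H.bundle.IsTest u → H'.bundle.IsTest w →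
        integral R.vol (NablaSobolev.bidiff R H H' m a u w) =
          integral R.vol
            (fun x => NablaSobolev.herm R H' 0 x (NablaSobolev.diffOp R H H' (2 * m) c u x) (w x))) ∧
      (∀ u w, H.bundle.IsTest u → H'.bundle.IsTest w →
        NablaSobolev.dirichletForm R H H' m a u w =
          integral R.vol (NablaSobolev.bidiff R H H' m a u w)) ∧
      NablaSobolev.IsExtension R H H' m a c 1 1 1 ∧
      ∀ (R₀ : NablaSobolev.RiemannianStructure n M) (ρ f h : M → ℝ),
        (∀ x, R₀.metric.inner x = (ρ x ^ 2)⁻¹ • R.metric.inner x) →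
        R₀.IsAdmissible ρ → R₀.IsAdmissible f → R₀.IsAdmissible h →
        (∃ C : ℝ, ∀ x, f x ≤ C * h x ∧ f x ≤ C * (h x * ρ x ^ (2 * m))) →
        NablaSobolev.IsExtension R H H' m a c f h ρ := by
  obtain ⟨N, X, hX⟩ := NablaSobolev.MetricBundle.exists_isParseval hM
  obtain ⟨c, hc, hQ⟩ := NablaSobolev.MetricBundle.isOperator_divergenceOp hX ha
  refine ⟨c, fun j _ => hc.isCoeff j,
    fun u w hu hw => NablaSobolev.MetricBundle.integral_bidiff hX ha hc hQ hu hw,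
    fun u w hu hw => NablaSobolev.MetricBundle.dirichletForm_eq_integral_bidiff hX hu hw,
    (NablaSobolev.MetricBundle.isWeightTriple_one m).isExtension hX ha hc hQ,
    fun R₀ ρ f h hg hρ hf hh hC => ?_⟩
  exact NablaSobolev.MetricBundle.IsWeightTriple.isExtension hX
    ⟨hf.1, hh.1, hρ.1.continuous, hf.2.1, hh.2.1, hρ.2.1,
      fun J => NablaSobolev.MetricBundle.hasBounds_logDeriv hX hg hρ hf J,
      fun J => NablaSobolev.MetricBundle.hasBounds_logDeriv hX hg hρ hh J, hC⟩ ha hc hQ
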